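/- **Setting.** Let $n,d_1,d_2\ge 1$, $T=d_1+d_2-1$, and let $\mathcal H$ map $\widetilde X=X_1\oplus\dots\oplus X_T$ ($X_t\in\mathbb R^{n\times n}$) to the $nd_1\times nd_2$ block Hankel matrix whose $(a,b)$ block is $X_{a+b-1}$. Let $\mathcal D$ be the diagonal operator multiplying the standard basis element $E_{i,j,t}$ by $\|\mathcal H(E_{i,j,t})\|_F$, and $\mathcal G=\mathcal H\mathcal D^{-1}$. Let $\Omega\subset[n]\times[n]\times[T]$ be a list of $m$ distinct locations, $P_\Omega$ the operator reading off the entries at $\Omega$, $y\in\mathbb R^m$ and $\lambda\ge 0$. For a singular value decomposition $H=U\,\mathrm{dg}(\sigma)V^*$ (orthogonal $U,V$; $\sigma_i$ non-increasing, $\sigma_i=0$ for $i>n\min(d_1,d_2)$) and $\varepsilon>0$ let $W_{H,\varepsilon}(Z)=U\Sigma_{1}^{-1}U^*ZV\Sigma_{2}^{-1}V^*$, where $\Sigma_1,\Sigma_2$ are the diagonal matrices with entries $\max(\sigma_i,\varepsilon)$ of size $nd_1$ and $nd_2$. TOIRLS with rank estimate $\widetilde r=r$ is the following iteration: with $W_{0}=\mathrm{Id}$,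 $\varepsilon_0=\infty$, for $k\ge1$, $$\widetilde X^{(k)}\in\arg\min_{\widetilde X}\ \langle \widetilde X,\mathcal H^*W_{k-1}\mathcal H\widetilde X\rangle+G(\widetilde X),\qquad H_k=\mathcal H(\widetilde X^{(k)}),\quad \varepsilon_k=\min(\varepsilon_{k-1},\sigma_{r+1}(H_k)),\quad W_k=W_{H_k,\varepsilon_k},$$ where $G(\widetilde X)=\frac1\lambda\|P_\Omega\widetilde X-y\|_2^2$ if $\lambda>0$, and, if $\lambda=0$, $G(\widetilde X)=0$ when $P_\Omega\widetilde X=y$ and $\infty$ otherwise. Let $r_k$ be the number of $i\le n\min(d_1,d_2)$ with $\sigma_i(H_k)>\varepsilon_k$. **Theorem 5.1.** Let $1\le r\le n$, $k\ge2$, $\varepsilon:=\varepsilon_{k-1}>0$ and $r_{k-1}=r$. Let $U\in\mathbb R^{nd_1\times r}$, $V\in\mathbb R^{nd_2\times r}$, $\sigma_1,\dots,\sigma_r$ be the $r$ leading singular vectors and singular values of $H_{k-1}$. For $\gamma=(\Gamma_1,\Gamma_2,\Gamma_3)\in\mathbb R^{r\times r}\times\mathbb R^{r\times nd_2}\times\mathbb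 R^{nd_1\times r}=:S$ put $$P_{\mathbf T}\gamma=U\Gamma_1V^*+U\Gamma_2(\mathrm{Id}-VV^*)+(\mathrm{Id}-UU^*)\Gamma_3V^*,$$ let $\mathbf D_S$ be the diagonal operator on $S$ with entries $\sigma_i^{-1}\sigma_j^{-1}$ on $(\Gamma_1)_{ij}$, $\sigma_i^{-1}\varepsilon^{-1}$ on row $i$ of $\Gamma_2$ and $\varepsilon^{-1}\sigma_j^{-1}$ on column $j$ of $\Gamma_3$, and let $\mathbf K=\lambda\varepsilon^{-2}\mathbf I+P_\Omega\mathcal D^{-2}P_\Omega^*$, $\mathbf E=P_\Omega\mathcal D^{-1}\mathcal G^*P_{\mathbf T}$, $$\mathbf M=\mathbf E^*\mathbf K^{-1}\mathbf E+\frac{\mathbf D_S^{-1}}{\mathbf D_S^{-1}-\varepsilon^2\mathbf I}-P_{\mathbf T}^*\mathcal G\mathcal G^*P_{\mathbf T},\qquad b=\mathbf E^*\mathbf K^{-1}y .$$ For $\gamma\in S$ let $p(\gamma)=\mathbf K^{-1}(y-\mathbf E\gamma)$ and $\widetilde X[\gamma]=\mathcal D^{-2}P_\Omega^*p(\gamma)+\mathcal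 D^{-1}\mathcal G^*P_{\mathbf T}\gamma$. Then, with absolute implied constants: 1. $\mathbf M$ is a symmetric positive definite matrix of size $\dim S=r(nd_1+nd_2+r)=O(rnT)$, and if $\mathbf M\gamma=b$, then $\widetilde X[\gamma]=\widetilde X^{(k)}$. 2. For $\gamma^{(0)}\in S$ let $\gamma_N=\gamma^{(0)}+\Delta_N$, where $\Delta_N$ is the result of $N$ steps of the conjugate gradient method (in exact arithmetic) for $\mathbf M\Delta=b-\mathbf M\gamma^{(0)}$, started at $0$; a step that starts at residual $0$ changes nothing. Then $\widetilde X[\gamma_N]$ is an approximation of $\widetilde X^{(k)}$, which is exact at the latest for $N=\dim S$: $\widetilde X[\gamma_N]=\widetilde X^{(k)}$ whenever $N\ge\dim S$. 3. There is one real-RAM program (unit cost for $+,-,\cdot,/,\sqrt{\ }$, comparisons, memory accesses and for arithmetic on integers of $O(\log(n+T+m+N))$ bits) that, for all such data, every $\gamma^{(0)}\in S$ and every $N\ge1$, computes from $n,d_1,d_2,r,m,N,\lambda,\varepsilon,\Omega,y,U,V,(\sigma_i)_{i\le r},\gamma^{(0)}$ the pair $(\gamma_N,p(\gamma_N))$ that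 parametrizes $\widetilde X[\gamma_N]$, with $$O(rnT+m)\ \text{space}\qquad\text{and}\qquad O\big(N\,rT\,(m+n\log T+nrT)\big)\ \text{time}.$$ -/

import Mathlib

open scoped Matrix

namespace TOIRLS

/-! ### Space-time samples and block Hankel matrices

`n` is the size of the blocks, `d₁`, `d₂` are the pencil parameters and `T = d₁ + d₂ - 1` is the
number of blocks.  All indices start at `0`. -/

/-- Space-time locations `(i, j, t)`.  An element `X₁ ⊕ ⋯ ⊕ X_T` of the direct sum of `T` copies of
the `n × n` matrices is a function on this type, `X (i, j, t)` being the `(i, j)` entry of the block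
with (zero-based) number `t`. -/
abbrev Loc (n d₁ d₂ : ℕ) : Type := Fin n × Fin n × Fin (d₁ + d₂ - 1)

/-- Row or column indices of a matrix that has `d` blocks of size `n` in this direction. -/
abbrev Blk (n d : ℕ) : Type := Fin d × Fin n

/-- The block Hankel matrix of `X`: its block `(a, b)` is the block `a + b` of `X`. -/
def blockHankel {n d₁ d₂ : ℕ} (X : Loc n d₁ d₂ → ℝ) : Matrix (Blk n d₁) (Blk n d₂) ℝ :=
  Matrix.of fun p q =>
    X (p.2, q.2, ⟨(p.1 : ℕ) + (q.1 : ℕ), by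
      have h₁ := p.1.isLt
      have h₂ := q.1.isLt
      omega⟩)

/-- The entries of a matrix as one vector. -/
def vec {n d₁ d₂ : ℕ} (Z : Matrix (Blk n d₁) (Blk n d₂) ℝ) : Blk n d₁ × Blk n d₂ → ℝ :=
  fun x => Z x.1 x.2

/-- The block Hankel operator as a matrix in the standard bases (so that its adjoint for the
Frobenius inner products is the transpose). -/
def hankelMat (n d₁ d₂ : ℕ) : Matrix (Blk n d₁ × Blk n d₂) (Loc n d₁ d₂) ℝ :=
  Matrix.of fun x l =>
    if l.1 = x.1.2 ∧ l.2.1 = x.2.2 ∧ (l.2.2 : ℕ) = (x.1.1 : ℕ) + (x.2.1 : ℕ) then 1 else 0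

theorem hankelMat_mulVec {n d₁ d₂ : ℕ} (X : Loc n d₁ d₂ → ℝ) :
    hankelMat n d₁ d₂ *ᵥ X = vec (blockHankel X) := by
  funext x
  obtain ⟨⟨a, i⟩, b, j⟩ := x
  have hlt : (a : ℕ) + (b : ℕ) < d₁ + d₂ - 1 := by
    have h₁ := a.isLt
    have h₂ := b.isLt
    omega
  have key : ∀ l : Loc n d₁ d₂,
      (l.1 = i ∧ l.2.1 = j ∧ (l.2.2 : ℕ) = (a : ℕ) + (b : ℕ)) ↔ l = (i, j, ⟨a + b, hlt⟩) := by
    rintro ⟨i', j', t⟩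
    simp [Prod.ext_iff, Fin.ext_iff]
  simp [Matrix.mulVec, dotProduct, hankelMat, vec, blockHankel, key]

/-- The diagonal operator that multiplies each standard basis element by the Frobenius norm of its
image under the block Hankel operator. -/
noncomputable def diagMat (n d₁ d₂ : ℕ) : Matrix (Loc n d₁ d₂) (Loc n d₁ d₂) ℝ :=
  Matrix.diagonal fun l => Real.sqrt (∑ x, hankelMat n d₁ d₂ x l ^ 2)

/-- The normalized block Hankel operator: each standard basis element is sent to its block Hankel
matrix divided by the Frobenius norm of that matrix. -/
noncomputable def normHankelMat (n d₁ d₂ : ℕ) :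
    Matrix (Blk n d₁ × Blk n d₂) (Loc n d₁ d₂) ℝ :=
  Matrix.of fun x l => hankelMat n d₁ d₂ x l / Real.sqrt (∑ x', hankelMat n d₁ d₂ x' l ^ 2)

/-- The sampling operator: it reads off the entries at the locations `ω 0, …, ω (m - 1)`. -/
def sampleMat {n d₁ d₂ m : ℕ} (ω : Fin m → Loc n d₁ d₂) : Matrix (Fin m) (Loc n d₁ d₂) ℝ :=
  Matrix.of fun l x => if x = ω l then 1 else 0

/-! ### The iteration -/

/-- `Z = U diag(σ) Vᵀ` is a (full) singular value decomposition, with the convention that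
`σ i = 0` for `i ≥ n * min d₁ d₂`. -/
structure IsSVD {n d₁ d₂ : ℕ} (Z : Matrix (Blk n d₁) (Blk n d₂) ℝ)
    (U : Matrix (Blk n d₁) (Fin (d₁ * n)) ℝ) (σ : ℕ → ℝ)
    (V : Matrix (Blk n d₂) (Fin (d₂ * n)) ℝ) : Prop where
  left_orth : Uᵀ * U = 1
  left_orth' : U * Uᵀ = 1
  right_orth : Vᵀ * V = 1
  right_orth' : V * Vᵀ = 1
  antitone : Antitone σ
  nonneg : ∀ i, 0 ≤ σ i
  zero : ∀ i, min d₁ d₂ * n ≤ i → σ i = 0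
  eq : Z = U * (Matrix.of fun (i : Fin (d₁ * n)) (j : Fin (d₂ * n)) =>
    if (i : ℕ) = (j : ℕ) then σ i else 0) * Vᵀ

/-- The optimal weight operator `Z ↦ U Σ_{ε,d₁}⁻¹ Uᵀ Z V Σ_{ε,d₂}⁻¹ Vᵀ`. -/
noncomputable def weightOp {n d₁ d₂ : ℕ} (U : Matrix (Blk n d₁) (Fin (d₁ * n)) ℝ) (σ : ℕ → ℝ)
    (V : Matrix (Blk n d₂) (Fin (d₂ * n)) ℝ) (ε : ℝ) (Z : Matrix (Blk n d₁) (Blk n d₂) ℝ) :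
    Matrix (Blk n d₁) (Blk n d₂) ℝ :=
  U * Matrix.diagonal (fun i : Fin (d₁ * n) => (max (σ i) ε)⁻¹) * Uᵀ * Z *
    V * Matrix.diagonal (fun j : Fin (d₂ * n) => (max (σ j) ε)⁻¹) * Vᵀ

/-- The effective weight operator: the operator `W` on matrices, composed with the block Hankel
operator on the right and with its adjoint on the left. -/
noncomputable def effWeight {n d₁ d₂ : ℕ}
    (W : Matrix (Blk n d₁) (Blk n d₂) ℝ → Matrix (Blk n d₁) (Blk n d₂) ℝ)
    (X : Loc n d₁ d₂ → ℝ) : Loc n d₁ d₂ → ℝ :=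
  (hankelMat n d₁ d₂)ᵀ *ᵥ vec (W (blockHankel X))

/-- The data fitting term. -/
noncomputable def dataFit {n d₁ d₂ m : ℕ} (ω : Fin m → Loc n d₁ d₂) (y : Fin m → ℝ) (lam : ℝ)
    (X : Loc n d₁ d₂ → ℝ) : EReal :=
  open Classical in
  if lam = 0 then (if sampleMat ω *ᵥ X = y then 0 else ⊤)
  else ((1 / lam * ∑ l, ((sampleMat ω *ᵥ X) l - y l) ^ 2 : ℝ) : EReal)

/-- `X` solves the weighted least squares problem for the weight operator `W`. -/
def IsWLS {n d₁ d₂ m : ℕ} (ω : Fin m → Loc n d₁ d₂) (y : Fin m → ℝ) (lam : ℝ)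
    (W : Matrix (Blk n d₁) (Blk n d₂) ℝ → Matrix (Blk n d₁) (Blk n d₂) ℝ)
    (X : Loc n d₁ d₂ → ℝ) : Prop :=
  ∀ Z : Loc n d₁ d₂ → ℝ,
    ((X ⬝ᵥ effWeight W X : ℝ) : EReal) + dataFit ω y lam X ≤
      ((Z ⬝ᵥ effWeight W Z : ℝ) : EReal) + dataFit ω y lam Z

/-- What the algorithm holds after one iteration: the iterate, the smoothing parameter, and a
singular value decomposition of the block Hankel matrix of the iterate. -/
structure Iterate (n d₁ d₂ : ℕ) where
  X : Loc n d₁ d₂ → ℝ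
  ε : ℝ
  U : Matrix (Blk n d₁) (Fin (d₁ * n)) ℝ
  σ : ℕ → ℝ
  V : Matrix (Blk n d₂) (Fin (d₂ * n)) ℝ

/-- `it 1, …, it K` are the first `K` iterations of TOIRLS, with rank estimate `rt`.  In the first
iteration the weight operator is the identity and the previous smoothing parameter is `∞`.  The
singular value number `rt + 1` has the zero-based number `rt`. -/
structure IsRun {n d₁ d₂ m : ℕ} (ω : Fin m → Loc n d₁ d₂) (y : Fin m → ℝ) (lam : ℝ) (rt K : ℕ)
    (it : ℕ → Iterate n d₁ d₂) : Prop where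
  svd : ∀ k, 1 ≤ k → k ≤ K → IsSVD (blockHankel (it k).X) (it k).U (it k).σ (it k).V
  first : 1 ≤ K → IsWLS ω y lam id (it 1).X
  first_ε : 1 ≤ K → (it 1).ε = (it 1).σ rt
  step : ∀ k, 1 ≤ k → k < K →
    IsWLS ω y lam (weightOp (it k).U (it k).σ (it k).V (it k).ε) (it (k + 1)).X
  step_ε : ∀ k, 1 ≤ k → k < K → (it (k + 1)).ε = min (it k).ε ((it (k + 1)).σ rt)

/-- The effective rank `r_k`: the number of singular values that exceed the smoothing parameter. -/
noncomputable def Iterate.rank {n d₁ d₂ : ℕ} (s : Iterate n d₁ d₂) : ℕ :=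
  Nat.card {i : Fin (min d₁ d₂ * n) // s.ε < s.σ i}

/-! ### The linear system of one iteration -/

/-- Index set of the unknowns `γ = (Γ₁, Γ₂, Γ₃)`, where `Γ₁` is `r × r`, `Γ₂` is `r × n d₂` and
`Γ₃` is `n d₁ × r`. -/
abbrev Par (n d₁ d₂ r : ℕ) : Type :=
  (Fin r × Fin r) ⊕ (Fin r × Blk n d₂) ⊕ (Blk n d₁ × Fin r)

/-- The parametrization of the tangent space,
`γ ↦ U Γ₁ Vᵀ + U Γ₂ (1 - V Vᵀ) + (1 - U Uᵀ) Γ₃ Vᵀ`. -/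
def tangentFun {n d₁ d₂ r : ℕ} (U : Matrix (Blk n d₁) (Fin r) ℝ) (V : Matrix (Blk n d₂) (Fin r) ℝ)
    (γ : Par n d₁ d₂ r → ℝ) : Matrix (Blk n d₁) (Blk n d₂) ℝ :=
  U * (Matrix.of fun i j => γ (Sum.inl (i, j))) * Vᵀ +
    U * (Matrix.of fun i q => γ (Sum.inr (Sum.inl (i, q)))) * (1 - V * Vᵀ) +
    (1 - U * Uᵀ) * (Matrix.of fun p j => γ (Sum.inr (Sum.inr (p, j)))) * Vᵀ

/-- The matrix of `tangentFun` in the standard bases. -/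
def tangentMat {n d₁ d₂ r : ℕ} (U : Matrix (Blk n d₁) (Fin r) ℝ) (V : Matrix (Blk n d₂) (Fin r) ℝ) :
    Matrix (Blk n d₁ × Blk n d₂) (Par n d₁ d₂ r) ℝ :=
  Matrix.of fun x c => vec (tangentFun U V (Pi.single c 1)) x

theorem tangentMat_mulVec {n d₁ d₂ r : ℕ} (U : Matrix (Blk n d₁) (Fin r) ℝ)
    (V : Matrix (Blk n d₂) (Fin r) ℝ) (γ : Par n d₁ d₂ r → ℝ) :
    tangentMat U V *ᵥ γ = vec (tangentFun U V γ) := by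
  let f : (Par n d₁ d₂ r → ℝ) →ₗ[ℝ] (Blk n d₁ × Blk n d₂ → ℝ) :=
    { toFun := fun γ => vec (tangentFun U V γ)
      map_add' := by
        intro γ δ
        funext x
        simp only [vec, tangentFun, Matrix.add_apply, Matrix.mul_apply, Matrix.of_apply,
          Pi.add_apply, mul_add, add_mul, Finset.sum_add_distrib]
        ring
      map_smul' := by
        intro c γ
        funext x
        simp only [vec, tangentFun, Matrix.add_apply, Matrix.mul_apply, Matrix.of_apply,
          Pi.smul_apply, smul_eq_mul, RingHom.id_apply, mul_add, Finset.mul_sum, Finset.sum_mul]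
        refine congrArg₂ _ (congrArg₂ _ ?_ ?_) ?_ <;>
          exact Finset.sum_congr rfl fun a _ => Finset.sum_congr rfl fun b _ => by ring }
  have h : tangentMat U V = LinearMap.toMatrix' f := by
    ext x c
    rw [LinearMap.toMatrix'_apply]
    rfl
  rw [h]
  exact LinearMap.toMatrix'_mulVec f γ

/-- Diagonal of the weight operator in the parametrization of the tangent space; the singular
values that do not occur in `σ` are at most `ε` and count as `ε`. -/
noncomputable def tangentWeight {n d₁ d₂ r : ℕ} (σ : Fin r → ℝ) (ε : ℝ) : Par n d₁ d₂ r → ℝ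
  | Sum.inl (i, j) => (max (σ i) ε)⁻¹ * (max (σ j) ε)⁻¹
  | Sum.inr (Sum.inl (i, _)) => (max (σ i) ε)⁻¹ * ε⁻¹
  | Sum.inr (Sum.inr (_, j)) => ε⁻¹ * (max (σ j) ε)⁻¹

/-- The data of one weighted least squares step: locations and values of the samples,
regularization parameter, smoothing parameter, leading singular values and singular vectors. -/
structure StepData (n d₁ d₂ r m : ℕ) where
  ω : Fin m → Loc n d₁ d₂
  y : Fin m → ℝ
  lam : ℝ
  ε : ℝ
  σ : Fin r → ℝ
  U : Matrix (Blk n d₁) (Fin r) ℝ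
  V : Matrix (Blk n d₂) (Fin r) ℝ

namespace StepData

variable {n d₁ d₂ r m : ℕ} (S : StepData n d₁ d₂ r m)

/-- The `m × m` matrix `K = λ ε⁻² I + P_Ω D⁻² P_Ωᵀ`. -/
noncomputable def K : Matrix (Fin m) (Fin m) ℝ :=
  (S.lam * (S.ε ^ 2)⁻¹) • (1 : Matrix (Fin m) (Fin m) ℝ) +
    sampleMat S.ω * (diagMat n d₁ d₂)⁻¹ * (diagMat n d₁ d₂)⁻¹ * (sampleMat S.ω)ᵀ

/-- The operator `P_Ω D⁻¹ Gᵀ P_T`. -/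
noncomputable def E : Matrix (Fin m) (Par n d₁ d₂ r) ℝ :=
  sampleMat S.ω * (diagMat n d₁ d₂)⁻¹ * (normHankelMat n d₁ d₂)ᵀ * tangentMat S.U S.V

/-- The matrix `P_Tᵀ G D⁻¹ P_Ωᵀ K⁻¹ P_Ω D⁻¹ Gᵀ P_T + D_S⁻¹ / (D_S⁻¹ - ε² I) - P_Tᵀ G Gᵀ P_T` of
the linear system. -/
noncomputable def M : Matrix (Par n d₁ d₂ r) (Par n d₁ d₂ r) ℝ :=
  S.Eᵀ * S.K⁻¹ * S.E +
    Matrix.diagonal (fun c =>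
      (tangentWeight S.σ S.ε c)⁻¹ / ((tangentWeight S.σ S.ε c)⁻¹ - S.ε ^ 2)) -
    (tangentMat S.U S.V)ᵀ * normHankelMat n d₁ d₂ * (normHankelMat n d₁ d₂)ᵀ * tangentMat S.U S.V

/-- The right-hand side `P_Tᵀ G D⁻¹ P_Ωᵀ K⁻¹ y`. -/
noncomputable def rhs : Par n d₁ d₂ r → ℝ := (S.Eᵀ * S.K⁻¹) *ᵥ S.y

/-- The residual `p = K⁻¹ (y - P_Ω D⁻¹ Gᵀ P_T γ)`. -/
noncomputable def residual (γ : Par n d₁ d₂ r → ℝ) : Fin m → ℝ := S.K⁻¹ *ᵥ (S.y - S.E *ᵥ γ)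

/-- The element `D⁻² P_Ωᵀ p + D⁻¹ Gᵀ P_T γ` of the direct sum of the `n × n` matrices that is
parametrized by `p` and `γ`. -/
noncomputable def reconstruct (p : Fin m → ℝ) (γ : Par n d₁ d₂ r → ℝ) : Loc n d₁ d₂ → ℝ :=
  ((diagMat n d₁ d₂)⁻¹ * (diagMat n d₁ d₂)⁻¹ * (sampleMat S.ω)ᵀ) *ᵥ p +
    ((diagMat n d₁ d₂)⁻¹ * (normHankelMat n d₁ d₂)ᵀ * tangentMat S.U S.V) *ᵥ γ

end StepData

/-- The data that iteration `s` hands to the next weighted least squares step: of the singular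
value decomposition only the `r` leading singular values and vectors are kept. -/
def stepData {n d₁ d₂ m : ℕ} (r : ℕ) (h₁ : r ≤ d₁ * n) (h₂ : r ≤ d₂ * n) (ω : Fin m → Loc n d₁ d₂)
    (y : Fin m → ℝ) (lam : ℝ) (s : Iterate n d₁ d₂) : StepData n d₁ d₂ r m where
  ω := ω
  y := y
  lam := lam
  ε := s.ε
  σ := fun i => s.σ i
  U := Matrix.of fun p i => s.U p (Fin.castLE h₁ i)
  V := Matrix.of fun q i => s.V q (Fin.castLE h₂ i)

/-! ### The conjugate gradient method -/

/-- Approximate solution, residual and search direction. -/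
structure CGState (ι : Type) where
  sol : ι → ℝ
  res : ι → ℝ
  dir : ι → ℝ

/-- One step of the conjugate gradient method.  (With `0 / 0 = 0`, a step that starts from
residual `0` does not change the approximate solution.) -/
noncomputable def cgStep {ι : Type} [Fintype ι] (A : Matrix ι ι ℝ) (s : CGState ι) : CGState ι :=
  let α := (s.res ⬝ᵥ s.res) / (s.dir ⬝ᵥ (A *ᵥ s.dir))
  let res' := s.res - α • (A *ᵥ s.dir)
  let β := (res' ⬝ᵥ res') / (s.res ⬝ᵥ s.res)
  { sol := s.sol + α • s.dir
    res := res'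
    dir := res' + β • s.dir }

/-- The approximate solution of `A x = b` after `N` steps of the conjugate gradient method started
from `0`. -/
noncomputable def cg {ι : Type} [Fintype ι] (A : Matrix ι ι ℝ) (b : ι → ℝ) (N : ℕ) : ι → ℝ :=
  ((cgStep A)^[N] { sol := 0, res := b, dir := b }).sol

/-- The parameter after `N` conjugate gradient steps for the correction `Δ` in
`M Δ = rhs - M γ₀`, from the initial guess `γ₀`. -/
noncomputable def StepData.cgParam {n d₁ d₂ r m : ℕ} (S : StepData n d₁ d₂ r m)
    (γ₀ : Par n d₁ d₂ r → ℝ) (N : ℕ) : Par n d₁ d₂ r → ℝ :=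
  γ₀ + cg S.M (S.rhs - S.M *ᵥ γ₀) N

/-! ### The machine model

A real RAM with structured programs.  It has integer and real registers and integer and real
arrays; the numbers of registers and of arrays are literals in the program text, so a program uses
a fixed finite number of each, whereas the positions inside an array are computed.  Every operation
on integers or reals, every memory access and every test costs one unit of time.  There is no
operation from reals to integers. -/

namespace RAM

/-- Contents of the memory. -/
structure Store where
  ireg : ℕ → ℕ
  rreg : ℕ → ℝ
  iarr : ℕ → ℕ → ℕ
  rarr : ℕ → ℕ → ℝ

/-- Resources used by a computation: `time` counts elementary operations, `space` exceeds every
position that is accessed inside an array (a program with `q` arrays uses at most `q * space` array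
cells), and `word` bounds every integer that is computed or read. -/
structure Usage where
  time : ℕ
  space : ℕ
  word : ℕ

/-- Resources of two computations, one after the other. -/
def Usage.comb (u v : Usage) : Usage :=
  ⟨u.time + v.time, max u.space v.space, max u.word v.word⟩

/-- One unit of time. -/
def Usage.tick : Usage := ⟨1, 0, 0⟩

/-- Integer expressions (`sub` is truncated). -/
inductive IExp : Type
  | lit (c : ℕ)
  | reg (i : ℕ)
  | get (arr : ℕ) (pos : IExp)
  | add (e f : IExp)
  | sub (e f : IExp)
  | mul (e f : IExp)
  | div (e f : IExp)
  | mod (e f : IExp)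

/-- Real expressions; `ofInt` converts an integer, a quotient by `0` is `0`. -/
inductive RExp : Type
  | ofInt (e : IExp)
  | reg (i : ℕ)
  | get (arr : ℕ) (pos : IExp)
  | add (x y : RExp)
  | sub (x y : RExp)
  | mul (x y : RExp)
  | div (x y : RExp)
  | sqrt (x : RExp)

/-- Programs.  `loop i e c` evaluates `e` once and then runs `c` that many times, with
`0, 1, 2, …` in the integer register `i`. -/
inductive Prog : Type
  | skip
  | setI (i : ℕ) (e : IExp)
  | setR (i : ℕ) (x : RExp)
  | putI (arr : ℕ) (pos : IExp) (e : IExp)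
  | putR (arr : ℕ) (pos : IExp) (x : RExp)
  | seq (c d : Prog)
  | ifLt (e f : IExp) (c d : Prog)
  | ifLe (x y : RExp) (c d : Prog)
  | loop (i : ℕ) (e : IExp) (c : Prog)

/-- Value of an integer expression. -/
def IExp.val (s : Store) : IExp → ℕ
  | lit c => c
  | reg i => s.ireg i
  | get arr pos => s.iarr arr (pos.val s)
  | add e f => e.val s + f.val s
  | sub e f => e.val s - f.val s
  | mul e f => e.val s * f.val s
  | div e f => e.val s / f.val s
  | mod e f => e.val s % f.val s

/-- Resources of the evaluation of an integer expression: one unit of time per node. -/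
def IExp.use (s : Store) : IExp → Usage
  | lit c => ⟨1, 0, c⟩
  | reg i => ⟨1, 0, s.ireg i⟩
  | get arr pos => (pos.use s).comb ⟨1, pos.val s + 1, s.iarr arr (pos.val s)⟩
  | add e f => ((e.use s).comb (f.use s)).comb ⟨1, 0, e.val s + f.val s⟩
  | sub e f => ((e.use s).comb (f.use s)).comb ⟨1, 0, e.val s - f.val s⟩
  | mul e f => ((e.use s).comb (f.use s)).comb ⟨1, 0, e.val s * f.val s⟩
  | div e f => ((e.use s).comb (f.use s)).comb ⟨1, 0, e.val s / f.val s⟩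
  | mod e f => ((e.use s).comb (f.use s)).comb ⟨1, 0, e.val s % f.val s⟩

/-- Value of a real expression. -/
noncomputable def RExp.val (s : Store) : RExp → ℝ
  | ofInt e => (e.val s : ℝ)
  | reg i => s.rreg i
  | get arr pos => s.rarr arr (pos.val s)
  | add x y => x.val s + y.val s
  | sub x y => x.val s - y.val s
  | mul x y => x.val s * y.val s
  | div x y => x.val s / y.val s
  | sqrt x => Real.sqrt (x.val s)

/-- Resources of the evaluation of a real expression: one unit of time per node. -/
def RExp.use (s : Store) : RExp → Usage
  | ofInt e => (e.use s).comb Usage.tick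
  | reg _ => Usage.tick
  | get _ pos => (pos.use s).comb ⟨1, pos.val s + 1, 0⟩
  | add x y => ((x.use s).comb (y.use s)).comb Usage.tick
  | sub x y => ((x.use s).comb (y.use s)).comb Usage.tick
  | mul x y => ((x.use s).comb (y.use s)).comb Usage.tick
  | div x y => ((x.use s).comb (y.use s)).comb Usage.tick
  | sqrt x => (x.use s).comb Usage.tick

/-- Run `f 0, …, f (k - 1)` one after the other; each round costs one additional unit of time. -/
def iter (f : ℕ → Store → Store × Usage) : ℕ → Store → Store × Usage
  | 0, s => (s, ⟨0, 0, 0⟩)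
  | k + 1, s =>
    let a := iter f k s
    let b := f k a.1
    (b.1, (a.2.comb b.2).comb Usage.tick)

/-- Execution of a program: the final store and the resources used. -/
noncomputable def Prog.exec : Prog → Store → Store × Usage
  | skip, s => (s, Usage.tick)
  | setI i e, s =>
    ({ s with ireg := Function.update s.ireg i (e.val s) }, (e.use s).comb Usage.tick)
  | setR i x, s =>
    ({ s with rreg := Function.update s.rreg i (x.val s) }, (x.use s).comb Usage.tick)
  | putI arr pos e, s =>
    ({ s with
        iarr := Function.update s.iarr arr (Function.update (s.iarr arr) (pos.val s) (e.val s)) },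
      ((pos.use s).comb (e.use s)).comb ⟨1, pos.val s + 1, 0⟩)
  | putR arr pos x, s =>
    ({ s with
        rarr := Function.update s.rarr arr (Function.update (s.rarr arr) (pos.val s) (x.val s)) },
      ((pos.use s).comb (x.use s)).comb ⟨1, pos.val s + 1, 0⟩)
  | seq c d, s =>
    let a := c.exec s
    let b := d.exec a.1
    (b.1, a.2.comb b.2)
  | ifLt e f c d, s =>
    open Classical in
    let b := if e.val s < f.val s then c.exec s else d.exec s
    (b.1, (((e.use s).comb (f.use s)).comb Usage.tick).comb b.2)
  | ifLe x y c d, s =>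
    open Classical in
    let b := if x.val s ≤ y.val s then c.exec s else d.exec s
    (b.1, (((x.use s).comb (y.use s)).comb Usage.tick).comb b.2)
  | loop i e c, s =>
    let b := iter (fun j s' => c.exec { s' with ireg := Function.update s'.ireg i j }) (e.val s) s
    (b.1, ((e.use s).comb Usage.tick).comb b.2)

end RAM

/-! ### Input and output -/

/-- The real arrays number `a`, `a + 1`, `a + 2` hold the matrices `Γ₁`, `Γ₂`, `Γ₃` of `γ`, row by
row. -/
def HoldsPar {n d₁ d₂ r : ℕ} (s : RAM.Store) (a : ℕ) (γ : Par n d₁ d₂ r → ℝ) : Prop :=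
  (∀ i j : Fin r, s.rarr a (i * r + j) = γ (Sum.inl (i, j))) ∧
  (∀ (i : Fin r) (q : Blk n d₂),
    s.rarr (a + 1) (i * (d₂ * n) + (q.1 * n + q.2)) = γ (Sum.inr (Sum.inl (i, q)))) ∧
  (∀ (p : Blk n d₁) (j : Fin r),
    s.rarr (a + 2) ((p.1 * n + p.2) * r + j) = γ (Sum.inr (Sum.inr (p, j))))

/-- The input: the numbers `n, d₁, d₂, r, m, N` in integer registers, `λ, ε` in real registers, the
sample locations in three integer arrays, and `U`, `V` (row by row), `σ`, `y` and the initial guess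
`γ₀` in real arrays.  The other registers and array cells are arbitrary. -/
structure HoldsInput {n d₁ d₂ r m : ℕ} (s : RAM.Store) (S : StepData n d₁ d₂ r m) (N : ℕ)
    (γ₀ : Par n d₁ d₂ r → ℝ) : Prop where
  n_eq : s.ireg 0 = n
  d₁_eq : s.ireg 1 = d₁
  d₂_eq : s.ireg 2 = d₂
  r_eq : s.ireg 3 = r
  m_eq : s.ireg 4 = m
  N_eq : s.ireg 5 = N
  lam_eq : s.rreg 0 = S.lam
  ε_eq : s.rreg 1 = S.ε
  row_eq : ∀ l : Fin m, s.iarr 0 l = (S.ω l).1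
  col_eq : ∀ l : Fin m, s.iarr 1 l = (S.ω l).2.1
  time_eq : ∀ l : Fin m, s.iarr 2 l = (S.ω l).2.2
  U_eq : ∀ (p : Blk n d₁) (i : Fin r), s.rarr 0 ((p.1 * n + p.2) * r + i) = S.U p i
  V_eq : ∀ (q : Blk n d₂) (i : Fin r), s.rarr 1 ((q.1 * n + q.2) * r + i) = S.V q i
  σ_eq : ∀ i : Fin r, s.rarr 2 i = S.σ i
  y_eq : ∀ l : Fin m, s.rarr 3 l = S.y l
  par : HoldsPar s 4 γ₀

/-- The output: `γ` has replaced the initial guess, and `p` is in the next real array. -/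
def HoldsOutput {n d₁ d₂ r m : ℕ} (s : RAM.Store) (γ : Par n d₁ d₂ r → ℝ) (p : Fin m → ℝ) : Prop :=
  HoldsPar s 4 γ ∧ ∀ l : Fin m, s.rarr 7 l = p l

end TOIRLS

/-! Exactly `r` singular values of the previous Hankel matrix exceed ε, so the weight operator is
ε⁻² times the identity plus a correction that lives on the tangent space: W = ε⁻² Id + P_T (D_S −
ε⁻²) P_Tᵀ (`vec_weightOp`). The first-order conditions of the weighted least squares problem are
HᵀWHX = ε⁻² P_Ωᵀ p and P_Ω X − y = −λ ε⁻² p with a multiplier p. The tangential unknown is γ = (I −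
ε² D_S) P_Tᵀ H X. Since HᵀH is the diagonal matrix of block counts D², the first condition becomes X
= D⁻² (P_Ωᵀ p + Hᵀ P_T γ), the second becomes p = K⁻¹(y − Eγ), and consistency of γ with X is
precisely Mγ = b. This is a Woodbury elimination, whose algebraic core is `mDiag_mul`;
`weight_reconstruct` and `sample_reconstruct` are the two conditions. W is positive definite and H
is injective, so expanding the objective around the reconstruction shows that every minimizer
coincides with it (`reconstruct_eq_of_isWLS`). The case λ = 0 is the same argument with the second
condition read as feasibility.

M is positive definite because Eᵀ K⁻¹ E is positive semidefinite, the entries of the diagonal part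
exceed 1, and the subtracted term is at most the identity: P_T and G are partial isometries
(`M_posDef`). For such a matrix the nonzero residuals of the conjugate gradient method are pairwise
orthogonal, so there are at most dim S of them (`cgSeq_orthogonal`, `mulVec_cg_eq`).

For the resources, P_T γ is kept as a product of two factors with 2r columns
(`tangentFun_eq_factors`). Up to the diagonal part, Mγ is P_Tᵀ applied to one block Hankel matrix
(`StepData.system_eq`), of which only the products with U and V are needed. The samples contribute
to these products entry by entry, at cost O(rTm). The low rank part is a convolution followed by a
weighted correlation in the block index, and both become pointwise operations or inner products
after a discrete Fourier transform of order L with T ≤ L ≤ 2T (`RAM.sum_conj_mixSum`). Treating one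
output frequency at a time keeps the space at O(rnT), and the time O(r²nT²) is within the bound even
though the transforms are evaluated by their definition. The root of unity comes from repeated angle
halving with square roots.

Resource bounds for programs are proved by a small calculus: the time is a syntactic constant times
a budget that is split among loop rounds (`RAM.Good.loop`), and integers stay below a fixed power of
a number X as long as registers and entries read from arrays are at most X (`RAM.Prog.Ok.bound`).
One generic rule for nested loops that accumulate into an array (`RAM.nest_addTo`) carries nearly
all program pieces. -/

namespace TOIRLS

/-! ### The normalized block Hankel operator -/

section Hankel

variable {n d₁ d₂ : ℕ}

/-- The number of blocks of a block Hankel matrix that hold the block `t`. -/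
noncomputable def blockCount (n d₁ d₂ : ℕ) (l : Loc n d₁ d₂) : ℝ :=
  ∑ x, hankelMat n d₁ d₂ x l ^ 2

/-- The first block column meets the antidiagonals below d₁ and the last block row meets the
remaining ones, so no antidiagonal is empty. This makes the operator D invertible. -/
theorem exists_hankelMat_eq_one [NeZero d₁] [NeZero d₂] (l : Loc n d₁ d₂) :
    ∃ x, hankelMat n d₁ d₂ x l = 1 := by
  obtain ⟨i, j, t, ht⟩ := l
  have h₁ := NeZero.pos d₁
  have h₂ := NeZero.pos d₂
  by_cases h : t < d₁
  · exact ⟨((⟨t, h⟩, i), (⟨0, by omega⟩, j)), by simp [hankelMat]⟩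
  · exact ⟨((⟨d₁ - 1, by omega⟩, i), (⟨t - (d₁ - 1), by omega⟩, j)), by
      simp [hankelMat]; omega⟩

theorem blockCount_pos [NeZero d₁] [NeZero d₂] (l : Loc n d₁ d₂) : 0 < blockCount n d₁ d₂ l := by
  obtain ⟨x, hx⟩ := exists_hankelMat_eq_one l
  exact Finset.sum_pos' (fun _ _ => sq_nonneg _) ⟨x, Finset.mem_univ x, by simp [hx]⟩

/-- Each entry of a block Hankel matrix is a copy of a single sample, so different samples have
disjoint supports. -/
theorem hankelMat_mul_hankelMat (x : Blk n d₁ × Blk n d₂) (l l' : Loc n d₁ d₂) (h : l ≠ l') :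
    hankelMat n d₁ d₂ x l * hankelMat n d₁ d₂ x l' = 0 := by
  simp only [hankelMat, Matrix.of_apply, mul_ite, mul_one, mul_zero]
  split_ifs with h1 h2
  · refine absurd ?_ h
    refine Prod.ext (h2.1.trans h1.1.symm) (Prod.ext (h2.2.1.trans h1.2.1.symm) (Fin.ext ?_))
    rw [h2.2.2, h1.2.2]
  · rfl
  · rfl

/-- Disjoint supports give orthogonal columns: HᵀH = D². All later simplifications rest on this. -/
theorem hankelMat_transpose_mul :
    (hankelMat n d₁ d₂)ᵀ * hankelMat n d₁ d₂ = Matrix.diagonal (blockCount n d₁ d₂) := by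
  ext l l'
  rw [Matrix.mul_apply]
  by_cases h : l = l'
  · subst h
    simp [blockCount, sq]
  · rw [Matrix.diagonal_apply_ne _ h]
    exact Finset.sum_eq_zero fun x _ => hankelMat_mul_hankelMat x l l' h

/-- The diagonal operator with the reciprocals of the block counts. -/
noncomputable def countInv (n d₁ d₂ : ℕ) : Matrix (Loc n d₁ d₂) (Loc n d₁ d₂) ℝ :=
  Matrix.diagonal fun l => (blockCount n d₁ d₂ l)⁻¹

theorem diagMat_inv [NeZero d₁] [NeZero d₂] :
    (diagMat n d₁ d₂)⁻¹ = Matrix.diagonal fun l => (Real.sqrt (blockCount n d₁ d₂ l))⁻¹ := by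
  apply Matrix.inv_eq_right_inv
  rw [diagMat, Matrix.diagonal_mul_diagonal, ← Matrix.diagonal_one]
  congr 1
  funext l
  exact mul_inv_cancel₀ (Real.sqrt_pos.mpr (blockCount_pos l)).ne'

theorem diagMat_inv_mul_self [NeZero d₁] [NeZero d₂] : (diagMat n d₁ d₂)⁻¹ * (diagMat n d₁ d₂)⁻¹ = countInv n d₁ d₂ := by
  rw [diagMat_inv, Matrix.diagonal_mul_diagonal, countInv]
  congr 1
  funext l
  rw [← mul_inv, Real.mul_self_sqrt (blockCount_pos l).le]

theorem normHankelMat_eq [NeZero d₁] [NeZero d₂] :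
    normHankelMat n d₁ d₂ = hankelMat n d₁ d₂ * (diagMat n d₁ d₂)⁻¹ := by
  ext x l
  rw [diagMat_inv, Matrix.mul_diagonal, normHankelMat, Matrix.of_apply, div_eq_mul_inv]
  rfl

theorem diagMat_inv_transpose [NeZero d₁] [NeZero d₂] : ((diagMat n d₁ d₂)⁻¹)ᵀ = (diagMat n d₁ d₂)⁻¹ := by
  rw [diagMat_inv, Matrix.diagonal_transpose]

/-- The two square roots combine, so D⁻¹Gᵀ involves only reciprocals of integer counts. The program
therefore never needs D itself. -/
theorem diagMat_inv_mul_normHankelMat [NeZero d₁] [NeZero d₂] :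
    (diagMat n d₁ d₂)⁻¹ * (normHankelMat n d₁ d₂)ᵀ = countInv n d₁ d₂ * (hankelMat n d₁ d₂)ᵀ := by
  rw [normHankelMat_eq, Matrix.transpose_mul, diagMat_inv_transpose, ← Matrix.mul_assoc,
    diagMat_inv_mul_self]

theorem normHankelMat_mul_transpose [NeZero d₁] [NeZero d₂] :
    normHankelMat n d₁ d₂ * (normHankelMat n d₁ d₂)ᵀ =
      hankelMat n d₁ d₂ * countInv n d₁ d₂ * (hankelMat n d₁ d₂)ᵀ := by
  rw [Matrix.mul_assoc, ← diagMat_inv_mul_normHankelMat, ← Matrix.mul_assoc, ← normHankelMat_eq]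

theorem countInv_mul [NeZero d₁] [NeZero d₂] : countInv n d₁ d₂ * Matrix.diagonal (blockCount n d₁ d₂) = 1 := by
  rw [countInv, Matrix.diagonal_mul_diagonal, ← Matrix.diagonal_one]
  congr 1
  funext l
  exact inv_mul_cancel₀ (blockCount_pos l).ne'

theorem countInv_transpose : (countInv n d₁ d₂)ᵀ = countInv n d₁ d₂ := by
  rw [countInv, Matrix.diagonal_transpose]

/-- D⁻² Hᵀ is a left inverse of H. -/
theorem eq_zero_of_hankelMat_mulVec [NeZero d₁] [NeZero d₂] {X : Loc n d₁ d₂ → ℝ}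
    (h : hankelMat n d₁ d₂ *ᵥ X = 0) :
    X = 0 := by
  have h1 : (countInv n d₁ d₂ * ((hankelMat n d₁ d₂)ᵀ * hankelMat n d₁ d₂)) *ᵥ X = 0 := by
    rw [← Matrix.mulVec_mulVec, ← Matrix.mulVec_mulVec, h, Matrix.mulVec_zero, Matrix.mulVec_zero]
  rwa [hankelMat_transpose_mul, countInv_mul, Matrix.one_mulVec] at h1

end Hankel

/-- A partial isometry is a contraction. -/
theorem dotProduct_mulVec_self_le {α β : Type*} [Fintype α] [Fintype β] {A : Matrix α β ℝ}
    (hA : A * Aᵀ * A = A) (v : β → ℝ) : (A *ᵥ v) ⬝ᵥ (A *ᵥ v) ≤ v ⬝ᵥ v := by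
  have h1 : (A *ᵥ v) ⬝ᵥ (A *ᵥ v) = v ⬝ᵥ (Aᵀ *ᵥ (A *ᵥ v)) := by
    rw [Matrix.dotProduct_mulVec v, Matrix.vecMul_transpose]
  have h2 : (Aᵀ *ᵥ (A *ᵥ v)) ⬝ᵥ (Aᵀ *ᵥ (A *ᵥ v)) = (A *ᵥ v) ⬝ᵥ (A *ᵥ v) := by
    rw [Matrix.dotProduct_mulVec, Matrix.vecMul_transpose, Matrix.mulVec_mulVec,
      Matrix.mulVec_mulVec, hA]
  -- By `h1` and `h2` this square equals ‖v‖² − ‖Av‖².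
  have h3 : 0 ≤ (v - Aᵀ *ᵥ (A *ᵥ v)) ⬝ᵥ (v - Aᵀ *ᵥ (A *ᵥ v)) :=
    Finset.sum_nonneg fun i _ => mul_self_nonneg _
  rw [sub_dotProduct, dotProduct_sub, dotProduct_sub, h2, dotProduct_comm (Aᵀ *ᵥ _), ← h1] at h3
  linarith

/-! ### The parametrization of the tangent space -/

section Tangent

variable {n d₁ d₂ r : ℕ} {U : Matrix (Blk n d₁) (Fin r) ℝ} {V : Matrix (Blk n d₂) (Fin r) ℝ}

/-- The parameter with given components. -/
def parOf (Γ₁ : Matrix (Fin r) (Fin r) ℝ) (Γ₂ : Matrix (Fin r) (Blk n d₂) ℝ)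
    (Γ₃ : Matrix (Blk n d₁) (Fin r) ℝ) : Par n d₁ d₂ r → ℝ
  | Sum.inl x => Γ₁ x.1 x.2
  | Sum.inr (Sum.inl x) => Γ₂ x.1 x.2
  | Sum.inr (Sum.inr x) => Γ₃ x.1 x.2

theorem tangentFun_parOf (Γ₁ : Matrix (Fin r) (Fin r) ℝ) (Γ₂ : Matrix (Fin r) (Blk n d₂) ℝ)
    (Γ₃ : Matrix (Blk n d₁) (Fin r) ℝ) :
    tangentFun U V (parOf Γ₁ Γ₂ Γ₃) =
      U * Γ₁ * Vᵀ + U * Γ₂ * (1 - V * Vᵀ) + (1 - U * Uᵀ) * Γ₃ * Vᵀ := rfl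

theorem exists_eq_parOf (γ : Par n d₁ d₂ r → ℝ) : ∃ Γ₁ Γ₂ Γ₃, γ = parOf Γ₁ Γ₂ Γ₃ :=
  ⟨Matrix.of fun i j => γ (Sum.inl (i, j)), Matrix.of fun i q => γ (Sum.inr (Sum.inl (i, q))),
    Matrix.of fun p j => γ (Sum.inr (Sum.inr (p, j))), by
      funext c
      rcases c with x | x | x <;> rfl⟩

/-- Frobenius inner products written as traces, so that adjoints can be computed by cyclic
permutation of factors. -/
theorem trace_transpose_mul {α β : Type*} [Fintype α] [Fintype β] (A B : Matrix α β ℝ) :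
    (Aᵀ * B).trace = ∑ x : α × β, A x.1 x.2 * B x.1 x.2 := by
  simp only [Matrix.trace, Matrix.diag, Matrix.mul_apply, Matrix.transpose_apply]
  rw [Fintype.sum_prod_type, Finset.sum_comm]

theorem parOf_dotProduct_parOf (Γ₁ Δ₁ : Matrix (Fin r) (Fin r) ℝ)
    (Γ₂ Δ₂ : Matrix (Fin r) (Blk n d₂) ℝ) (Γ₃ Δ₃ : Matrix (Blk n d₁) (Fin r) ℝ) :
    parOf Γ₁ Γ₂ Γ₃ ⬝ᵥ parOf Δ₁ Δ₂ Δ₃ =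
      (Γ₁ᵀ * Δ₁).trace + (Γ₂ᵀ * Δ₂).trace + (Γ₃ᵀ * Δ₃).trace := by
  rw [trace_transpose_mul, trace_transpose_mul, trace_transpose_mul, dotProduct, Fintype.sum_sum_type, Fintype.sum_sum_type, add_assoc]
  rfl

/-- The adjoint of the parametrization of the tangent space. -/
theorem tangentMat_transpose_mulVec (Z : Matrix (Blk n d₁) (Blk n d₂) ℝ) :
    (tangentMat U V)ᵀ *ᵥ vec Z =
      parOf (Uᵀ * Z * V) (Uᵀ * Z * (1 - V * Vᵀ)) ((1 - U * Uᵀ) * Z * V) := by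
  apply dotProduct_eq
  intro γ
  obtain ⟨Γ₁, Γ₂, Γ₃, rfl⟩ := exists_eq_parOf γ
  rw [dotProduct_comm, dotProduct_comm _ (parOf Γ₁ Γ₂ Γ₃), Matrix.dotProduct_mulVec,
    Matrix.vecMul_transpose, tangentMat_mulVec, tangentFun_parOf,
    parOf_dotProduct_parOf]
  -- Both sides are now sums of three traces, which agree term by term after one cyclic permutation.
  refine (trace_transpose_mul _ Z).symm.trans ?_
  simp only [Matrix.transpose_add, Matrix.transpose_mul, Matrix.transpose_sub,
    Matrix.transpose_one, Matrix.transpose_transpose, Matrix.add_mul, Matrix.trace_add]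
  congr 1
  · congr 1
    · rw [Matrix.mul_assoc, Matrix.trace_mul_comm]
      simp only [Matrix.mul_assoc]
    · rw [Matrix.mul_assoc, Matrix.trace_mul_comm]
      simp only [Matrix.mul_assoc]
  · rw [Matrix.mul_assoc, Matrix.trace_mul_comm]
    simp only [Matrix.mul_assoc]

/-- The parametrization is redundant: the part of Γ₂ in the row space of Vᵀ and the part of Γ₃ in
the column space of U are lost. It is thus a partial isometry and not an isometry. Orthonormality of
the columns of U and V turns the composition with the adjoint into the projections that are already
present. -/
theorem tangentMat_partialIsometry (hU : Uᵀ * U = 1) (hV : Vᵀ * V = 1) :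
    tangentMat U V * (tangentMat U V)ᵀ * tangentMat U V = tangentMat U V := by
  have hU' : ∀ {β : Type} (A : Matrix (Fin r) β ℝ), Uᵀ * (U * A) = A := fun A => by
    rw [← Matrix.mul_assoc, hU, Matrix.one_mul]
  have hV' : ∀ {β : Type} (A : Matrix (Fin r) β ℝ), Vᵀ * (V * A) = A := fun A => by
    rw [← Matrix.mul_assoc, hV, Matrix.one_mul]
  refine Matrix.mulVec_injective (funext fun γ => ?_)
  obtain ⟨Γ₁, Γ₂, Γ₃, rfl⟩ := exists_eq_parOf γ
  rw [← Matrix.mulVec_mulVec, ← Matrix.mulVec_mulVec, tangentMat_mulVec U V (parOf _ _ _),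
    tangentMat_transpose_mulVec, tangentMat_mulVec, tangentFun_parOf, tangentFun_parOf]
  congr 1
  simp only [Matrix.mul_add, Matrix.add_mul, Matrix.mul_sub, Matrix.sub_mul, Matrix.mul_assoc,
    Matrix.one_mul, Matrix.mul_one, hU', hV', hV]
  abel

end Tangent

/-! ### The linear system -/

namespace StepData

variable {n d₁ d₂ r m : ℕ}

/-- The properties of the data of a step that make the linear system well posed. -/
structure Valid (S : StepData n d₁ d₂ r m) : Prop where
  inj : Function.Injective S.ω
  lam_nonneg : 0 ≤ S.lam
  ε_pos : 0 < S.ε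
  ε_lt : ∀ i, S.ε < S.σ i

variable {S : StepData n d₁ d₂ r m}

/-- The locations are distinct, hence no two samples interact. This is why K is diagonal and its
inverse costs O(m). -/
theorem sampleMat_mul_diagonal (hS : S.Valid) (w : Loc n d₁ d₂ → ℝ) :
    sampleMat S.ω * Matrix.diagonal w * (sampleMat S.ω)ᵀ =
      Matrix.diagonal fun l => w (S.ω l) := by
  ext l l'
  rw [Matrix.mul_apply]
  simp only [Matrix.mul_diagonal, sampleMat, Matrix.transpose_apply, Matrix.of_apply, ite_mul,
    one_mul, zero_mul, Finset.sum_ite_eq', Finset.mem_univ, if_true, mul_ite,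
    mul_one, mul_zero, Matrix.diagonal_apply, hS.inj.eq_iff]
  by_cases h : l = l'
  · simp [h]
  · simp [h, Ne.symm h]

/-- The diagonal entries of `K`. -/
noncomputable def kDiag (S : StepData n d₁ d₂ r m) (l : Fin m) : ℝ :=
  S.lam * (S.ε ^ 2)⁻¹ + (blockCount n d₁ d₂ (S.ω l))⁻¹

/-- The reciprocal block count is positive by itself, so λ = 0 is allowed. -/
theorem kDiag_pos [NeZero d₁] [NeZero d₂] (hS : S.Valid) (l : Fin m) : 0 < S.kDiag l :=
  add_pos_of_nonneg_of_pos (mul_nonneg hS.lam_nonneg (by positivity))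
    (inv_pos.mpr (blockCount_pos _))

theorem K_eq [NeZero d₁] [NeZero d₂] (hS : S.Valid) : S.K = Matrix.diagonal S.kDiag := by
  rw [K, Matrix.mul_assoc (sampleMat S.ω), diagMat_inv_mul_self, countInv,
    sampleMat_mul_diagonal hS, Matrix.smul_one_eq_diagonal, Matrix.diagonal_add]
  rfl

theorem K_inv [NeZero d₁] [NeZero d₂] (hS : S.Valid) : S.K⁻¹ = Matrix.diagonal fun l => (S.kDiag l)⁻¹ := by
  apply Matrix.inv_eq_right_inv
  rw [K_eq hS, Matrix.diagonal_mul_diagonal, ← Matrix.diagonal_one]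
  congr 1
  funext l
  exact mul_inv_cancel₀ (kDiag_pos hS l).ne'

theorem K_mul_inv [NeZero d₁] [NeZero d₂] (hS : S.Valid) : S.K * S.K⁻¹ = 1 := by
  rw [K_inv hS, K_eq hS, Matrix.diagonal_mul_diagonal, ← Matrix.diagonal_one]
  congr 1
  funext l
  exact mul_inv_cancel₀ (kDiag_pos hS l).ne'

theorem E_eq [NeZero d₁] [NeZero d₂] : S.E = sampleMat S.ω * countInv n d₁ d₂ * (hankelMat n d₁ d₂)ᵀ *
    tangentMat S.U S.V := by
  rw [E, Matrix.mul_assoc (sampleMat S.ω), diagMat_inv_mul_normHankelMat, ← Matrix.mul_assoc]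

/-- The diagonal part of `M`. -/
noncomputable def mDiag (S : StepData n d₁ d₂ r m) (c : Par n d₁ d₂ r) : ℝ :=
  (tangentWeight S.σ S.ε c)⁻¹ / ((tangentWeight S.σ S.ε c)⁻¹ - S.ε ^ 2)

theorem M_eq : S.M = S.Eᵀ * S.K⁻¹ * S.E + Matrix.diagonal S.mDiag -
    (tangentMat S.U S.V)ᵀ * normHankelMat n d₁ d₂ * (normHankelMat n d₁ d₂)ᵀ *
      tangentMat S.U S.V := rfl

theorem tangentWeight_pos (hS : S.Valid) (c : Par n d₁ d₂ r) :
    0 < tangentWeight S.σ S.ε c := by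
  have h : ∀ i, 0 < max (S.σ i) S.ε := fun i => lt_max_of_lt_right hS.ε_pos
  rcases c with ⟨i, j⟩ | ⟨i, q⟩ | ⟨p, j⟩
  · exact mul_pos (inv_pos.mpr (h i)) (inv_pos.mpr (h j))
  · exact mul_pos (inv_pos.mpr (h i)) (inv_pos.mpr hS.ε_pos)
  · exact mul_pos (inv_pos.mpr hS.ε_pos) (inv_pos.mpr (h j))

/-- Every inverse weight is a product of two factors, both at least ε and one of them a leading
singular value, which is strictly larger. So the denominators in the diagonal part of M are
positive. -/
theorem lt_tangentWeight_inv (hS : S.Valid) (c : Par n d₁ d₂ r) :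
    S.ε ^ 2 < (tangentWeight S.σ S.ε c)⁻¹ := by
  have h : ∀ i, S.ε < max (S.σ i) S.ε := fun i => lt_max_of_lt_left (hS.ε_lt i)
  have h0 := hS.ε_pos
  rcases c with ⟨i, j⟩ | ⟨i, q⟩ | ⟨p, j⟩ <;> simp only [tangentWeight, mul_inv, inv_inv, sq]
  · exact mul_lt_mul'' (h i) (h j) h0.le h0.le
  · exact mul_lt_mul_of_pos_right (h i) h0
  · exact mul_lt_mul_of_pos_left (h j) h0

theorem one_lt_mDiag (hS : S.Valid) (c : Par n d₁ d₂ r) : 1 < S.mDiag c := by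
  have h := lt_tangentWeight_inv hS c
  have h0 := hS.ε_pos
  rw [mDiag, one_lt_div (sub_pos.mpr h)]
  have : 0 < S.ε ^ 2 := by positivity
  linarith

/-- With w the tangential weight, the diagonal entry of M is 1/(1 − ε²w), that is, −ε⁻² times the
inverse of the correction w − ε⁻². This is the cancellation behind the elimination of the tangential
unknown. -/
theorem mDiag_mul (hS : S.Valid) (c : Par n d₁ d₂ r) :
    (tangentWeight S.σ S.ε c - (S.ε ^ 2)⁻¹) * S.mDiag c = -(S.ε ^ 2)⁻¹ := by
  have h := lt_tangentWeight_inv hS c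
  have h1 := tangentWeight_pos hS c
  have h0 := hS.ε_pos
  rw [mDiag]
  have h2 := (sub_pos.mpr h).ne'
  generalize tangentWeight S.σ S.ε c = t at *
  have h3 : 1 - S.ε ^ 2 * t ≠ 0 := by
    intro h4
    apply h2
    field_simp
    linarith
  have h5 : t⁻¹ / (t⁻¹ - S.ε ^ 2) = 1 / (1 - S.ε ^ 2 * t) := by
    field_simp
  rw [h5, mul_one_div, div_eq_iff h3]
  field_simp
  ring

/-- The columns of G are even orthonormal; the weaker form is what transposes to a contraction
statement for Gᵀ. -/
theorem normHankelMat_partialIsometry [NeZero d₁] [NeZero d₂] :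
    normHankelMat n d₁ d₂ * (normHankelMat n d₁ d₂)ᵀ * normHankelMat n d₁ d₂ =
      normHankelMat n d₁ d₂ := by
  rw [normHankelMat_mul_transpose, normHankelMat_eq]
  simp only [Matrix.mul_assoc]
  rw [← Matrix.mul_assoc (hankelMat n d₁ d₂)ᵀ, hankelMat_transpose_mul, ← Matrix.mul_assoc
    (countInv n d₁ d₂), countInv_mul, Matrix.one_mul]

/-- The first summand is a congruence of a positive diagonal matrix, the diagonal part strictly
exceeds the identity, and the quadratic form of the subtracted term is ‖GᵀP_T x‖² ≤ ‖x‖² by two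
contractions. Strictness comes from the diagonal part alone. -/
theorem M_posDef [NeZero d₁] [NeZero d₂] (hS : S.Valid) (hU : S.Uᵀ * S.U = 1)
    (hV : S.Vᵀ * S.V = 1) : S.M.PosDef := by
  refine Matrix.PosDef.of_dotProduct_mulVec_pos ?_ fun x hx => ?_
  · have hK : (S.K⁻¹)ᵀ = S.K⁻¹ := by rw [K_inv hS, Matrix.diagonal_transpose]
    rw [Matrix.IsHermitian, Matrix.conjTranspose_eq_transpose_of_trivial, M_eq]
    simp only [Matrix.transpose_add, Matrix.transpose_sub, Matrix.transpose_mul,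
      Matrix.transpose_transpose, Matrix.diagonal_transpose, hK, Matrix.mul_assoc]
  · rw [star_trivial, M_eq, Matrix.sub_mulVec, Matrix.add_mulVec, dotProduct_sub, dotProduct_add]
    have h1 : 0 ≤ x ⬝ᵥ ((S.Eᵀ * S.K⁻¹ * S.E) *ᵥ x) := by
      rw [← Matrix.mulVec_mulVec, ← Matrix.mulVec_mulVec, Matrix.dotProduct_mulVec,
        Matrix.vecMul_transpose, K_inv hS]
      refine Finset.sum_nonneg fun l _ => ?_
      rw [Matrix.mulVec_diagonal]
      nlinarith [inv_pos.mpr (kDiag_pos hS l), mul_self_nonneg ((S.E *ᵥ x) l),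
        mul_nonneg (inv_pos.mpr (kDiag_pos hS l)).le (mul_self_nonneg ((S.E *ᵥ x) l))]
    have h2 : x ⬝ᵥ x < x ⬝ᵥ (Matrix.diagonal S.mDiag *ᵥ x) := by
      obtain ⟨c, hc⟩ := Function.ne_iff.mp hx
      have hle : ∀ c, x c * x c ≤ x c * (Matrix.diagonal S.mDiag *ᵥ x) c := fun c => by
        rw [Matrix.mulVec_diagonal]
        nlinarith [one_lt_mDiag hS c, mul_self_nonneg (x c)]
      refine Finset.sum_lt_sum (fun c _ => hle c) ⟨c, Finset.mem_univ c, ?_⟩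
      rw [Matrix.mulVec_diagonal]
      have : 0 < x c * x c := mul_self_pos.mpr hc
      nlinarith [one_lt_mDiag hS c]
    have h3 : x ⬝ᵥ (((tangentMat S.U S.V)ᵀ * normHankelMat n d₁ d₂ * (normHankelMat n d₁ d₂)ᵀ *
        tangentMat S.U S.V) *ᵥ x) ≤ x ⬝ᵥ x := by
      rw [Matrix.mul_assoc, ← Matrix.transpose_transpose (normHankelMat n d₁ d₂),
        ← Matrix.transpose_mul, Matrix.transpose_transpose, ← Matrix.mulVec_mulVec,
        Matrix.dotProduct_mulVec, Matrix.vecMul_transpose, ← Matrix.mulVec_mulVec]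
      refine (dotProduct_mulVec_self_le ?_ _).trans
        (dotProduct_mulVec_self_le (tangentMat_partialIsometry hU hV) x)
      have h := congrArg Matrix.transpose (normHankelMat_partialIsometry (n := n) (d₁ := d₁)
        (d₂ := d₂))
      simpa only [Matrix.transpose_mul, Matrix.transpose_transpose, Matrix.mul_assoc] using h
    linarith

/-! ### Optimality of the reconstruction -/

/-- The weight operator in terms of the leading singular vectors. -/
noncomputable def weightMat (S : StepData n d₁ d₂ r m) :
    Matrix (Blk n d₁ × Blk n d₂) (Blk n d₁ × Blk n d₂) ℝ :=
  (S.ε ^ 2)⁻¹ • (1 : Matrix (Blk n d₁ × Blk n d₂) (Blk n d₁ × Blk n d₂) ℝ) + tangentMat S.U S.V *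
    Matrix.diagonal (fun c : Par n d₁ d₂ r => tangentWeight S.σ S.ε c - (S.ε ^ 2)⁻¹) *
      (tangentMat S.U S.V)ᵀ

theorem weightMat_transpose : S.weightMatᵀ = S.weightMat := by
  simp only [weightMat, Matrix.transpose_add, Matrix.transpose_smul, Matrix.transpose_one,
    Matrix.transpose_mul, Matrix.transpose_transpose, Matrix.diagonal_transpose, Matrix.mul_assoc]

/-- With q = P_Tᵀ v the quadratic form is ε⁻²(‖v‖² − ‖q‖²) plus a positively weighted square norm of
q. Both parts are nonnegative because P_Tᵀ is a contraction; if both vanish, then q = 0 and next v =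
0. -/
theorem eq_zero_of_weightMat (hS : S.Valid) (hU : S.Uᵀ * S.U = 1) (hV : S.Vᵀ * S.V = 1)
    (v : Blk n d₁ × Blk n d₂ → ℝ) (h : v ⬝ᵥ (S.weightMat *ᵥ v) ≤ 0) : v = 0 := by
  set q := (tangentMat S.U S.V)ᵀ *ᵥ v with hq
  have hle : q ⬝ᵥ q ≤ v ⬝ᵥ v := by
    refine dotProduct_mulVec_self_le (A := (tangentMat S.U S.V)ᵀ) ?_ v
    have h := congrArg Matrix.transpose (tangentMat_partialIsometry hU hV)
    simpa only [Matrix.transpose_mul, Matrix.transpose_transpose, Matrix.mul_assoc] using h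
  have h1 : v ⬝ᵥ (S.weightMat *ᵥ v) =
      (S.ε ^ 2)⁻¹ * (v ⬝ᵥ v - q ⬝ᵥ q) + ∑ c, tangentWeight S.σ S.ε c * (q c * q c) := by
    rw [weightMat, Matrix.add_mulVec, dotProduct_add, Matrix.smul_mulVec, Matrix.one_mulVec,
      dotProduct_smul, ← Matrix.mulVec_mulVec, ← Matrix.mulVec_mulVec, ← hq,
      Matrix.dotProduct_mulVec, ← Matrix.mulVec_transpose, ← hq, mul_sub, smul_eq_mul]
    have h2 : q ⬝ᵥ (Matrix.diagonal (fun c : Par n d₁ d₂ r => tangentWeight S.σ S.ε c - (S.ε ^ 2)⁻¹) *ᵥ q) =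
        ∑ c, tangentWeight S.σ S.ε c * (q c * q c) - (S.ε ^ 2)⁻¹ * (q ⬝ᵥ q) := by
      rw [dotProduct, dotProduct, Finset.mul_sum, ← Finset.sum_sub_distrib]
      refine Finset.sum_congr rfl fun c _ => ?_
      rw [Matrix.mulVec_diagonal]
      ring
    rw [h2]
    ring
  have hε : 0 < (S.ε ^ 2)⁻¹ := by have := hS.ε_pos; positivity
  have h0 : ∀ c ∈ Finset.univ, 0 ≤ tangentWeight S.σ S.ε c * (q c * q c) := fun c _ =>
    mul_nonneg (tangentWeight_pos hS c).le (mul_self_nonneg _)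
  have h3 := Finset.sum_nonneg h0
  have h4 : 0 ≤ (S.ε ^ 2)⁻¹ * (v ⬝ᵥ v - q ⬝ᵥ q) := mul_nonneg hε.le (sub_nonneg.mpr hle)
  have h5 : ∑ c, tangentWeight S.σ S.ε c * (q c * q c) = 0 := by linarith
  have h6 : (S.ε ^ 2)⁻¹ * (v ⬝ᵥ v - q ⬝ᵥ q) = 0 := by linarith
  have h7 : q = 0 := by
    funext c
    have := (Finset.sum_eq_zero_iff_of_nonneg h0).mp h5 c (Finset.mem_univ c)
    exact mul_self_eq_zero.mp ((mul_eq_zero.mp this).resolve_left (tangentWeight_pos hS c).ne')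
  have h8 := (mul_eq_zero.mp h6).resolve_left hε.ne'
  rw [h7, zero_dotProduct, sub_zero] at h8
  exact dotProduct_self_eq_zero.mp h8

/-! ### First-order conditions for the reconstruction, and uniqueness of the minimizer -/

section Stationary

variable [NeZero d₁] [NeZero d₂] {γ : Par n d₁ d₂ r → ℝ}

/-- Sampling the reconstruction gives (K − λε⁻²)p + Eγ, and Kp = y − Eγ by the choice of p. No
equation for γ is needed here. For λ = 0 it says that the reconstruction interpolates the data. -/
theorem sample_reconstruct (hS : S.Valid) (γ : Par n d₁ d₂ r → ℝ) :
    sampleMat S.ω *ᵥ S.reconstruct (S.residual γ) γ - S.y =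
      -(S.lam * (S.ε ^ 2)⁻¹) • S.residual γ := by
  have hK : S.K *ᵥ S.residual γ = S.y - S.E *ᵥ γ := by
    rw [residual, Matrix.mulVec_mulVec, K_mul_inv hS, Matrix.one_mulVec]
  have h1 : sampleMat S.ω *ᵥ S.reconstruct (S.residual γ) γ =
      S.K *ᵥ S.residual γ - (S.lam * (S.ε ^ 2)⁻¹) • S.residual γ + S.E *ᵥ γ := by
    rw [reconstruct, Matrix.mulVec_add, Matrix.mulVec_mulVec, Matrix.mulVec_mulVec]
    congr 1
    · rw [K, Matrix.add_mulVec, Matrix.smul_mulVec, Matrix.one_mulVec, add_sub_cancel_left]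
      simp only [Matrix.mul_assoc]
    · rw [E]
      simp only [Matrix.mul_assoc]
  rw [h1, hK, neg_smul]
  abel

/-- The linear system identifies P_Tᵀ H X, on which the correction of the weight then acts as −ε⁻²
γ. The resulting term −ε⁻² HᵀP_T γ cancels the low rank part of ε⁻² HᵀHX, and only the sampled part
remains. -/
theorem weight_reconstruct (hS : S.Valid) (h : S.M *ᵥ γ = S.rhs) :
    ((hankelMat n d₁ d₂)ᵀ * S.weightMat * hankelMat n d₁ d₂) *ᵥ
        S.reconstruct (S.residual γ) γ =
      (S.ε ^ 2)⁻¹ • ((sampleMat S.ω)ᵀ *ᵥ S.residual γ) := by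
  set p := S.residual γ with hp
  set X := S.reconstruct p γ with hX
  set H := hankelMat n d₁ d₂ with hH
  set 𝒯 := tangentMat S.U S.V with hT
  have hX' : X = countInv n d₁ d₂ *ᵥ ((sampleMat S.ω)ᵀ *ᵥ p) +
      countInv n d₁ d₂ *ᵥ (Hᵀ *ᵥ (𝒯 *ᵥ γ)) := by
    rw [hX, reconstruct, diagMat_inv_mul_self, diagMat_inv_mul_normHankelMat]
    simp only [Matrix.mulVec_mulVec, Matrix.mul_assoc, hH, hT]
  -- This is the linear system itself, with Eᵀp inserted from the definition of p.
  have hq : 𝒯ᵀ *ᵥ (H *ᵥ X) = Matrix.diagonal S.mDiag *ᵥ γ := by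
    have h1 : S.M *ᵥ γ = S.Eᵀ *ᵥ (S.K⁻¹ *ᵥ (S.E *ᵥ γ)) + Matrix.diagonal S.mDiag *ᵥ γ -
        𝒯ᵀ *ᵥ (H *ᵥ (countInv n d₁ d₂ *ᵥ (Hᵀ *ᵥ (𝒯 *ᵥ γ)))) := by
      rw [M_eq, Matrix.mul_assoc (tangentMat S.U S.V)ᵀ, normHankelMat_mul_transpose]
      simp only [Matrix.sub_mulVec, Matrix.add_mulVec, Matrix.mulVec_mulVec, Matrix.mul_assoc,
        hH, hT]
    have h2 : S.Eᵀ *ᵥ p = 𝒯ᵀ *ᵥ (H *ᵥ (countInv n d₁ d₂ *ᵥ ((sampleMat S.ω)ᵀ *ᵥ p))) := by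
      rw [E_eq]
      simp only [Matrix.transpose_mul, Matrix.mulVec_mulVec, Matrix.mul_assoc, countInv_transpose,
        Matrix.transpose_transpose, hH, hT]
    have h3 : S.Eᵀ *ᵥ p = S.rhs - S.Eᵀ *ᵥ (S.K⁻¹ *ᵥ (S.E *ᵥ γ)) := by
      rw [hp, residual, rhs, Matrix.mulVec_sub, Matrix.mulVec_sub, Matrix.mulVec_mulVec _ S.Eᵀ]
    rw [hX', Matrix.mulVec_add, Matrix.mulVec_add, ← h2, h3, ← h, h1]
    abel
  have hdiag : Matrix.diagonal (fun c : Par n d₁ d₂ r => tangentWeight S.σ S.ε c - (S.ε ^ 2)⁻¹) *ᵥ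
      (Matrix.diagonal S.mDiag *ᵥ γ) = -((S.ε ^ 2)⁻¹ • γ) := by
    funext c
    rw [Matrix.mulVec_diagonal, Matrix.mulVec_diagonal, ← mul_assoc, mDiag_mul hS]
    simp
  -- HᵀH = D² cancels the factor D⁻² in front of both parts of X.
  have hHH : Hᵀ *ᵥ (H *ᵥ X) = (sampleMat S.ω)ᵀ *ᵥ p + Hᵀ *ᵥ (𝒯 *ᵥ γ) := by
    have h1 : Matrix.diagonal (blockCount n d₁ d₂) * countInv n d₁ d₂ = 1 := by
      have := congrArg Matrix.transpose (countInv_mul (n := n) (d₁ := d₁) (d₂ := d₂))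
      simpa [Matrix.transpose_mul, countInv_transpose] using this
    rw [Matrix.mulVec_mulVec, hH, hankelMat_transpose_mul, hX', Matrix.mulVec_add,
      Matrix.mulVec_mulVec _ _ (countInv n d₁ d₂), Matrix.mulVec_mulVec _ _ (countInv n d₁ d₂), h1,
      Matrix.one_mulVec, Matrix.one_mulVec]
  rw [← Matrix.mulVec_mulVec, ← Matrix.mulVec_mulVec, weightMat, Matrix.add_mulVec,
    Matrix.smul_mulVec, Matrix.one_mulVec, ← Matrix.mulVec_mulVec, ← Matrix.mulVec_mulVec, hq,
    hdiag, Matrix.mulVec_add, Matrix.mulVec_smul, hHH, Matrix.mulVec_neg, Matrix.mulVec_smul,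
    Matrix.mulVec_neg, Matrix.mulVec_smul, smul_add]
  abel

/-- A weighted least squares problem whose weight operator is given by `weightMat` has the
reconstruction from a solution of the linear system as its only solution. -/
theorem reconstruct_eq_of_isWLS (hS : S.Valid) (hU : S.Uᵀ * S.U = 1) (hV : S.Vᵀ * S.V = 1)
    {W : Matrix (Blk n d₁) (Blk n d₂) ℝ → Matrix (Blk n d₁) (Blk n d₂) ℝ}
    (hW : ∀ Z, vec (W Z) = S.weightMat *ᵥ vec Z) {Y : Loc n d₁ d₂ → ℝ}
    (hY : IsWLS S.ω S.y S.lam W Y) (h : S.M *ᵥ γ = S.rhs) :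
    S.reconstruct (S.residual γ) γ = Y := by
  set X := S.reconstruct (S.residual γ) γ with hX
  set Q := (hankelMat n d₁ d₂)ᵀ * S.weightMat * hankelMat n d₁ d₂ with hQ
  set p := S.residual γ with hp
  have heff : ∀ Z, effWeight W Z = Q *ᵥ Z := fun Z => by
    rw [effWeight, hW, ← hankelMat_mulVec, Matrix.mulVec_mulVec, Matrix.mulVec_mulVec, hQ]
  have hQX : Q *ᵥ X = (S.ε ^ 2)⁻¹ • ((sampleMat S.ω)ᵀ *ᵥ p) := weight_reconstruct hS h
  have hPX := sample_reconstruct hS γ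
  rw [← hp, ← hX] at hPX
  have hQT : Qᵀ = Q := by
    rw [hQ]
    simp only [Matrix.transpose_mul, Matrix.transpose_transpose, weightMat_transpose,
      Matrix.mul_assoc]
  set δ := Y - X with hδ
  have hYX : Y = X + δ := by rw [hδ]; abel
  -- Expansion around X. By stationarity the linear term only sees the sampled entries of δ.
  have hquad : Y ⬝ᵥ (Q *ᵥ Y) = X ⬝ᵥ (Q *ᵥ X) +
      2 * (S.ε ^ 2)⁻¹ * ((sampleMat S.ω *ᵥ δ) ⬝ᵥ p) + δ ⬝ᵥ (Q *ᵥ δ) := by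
    have h1 : X ⬝ᵥ (Q *ᵥ δ) = δ ⬝ᵥ (Q *ᵥ X) := by
      rw [Matrix.dotProduct_mulVec, ← Matrix.mulVec_transpose, hQT, dotProduct_comm]
    have h2 : δ ⬝ᵥ (Q *ᵥ X) = (S.ε ^ 2)⁻¹ * ((sampleMat S.ω *ᵥ δ) ⬝ᵥ p) := by
      rw [hQX, dotProduct_smul, Matrix.dotProduct_mulVec, Matrix.vecMul_transpose, smul_eq_mul]
    rw [hYX, Matrix.mulVec_add, add_dotProduct, dotProduct_add, dotProduct_add, h1, h2]
    ring
  have key : δ ⬝ᵥ (Q *ᵥ δ) ≤ 0 := by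
    have hle := hY X
    rw [heff, heff, dataFit, dataFit] at hle
    -- For λ = 0 the candidate X is feasible and has a finite value, so the minimizer Y must be
    -- feasible too. Then δ vanishes at the samples and the linear term disappears.
    by_cases hl : S.lam = 0
    · have hPX0 : sampleMat S.ω *ᵥ X = S.y := by
        rw [hl] at hPX
        simpa [sub_eq_zero] using hPX
      rw [if_pos hl, if_pos hl, if_pos hPX0, add_zero] at hle
      have hPY : sampleMat S.ω *ᵥ Y = S.y := by
        by_contra hne
        rw [if_neg hne, EReal.coe_add_top] at hle
        exact absurd hle (not_le.mpr (EReal.coe_lt_top _))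
      rw [if_pos hPY, add_zero, EReal.coe_le_coe_iff, hquad] at hle
      have h0 : sampleMat S.ω *ᵥ δ = 0 := by
        rw [hδ, Matrix.mulVec_sub, hPX0, hPY, sub_self]
      rw [h0, zero_dotProduct] at hle
      linarith
    · have hlpos : 0 < S.lam := lt_of_le_of_ne hS.lam_nonneg (Ne.symm hl)
      rw [if_neg hl, if_neg hl, ← EReal.coe_add, ← EReal.coe_add, EReal.coe_le_coe_iff, hquad]
        at hle
      -- For λ > 0 the linear term of the data fit, divided by λ, is the negative of the one in
      -- `hquad`; what is left of the difference of the objectives is nonnegative apart from the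
      -- quadratic form of δ.
      have hfit : ∑ l, ((sampleMat S.ω *ᵥ Y) l - S.y l) ^ 2 =
          ∑ l, ((sampleMat S.ω *ᵥ X) l - S.y l) ^ 2 -
            2 * (S.lam * (S.ε ^ 2)⁻¹) * ((sampleMat S.ω *ᵥ δ) ⬝ᵥ p) +
              ∑ l, ((sampleMat S.ω *ᵥ δ) l) ^ 2 := by
        rw [dotProduct, Finset.mul_sum, ← Finset.sum_sub_distrib, ← Finset.sum_add_distrib]
        refine Finset.sum_congr rfl fun l _ => ?_
        have h1 := congrFun hPX l
        simp only [Pi.sub_apply, Pi.smul_apply, smul_eq_mul] at h1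
        rw [hYX, Matrix.mulVec_add, Pi.add_apply]
        have h2 : (sampleMat S.ω *ᵥ X) l = S.y l - S.lam * (S.ε ^ 2)⁻¹ * p l := by
          linarith
        rw [h2]
        ring
      rw [hfit] at hle
      have h1 : 1 / S.lam * (∑ l, ((sampleMat S.ω *ᵥ X) l - S.y l) ^ 2 -
            2 * (S.lam * (S.ε ^ 2)⁻¹) * ((sampleMat S.ω *ᵥ δ) ⬝ᵥ p) +
              ∑ l, ((sampleMat S.ω *ᵥ δ) l) ^ 2) =
          1 / S.lam * ∑ l, ((sampleMat S.ω *ᵥ X) l - S.y l) ^ 2 -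
            2 * (S.ε ^ 2)⁻¹ * ((sampleMat S.ω *ᵥ δ) ⬝ᵥ p) +
              1 / S.lam * ∑ l, ((sampleMat S.ω *ᵥ δ) l) ^ 2 := by
        field_simp
      have h2 : 0 ≤ 1 / S.lam * ∑ l, ((sampleMat S.ω *ᵥ δ) l) ^ 2 :=
        mul_nonneg (by positivity) (Finset.sum_nonneg fun l _ => sq_nonneg _)
      linarith
  have hδ0 : δ = 0 := by
    apply eq_zero_of_hankelMat_mulVec
    apply eq_zero_of_weightMat hS hU hV
    have h1 : δ ⬝ᵥ (Q *ᵥ δ) = (hankelMat n d₁ d₂ *ᵥ δ) ⬝ᵥ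
        (S.weightMat *ᵥ (hankelMat n d₁ d₂ *ᵥ δ)) := by
      rw [hQ, ← Matrix.mulVec_mulVec, ← Matrix.mulVec_mulVec, Matrix.dotProduct_mulVec,
        Matrix.vecMul_transpose]
    rw [← h1]
    exact key
  rw [hYX, hδ0, add_zero]

end Stationary

end StepData

/-! ### From an iterate to the data of the next step -/

section FromIterate

variable {n d₁ d₂ r m : ℕ}

theorem sum_castLE {N r : ℕ} (h : r ≤ N) (f : Fin N → ℝ) :
    ∑ i : Fin N, (if (i : ℕ) < r then f i else 0) = ∑ i : Fin r, f (Fin.castLE h i) := by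
  rw [← Finset.sum_filter]
  refine (Finset.sum_bij (fun i _ => Fin.castLE h i) (fun i _ => ?_) (fun i _ j _ hij => ?_)
    (fun i hi => ?_) fun _ _ => rfl).symm
  · simp
  · exact Fin.ext (congrArg (fun x : Fin N => (x : ℕ)) hij)
  · exact ⟨⟨i, (Finset.mem_filter.mp hi).2⟩, Finset.mem_univ _, rfl⟩

/-- The leading singular vectors as a submatrix. -/
def leadingCols {β : Type} {N r : ℕ} (h : r ≤ N) (A : Matrix β (Fin N) ℝ) : Matrix β (Fin r) ℝ :=
  Matrix.of fun p i => A p (Fin.castLE h i)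

theorem leadingCols_transpose_mul {β : Type} [Fintype β] {N r : ℕ} (h : r ≤ N)
    {A : Matrix β (Fin N) ℝ} (hA : Aᵀ * A = 1) :
    (leadingCols h A)ᵀ * leadingCols h A = 1 := by
  ext i j
  have := congrFun (congrFun hA (Fin.castLE h i)) (Fin.castLE h j)
  simp only [Matrix.mul_apply, Matrix.transpose_apply, Matrix.one_apply] at this
  simp only [Matrix.mul_apply, Matrix.transpose_apply, leadingCols, Matrix.of_apply, this,
    Matrix.one_apply, Fin.ext_iff, Fin.val_castLE]

/-- Write A diag(s)⁻¹ Aᵀ as ε⁻¹ A Aᵀ plus the rest. Beyond the first r indices s equals ε, so the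
rest only involves the leading columns. -/
theorem conj_diagonal_eq {β : Type} [Fintype β] [DecidableEq β] {N r : ℕ} (h : r ≤ N)
    {A : Matrix β (Fin N) ℝ} (hA : A * Aᵀ = 1) (s : ℕ → ℝ) (ε : ℝ) (hs : ∀ i, r ≤ i → s i = ε) :
    A * Matrix.diagonal (fun i : Fin N => (s i)⁻¹) * Aᵀ =
      ε⁻¹ • (1 : Matrix β β ℝ) + leadingCols h A *
        Matrix.diagonal (fun i : Fin r => (s i)⁻¹ - ε⁻¹) * (leadingCols h A)ᵀ := by
  ext p q
  rw [← hA]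
  simp only [Matrix.add_apply, Matrix.smul_apply, smul_eq_mul, Matrix.mul_apply (M := _ * _),
    Matrix.mul_diagonal, Matrix.transpose_apply, leadingCols, Matrix.of_apply]
  rw [Matrix.mul_apply, Finset.mul_sum]
  refine Eq.trans ?_ (congrArg₂ (· + ·) rfl
    (sum_castLE h fun i => A p i * ((s i)⁻¹ - ε⁻¹) * A q i))
  rw [← Finset.sum_add_distrib]
  refine Finset.sum_congr rfl fun i _ => ?_
  rw [Matrix.transpose_apply]
  split_ifs with hi
  · ring
  · rw [hs i (not_lt.mp hi)]
    ring

/-- The weight operator in terms of the leading singular vectors. -/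
theorem vec_weightOp (S : StepData n d₁ d₂ r m) (h₁ : r ≤ d₁ * n) (h₂ : r ≤ d₂ * n)
    {U : Matrix (Blk n d₁) (Fin (d₁ * n)) ℝ} {V : Matrix (Blk n d₂) (Fin (d₂ * n)) ℝ}
    {σ : ℕ → ℝ} (hU : U * Uᵀ = 1) (hV : V * Vᵀ = 1)
    (hSU : S.U = leadingCols h₁ U) (hSV : S.V = leadingCols h₂ V) (hSσ : ∀ i, S.σ i = σ i)
    (hσ : ∀ i, r ≤ i → σ i ≤ S.ε) (hV1 : S.Vᵀ * S.V = 1) (hU1 : S.Uᵀ * S.U = 1)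
    (Z : Matrix (Blk n d₁) (Blk n d₂) ℝ) :
    vec (weightOp U σ V S.ε Z) = S.weightMat *ᵥ vec Z := by
  set ε := S.ε with hε
  set s : ℕ → ℝ := fun i => max (σ i) ε with hs
  have hsε : ∀ i, r ≤ i → s i = ε := fun i hi => max_eq_right (hσ i hi)
  have hA := conj_diagonal_eq h₁ hU s ε hsε
  have hB := conj_diagonal_eq h₂ hV s ε hsε
  rw [← hSU] at hA
  rw [← hSV] at hB
  set Δ := Matrix.diagonal (fun i : Fin r => (s i)⁻¹ - ε⁻¹) with hΔ
  have hW : weightOp U σ V ε Z =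
      (ε⁻¹ • (1 : Matrix (Blk n d₁) (Blk n d₁) ℝ) + S.U * Δ * S.Uᵀ) * Z *
        (ε⁻¹ • (1 : Matrix (Blk n d₂) (Blk n d₂) ℝ) + S.V * Δ * S.Vᵀ) := by
    rw [← hA, ← hB, weightOp]
    simp only [Matrix.mul_assoc, hs]
  -- With e = ε⁻¹ and a, b the corrections s⁻¹ − e of two leading singular values, the weight
  -- satisfies (e + a)(e + b) − e² = ea + eb + ab on Γ₁, while on Γ₂ and Γ₃ one of the corrections
  -- is zero. These are the terms in the expansion of the two-sided product `hW`.
  have hq : Matrix.diagonal (fun c : Par n d₁ d₂ r => tangentWeight S.σ ε c - (ε ^ 2)⁻¹) *ᵥ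
      ((tangentMat S.U S.V)ᵀ *ᵥ vec Z) =
      parOf (ε⁻¹ • (Δ * (S.Uᵀ * Z * S.V)) + ε⁻¹ • ((S.Uᵀ * Z * S.V) * Δ) +
          Δ * (S.Uᵀ * Z * S.V) * Δ)
        (ε⁻¹ • (Δ * (S.Uᵀ * Z * (1 - S.V * S.Vᵀ))))
        (ε⁻¹ • ((1 - S.U * S.Uᵀ) * Z * S.V * Δ)) := by
    rw [tangentMat_transpose_mulVec]
    generalize S.Uᵀ * Z * S.V = Y₁
    generalize S.Uᵀ * Z * (1 - S.V * S.Vᵀ) = Y₂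
    generalize (1 - S.U * S.Uᵀ) * Z * S.V = Y₃
    funext c
    rw [Matrix.mulVec_diagonal]
    rcases c with ⟨i, j⟩ | ⟨i, q⟩ | ⟨p, j⟩ <;>
      simp only [parOf, tangentWeight, hSσ, Matrix.add_apply, Matrix.smul_apply, hΔ, hs,
        Matrix.diagonal_mul, Matrix.mul_diagonal, smul_eq_mul, sq, mul_inv] <;> ring
  have hV' : ∀ {β : Type} (A : Matrix (Fin r) β ℝ), S.Vᵀ * (S.V * A) = A := fun A => by
    rw [← Matrix.mul_assoc, hV1, Matrix.one_mul]
  have hU' : ∀ {β : Type} (A : Matrix (Fin r) β ℝ), S.Uᵀ * (S.U * A) = A := fun A => by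
    rw [← Matrix.mul_assoc, hU1, Matrix.one_mul]
  rw [StepData.weightMat, Matrix.add_mulVec, Matrix.smul_mulVec, Matrix.one_mulVec,
    ← Matrix.mulVec_mulVec, ← Matrix.mulVec_mulVec, hq, tangentMat_mulVec, tangentFun_parOf, hW]
  have hvec : ∀ (c : ℝ) (A B : Matrix (Blk n d₁) (Blk n d₂) ℝ),
      c • vec A + vec B = vec (c • A + B) := fun _ _ _ => rfl
  rw [hvec, sq, mul_inv]
  congr 1
  simp only [Matrix.mul_add, Matrix.add_mul, Matrix.mul_sub, Matrix.sub_mul, Matrix.mul_assoc,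
    Matrix.one_mul, Matrix.mul_one, Matrix.smul_mul, Matrix.mul_smul, smul_sub, hU', hV',
    smul_add, mul_smul]
  abel

/-- By monotonicity, a failure at index i confines all singular values above ε to indices below i,
so there would be fewer than r of them. -/
theorem lt_sigma_of_rank {s : Iterate n d₁ d₂} (hσ : Antitone s.σ) (hrank : s.rank = r)
    {i : ℕ} (hi : i < r) : s.ε < s.σ i := by
  by_contra hle
  have h : ∀ j : {j : Fin (min d₁ d₂ * n) // s.ε < s.σ j}, (j.1 : ℕ) < i := fun j => by
    by_contra hj
    exact hle (j.2.trans_le (hσ (not_lt.mp hj)))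
  have hcard := Nat.card_le_card_of_injective
    (fun j : {j : Fin (min d₁ d₂ * n) // s.ε < s.σ j} => (⟨j.1, h j⟩ : Fin i))
    (fun j j' hjj => Subtype.ext (Fin.ext (congrArg (fun x : Fin i => (x : ℕ)) hjj)))
  rw [Nat.card_fin] at hcard
  unfold Iterate.rank at hrank
  omega

/-- A singular value above ε at an index i ≥ r brings i + 1 > r of them. The positivity of ε
excludes the indices where the singular values are zero by convention. -/
theorem sigma_le_of_rank {s : Iterate n d₁ d₂} (hσ : Antitone s.σ)
    (hz : ∀ i, min d₁ d₂ * n ≤ i → s.σ i = 0) (hε : 0 < s.ε) (hrank : s.rank = r)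
    {i : ℕ} (hi : r ≤ i) : s.σ i ≤ s.ε := by
  by_contra hlt
  rw [not_le] at hlt
  have hin : i < min d₁ d₂ * n := by
    by_contra hge
    rw [hz i (not_lt.mp hge)] at hlt
    exact absurd hε (not_lt.mpr hlt.le)
  have hcard := Nat.card_le_card_of_injective
    (fun j : Fin (i + 1) => (⟨⟨j, by omega⟩, hlt.trans_le (hσ (Nat.lt_succ_iff.mp j.isLt))⟩ :
      {j : Fin (min d₁ d₂ * n) // s.ε < s.σ j}))
    (fun j j' hjj => Fin.ext (congrArg (fun x => (x.1 : ℕ)) hjj))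
  rw [Nat.card_fin] at hcard
  unfold Iterate.rank at hrank
  omega

end FromIterate

/-! ### Finite termination of the conjugate gradient method -/

section ConjugateGradient

variable {ι : Type} [Fintype ι]

/-- The states of the conjugate gradient method for `A x = b`, started from `0`. -/
noncomputable def cgSeq (A : Matrix ι ι ℝ) (b : ι → ℝ) (k : ℕ) : CGState ι :=
  (cgStep A)^[k] { sol := 0, res := b, dir := b }

theorem cgSeq_succ (A : Matrix ι ι ℝ) (b : ι → ℝ) (k : ℕ) :
    cgSeq A b (k + 1) = cgStep A (cgSeq A b k) := by
  simp only [cgSeq, Function.iterate_succ_apply']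

/-- The solution and the residual are updated with the same step length, so the recursive residual
is the true one, whatever the denominators are. -/
theorem cgSeq_res_eq (A : Matrix ι ι ℝ) (b : ι → ℝ) (k : ℕ) :
    (cgSeq A b k).res = b - A *ᵥ (cgSeq A b k).sol := by
  induction k with
  | zero => simp [cgSeq]
  | succ k ih =>
    rw [cgSeq_succ]
    simp only [cgStep, Matrix.mulVec_add, Matrix.mulVec_smul]
    rw [ih]
    abel

/-- At residual 0 the step length has numerator 0, so it vanishes even if its denominator does too.
-/
theorem cgSeq_res_zero_of_le (A : Matrix ι ι ℝ) (b : ι → ℝ) {j k : ℕ} (hjk : j ≤ k)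
    (h : (cgSeq A b j).res = 0) : (cgSeq A b k).res = 0 := by
  induction k, hjk using Nat.le_induction with
  | base => exact h
  | succ k _ ih =>
    rw [cgSeq_succ]
    simp [cgStep, ih]

/-- Orthogonality relations between the residuals and the search directions. -/
theorem cgSeq_orthogonal {A : Matrix ι ι ℝ} (hA : A.PosDef) (b : ι → ℝ) (k : ℕ)
    (hne : ∀ j < k, (cgSeq A b j).res ≠ 0) :
    (∀ i < k, (cgSeq A b k).res ⬝ᵥ (cgSeq A b i).dir = 0) ∧
    (∀ i < k, (cgSeq A b k).dir ⬝ᵥ (A *ᵥ (cgSeq A b i).dir) = 0) ∧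
    (∀ i < k, (cgSeq A b k).res ⬝ᵥ (cgSeq A b i).res = 0) ∧
    (cgSeq A b k).dir ⬝ᵥ (cgSeq A b k).res = (cgSeq A b k).res ⬝ᵥ (cgSeq A b k).res := by
  -- The relations are needed at all earlier indices, since nonvanishing of every earlier step
  -- length enters below.
  induction k using Nat.strong_induction_on with
  | _ k IH =>
  cases k with
  | zero => simp [cgSeq]
  | succ k =>
    have ih := IH k (Nat.lt_succ_self k)
    have ihs : ∀ j ≤ k, (cgSeq A b j).res ⬝ᵥ (cgSeq A b j).res ≠ 0 := fun j hj h =>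
      hne j (Nat.lt_succ_of_le hj) (dotProduct_self_eq_zero.mp h)
    obtain ⟨ha, hb, hc, hd⟩ := ih fun j hj => hne j (hj.trans (Nat.lt_succ_self k))
    have hsym : ∀ v w : ι → ℝ, v ⬝ᵥ (A *ᵥ w) = w ⬝ᵥ (A *ᵥ v) := by
      intro v w
      have hT : Aᵀ = A := by simpa using hA.isHermitian.eq
      rw [Matrix.dotProduct_mulVec, ← Matrix.mulVec_transpose, hT, dotProduct_comm]
    have hrec : ∀ i, ∃ α β : ℝ,
        (cgSeq A b (i + 1)).res = (cgSeq A b i).res - α • (A *ᵥ (cgSeq A b i).dir) ∧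
        (cgSeq A b (i + 1)).dir = (cgSeq A b (i + 1)).res + β • (cgSeq A b i).dir ∧
        α = ((cgSeq A b i).res ⬝ᵥ (cgSeq A b i).res) /
          ((cgSeq A b i).dir ⬝ᵥ (A *ᵥ (cgSeq A b i).dir)) ∧
        β = ((cgSeq A b (i + 1)).res ⬝ᵥ (cgSeq A b (i + 1)).res) /
          ((cgSeq A b i).res ⬝ᵥ (cgSeq A b i).res) := by
      intro i
      rw [cgSeq_succ]
      exact ⟨_, _, rfl, rfl, rfl, rfl⟩
    choose α β hres hdir hα hβ using hrec
    -- The inner product of direction and residual is ‖residual‖² ≠ 0, so the direction is nonzero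
    -- and positive definiteness applies.
    have hcurv : ∀ i ≤ k, (cgSeq A b i).dir ⬝ᵥ (A *ᵥ (cgSeq A b i).dir) ≠ 0 := by
      intro i hi
      have hdi := (IH i (Nat.lt_succ_of_le hi) fun j hj => hne j (by omega)).2.2.2
      have hp : (cgSeq A b i).dir ≠ 0 := by
        intro h
        rw [h, zero_dotProduct] at hdi
        exact ihs i hi hdi.symm
      have := hA.dotProduct_mulVec_pos hp
      simpa using this.ne'
    have hα0 : ∀ i ≤ k, α i ≠ 0 := fun i hi => by
      rw [hα]
      exact div_ne_zero (ihs i hi) (hcurv i hi)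
    have hαk : α k * ((cgSeq A b k).dir ⬝ᵥ (A *ᵥ (cgSeq A b k).dir)) =
        (cgSeq A b k).res ⬝ᵥ (cgSeq A b k).res := by
      rw [hα, div_mul_cancel₀ _ (hcurv k le_rfl)]
    have ha' : ∀ i < k + 1, (cgSeq A b (k + 1)).res ⬝ᵥ (cgSeq A b i).dir = 0 := by
      intro i hi
      rw [hres, sub_dotProduct, smul_dotProduct, smul_eq_mul,
        dotProduct_comm (A *ᵥ _)]
      rcases Nat.lt_succ_iff_lt_or_eq.mp hi with hi | rfl
      · rw [ha i hi, hsym, hb i hi]; simp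
      · rw [hαk, dotProduct_comm, hd, sub_self]
    -- Every residual is a combination of at most two consecutive directions, and the zeroth one is
    -- the zeroth direction.
    have hc' : ∀ i < k + 1, (cgSeq A b (k + 1)).res ⬝ᵥ (cgSeq A b i).res = 0 := by
      intro i hi
      cases i with
      | zero => exact ha' 0 hi
      | succ i =>
        have h : (cgSeq A b (i + 1)).res = (cgSeq A b (i + 1)).dir - β i • (cgSeq A b i).dir := by
          rw [hdir i]; abel
        rw [h, dotProduct_sub, dotProduct_smul, ha' _ hi, ha' i (by omega)]
        simp
    -- A times a direction is, up to the step length, a difference of consecutive residuals.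
    -- Conjugacy thus reduces to orthogonality of residuals.
    have hconj : ∀ i, α i * ((cgSeq A b (k + 1)).res ⬝ᵥ (A *ᵥ (cgSeq A b i).dir)) =
        (cgSeq A b (k + 1)).res ⬝ᵥ (cgSeq A b i).res -
          (cgSeq A b (k + 1)).res ⬝ᵥ (cgSeq A b (i + 1)).res := by
      intro i
      rw [hres i, dotProduct_sub, dotProduct_smul, smul_eq_mul]
      ring
    refine ⟨ha', ?_, hc', ?_⟩
    · intro i hi
      rw [hdir k, add_dotProduct, smul_dotProduct, smul_eq_mul]
      rcases Nat.lt_succ_iff_lt_or_eq.mp hi with hi | rfl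
      · have h := hconj i
        rw [hc' i (by omega), hc' (i + 1) (by omega), sub_self] at h
        rw [(mul_eq_zero.mp h).resolve_left (hα0 i hi.le), hb i hi]
        simp
      -- For the latest direction β is exactly the coefficient that restores conjugacy.
      · have h := hconj i
        rw [hc' i hi, zero_sub] at h
        have h1 : β i * ((cgSeq A b i).res ⬝ᵥ (cgSeq A b i).res) =
            (cgSeq A b (i + 1)).res ⬝ᵥ (cgSeq A b (i + 1)).res := by
          rw [hβ, div_mul_cancel₀ _ (ihs i le_rfl)]
        rw [← hαk] at h1
        apply mul_left_cancel₀ (hα0 i le_rfl)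
        linear_combination h + h1
    · rw [hdir k, add_dotProduct, smul_dotProduct, dotProduct_comm (cgSeq A b k).dir,
        ha' k (Nat.lt_succ_self k)]
      simp

/-- After as many steps as there are unknowns the conjugate gradient method has found the
solution. -/
theorem mulVec_cg_eq {A : Matrix ι ι ℝ} (hA : A.PosDef) (b : ι → ℝ) {N : ℕ}
    (hN : Fintype.card ι ≤ N) : A *ᵥ cg A b N = b := by
  have hzero : ∃ j ≤ N, (cgSeq A b j).res = 0 := by
    by_contra! hne
    have horth : ∀ i ≤ N, ∀ j < i, (cgSeq A b i).res ⬝ᵥ (cgSeq A b j).res = 0 := fun i hi j hj =>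
      (cgSeq_orthogonal hA b i fun l hl => hne l (by omega)).2.2.1 j hj
    -- If none vanished, the residuals with indices 0, …, N would be N + 1 independent vectors in a
    -- space of dimension at most N.
    have hli : LinearIndependent ℝ
        (fun i : Fin (N + 1) => (WithLp.toLp 2 (cgSeq A b i).res : EuclideanSpace ℝ ι)) := by
      refine linearIndependent_of_ne_zero_of_inner_eq_zero (𝕜 := ℝ) (fun i h => ?_) ?_
      · exact hne i (Nat.lt_succ_iff.mp i.isLt) (by simpa using h)
      · intro i j hij
        rw [EuclideanSpace.inner_eq_star_dotProduct]
        rcases lt_or_gt_of_ne (Fin.val_ne_of_ne hij) with h | h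
        · simpa using horth j (Nat.lt_succ_iff.mp j.isLt) i h
        · simpa [dotProduct_comm] using horth i (Nat.lt_succ_iff.mp i.isLt) j h
    have := hli.fintype_card_le_finrank
    rw [finrank_euclideanSpace, Fintype.card_fin] at this
    omega
  obtain ⟨j, hj, h⟩ := hzero
  have h1 := cgSeq_res_zero_of_le A b hj h
  rw [cgSeq_res_eq, sub_eq_zero] at h1
  exact h1.symm

end ConjugateGradient

/-! ### Resource calculus for real RAM programs -/

namespace RAM

/-! ### Syntactic size, cost and footprint of expressions and programs -/

/-- Number of nodes. -/
def IExp.nodes : IExp → ℕ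
  | lit _ => 1
  | reg _ => 1
  | get _ p => p.nodes + 1
  | add e f => e.nodes + f.nodes + 1
  | sub e f => e.nodes + f.nodes + 1
  | mul e f => e.nodes + f.nodes + 1
  | div e f => e.nodes + f.nodes + 1
  | mod e f => e.nodes + f.nodes + 1

/-- Number of nodes, where a literal counts with its value. -/
def IExp.size : IExp → ℕ
  | lit c => c + 1
  | reg _ => 1
  | get _ p => p.size + 1
  | add e f => e.size + f.size + 1
  | sub e f => e.size + f.size + 1
  | mul e f => e.size + f.size + 1
  | div e f => e.size + f.size + 1
  | mod e f => e.size + f.size + 1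

/-- The registers that occur in an expression. -/
def IExp.regs : IExp → List ℕ
  | lit _ => []
  | reg i => [i]
  | get _ p => p.regs
  | add e f => e.regs ++ f.regs
  | sub e f => e.regs ++ f.regs
  | mul e f => e.regs ++ f.regs
  | div e f => e.regs ++ f.regs
  | mod e f => e.regs ++ f.regs

/-- All positions that are read lie below `SP`, and all integers read there are at most `X`. -/
def IExp.Ok (X SP : ℕ) (s : Store) : IExp → Prop
  | lit _ => True
  | reg _ => True
  | get a p => p.Ok X SP s ∧ p.val s < SP ∧ s.iarr a (p.val s) ≤ X
  | add e f => e.Ok X SP s ∧ f.Ok X SP s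
  | sub e f => e.Ok X SP s ∧ f.Ok X SP s
  | mul e f => e.Ok X SP s ∧ f.Ok X SP s
  | div e f => e.Ok X SP s ∧ f.Ok X SP s
  | mod e f => e.Ok X SP s ∧ f.Ok X SP s

/-- Number of nodes. -/
def RExp.nodes : RExp → ℕ
  | ofInt e => e.nodes + 1
  | reg _ => 1
  | get _ p => p.nodes + 1
  | add x y => x.nodes + y.nodes + 1
  | sub x y => x.nodes + y.nodes + 1
  | mul x y => x.nodes + y.nodes + 1
  | div x y => x.nodes + y.nodes + 1
  | sqrt x => x.nodes + 1

/-- Total size of the integer expressions that occur. -/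
def RExp.size : RExp → ℕ
  | ofInt e => e.size
  | reg _ => 0
  | get _ p => p.size
  | add x y => x.size + y.size
  | sub x y => x.size + y.size
  | mul x y => x.size + y.size
  | div x y => x.size + y.size
  | sqrt x => x.size

/-- The integer registers that occur in an expression. -/
def RExp.regs : RExp → List ℕ
  | ofInt e => e.regs
  | reg _ => []
  | get _ p => p.regs
  | add x y => x.regs ++ y.regs
  | sub x y => x.regs ++ y.regs
  | mul x y => x.regs ++ y.regs
  | div x y => x.regs ++ y.regs
  | sqrt x => x.regs

/-- The real arrays that occur in an expression. -/
def RExp.arrs : RExp → List ℕ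
  | ofInt _ => []
  | reg _ => []
  | get a _ => [a]
  | add x y => x.arrs ++ y.arrs
  | sub x y => x.arrs ++ y.arrs
  | mul x y => x.arrs ++ y.arrs
  | div x y => x.arrs ++ y.arrs
  | sqrt x => x.arrs

/-- All positions that are read lie below `SP`, and all integers read there are at most `X`. -/
def RExp.Ok (X SP : ℕ) (s : Store) : RExp → Prop
  | ofInt e => e.Ok X SP s
  | reg _ => True
  | get _ p => p.Ok X SP s ∧ p.val s < SP
  | add x y => x.Ok X SP s ∧ y.Ok X SP s
  | sub x y => x.Ok X SP s ∧ y.Ok X SP s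
  | mul x y => x.Ok X SP s ∧ y.Ok X SP s
  | div x y => x.Ok X SP s ∧ y.Ok X SP s
  | sqrt x => x.Ok X SP s

theorem IExp.use_time (s : Store) (e : IExp) : (e.use s).time = e.nodes := by
  induction e <;> simp_all [IExp.use, IExp.nodes, Usage.comb]

theorem RExp.use_time (s : Store) (x : RExp) : (x.use s).time = x.nodes := by
  induction x <;> simp_all [RExp.use, RExp.nodes, Usage.comb, IExp.use_time, Usage.tick]

/-- Each operation at most adds the exponents of its operands and one more, so the value of an
expression is at most X to a power read off from the program text. That keeps all integers at O(log
X) bits. -/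
theorem IExp.use_bound {X SP : ℕ} (hX : 2 ≤ X) (s : Store) (e : IExp) (h : e.Ok X SP s)
    (hr : ∀ i ∈ e.regs, s.ireg i ≤ X) :
    e.val s ≤ X ^ e.size ∧ (e.use s).space ≤ SP ∧ (e.use s).word ≤ X ^ e.size := by
  have hpow : ∀ {a b : ℕ}, a ≤ b → X ^ a ≤ X ^ b := fun h => Nat.pow_le_pow_right (by omega) h
  -- A sum of two numbers ≥ 1 is at most twice their product, and 2 ≤ X.
  have hadd : ∀ a b : ℕ, X ^ a + X ^ b ≤ X ^ (a + b + 1) := fun a b => by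
    have h1 : 1 ≤ X ^ a := Nat.one_le_pow _ _ (by omega)
    have h2 : 1 ≤ X ^ b := Nat.one_le_pow _ _ (by omega)
    have h3 : X ^ a * X ^ b * 2 ≤ X ^ a * X ^ b * X := Nat.mul_le_mul_left _ hX
    rw [pow_succ, pow_add]
    nlinarith
  have hbin : ∀ {e f : IExp} {v : ℕ}, e.val s ≤ X ^ e.size ∧ (e.use s).space ≤ SP ∧
      (e.use s).word ≤ X ^ e.size → f.val s ≤ X ^ f.size ∧ (f.use s).space ≤ SP ∧
      (f.use s).word ≤ X ^ f.size → (v ≤ X ^ (e.size + f.size + 1)) →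
      v ≤ X ^ (e.size + f.size + 1) ∧
      (((e.use s).comb (f.use s)).comb ⟨1, 0, v⟩).space ≤ SP ∧
      (((e.use s).comb (f.use s)).comb ⟨1, 0, v⟩).word ≤ X ^ (e.size + f.size + 1) := by
    intro e f v he hf hv
    have h1 := hpow (show e.size ≤ e.size + f.size + 1 by omega)
    have h2 := hpow (show f.size ≤ e.size + f.size + 1 by omega)
    refine ⟨hv, ?_, ?_⟩
    · simp only [Usage.comb]; omega
    · simp only [Usage.comb]; omega
  induction e with
  | lit c =>
    -- Literals count with their value in `IExp.size` precisely for this estimate.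
    have h1 : c ≤ X ^ (c + 1) := (Nat.lt_pow_self (by omega)).le.trans (hpow (Nat.le_succ c))
    exact ⟨h1, Nat.zero_le _, h1⟩
  | reg i =>
    have h1 : s.ireg i ≤ X ^ 1 := by rw [pow_one]; exact hr i (by simp [IExp.regs])
    exact ⟨h1, Nat.zero_le _, h1⟩
  | get a p ih =>
    obtain ⟨h1, h2, h3⟩ := h
    have h4 := ih h1 hr
    have h5 : X ≤ X ^ (p.size + 1) := by
      simpa using hpow (show 1 ≤ p.size + 1 by omega)
    have h6 := hpow (show p.size ≤ p.size + 1 by omega)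
    refine ⟨h3.trans h5, ?_, ?_⟩
    · simp only [IExp.use, Usage.comb]; omega
    · simp only [IExp.use, Usage.comb, IExp.size]; omega
  | add e f he hf =>
    have h1 := he h.1 fun i hi => hr i (List.mem_append_left _ hi)
    have h2 := hf h.2 fun i hi => hr i (List.mem_append_right _ hi)
    exact hbin h1 h2 ((Nat.add_le_add h1.1 h2.1).trans (hadd _ _))
  | sub e f he hf =>
    have h1 := he h.1 fun i hi => hr i (List.mem_append_left _ hi)
    have h2 := hf h.2 fun i hi => hr i (List.mem_append_right _ hi)
    exact hbin h1 h2 ((Nat.sub_le _ _).trans (h1.1.trans (hpow (by omega))))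
  | mul e f he hf =>
    have h1 := he h.1 fun i hi => hr i (List.mem_append_left _ hi)
    have h2 := hf h.2 fun i hi => hr i (List.mem_append_right _ hi)
    exact hbin h1 h2 ((Nat.mul_le_mul h1.1 h2.1).trans (by rw [← pow_add]; exact hpow (by omega)))
  | div e f he hf =>
    have h1 := he h.1 fun i hi => hr i (List.mem_append_left _ hi)
    have h2 := hf h.2 fun i hi => hr i (List.mem_append_right _ hi)
    exact hbin h1 h2 ((Nat.div_le_self _ _).trans (h1.1.trans (hpow (by omega))))
  | mod e f he hf =>
    have h1 := he h.1 fun i hi => hr i (List.mem_append_left _ hi)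
    have h2 := hf h.2 fun i hi => hr i (List.mem_append_right _ hi)
    exact hbin h1 h2 ((Nat.mod_le _ _).trans (h1.1.trans (hpow (by omega))))

theorem RExp.use_bound {X SP : ℕ} (hX : 2 ≤ X) (s : Store) (x : RExp) (h : x.Ok X SP s)
    (hr : ∀ i ∈ x.regs, s.ireg i ≤ X) :
    (x.use s).space ≤ SP ∧ (x.use s).word ≤ X ^ x.size := by
  have hpow : ∀ {a b : ℕ}, a ≤ b → X ^ a ≤ X ^ b := fun h => Nat.pow_le_pow_right (by omega) h
  have hbin : ∀ {x y : RExp}, (x.use s).space ≤ SP ∧ (x.use s).word ≤ X ^ x.size →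
      (y.use s).space ≤ SP ∧ (y.use s).word ≤ X ^ y.size →
      (((x.use s).comb (y.use s)).comb Usage.tick).space ≤ SP ∧
      (((x.use s).comb (y.use s)).comb Usage.tick).word ≤ X ^ (x.size + y.size) := by
    intro x y hx hy
    have h1 := hpow (show x.size ≤ x.size + y.size by omega)
    have h2 := hpow (show y.size ≤ x.size + y.size by omega)
    constructor <;> simp only [Usage.comb, Usage.tick] <;> omega
  induction x with
  | ofInt e =>
    have h1 := e.use_bound hX s h hr
    constructor <;> simp only [RExp.use, Usage.comb, Usage.tick, RExp.size] <;> omega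
  | reg i => exact ⟨Nat.zero_le _, Nat.zero_le _⟩
  | get a p =>
    have h1 := p.use_bound hX s h.1 hr
    have h2 := h.2
    constructor <;> simp only [RExp.use, Usage.comb, RExp.size] <;> omega
  | add x y hx hy =>
    exact hbin (hx h.1 fun i hi => hr i (List.mem_append_left _ hi))
      (hy h.2 fun i hi => hr i (List.mem_append_right _ hi))
  | sub x y hx hy =>
    exact hbin (hx h.1 fun i hi => hr i (List.mem_append_left _ hi))
      (hy h.2 fun i hi => hr i (List.mem_append_right _ hi))
  | mul x y hx hy =>
    exact hbin (hx h.1 fun i hi => hr i (List.mem_append_left _ hi))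
      (hy h.2 fun i hi => hr i (List.mem_append_right _ hi))
  | div x y hx hy =>
    exact hbin (hx h.1 fun i hi => hr i (List.mem_append_left _ hi))
      (hy h.2 fun i hi => hr i (List.mem_append_right _ hi))
  | sqrt x hx =>
    have h1 := hx h hr
    constructor <;> simp only [RExp.use, Usage.comb, Usage.tick, RExp.size] <;> omega

/-- Cost of one pass through a program. -/
def Prog.cost : Prog → ℕ
  | skip => 1
  | setI _ e => e.nodes + 1
  | setR _ x => x.nodes + 1
  | putI _ p e => p.nodes + e.nodes + 1
  | putR _ p x => p.nodes + x.nodes + 1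
  | seq c d => c.cost + d.cost
  | ifLt e f c d => e.nodes + f.nodes + 1 + c.cost + d.cost
  | ifLe x y c d => x.nodes + y.nodes + 1 + c.cost + d.cost
  | loop _ e c => e.nodes + 2 + c.cost

/-- Total size of the integer expressions that occur. -/
def Prog.size : Prog → ℕ
  | skip => 0
  | setI _ e => e.size
  | setR _ x => x.size
  | putI _ p e => p.size + e.size
  | putR _ p x => p.size + x.size
  | seq c d => c.size + d.size
  | ifLt e f c d => e.size + f.size + c.size + d.size
  | ifLe x y c d => x.size + y.size + c.size + d.size
  | loop _ e c => e.size + c.size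

/-- The integer registers that a program may write. -/
def Prog.wI : Prog → List ℕ
  | setI i _ => [i]
  | seq c d => c.wI ++ d.wI
  | ifLt _ _ c d => c.wI ++ d.wI
  | ifLe _ _ c d => c.wI ++ d.wI
  | loop i _ c => i :: c.wI
  | _ => []

/-- The real registers that a program may write. -/
def Prog.wR : Prog → List ℕ
  | setR i _ => [i]
  | seq c d => c.wR ++ d.wR
  | ifLt _ _ c d => c.wR ++ d.wR
  | ifLe _ _ c d => c.wR ++ d.wR
  | loop _ _ c => c.wR
  | _ => []

/-- The integer arrays that a program may write. -/
def Prog.wIA : Prog → List ℕ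
  | putI a _ _ => [a]
  | seq c d => c.wIA ++ d.wIA
  | ifLt _ _ c d => c.wIA ++ d.wIA
  | ifLe _ _ c d => c.wIA ++ d.wIA
  | loop _ _ c => c.wIA
  | _ => []

/-- The real arrays that a program may write. -/
def Prog.wA : Prog → List ℕ
  | putR a _ _ => [a]
  | seq c d => c.wA ++ d.wA
  | ifLt _ _ c d => c.wA ++ d.wA
  | ifLe _ _ c d => c.wA ++ d.wA
  | loop _ _ c => c.wA
  | _ => []

/-- The store with a new value in an integer register. -/
def Store.withI (s : Store) (i v : ℕ) : Store :=
  { s with ireg := Function.update s.ireg i v }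

@[simp] theorem Store.withI_ireg (s : Store) (i v j : ℕ) :
    (s.withI i v).ireg j = if j = i then v else s.ireg j := by
  simp [Store.withI, Function.update_apply]

@[simp] theorem Store.withI_rreg (s : Store) (i v : ℕ) : (s.withI i v).rreg = s.rreg := rfl
@[simp] theorem Store.withI_iarr (s : Store) (i v : ℕ) : (s.withI i v).iarr = s.iarr := rfl
@[simp] theorem Store.withI_rarr (s : Store) (i v : ℕ) : (s.withI i v).rarr = s.rarr := rfl

/-- The store after `j` rounds of a loop. -/
noncomputable def Prog.rounds (i : ℕ) (c : Prog) (s : Store) : ℕ → Store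
  | 0 => s
  | j + 1 => (c.exec ((Prog.rounds i c s j).withI i j)).1

theorem iter_fst (i : ℕ) (c : Prog) (s : Store) (k : ℕ) :
    (iter (fun j s' => c.exec { s' with ireg := Function.update s'.ireg i j }) k s).1 =
      Prog.rounds i c s k := by
  induction k with
  | zero => rfl
  | succ k ih => simp only [iter, Prog.rounds, ih]; rfl

theorem exec_loop (i : ℕ) (e : IExp) (c : Prog) (s : Store) :
    ((Prog.loop i e c).exec s).1 = Prog.rounds i c s (e.val s) := by
  simp only [Prog.exec, iter_fst]

theorem exec_seq (c d : Prog) (s : Store) :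
    ((Prog.seq c d).exec s).1 = (d.exec (c.exec s).1).1 := rfl

/-- `s'` agrees with `s` outside of the given registers and arrays. -/
structure Frame (I R IA A : List ℕ) (s s' : Store) : Prop where
  ireg : ∀ i ∉ I, s'.ireg i = s.ireg i
  rreg : ∀ i ∉ R, s'.rreg i = s.rreg i
  iarr : ∀ i ∉ IA, s'.iarr i = s.iarr i
  rarr : ∀ i ∉ A, s'.rarr i = s.rarr i

theorem Frame.refl (I R IA A : List ℕ) (s : Store) : Frame I R IA A s s :=
  ⟨fun _ _ => rfl, fun _ _ => rfl, fun _ _ => rfl, fun _ _ => rfl⟩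

theorem Frame.trans {I R IA A : List ℕ} {s s' s'' : Store} (h : Frame I R IA A s s')
    (h' : Frame I R IA A s' s'') : Frame I R IA A s s'' :=
  ⟨fun i hi => (h'.ireg i hi).trans (h.ireg i hi), fun i hi => (h'.rreg i hi).trans (h.rreg i hi),
    fun i hi => (h'.iarr i hi).trans (h.iarr i hi), fun i hi => (h'.rarr i hi).trans (h.rarr i hi)⟩

theorem Frame.mono {I R IA A I' R' IA' A' : List ℕ} {s s' : Store} (h : Frame I R IA A s s')
    (hI : I ⊆ I') (hR : R ⊆ R') (hIA : IA ⊆ IA') (hA : A ⊆ A') : Frame I' R' IA' A' s s' :=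
  ⟨fun i hi => h.ireg i fun hm => hi (hI hm), fun i hi => h.rreg i fun hm => hi (hR hm),
    fun i hi => h.iarr i fun hm => hi (hIA hm), fun i hi => h.rarr i fun hm => hi (hA hm)⟩

/-- The writable registers and arrays are determined syntactically, whichever branches are taken and
however often loops run. -/
theorem exec_frame (c : Prog) (s : Store) : Frame c.wI c.wR c.wIA c.wA s (c.exec s).1 := by
  induction c generalizing s with
  | skip => exact Frame.refl _ _ _ _ _
  | setI i e =>
    refine ⟨fun j hj => ?_, fun _ _ => rfl, fun _ _ => rfl, fun _ _ => rfl⟩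
    exact Function.update_of_ne (by simpa [Prog.wI] using hj) _ _
  | setR i e =>
    refine ⟨fun _ _ => rfl, fun j hj => ?_, fun _ _ => rfl, fun _ _ => rfl⟩
    exact Function.update_of_ne (by simpa [Prog.wR] using hj) _ _
  | putI a p e =>
    refine ⟨fun _ _ => rfl, fun _ _ => rfl, fun j hj => ?_, fun _ _ => rfl⟩
    exact Function.update_of_ne (by simpa [Prog.wIA] using hj) _ _
  | putR a p e =>
    refine ⟨fun _ _ => rfl, fun _ _ => rfl, fun _ _ => rfl, fun j hj => ?_⟩
    exact Function.update_of_ne (by simpa [Prog.wA] using hj) _ _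
  | seq c d hc hd =>
    rw [exec_seq]
    refine ((hc s).mono ?_ ?_ ?_ ?_).trans ((hd _).mono ?_ ?_ ?_ ?_) <;>
      simp [Prog.wI, Prog.wR, Prog.wIA, Prog.wA]
  | ifLt e f c d hc hd =>
    simp only [Prog.exec]
    split_ifs
    · refine (hc s).mono ?_ ?_ ?_ ?_ <;> simp [Prog.wI, Prog.wR, Prog.wIA, Prog.wA]
    · refine (hd s).mono ?_ ?_ ?_ ?_ <;> simp [Prog.wI, Prog.wR, Prog.wIA, Prog.wA]
  | ifLe e f c d hc hd =>
    simp only [Prog.exec]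
    split_ifs
    · refine (hc s).mono ?_ ?_ ?_ ?_ <;> simp [Prog.wI, Prog.wR, Prog.wIA, Prog.wA]
    · refine (hd s).mono ?_ ?_ ?_ ?_ <;> simp [Prog.wI, Prog.wR, Prog.wIA, Prog.wA]
  | loop i e c hc =>
    rw [exec_loop]
    generalize e.val s = k
    induction k with
    | zero => exact Frame.refl _ _ _ _ _
    | succ k ih =>
      refine ih.trans (Frame.trans (s' := (Prog.rounds i c s k).withI i k) ?_
        ((hc _).mono ?_ ?_ ?_ ?_))
      · refine ⟨fun j hj => ?_, fun _ _ => rfl, fun _ _ => rfl, fun _ _ => rfl⟩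
        have : j ≠ i := fun h => hj (by simp [Prog.wI, h])
        simp [this]
      all_goals simp [Prog.wI, Prog.wR, Prog.wIA, Prog.wA]

/-! ### Admissible executions -/

/-- All integers that an execution reads or computes are bounded in terms of `X`, and all positions
that it accesses lie below `SP`. -/
def Prog.Ok (X SP : ℕ) : Prog → Store → Prop
  | skip, _ => True
  | setI _ e, s => e.Ok X SP s ∧ ∀ i ∈ e.regs, s.ireg i ≤ X
  | setR _ x, s => x.Ok X SP s ∧ ∀ i ∈ x.regs, s.ireg i ≤ X
  | putI _ p e, s => p.Ok X SP s ∧ p.val s < SP ∧ e.Ok X SP s ∧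
      ∀ i ∈ p.regs ++ e.regs, s.ireg i ≤ X
  | putR _ p x, s => p.Ok X SP s ∧ p.val s < SP ∧ x.Ok X SP s ∧
      ∀ i ∈ p.regs ++ x.regs, s.ireg i ≤ X
  | seq c d, s => c.Ok X SP s ∧ d.Ok X SP (c.exec s).1
  | ifLt e f c d, s => e.Ok X SP s ∧ f.Ok X SP s ∧ (∀ i ∈ e.regs ++ f.regs, s.ireg i ≤ X) ∧
      (e.val s < f.val s → c.Ok X SP s) ∧ (¬e.val s < f.val s → d.Ok X SP s)
  | ifLe x y c d, s => x.Ok X SP s ∧ y.Ok X SP s ∧ (∀ i ∈ x.regs ++ y.regs, s.ireg i ≤ X) ∧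
      (x.val s ≤ y.val s → c.Ok X SP s) ∧ (¬x.val s ≤ y.val s → d.Ok X SP s)
  | loop i e c, s => e.Ok X SP s ∧ (∀ i ∈ e.regs, s.ireg i ≤ X) ∧
      ∀ j < e.val s, c.Ok X SP ((Prog.rounds i c s j).withI i j)

/-- Admissibility requires the registers to be at most X afresh at every evaluation. Therefore the
exponent does not grow with the number of loop rounds and depends on the program text only. -/
theorem Prog.Ok.bound {X SP : ℕ} (hX : 2 ≤ X) (c : Prog) (s : Store) (h : c.Ok X SP s) :
    (c.exec s).2.space ≤ SP ∧ (c.exec s).2.word ≤ X ^ c.size := by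
  have hpow : ∀ {a b : ℕ}, a ≤ b → X ^ a ≤ X ^ b := fun h => Nat.pow_le_pow_right (by omega) h
  induction c generalizing s with
  | skip => exact ⟨Nat.zero_le _, Nat.zero_le _⟩
  | setI i e =>
    have h1 := e.use_bound hX s h.1 h.2
    constructor <;> simp only [Prog.exec, Usage.comb, Usage.tick, Prog.size] <;> omega
  | setR i x =>
    have h1 := x.use_bound hX s h.1 h.2
    constructor <;> simp only [Prog.exec, Usage.comb, Usage.tick, Prog.size] <;> omega
  | putI a p e =>
    obtain ⟨h1, h2, h3, h4⟩ := h
    have h5 := p.use_bound hX s h1 fun i hi => h4 i (List.mem_append_left _ hi)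
    have h6 := e.use_bound hX s h3 fun i hi => h4 i (List.mem_append_right _ hi)
    have h7 := hpow (show p.size ≤ p.size + e.size by omega)
    have h8 := hpow (show e.size ≤ p.size + e.size by omega)
    constructor <;> simp only [Prog.exec, Usage.comb, Prog.size] <;> omega
  | putR a p x =>
    obtain ⟨h1, h2, h3, h4⟩ := h
    have h5 := p.use_bound hX s h1 fun i hi => h4 i (List.mem_append_left _ hi)
    have h6 := x.use_bound hX s h3 fun i hi => h4 i (List.mem_append_right _ hi)
    have h7 := hpow (show p.size ≤ p.size + x.size by omega)
    have h8 := hpow (show x.size ≤ p.size + x.size by omega)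
    constructor <;> simp only [Prog.exec, Usage.comb, Prog.size] <;> omega
  | seq c d hc hd =>
    have h1 := hc s h.1
    have h2 := hd _ h.2
    have h7 := hpow (show c.size ≤ c.size + d.size by omega)
    have h8 := hpow (show d.size ≤ c.size + d.size by omega)
    constructor <;> simp only [Prog.exec, Usage.comb, Prog.size] <;> omega
  | ifLt e f c d hc hd =>
    obtain ⟨h1, h2, h3, h4, h5⟩ := h
    have h6 := e.use_bound hX s h1 fun i hi => h3 i (List.mem_append_left _ hi)
    have h7 := f.use_bound hX s h2 fun i hi => h3 i (List.mem_append_right _ hi)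
    have h8 := hpow (show e.size ≤ e.size + f.size + c.size + d.size by omega)
    have h9 := hpow (show f.size ≤ e.size + f.size + c.size + d.size by omega)
    have h10 := hpow (show c.size ≤ e.size + f.size + c.size + d.size by omega)
    have h11 := hpow (show d.size ≤ e.size + f.size + c.size + d.size by omega)
    by_cases hlt : e.val s < f.val s
    · have h12 := hc s (h4 hlt)
      constructor <;> simp only [Prog.exec, Usage.comb, Usage.tick, Prog.size, if_pos hlt] <;> omega
    · have h12 := hd s (h5 hlt)
      constructor <;> simp only [Prog.exec, Usage.comb, Usage.tick, Prog.size, if_neg hlt] <;> omega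
  | ifLe e f c d hc hd =>
    obtain ⟨h1, h2, h3, h4, h5⟩ := h
    have h6 := e.use_bound hX s h1 fun i hi => h3 i (List.mem_append_left _ hi)
    have h7 := f.use_bound hX s h2 fun i hi => h3 i (List.mem_append_right _ hi)
    have h8 := hpow (show e.size ≤ e.size + f.size + c.size + d.size by omega)
    have h9 := hpow (show f.size ≤ e.size + f.size + c.size + d.size by omega)
    have h10 := hpow (show c.size ≤ e.size + f.size + c.size + d.size by omega)
    have h11 := hpow (show d.size ≤ e.size + f.size + c.size + d.size by omega)
    by_cases hlt : e.val s ≤ f.val s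
    · have h12 := hc s (h4 hlt)
      constructor <;> simp only [Prog.exec, Usage.comb, Usage.tick, Prog.size, if_pos hlt] <;> omega
    · have h12 := hd s (h5 hlt)
      constructor <;> simp only [Prog.exec, Usage.comb, Usage.tick, Prog.size, if_neg hlt] <;> omega
  | loop i e c hc =>
    obtain ⟨h1, h2, h3⟩ := h
    have h4 := e.use_bound hX s h1 h2
    have h5 := hpow (show e.size ≤ e.size + c.size by omega)
    have h6 := hpow (show c.size ≤ e.size + c.size by omega)
    have h7 : ∀ k ≤ e.val s,
        (iter (fun j s' => c.exec { s' with ireg := Function.update s'.ireg i j }) k s).2.space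
          ≤ SP ∧
        (iter (fun j s' => c.exec { s' with ireg := Function.update s'.ireg i j }) k s).2.word
          ≤ X ^ c.size := by
      intro k hk
      induction k with
      | zero => exact ⟨Nat.zero_le _, Nat.zero_le _⟩
      | succ k ih =>
        have h8 := ih (by omega)
        have h9 := hc _ (h3 k (by omega))
        simp only [iter, Usage.comb, Usage.tick, iter_fst]
        change max (max _ (c.exec ((Prog.rounds i c s k).withI i k)).2.space) _ ≤ _ ∧
          max (max _ (c.exec ((Prog.rounds i c s k).withI i k)).2.word) _ ≤ _
        omega
    have h8 := h7 _ le_rfl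
    constructor <;> simp only [Prog.exec, Usage.comb, Usage.tick, Prog.size] <;> omega

/-- The execution is admissible and takes time at most proportional to `B`. -/
structure Good (X SP B : ℕ) (c : Prog) (s : Store) : Prop where
  ok : c.Ok X SP s
  time : (c.exec s).2.time ≤ c.cost * B

variable {X SP B : ℕ}

theorem Good.seq {c d : Prog} {s : Store} (hc : Good X SP B c s)
    (hd : Good X SP B d (c.exec s).1) : Good X SP B (Prog.seq c d) s := by
  refine ⟨⟨hc.ok, hd.ok⟩, ?_⟩
  have h1 := hc.time
  have h2 := hd.time
  simp only [Prog.exec, Usage.comb, Prog.cost, add_mul]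
  omega

theorem Good.setI {i : ℕ} {e : IExp} {s : Store} (hB : 1 ≤ B) (he : e.Ok X SP s)
    (hr : ∀ i ∈ e.regs, s.ireg i ≤ X) : Good X SP B (Prog.setI i e) s := by
  refine ⟨⟨he, hr⟩, ?_⟩
  simp only [Prog.exec, Usage.comb, Prog.cost, Usage.tick, IExp.use_time]
  exact Nat.le_mul_of_pos_right _ hB

theorem Good.setR {i : ℕ} {x : RExp} {s : Store} (hB : 1 ≤ B) (hx : x.Ok X SP s)
    (hr : ∀ i ∈ x.regs, s.ireg i ≤ X) : Good X SP B (Prog.setR i x) s := by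
  refine ⟨⟨hx, hr⟩, ?_⟩
  simp only [Prog.exec, Usage.comb, Prog.cost, Usage.tick, RExp.use_time]
  exact Nat.le_mul_of_pos_right _ hB

theorem Good.putR {a : ℕ} {p : IExp} {x : RExp} {s : Store} (hB : 1 ≤ B) (hp : p.Ok X SP s)
    (hlt : p.val s < SP) (hx : x.Ok X SP s) (hr : ∀ i ∈ p.regs ++ x.regs, s.ireg i ≤ X) :
    Good X SP B (Prog.putR a p x) s := by
  refine ⟨⟨hp, hlt, hx, hr⟩, ?_⟩
  simp only [Prog.exec, Usage.comb, Prog.cost, RExp.use_time, IExp.use_time]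
  exact Nat.le_mul_of_pos_right _ hB

theorem Good.ifLt {e f : IExp} {c d : Prog} {s : Store} (hB : 1 ≤ B) (he : e.Ok X SP s)
    (hf : f.Ok X SP s) (hr : ∀ i ∈ e.regs ++ f.regs, s.ireg i ≤ X)
    (hc : e.val s < f.val s → Good X SP B c s) (hd : ¬e.val s < f.val s → Good X SP B d s) :
    Good X SP B (Prog.ifLt e f c d) s := by
  refine ⟨⟨he, hf, hr, fun h => (hc h).ok, fun h => (hd h).ok⟩, ?_⟩
  simp only [Prog.exec, Usage.comb, Prog.cost, Usage.tick, IExp.use_time, add_mul]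
  have h1 : e.nodes ≤ e.nodes * B := Nat.le_mul_of_pos_right _ hB
  have h2 : f.nodes ≤ f.nodes * B := Nat.le_mul_of_pos_right _ hB
  split_ifs with h
  · have := (hc h).time
    omega
  · have := (hd h).time
    omega

/-- The loop rule. -/
theorem Good.loop {i k B' : ℕ} {e : IExp} {c : Prog} {s : Store} (Inv : ℕ → Store → Prop)
    (he : e.Ok X SP s) (hr : ∀ i ∈ e.regs, s.ireg i ≤ X) (hk : e.val s = k) (hB : 1 ≤ B)
    (hB' : 1 ≤ B') (hkB : k * B' ≤ B) (h0 : Inv 0 s)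
    (hstep : ∀ j < k, ∀ s', Inv j s' → Good X SP B' c (s'.withI i j) ∧
      Inv (j + 1) (c.exec (s'.withI i j)).1) :
    Good X SP B (Prog.loop i e c) s ∧ Inv k ((Prog.loop i e c).exec s).1 := by
  have hinv : ∀ j ≤ k, Inv j (Prog.rounds i c s j) := by
    intro j hj
    induction j with
    | zero => exact h0
    | succ j ih => exact (hstep j (by omega) _ (ih (by omega))).2
  have hgood : ∀ j < k, Good X SP B' c ((Prog.rounds i c s j).withI i j) := fun j hj =>
    (hstep j hj _ (hinv j hj.le)).1
  refine ⟨⟨⟨he, hr, fun j hj => (hgood j (hk ▸ hj)).ok⟩, ?_⟩, ?_⟩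
  · have htime : ∀ j ≤ k,
        (iter (fun j s' => c.exec { s' with ireg := Function.update s'.ireg i j }) j s).2.time
          ≤ j * (c.cost * B' + 1) := by
      intro j hj
      induction j with
      | zero => exact Nat.zero_le _
      | succ j ih =>
        have h1 := ih (by omega)
        have h2 := (hgood j (by omega)).time
        simp only [iter, Usage.comb, Usage.tick, iter_fst]
        change _ + (c.exec ((Prog.rounds i c s j).withI i j)).2.time + 1 ≤ _
        rw [add_mul, one_mul]
        omega
    have h1 := htime k le_rfl
    simp only [Prog.exec, Usage.comb, Usage.tick, Prog.cost, IExp.use_time, hk]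
    -- The k rounds cost at most k·B' ≤ B times the cost of the body, and the loop counter adds k ≤
    -- B units. This explains the summand 2 in the cost of a loop: one for the counter, one for the
    -- loop itself.
    have h2 : k ≤ B := (Nat.le_mul_of_pos_right k hB').trans hkB
    have h3 : c.cost * (k * B') ≤ c.cost * B := Nat.mul_le_mul_left _ hkB
    have h4 : e.nodes + 1 ≤ (e.nodes + 1) * B := Nat.le_mul_of_pos_right _ hB
    nlinarith
  · rw [exec_loop, hk]
    exact hinv k le_rfl

end RAM

namespace RAM

variable {X SP B : ℕ}

/-! ### Dependence of expressions on the registers -/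

theorem IExp.val_congr {s s' : Store} {e : IExp} (h : ∀ i ∈ e.regs, s'.ireg i = s.ireg i)
    (ha : s'.iarr = s.iarr) : e.val s' = e.val s := by
  induction e with
  | lit c => rfl
  | reg i => exact h i (by simp [IExp.regs])
  | get a p ih => simp only [IExp.val, ih h, ha]
  | add e f he hf =>
    simp only [IExp.val, he fun i hi => h i (List.mem_append_left _ hi),
      hf fun i hi => h i (List.mem_append_right _ hi)]
  | sub e f he hf =>
    simp only [IExp.val, he fun i hi => h i (List.mem_append_left _ hi),
      hf fun i hi => h i (List.mem_append_right _ hi)]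
  | mul e f he hf =>
    simp only [IExp.val, he fun i hi => h i (List.mem_append_left _ hi),
      hf fun i hi => h i (List.mem_append_right _ hi)]
  | div e f he hf =>
    simp only [IExp.val, he fun i hi => h i (List.mem_append_left _ hi),
      hf fun i hi => h i (List.mem_append_right _ hi)]
  | mod e f he hf =>
    simp only [IExp.val, he fun i hi => h i (List.mem_append_left _ hi),
      hf fun i hi => h i (List.mem_append_right _ hi)]

theorem IExp.Ok.congr {s s' : Store} {e : IExp} (hok : e.Ok X SP s)
    (h : ∀ i ∈ e.regs, s'.ireg i = s.ireg i) (ha : s'.iarr = s.iarr) : e.Ok X SP s' := by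
  induction e with
  | lit c => trivial
  | reg i => trivial
  | get a p ih =>
    have h1 := IExp.val_congr (e := p) h ha
    refine ⟨ih hok.1 h, ?_, ?_⟩
    · rw [h1]; exact hok.2.1
    · rw [h1, ha]; exact hok.2.2
  | add e f he hf => exact ⟨he hok.1 fun i hi => h i (List.mem_append_left _ hi),
      hf hok.2 fun i hi => h i (List.mem_append_right _ hi)⟩
  | sub e f he hf => exact ⟨he hok.1 fun i hi => h i (List.mem_append_left _ hi),
      hf hok.2 fun i hi => h i (List.mem_append_right _ hi)⟩
  | mul e f he hf => exact ⟨he hok.1 fun i hi => h i (List.mem_append_left _ hi),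
      hf hok.2 fun i hi => h i (List.mem_append_right _ hi)⟩
  | div e f he hf => exact ⟨he hok.1 fun i hi => h i (List.mem_append_left _ hi),
      hf hok.2 fun i hi => h i (List.mem_append_right _ hi)⟩
  | mod e f he hf => exact ⟨he hok.1 fun i hi => h i (List.mem_append_left _ hi),
      hf hok.2 fun i hi => h i (List.mem_append_right _ hi)⟩

theorem Frame.ireg_eq {A : List ℕ} {s s' : Store} (h : Frame [] [] [] A s s') :
    s'.ireg = s.ireg := funext fun i => h.ireg i (by simp)

theorem Frame.iarr_eq {I A : List ℕ} {s s' : Store} (h : Frame I [] [] A s s') :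
    s'.iarr = s.iarr := funext fun i => h.iarr i (by simp)

theorem IExp.val_of_frame {A : List ℕ} {s s' : Store} (h : Frame [] [] [] A s s') (e : IExp) :
    e.val s' = e.val s :=
  IExp.val_congr (fun i _ => congrFun h.ireg_eq i) h.iarr_eq

theorem IExp.Ok.of_frame {A : List ℕ} {s s' : Store} (h : Frame [] [] [] A s s') {e : IExp}
    (he : e.Ok X SP s) : e.Ok X SP s' :=
  he.congr (fun i _ => congrFun h.ireg_eq i) h.iarr_eq

theorem RExp.val_of_frame {A : List ℕ} {s s' : Store} (h : Frame [] [] [] A s s') (x : RExp)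
    (hx : ∀ a ∈ x.arrs, a ∉ A) : x.val s' = x.val s := by
  induction x with
  | ofInt e => simp only [RExp.val, IExp.val_of_frame h]
  | reg i => exact h.rreg i (by simp)
  | get a p => simp only [RExp.val, IExp.val_of_frame h, h.rarr a (hx a (by simp [RExp.arrs]))]
  | add x y ihx ihy =>
    simp only [RExp.val, ihx fun a ha => hx a (List.mem_append_left _ ha),
      ihy fun a ha => hx a (List.mem_append_right _ ha)]
  | sub x y ihx ihy =>
    simp only [RExp.val, ihx fun a ha => hx a (List.mem_append_left _ ha),
      ihy fun a ha => hx a (List.mem_append_right _ ha)]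
  | mul x y ihx ihy =>
    simp only [RExp.val, ihx fun a ha => hx a (List.mem_append_left _ ha),
      ihy fun a ha => hx a (List.mem_append_right _ ha)]
  | div x y ihx ihy =>
    simp only [RExp.val, ihx fun a ha => hx a (List.mem_append_left _ ha),
      ihy fun a ha => hx a (List.mem_append_right _ ha)]
  | sqrt x ih => simp only [RExp.val, ih hx]

theorem RExp.Ok.of_frame {A : List ℕ} {s s' : Store} (h : Frame [] [] [] A s s') {x : RExp}
    (hx : x.Ok X SP s) : x.Ok X SP s' := by
  induction x with
  | ofInt e => exact IExp.Ok.of_frame h hx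
  | reg i => trivial
  | get a p => exact ⟨IExp.Ok.of_frame h hx.1, by rw [IExp.val_of_frame h]; exact hx.2⟩
  | add x y ihx ihy => exact ⟨ihx hx.1, ihy hx.2⟩
  | sub x y ihx ihy => exact ⟨ihx hx.1, ihy hx.2⟩
  | mul x y ihx ihy => exact ⟨ihx hx.1, ihy hx.2⟩
  | div x y ihx ihy => exact ⟨ihx hx.1, ihy hx.2⟩
  | sqrt x ih => exact ih hx

/-! ### Nested loops that accumulate into an array -/

/-- Nested loops; every item of the list is a loop register and the number of rounds. -/
def nest : List (ℕ × IExp) → Prog → Prog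
  | [], c => c
  | t :: l, c => Prog.loop t.1 t.2 (nest l c)

/-- Add the value of `x` to one array cell. -/
def addTo (dst : ℕ) (pos : IExp) (x : RExp) : Prog :=
  Prog.putR dst pos (RExp.add (RExp.get dst pos) x)

/-- Sum over the index box of nested loops. -/
noncomputable def boxSum : List (ℕ × IExp) → (Store → ℝ) → Store → ℝ
  | [], F, s => F s
  | t :: l, F, s => ∑ j ∈ Finset.range (t.2.val s), boxSum l F (s.withI t.1 j)

/-- Validity on the index box of nested loops. -/
def boxAll : List (ℕ × IExp) → (Store → Prop) → Store → Prop
  | [], K, s => K s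
  | t :: l, K, s => ∀ j < t.2.val s, boxAll l K (s.withI t.1 j)

/-- Bound for the size of the index box of nested loops. -/
def boxVol (l : List (ℕ × IExp)) (s : Store) : ℕ :=
  (l.map fun t => max 1 (t.2.val s)).prod

/-- The numbers of rounds do not depend on the loop registers. -/
def Indep (l : List (ℕ × IExp)) : Prop :=
  ∀ t ∈ l, ∀ i ∈ t.2.regs, i ∉ l.map Prod.fst

instance (l : List (ℕ × IExp)) : Decidable (Indep l) := by
  unfold Indep; infer_instance

theorem Indep.tail {t : ℕ × IExp} {l : List (ℕ × IExp)} (h : Indep (t :: l)) : Indep l :=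
  fun u hu i hi hm => h u (List.mem_cons_of_mem _ hu) i hi (by
    rw [List.map_cons]; exact List.mem_cons_of_mem _ hm)

theorem Frame.withI {I A : List ℕ} {s s' : Store} {i : ℕ} (h : Frame (i :: I) [] [] A s s')
    (j : ℕ) : Frame I [] [] A (s.withI i j) (s'.withI i j) := by
  refine ⟨fun a ha => ?_, h.rreg, h.iarr, h.rarr⟩
  by_cases hai : a = i
  · simp [hai]
  · simp [hai, h.ireg a (by simp [hai, ha])]

theorem Indep.val_eq {l : List (ℕ × IExp)} (hl : Indep l) {A : List ℕ} {s s' : Store}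
    (h : Frame (l.map Prod.fst) [] [] A s s') {t : ℕ × IExp} (ht : t ∈ l) :
    t.2.val s' = t.2.val s :=
  IExp.val_congr (fun i hi => h.ireg i (hl t ht i hi)) h.iarr_eq

theorem boxSum_congr {l : List (ℕ × IExp)} (hl : Indep l) {A : List ℕ} {F : Store → ℝ}
    (hF : ∀ s s', Frame [] [] [] A s s' → F s' = F s) {s s' : Store}
    (h : Frame (l.map Prod.fst) [] [] A s s') : boxSum l F s' = boxSum l F s := by
  induction l generalizing s s' with
  | nil => exact hF s s' h
  | cons t l ih =>
    simp only [boxSum, hl.val_eq h (List.mem_cons_self ..)]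
    exact Finset.sum_congr rfl fun j _ => ih hl.tail (h.withI j)

theorem boxAll_congr {l : List (ℕ × IExp)} (hl : Indep l) {A : List ℕ} {K : Store → Prop}
    (hK : ∀ s s', Frame [] [] [] A s s' → K s → K s') {s s' : Store}
    (h : Frame (l.map Prod.fst) [] [] A s s') (hs : boxAll l K s) : boxAll l K s' := by
  induction l generalizing s s' with
  | nil => exact hK s s' h hs
  | cons t l ih =>
    intro j hj
    rw [hl.val_eq h (List.mem_cons_self ..)] at hj
    exact ih hl.tail (h.withI j) (hs j hj)

theorem boxVol_congr {l l' : List (ℕ × IExp)} {A : List ℕ} {s s' : Store} (hl : Indep l')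
    (hsub : ∀ t ∈ l, t ∈ l') (h : Frame (l'.map Prod.fst) [] [] A s s') :
    boxVol l s' = boxVol l s := by
  unfold boxVol
  congr 1
  exact List.map_congr_left fun t ht => by rw [hl.val_eq h (hsub t ht)]

/-- The factors are at least 1 by definition, because a loop without rounds still takes time. -/
theorem boxVol_pos (l : List (ℕ × IExp)) (s : Store) : 1 ≤ boxVol l s := by
  unfold boxVol
  refine List.one_le_prod_of_one_le fun x hx => ?_
  obtain ⟨t, _, rfl⟩ := List.mem_map.mp hx
  exact le_max_left _ _

/-- The loop bounds are admissible. -/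
def BoundsOk (X SP : ℕ) (l : List (ℕ × IExp)) (s : Store) : Prop :=
  ∀ t ∈ l, t.2.Ok X SP s ∧ (∀ i ∈ t.2.regs, s.ireg i ≤ X) ∧ t.2.val s ≤ X

/-- The summand does not read the destination array, and positions and bounds do not depend on real
arrays. Hence in every round the summand has the value it would have in the initial store with the
loop registers set, and a cell collects the values of those rounds that address it. The induction is
on the depth of nesting. -/
theorem nest_addTo {l : List (ℕ × IExp)} {dst : ℕ} {pos : IExp} {x : RExp} {s : Store}
    (hl : Indep l) (hb : BoundsOk X SP l s) (hx : dst ∉ x.arrs)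
    (hr : ∀ i ∈ pos.regs ++ x.regs, i ∈ l.map Prod.fst ∨ s.ireg i ≤ X)
    (hok : boxAll l (fun s => pos.Ok X SP s ∧ pos.val s < SP ∧ x.Ok X SP s) s)
    (hB : boxVol l s ≤ B) :
    Good X SP B (nest l (addTo dst pos x)) s ∧
      Frame (l.map Prod.fst) [] [] [dst] s ((nest l (addTo dst pos x)).exec s).1 ∧
      ∀ y, ((nest l (addTo dst pos x)).exec s).1.rarr dst y =
        s.rarr dst y + boxSum l (fun s => if pos.val s = y then x.val s else 0) s := by
  induction l generalizing s B with
  | nil =>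
    obtain ⟨h1, h2, h3⟩ := hok
    have hr' : ∀ i ∈ pos.regs ++ x.regs, s.ireg i ≤ X := fun i hi =>
      (hr i hi).resolve_left (by simp)
    refine ⟨Good.putR ((boxVol_pos [] s).trans hB) h1 h2 ⟨⟨h1, h2⟩, h3⟩ fun i hi => ?_, ?_, ?_⟩
    · refine hr' i ?_
      simp only [RExp.regs, List.mem_append] at hi ⊢
      tauto
    · exact exec_frame (addTo dst pos x) s
    · intro y
      simp only [nest, addTo, Prog.exec, RExp.val, Function.update_self, Function.update_apply,
        boxSum]
      by_cases hy : y = pos.val s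
      · simp [hy]
      · rw [if_neg hy, if_neg (Ne.symm hy), add_zero]
  | cons t l ih =>
    have hb0 := hb t (List.mem_cons_self ..)
    have hvol : boxVol (t :: l) s = max 1 (t.2.val s) * boxVol l s := by
      simp [boxVol]
    have hB1 : 1 ≤ B := (boxVol_pos _ _).trans hB
    have hkB : t.2.val s * boxVol l s ≤ B :=
      (Nat.mul_le_mul_right _ (le_max_right 1 _)).trans (hvol ▸ hB)
    -- The invariant compares with the store before the outermost loop: only the destination has
    -- changed, by the partial sum over the outer index.
    have key := Good.loop (X := X) (SP := SP) (i := t.1) (e := t.2) (c := nest l (addTo dst pos x))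
      (fun j s' => Frame ((t :: l).map Prod.fst) [] [] [dst] s s' ∧
        ∀ y, s'.rarr dst y = s.rarr dst y + ∑ j' ∈ Finset.range j,
          boxSum l (fun s => if pos.val s = y then x.val s else 0) (s.withI t.1 j'))
      hb0.1 hb0.2.1 rfl hB1 (boxVol_pos l s) hkB ⟨Frame.refl _ _ _ _ _, by simp⟩ ?_
    · exact ⟨key.1, key.2.1, key.2.2⟩
    · rintro j hj s' ⟨hf, hv⟩
      have hfl : Frame (l.map Prod.fst) [] [] [dst] (s.withI t.1 j) (s'.withI t.1 j) := by
        rw [List.map_cons] at hf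
        exact hf.withI j
      have hfs : Frame ((t :: l).map Prod.fst) [] [] [dst] s (s'.withI t.1 j) := by
        refine ⟨fun a ha => ?_, hf.rreg, hf.iarr, hf.rarr⟩
        have hne : a ≠ t.1 := fun h => ha (by simp [h])
        rw [Store.withI_ireg, if_neg hne, hf.ireg a ha]
      have hIH := ih (s := s'.withI t.1 j) (B := boxVol l s) hl.tail (fun u hu => ?_)
        (fun i hi => ?_) ?_ (boxVol_congr hl (fun u hu => List.mem_cons_of_mem _ hu) hfs).le
      · obtain ⟨h1, h2, h3⟩ := hIH
        refine ⟨h1, ?_, fun y => ?_⟩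
        · refine hfs.trans (h2.mono ?_ ?_ ?_ ?_) <;> simp
        · rw [h3 y, Finset.sum_range_succ, ← add_assoc, Store.withI_rarr, hv y]
          congr 1
          refine boxSum_congr hl.tail (A := [dst]) (fun u u' hu => ?_) hfl
          rw [IExp.val_of_frame hu, RExp.val_of_frame hu x fun a ha => by
            simp only [List.mem_singleton]; rintro rfl; exact hx ha]
      · have hbu := hb u (List.mem_cons_of_mem _ hu)
        have hreg : ∀ i ∈ u.2.regs, (s'.withI t.1 j).ireg i = s.ireg i := fun i hi =>
          hfs.ireg i (hl u (List.mem_cons_of_mem _ hu) i hi)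
        refine ⟨hbu.1.congr hreg hfs.iarr_eq, fun i hi => (hreg i hi).trans_le (hbu.2.1 i hi), ?_⟩
        rw [IExp.val_congr hreg hfs.iarr_eq]
        exact hbu.2.2
      · by_cases hm : i ∈ l.map Prod.fst
        · exact Or.inl hm
        · right
          by_cases hit : i = t.1
          · simp only [hit, Store.withI_ireg, if_true]
            exact hj.le.trans hb0.2.2
          · have hm' : i ∉ (t :: l).map Prod.fst := by
              rw [List.map_cons, List.mem_cons, not_or]; exact ⟨hit, hm⟩
            rw [hfs.ireg i hm']
            exact (hr i hi).resolve_left hm'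
      · refine boxAll_congr hl.tail (A := [dst]) (fun u u' hu hK => ?_) hfl (hok j hj)
        refine ⟨IExp.Ok.of_frame hu hK.1, ?_, RExp.Ok.of_frame hu hK.2.2⟩
        rw [IExp.val_of_frame hu]
        exact hK.2.1

/-- Set the first cells of an array to zero. -/
def zeroArr (i dst : ℕ) (len : IExp) : Prog :=
  Prog.loop i len (Prog.putR dst (IExp.reg i) (RExp.ofInt (IExp.lit 0)))

theorem zeroArr_spec {i dst : ℕ} {len : IExp} {s : Store} (hlen : len.Ok X SP s)
    (hr : ∀ i ∈ len.regs, s.ireg i ≤ X) (hX : len.val s ≤ X) (hSP : len.val s ≤ SP)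
    (hB : len.val s ≤ B) (hB1 : 1 ≤ B) :
    Good X SP B (zeroArr i dst len) s ∧
      Frame [i] [] [] [dst] s ((zeroArr i dst len).exec s).1 ∧
      ∀ y < len.val s, ((zeroArr i dst len).exec s).1.rarr dst y = 0 := by
  have key := Good.loop (X := X) (SP := SP) (B := B) (B' := 1) (i := i) (e := len)
    (c := Prog.putR dst (IExp.reg i) (RExp.ofInt (IExp.lit 0))) (s := s)
    (fun j s' => ∀ y < j, s'.rarr dst y = 0) hlen hr rfl hB1 le_rfl (by omega) (by simp) ?_
  · exact ⟨key.1, exec_frame (zeroArr i dst len) s, key.2⟩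
  · intro j hj s' hv
    refine ⟨Good.putR le_rfl trivial ?_ trivial fun a ha => ?_, fun y hy => ?_⟩
    · simp only [IExp.val, Store.withI_ireg, if_true]
      omega
    · simp only [IExp.regs, RExp.regs, List.append_nil, List.mem_singleton] at ha
      simp only [ha, Store.withI_ireg, if_true]
      omega
    · simp only [Prog.exec, Function.update_self, Function.update_apply, IExp.val,
        Store.withI_ireg, if_true, Store.withI_rarr, RExp.val, Nat.cast_zero]
      by_cases hyj : y = j
      · rw [if_pos hyj]
      · rw [if_neg hyj]
        exact hv y (by omega)

/-- Overwrite an array by accumulation in nested loops. -/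
def compute (i dst : ℕ) (len : IExp) (l : List (ℕ × IExp)) (pos : IExp) (x : RExp) : Prog :=
  Prog.seq (zeroArr i dst len) (nest l (addTo dst pos x))

/-- Zeroing the array first turns accumulation into assignment. Cells beyond the given length remain
uncontrolled. -/
theorem compute_spec {i dst : ℕ} {len : IExp} {l : List (ℕ × IExp)} {pos : IExp} {x : RExp}
    {s : Store} (hi : i ∈ l.map Prod.fst) (hlen : len.Ok X SP s)
    (hlr : ∀ i ∈ len.regs, s.ireg i ≤ X) (hlX : len.val s ≤ X) (hlSP : len.val s ≤ SP)
    (hlB : len.val s ≤ B)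
    (hl : Indep l) (hb : BoundsOk X SP l s) (hx : dst ∉ x.arrs)
    (hr : ∀ i ∈ pos.regs ++ x.regs, i ∈ l.map Prod.fst ∨ s.ireg i ≤ X)
    (hok : boxAll l (fun s => pos.Ok X SP s ∧ pos.val s < SP ∧ x.Ok X SP s) s)
    (hB : boxVol l s ≤ B) :
    Good X SP B (compute i dst len l pos x) s ∧
      Frame (l.map Prod.fst) [] [] [dst] s ((compute i dst len l pos x).exec s).1 ∧
      ∀ y < len.val s, ((compute i dst len l pos x).exec s).1.rarr dst y =
        boxSum l (fun s => if pos.val s = y then x.val s else 0) s := by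
  obtain ⟨h1, h2, h3⟩ := zeroArr_spec (i := i) (dst := dst) hlen hlr hlX hlSP hlB
    ((boxVol_pos _ _).trans hB)
  set s₁ := ((zeroArr i dst len).exec s).1 with hs₁
  have hf : Frame (l.map Prod.fst) [] [] [dst] s s₁ := by
    refine h2.mono (fun a ha => ?_) ?_ ?_ ?_
    · rw [List.mem_singleton] at ha; exact ha ▸ hi
    all_goals simp
  have key := nest_addTo (X := X) (SP := SP) (B := B) (l := l) (dst := dst) (pos := pos) (x := x)
    (s := s₁) hl (fun u hu => ?_) hx (fun a ha => ?_) ?_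
    ((boxVol_congr hl (fun u hu => hu) hf).trans_le hB)
  · refine ⟨h1.seq key.1, hf.trans key.2.1, fun y hy => ?_⟩
    rw [compute, exec_seq, ← hs₁, key.2.2 y, h3 y hy, zero_add]
    refine boxSum_congr hl (A := [dst]) (fun u u' hu => ?_) hf
    rw [IExp.val_of_frame hu, RExp.val_of_frame hu x fun a ha => by
      simp only [List.mem_singleton]; rintro rfl; exact hx ha]
  · have hreg : ∀ i ∈ u.2.regs, s₁.ireg i = s.ireg i := fun i hi => hf.ireg i (hl u hu i hi)
    refine ⟨(hb u hu).1.congr hreg hf.iarr_eq,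
      fun i hi => (hreg i hi).trans_le ((hb u hu).2.1 i hi), ?_⟩
    rw [IExp.val_congr hreg hf.iarr_eq]
    exact (hb u hu).2.2
  · by_cases hm : a ∈ l.map Prod.fst
    · exact Or.inl hm
    · right
      rw [hf.ireg a hm]
      exact (hr a ha).resolve_left hm
  · refine boxAll_congr hl (A := [dst]) (fun u u' hu hK => ?_) hf hok
    refine ⟨IExp.Ok.of_frame hu hK.1, ?_, RExp.Ok.of_frame hu hK.2.2⟩
    rw [IExp.val_of_frame hu]
    exact hK.2.1

end RAM

namespace RAM

/-! ### The program -/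

open IExp

/-- The expression `a * b + c`. -/
abbrev ix (a b c : IExp) : IExp := add (mul a b) c

/-- The real number `0 - x`. -/
abbrev neg (x : RExp) : RExp := RExp.sub (RExp.ofInt (lit 0)) x

/-- Position of an entry of a matrix with `n` rows in a block. -/
abbrev ix3 (a i w k : IExp) : IExp := ix (ix a (reg 0) i) w k

/-- Real or imaginary parts of the discrete Fourier transforms of the columns of a matrix. -/
def dft (src d wd dst tab : ℕ) : Prog :=
  compute 10 dst (mul (mul (reg 0) (reg wd)) (reg 6))
    [(10, reg 0), (11, reg wd), (12, reg 6), (13, reg d)]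
    (ix (ix (reg 10) (reg wd) (reg 11)) (reg 6) (reg 12))
    (RExp.mul (RExp.get src (ix3 (reg 13) (reg 10) (reg wd) (reg 11)))
      (RExp.get tab (mod (mul (reg 12) (reg 13)) (reg 6))))

/-- Entry of the transform of the first factor, at the frequency in register 9. -/
abbrev pEntry (arr : ℕ) : RExp :=
  RExp.get arr (ix (ix (reg 13) (reg 3) (reg 10)) (reg 6) (reg 9))

/-- Entry of the transform of the second factor, at the frequency in register 12. -/
abbrev fEntry (arr : ℕ) : RExp :=
  RExp.get arr (ix (ix (reg 13) (reg 7) (reg 11)) (reg 6) (reg 12))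

/-- Gram matrices of the columns of the transforms. -/
def gram (dst : ℕ) (x : RExp) : Prog :=
  compute 10 dst (mul (mul (reg 3) (reg 7)) (reg 6))
    [(10, reg 3), (11, reg 7), (12, reg 6), (13, reg 0)]
    (ix (ix (reg 10) (reg 7) (reg 11)) (reg 6) (reg 12)) x

/-- Weight spectrum at the difference of the output frequency (register 9) and the summation
frequency (register 13), modulo L. Adding L first keeps the truncated subtraction exact. -/
abbrev wEntry (arr : ℕ) : RExp :=
  RExp.get arr (mod (sub (add (reg 9) (reg 6)) (reg 13)) (reg 6))

/-- Registers 10, 12, 13 are the column of P, the column of the factors, and the summation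
frequency. -/
abbrev gramEntry (arr : ℕ) : RExp :=
  RExp.get arr (ix (ix (reg 10) (reg 7) (reg 12)) (reg 6) (reg 13))

abbrev gEntry (arr : ℕ) : RExp :=
  RExp.get arr (ix (ix (reg 11) (reg 7) (reg 12)) (reg 6) (reg 13))

/-- Sum over the frequencies of the second and third factor. -/
def mix (dst : ℕ) (x : RExp) : Prog :=
  compute 10 dst (mul (reg 3) (reg 0))
    [(10, reg 3), (11, reg 0), (12, reg 7), (13, reg 6)]
    (ix (reg 10) (reg 0) (reg 11)) x

/-- Real part of the product of three complex expressions. -/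
abbrev mul3Re (ar ai br bi cr ci : RExp) : RExp :=
  RExp.sub (RExp.mul (RExp.sub (RExp.mul ar br) (RExp.mul ai bi)) cr)
    (RExp.mul (RExp.add (RExp.mul ar bi) (RExp.mul ai br)) ci)

/-- Imaginary part of the product of three complex expressions. -/
abbrev mul3Im (ar ai br bi cr ci : RExp) : RExp :=
  RExp.add (RExp.mul (RExp.sub (RExp.mul ar br) (RExp.mul ai bi)) ci)
    (RExp.mul (RExp.add (RExp.mul ar bi) (RExp.mul ai br)) cr)

/-- Contribution of one frequency of the first factor. -/
def coreStep (out dG : ℕ) : Prog :=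
  Prog.seq (gram 34 (RExp.add (RExp.mul (pEntry 28) (fEntry 30)) (RExp.mul (pEntry 29) (fEntry 31))))
  (Prog.seq (gram 35 (RExp.sub (RExp.mul (pEntry 28) (fEntry 31)) (RExp.mul (pEntry 29) (fEntry 30))))
  (Prog.seq (mix 36 (mul3Re (wEntry 11) (wEntry 12) (gramEntry 34) (gramEntry 35) (gEntry 32)
    (gEntry 33)))
  (Prog.seq (mix 37 (mul3Im (wEntry 11) (wEntry 12) (gramEntry 34) (gramEntry 35) (gEntry 32)
    (gEntry 33)))
  (nest [(10, reg dG), (11, reg 0), (12, reg 3)]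
    (addTo out (ix3 (reg 10) (reg 11) (reg 3) (reg 12))
      (neg (RExp.div
        (RExp.add
          (RExp.mul (RExp.get 8 (mod (mul (reg 9) (reg 10)) (reg 6)))
            (RExp.get 36 (ix (reg 12) (reg 0) (reg 11))))
          (RExp.mul (RExp.get 9 (mod (mul (reg 9) (reg 10)) (reg 6)))
            (RExp.get 37 (ix (reg 12) (reg 0) (reg 11)))))
        (RExp.ofInt (mul (reg 6) (reg 6))))))))))

/-- Subtract from `out` the product of the transposed block Hankel matrix of the weighted
block-diagonal sums of `F Gᵀ` with `P`. -/
def core (P F G out dP dG : ℕ) : Prog :=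
  Prog.seq (dft P dP 3 28 8) (Prog.seq (dft P dP 3 29 9)
  (Prog.seq (dft F dP 7 30 8) (Prog.seq (dft F dP 7 31 9)
  (Prog.seq (dft G dG 7 32 8) (Prog.seq (dft G dG 7 33 9)
  (Prog.loop 9 (reg 6) (coreStep out dG)))))))

/-- `1` if the sample in register 10 lies on the block antidiagonal through the block row in
register 11, else `0`. -/
abbrev onDiag (dG : ℕ) : IExp :=
  mul (sub (lit 1) (sub (reg 11) (get 2 (reg 10))))
    (sub (lit 1) (sub (add (sub (get 2 (reg 10)) (reg 11)) (lit 1)) (reg dG)))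

/-- Product of the transposed sparse block Hankel matrix of the weighted samples with `P`. -/
def scatter (P out dP dG iaP iaG : ℕ) : Prog :=
  compute 10 out (mul (mul (reg dG) (reg 0)) (reg 3))
    [(10, reg 4), (11, reg dP), (12, reg 3)]
    (ix3 (sub (get 2 (reg 10)) (reg 11)) (get iaG (reg 10)) (reg 3) (reg 12))
    (RExp.mul (RExp.mul (RExp.ofInt (onDiag dG))
      (RExp.mul (RExp.get 10 (get 2 (reg 10))) (RExp.get 24 (reg 10))))
      (RExp.get P (ix3 (reg 11) (get iaP (reg 10)) (reg 3) (reg 12))))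

/-- One of the two products of the residual matrix with singular vectors: the sampled part is
written, then the low rank part is subtracted. The arguments allow the same text to serve the matrix
and its transpose. -/
def half (P F G out dP dG iaP iaG : ℕ) : Prog :=
  Prog.seq (scatter P out dP dG iaP iaG) (core P F G out dP dG)

/-- Number of entries of the first two components of a parameter. -/
abbrev off2 : IExp := mul (reg 3) (reg 3)
abbrev off3 : IExp := add off2 (mul (reg 3) (mul (reg 2) (reg 0)))
abbrev tot : IExp := add off3 (mul (mul (reg 1) (reg 0)) (reg 3))

/-- Positions of the entries of a parameter. -/
abbrev pos1 (i j : IExp) : IExp := ix i (reg 3) j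
abbrev pos2 (i b j : IExp) : IExp := add off2 (ix i (mul (reg 2) (reg 0)) (ix b (reg 0) j))
abbrev pos3 (a i j : IExp) : IExp := add off3 (ix3 a i (reg 3) j)

/-- The low rank factors of the image of a parameter under the tangent space parametrization. -/
def factors : Prog :=
  Prog.seq (compute 10 20 off2 [(10, reg 3), (11, reg 3)] (pos1 (reg 10) (reg 11))
    (RExp.get 15 (pos1 (reg 10) (reg 11))))
  (Prog.seq (nest [(10, reg 3), (11, reg 3), (12, reg 2), (13, reg 0)]
    (addTo 20 (pos1 (reg 10) (reg 11))
      (neg (RExp.mul (RExp.get 15 (pos2 (reg 10) (reg 12) (reg 13)))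
        (RExp.get 1 (ix3 (reg 12) (reg 13) (reg 3) (reg 11)))))))
  (Prog.seq (compute 10 21 off2 [(10, reg 3), (11, reg 3), (12, reg 1), (13, reg 0)]
    (pos1 (reg 10) (reg 11))
    (RExp.mul (RExp.get 0 (ix3 (reg 12) (reg 13) (reg 3) (reg 10)))
      (RExp.get 15 (pos3 (reg 12) (reg 13) (reg 11)))))
  (Prog.seq (compute 10 22 (mul (mul (reg 1) (reg 0)) (reg 7)) [(10, reg 1), (11, reg 0), (12, reg 3)]
    (ix3 (reg 10) (reg 11) (reg 7) (reg 12))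
    (RExp.get 0 (ix3 (reg 10) (reg 11) (reg 3) (reg 12))))
  (Prog.seq (nest [(10, reg 1), (11, reg 0), (12, reg 3)]
    (addTo 22 (ix3 (reg 10) (reg 11) (reg 7) (add (reg 3) (reg 12)))
      (RExp.get 15 (pos3 (reg 10) (reg 11) (reg 12)))))
  (Prog.seq (nest [(10, reg 1), (11, reg 0), (12, reg 3), (13, reg 3)]
    (addTo 22 (ix3 (reg 10) (reg 11) (reg 7) (add (reg 3) (reg 12)))
      (neg (RExp.mul (RExp.get 0 (ix3 (reg 10) (reg 11) (reg 3) (reg 13)))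
        (RExp.get 21 (pos1 (reg 13) (reg 12)))))))
  (Prog.seq (compute 10 23 (mul (mul (reg 2) (reg 0)) (reg 7)) [(10, reg 2), (11, reg 0), (12, reg 3)]
    (ix3 (reg 10) (reg 11) (reg 7) (add (reg 3) (reg 12)))
    (RExp.get 1 (ix3 (reg 10) (reg 11) (reg 3) (reg 12))))
  (Prog.seq (nest [(10, reg 2), (11, reg 0), (12, reg 3)]
    (addTo 23 (ix3 (reg 10) (reg 11) (reg 7) (reg 12))
      (RExp.get 15 (pos2 (reg 12) (reg 10) (reg 11)))))
  (nest [(10, reg 2), (11, reg 0), (12, reg 3), (13, reg 3)]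
    (addTo 23 (ix3 (reg 10) (reg 11) (reg 7) (reg 12))
      (RExp.mul (RExp.get 20 (pos1 (reg 12) (reg 13)))
        (RExp.get 1 (ix3 (reg 10) (reg 11) (reg 3) (reg 13)))))))))))))

/-- Diagonal entry of `K` for the sample in register 10. -/
abbrev kEntry : RExp :=
  RExp.add (RExp.div (RExp.reg 0) (RExp.mul (RExp.reg 1) (RExp.reg 1)))
    (RExp.get 10 (get 2 (reg 10)))

/-- The vector `K⁻¹ (E γ - κ y)`. -/
def samples : Prog :=
  Prog.seq (compute 10 24 (reg 4) [(10, reg 4), (11, reg 1), (12, reg 7)] (reg 10)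
    (RExp.mul (RExp.mul (RExp.ofInt (onDiag 2)) (RExp.div (RExp.get 10 (get 2 (reg 10))) kEntry))
      (RExp.mul (RExp.get 22 (ix3 (reg 11) (get 0 (reg 10)) (reg 7) (reg 12)))
        (RExp.get 23 (ix3 (sub (get 2 (reg 10)) (reg 11)) (get 1 (reg 10)) (reg 7) (reg 12))))))
  (nest [(10, reg 4)] (addTo 24 (reg 10)
    (neg (RExp.div (RExp.mul (RExp.reg 2) (RExp.get 3 (reg 10))) kEntry))))

/-- Multiplication of the real number at `p` with a diagonal entry of the linear system; `a`, `b`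
are the two singular values, with the smoothing parameter for the missing ones. -/
abbrev diagTerm (p : IExp) (a b : RExp) : RExp :=
  RExp.mul (RExp.get 15 p) (RExp.div (RExp.mul a b)
    (RExp.sub (RExp.mul a b) (RExp.mul (RExp.reg 1) (RExp.reg 1))))

/-- Assemble the image under the linear system. -/
def gather : Prog :=
  Prog.seq (compute 10 27 off2 [(10, reg 3), (11, reg 3), (12, reg 1), (13, reg 0)]
    (pos1 (reg 10) (reg 11))
    (RExp.mul (RExp.get 0 (ix3 (reg 12) (reg 13) (reg 3) (reg 10)))
      (RExp.get 26 (ix3 (reg 12) (reg 13) (reg 3) (reg 11)))))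
  (Prog.seq (compute 10 16 tot [(10, reg 3), (11, reg 3)] (pos1 (reg 10) (reg 11))
    (RExp.add (RExp.get 27 (pos1 (reg 10) (reg 11)))
      (diagTerm (pos1 (reg 10) (reg 11)) (RExp.get 2 (reg 10)) (RExp.get 2 (reg 11)))))
  (Prog.seq (nest [(10, reg 3), (11, reg 2), (12, reg 0)]
    (addTo 16 (pos2 (reg 10) (reg 11) (reg 12))
      (RExp.add (RExp.get 25 (ix3 (reg 11) (reg 12) (reg 3) (reg 10)))
        (diagTerm (pos2 (reg 10) (reg 11) (reg 12)) (RExp.get 2 (reg 10)) (RExp.reg 1)))))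
  (Prog.seq (nest [(10, reg 3), (11, reg 2), (12, reg 0), (13, reg 3)]
    (addTo 16 (pos2 (reg 10) (reg 11) (reg 12))
      (neg (RExp.mul (RExp.get 27 (pos1 (reg 10) (reg 13)))
        (RExp.get 1 (ix3 (reg 11) (reg 12) (reg 3) (reg 13)))))))
  (Prog.seq (nest [(10, reg 1), (11, reg 0), (12, reg 3)]
    (addTo 16 (pos3 (reg 10) (reg 11) (reg 12))
      (RExp.add (RExp.get 26 (ix3 (reg 10) (reg 11) (reg 3) (reg 12)))
        (diagTerm (pos3 (reg 10) (reg 11) (reg 12)) (RExp.reg 1) (RExp.get 2 (reg 12))))))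
  (nest [(10, reg 1), (11, reg 0), (12, reg 3), (13, reg 3)]
    (addTo 16 (pos3 (reg 10) (reg 11) (reg 12))
      (neg (RExp.mul (RExp.get 0 (ix3 (reg 10) (reg 11) (reg 3) (reg 13)))
        (RExp.get 27 (pos1 (reg 13) (reg 12)))))))))))

/-- Apply the linear system to the parameter in array 15. -/
def applySystem : Prog :=
  Prog.seq factors (Prog.seq samples
    (Prog.seq (half 0 22 23 25 1 2 0 1) (Prog.seq (half 1 23 22 26 2 1 1 0) gather)))

/-- Inner product of two parameters. -/
def dotPar (dst a b : ℕ) : Prog :=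
  Prog.seq (compute 10 dst (lit 1) [(10, reg 3), (11, reg 3)] (lit 0)
    (RExp.mul (RExp.get a (pos1 (reg 10) (reg 11))) (RExp.get b (pos1 (reg 10) (reg 11)))))
  (Prog.seq (nest [(10, reg 3), (11, reg 2), (12, reg 0)] (addTo dst (lit 0)
    (RExp.mul (RExp.get a (pos2 (reg 10) (reg 11) (reg 12)))
      (RExp.get b (pos2 (reg 10) (reg 11) (reg 12))))))
  (nest [(10, reg 1), (11, reg 0), (12, reg 3)] (addTo dst (lit 0)
    (RExp.mul (RExp.get a (pos3 (reg 10) (reg 11) (reg 12)))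
      (RExp.get b (pos3 (reg 10) (reg 11) (reg 12)))))))

/-- Entrywise assignment to a parameter. -/
def setPar (dst : ℕ) (x : RExp) : Prog :=
  compute 10 dst tot [(10, tot)] (reg 10) x

/-- Entrywise addition to a parameter. -/
def addPar (dst : ℕ) (x : RExp) : Prog :=
  nest [(10, tot)] (addTo dst (reg 10) x)

/-- One step of the conjugate gradient method. -/
def cgBody : Prog :=
  Prog.seq applySystem (Prog.seq (dotPar 18 15 16)
  (Prog.seq (addPar 13 (RExp.mul (RExp.div (RExp.get 17 (lit 0)) (RExp.get 18 (lit 0)))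
    (RExp.get 15 (reg 10))))
  (Prog.seq (addPar 14 (neg (RExp.mul (RExp.div (RExp.get 17 (lit 0)) (RExp.get 18 (lit 0)))
    (RExp.get 16 (reg 10)))))
  (Prog.seq (dotPar 19 14 14)
  (Prog.seq (setPar 39 (RExp.get 15 (reg 10)))
  (Prog.seq (setPar 15 (RExp.add (RExp.get 14 (reg 10))
    (RExp.mul (RExp.div (RExp.get 19 (lit 0)) (RExp.get 17 (lit 0))) (RExp.get 39 (reg 10)))))
  (compute 10 17 (lit 1) [(10, lit 1)] (reg 10) (RExp.get 19 (lit 0)))))))))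

/-- Load the initial guess into array 15. -/
def load : Prog :=
  Prog.seq (compute 10 15 tot [(10, reg 3), (11, reg 3)] (pos1 (reg 10) (reg 11))
    (RExp.get 4 (ix (reg 10) (reg 3) (reg 11))))
  (Prog.seq (nest [(10, reg 3), (11, reg 2), (12, reg 0)]
    (addTo 15 (pos2 (reg 10) (reg 11) (reg 12))
      (RExp.get 5 (ix (reg 10) (mul (reg 2) (reg 0)) (ix (reg 11) (reg 0) (reg 12))))))
  (nest [(10, reg 1), (11, reg 0), (12, reg 3)]
    (addTo 15 (pos3 (reg 10) (reg 11) (reg 12))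
      (RExp.get 6 (ix3 (reg 10) (reg 11) (reg 3) (reg 12))))))

/-- Store the result. -/
def save : Prog :=
  Prog.seq (compute 10 7 (reg 4) [(10, reg 4)] (reg 10) (neg (RExp.get 24 (reg 10))))
  (Prog.seq (compute 10 4 off2 [(10, reg 3), (11, reg 3)] (pos1 (reg 10) (reg 11))
    (RExp.get 13 (pos1 (reg 10) (reg 11))))
  (Prog.seq (compute 10 5 (mul (reg 3) (mul (reg 2) (reg 0))) [(10, reg 3), (11, reg 2), (12, reg 0)]
    (ix (reg 10) (mul (reg 2) (reg 0)) (ix (reg 11) (reg 0) (reg 12)))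
    (RExp.get 13 (pos2 (reg 10) (reg 11) (reg 12))))
  (compute 10 6 (mul (mul (reg 1) (reg 0)) (reg 3)) [(10, reg 1), (11, reg 0), (12, reg 3)]
    (ix3 (reg 10) (reg 11) (reg 3) (reg 12))
    (RExp.get 13 (pos3 (reg 10) (reg 11) (reg 12))))))

/-- One step of the search for a root of unity of sufficiently large order: double the order and
halve the angle. -/
def rootStep : Prog :=
  Prog.ifLt (reg 6) (reg 8)
    (Prog.seq (Prog.setI 6 (mul (lit 2) (reg 6)))
    (Prog.seq (Prog.setR 5 (RExp.sqrt (RExp.div (RExp.add (RExp.ofInt (lit 1)) (RExp.reg 3))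
      (RExp.ofInt (lit 2)))))
    (Prog.seq (Prog.setR 4 (RExp.sqrt (RExp.div (RExp.sub (RExp.ofInt (lit 1)) (RExp.reg 3))
      (RExp.ofInt (lit 2)))))
    (Prog.setR 3 (RExp.reg 5))))) Prog.skip

/-- One step of the tabulation of the powers of the root of unity. -/
def tableStep : Prog :=
  Prog.seq (Prog.putR 8 (reg 10) (RExp.reg 5)) (Prog.seq (Prog.putR 9 (reg 10) (RExp.reg 6))
  (Prog.seq (Prog.setR 7 (RExp.sub (RExp.mul (RExp.reg 5) (RExp.reg 3))
    (RExp.mul (RExp.reg 6) (RExp.reg 4))))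
  (Prog.seq (Prog.setR 6 (RExp.add (RExp.mul (RExp.reg 5) (RExp.reg 4))
    (RExp.mul (RExp.reg 6) (RExp.reg 3))))
  (Prog.setR 5 (RExp.reg 7)))))

/-- Auxiliary numbers and a root of unity. -/
def setupRoot : Prog :=
  Prog.seq (Prog.setI 8 (sub (add (reg 1) (reg 2)) (lit 1)))
  (Prog.seq (Prog.setI 7 (mul (lit 2) (reg 3)))
  (Prog.seq (Prog.setI 6 (lit 2))
  (Prog.seq (Prog.setR 3 (neg (RExp.ofInt (lit 1))))
  (Prog.seq (Prog.setR 4 (RExp.ofInt (lit 0)))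
  (Prog.loop 10 (reg 8) rootStep)))))

/-- Tables of the powers of the root of unity, of the weights and of their transform. -/
def setupTables : Prog :=
  Prog.seq (Prog.setR 5 (RExp.ofInt (lit 1)))
  (Prog.seq (Prog.setR 6 (RExp.ofInt (lit 0)))
  (Prog.seq (Prog.loop 10 (reg 6) tableStep)
  (Prog.seq (compute 10 38 (reg 8) [(10, reg 1), (11, reg 2)] (add (reg 10) (reg 11))
    (RExp.ofInt (lit 1)))
  (Prog.seq (compute 10 10 (reg 8) [(10, reg 8)] (reg 10)
    (RExp.div (RExp.ofInt (lit 1)) (RExp.get 38 (reg 10))))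
  (Prog.seq (compute 10 11 (reg 6) [(10, reg 6), (11, reg 8)] (reg 10)
    (RExp.mul (RExp.get 10 (reg 11)) (RExp.get 8 (mod (mul (reg 10) (reg 11)) (reg 6)))))
  (compute 10 12 (reg 6) [(10, reg 6), (11, reg 8)] (reg 10)
    (RExp.mul (RExp.get 10 (reg 11)) (RExp.get 9 (mod (mul (reg 10) (reg 11)) (reg 6))))))))))

/-- Initial residual and search direction. -/
def cgInit : Prog :=
  Prog.seq load (Prog.seq (setPar 13 (RExp.get 15 (reg 10)))
  (Prog.seq (Prog.setR 2 (RExp.ofInt (lit 1))) (Prog.seq applySystem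
  (Prog.seq (setPar 14 (neg (RExp.get 16 (reg 10))))
  (Prog.seq (setPar 15 (RExp.get 14 (reg 10)))
  (Prog.seq (Prog.setR 2 (RExp.ofInt (lit 0))) (dotPar 17 14 14)))))))

/-- The residual of the final parameter. -/
def cgFinish : Prog :=
  Prog.seq (setPar 15 (RExp.get 13 (reg 10)))
    (Prog.seq (Prog.setR 2 (RExp.ofInt (lit 1))) (Prog.seq applySystem save))

/-- Conjugate gradient steps for the linear system. -/
def mainProg : Prog :=
  Prog.seq setupRoot (Prog.seq setupTables (Prog.seq cgInit
    (Prog.seq (Prog.loop 20 (reg 5) cgBody) cgFinish)))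

/-! ### The rule for `compute` with decidable side conditions -/

/-- There is no array access in the expression. -/
def IExp.noGet : IExp → Bool
  | lit _ => true
  | reg _ => true
  | get _ _ => false
  | add e f => e.noGet && f.noGet
  | sub e f => e.noGet && f.noGet
  | mul e f => e.noGet && f.noGet
  | div e f => e.noGet && f.noGet
  | mod e f => e.noGet && f.noGet

theorem IExp.Ok.of_noGet {X SP : ℕ} {s : Store} {e : IExp} (h : e.noGet = true) :
    e.Ok X SP s := by
  induction e <;> simp_all [IExp.noGet, IExp.Ok]

/-- Syntactic side conditions of nested loops. -/
def NestSide (rs : List ℕ) (dst : ℕ) (l : List (ℕ × IExp)) (pos : IExp) (x : RExp) : Prop :=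
  Indep l ∧ (∀ t ∈ l, t.2.noGet = true ∧ ∀ i ∈ t.2.regs, i ∈ rs) ∧ dst ∉ x.arrs ∧
    ∀ i ∈ pos.regs ++ x.regs, i ∈ l.map Prod.fst ∨ i ∈ rs

instance (rs : List ℕ) (dst : ℕ) (l : List (ℕ × IExp)) (pos : IExp) (x : RExp) :
    Decidable (NestSide rs dst l pos x) := by
  unfold NestSide; infer_instance

/-- Syntactic side conditions of the length of an array. -/
def LenSide (rs : List ℕ) (i : ℕ) (len : IExp) (l : List (ℕ × IExp)) : Prop :=
  i ∈ l.map Prod.fst ∧ len.noGet = true ∧ ∀ i ∈ len.regs, i ∈ rs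

instance (rs : List ℕ) (i : ℕ) (len : IExp) (l : List (ℕ × IExp)) :
    Decidable (LenSide rs i len l) := by
  unfold LenSide; infer_instance

/-- The bounds for the resources fit together. -/
structure Bounds (X SP B : ℕ) : Prop where
  le_X : SP ≤ X
  le_B : SP ≤ B
  two_le : 2 ≤ X
  pos : 1 ≤ B

variable {X SP B : ℕ}

/-- The conditions on the program text are separated from those on numbers, so that the former can
be decided by evaluation. -/
theorem nest_rule (hXB : Bounds X SP B) {rs : List ℕ} {dst : ℕ} {l : List (ℕ × IExp)} {pos : IExp}
    {x : RExp} {s : Store} (hrs : ∀ i ∈ rs, s.ireg i ≤ X) (hside : NestSide rs dst l pos x)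
    (hb : ∀ t ∈ l, t.2.val s ≤ SP) (hB : boxVol l s ≤ B)
    (hok : boxAll l (fun s => pos.Ok X SP s ∧ pos.val s < SP ∧ x.Ok X SP s) s) :
    Good X SP B (nest l (addTo dst pos x)) s ∧
      Frame (l.map Prod.fst) [] [] [dst] s ((nest l (addTo dst pos x)).exec s).1 ∧
      ∀ y, ((nest l (addTo dst pos x)).exec s).1.rarr dst y =
        s.rarr dst y + boxSum l (fun s => if pos.val s = y then x.val s else 0) s :=
  nest_addTo hside.1 (fun t ht => ⟨IExp.Ok.of_noGet (hside.2.1 t ht).1,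
    fun i hi => hrs i ((hside.2.1 t ht).2 i hi), (hb t ht).trans hXB.le_X⟩) hside.2.2.1
    (fun i hi => (hside.2.2.2 i hi).imp_right (hrs i)) hok hB

theorem compute_rule (hXB : Bounds X SP B) {rs : List ℕ} {i dst : ℕ} {len : IExp}
    {l : List (ℕ × IExp)} {pos : IExp}
    {x : RExp} {s : Store} (hrs : ∀ i ∈ rs, s.ireg i ≤ X) (hside : NestSide rs dst l pos x)
    (hlen : LenSide rs i len l) (hlSP : len.val s ≤ SP)
    (hb : ∀ t ∈ l, t.2.val s ≤ SP) (hB : boxVol l s ≤ B)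
    (hok : boxAll l (fun s => pos.Ok X SP s ∧ pos.val s < SP ∧ x.Ok X SP s) s) :
    Good X SP B (compute i dst len l pos x) s ∧
      Frame (l.map Prod.fst) [] [] [dst] s ((compute i dst len l pos x).exec s).1 ∧
      ∀ y < len.val s, ((compute i dst len l pos x).exec s).1.rarr dst y =
        boxSum l (fun s => if pos.val s = y then x.val s else 0) s :=
  compute_spec hlen.1 (IExp.Ok.of_noGet hlen.2.1) (fun i hi => hrs i (hlen.2.2 i hi))
    (hlSP.trans hXB.le_X) hlSP (hlSP.trans hXB.le_B) hside.1
    (fun t ht => ⟨IExp.Ok.of_noGet (hside.2.1 t ht).1,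
    fun i hi => hrs i ((hside.2.1 t ht).2 i hi), (hb t ht).trans hXB.le_X⟩) hside.2.2.1
    (fun i hi => (hside.2.2.2 i hi).imp_right (hrs i)) hok hB

end RAM

/-! ### Index arithmetic -/

theorem idx_lt {a A k B : ℕ} (ha : a < A) (hk : k < B) : a * B + k < A * B := by
  calc a * B + k < a * B + B := by omega
    _ = (a + 1) * B := by ring
    _ ≤ A * B := Nat.mul_le_mul_right _ ha

theorem idx_inj {a a' k k' B : ℕ} (hk : k < B) (hk' : k' < B) :
    a * B + k = a' * B + k' ↔ a = a' ∧ k = k' := by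
  constructor
  · intro h
    have h1 : k = k' := by
      have := congrArg (· % B) h
      simpa [Nat.mul_add_mod_of_lt, Nat.add_mod, Nat.mod_eq_of_lt hk, Nat.mod_eq_of_lt hk']
        using this
    refine ⟨?_, h1⟩
    subst h1
    exact Nat.eq_of_mul_eq_mul_right (by omega) (Nat.add_right_cancel h)
  · rintro ⟨rfl, rfl⟩; rfl

theorem sum_ite_const {ι : Type*} (S : Finset ι) (p : Prop) [Decidable p] (f : ι → ℝ) :
    ∑ x ∈ S, (if p then f x else 0) = if p then ∑ x ∈ S, f x else 0 := by
  split_ifs <;> simp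

/-- Row-major addresses are distinct, so exactly one round of the index box hits a given cell. -/
theorem sum_idx2 {A B a k : ℕ} (ha : a < A) (hk : k < B) (f : ℕ → ℕ → ℝ) :
    ∑ a' ∈ Finset.range A, ∑ k' ∈ Finset.range B,
      (if a' * B + k' = a * B + k then f a' k' else 0) = f a k := by
  rw [Finset.sum_eq_single a, Finset.sum_eq_single k]
  · simp
  · intro k' hk' hne
    rw [if_neg fun h => hne ((idx_inj (Finset.mem_range.mp hk') hk).mp h).2]
  · intro h; exact absurd (Finset.mem_range.mpr hk) h
  · intro a' _ hne
    refine Finset.sum_eq_zero fun k' hk' => ?_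
    rw [if_neg fun h => hne ((idx_inj (Finset.mem_range.mp hk') hk).mp h).1]
  · intro h; exact absurd (Finset.mem_range.mpr ha) h

theorem sum_idx3 {A C B a c k : ℕ} (ha : a < A) (hc : c < C) (hk : k < B)
    (f : ℕ → ℕ → ℕ → ℝ) :
    ∑ a' ∈ Finset.range A, ∑ c' ∈ Finset.range C, ∑ k' ∈ Finset.range B,
      (if (a' * C + c') * B + k' = (a * C + c) * B + k then f a' c' k' else 0) = f a c k := by
  rw [← sum_idx2 ha hc fun a c => f a c k]
  refine Finset.sum_congr rfl fun a' _ => Finset.sum_congr rfl fun c' _ => ?_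
  rw [Finset.sum_eq_single k]
  · congr 1
    exact propext ((idx_inj hk hk).trans (by simp))
  · intro k' hk' hne
    rw [if_neg fun h => hne ((idx_inj (Finset.mem_range.mp hk') hk).mp h).2]
  · intro h; exact absurd (Finset.mem_range.mpr hk) h

/-! ### Dimensions -/

/-- The dimensions of a problem with `T = d₁ + d₂ - 1`, the order `L` of the root of unity, and the
bounds for the resources. -/
structure Dims (n d₁ d₂ r m T L X SP B : ℕ) : Prop where
  bounds : RAM.Bounds X SP B
  hn : 1 ≤ n
  hd₁ : 1 ≤ d₁
  hd₂ : 1 ≤ d₂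
  hr : 1 ≤ r
  hrn : r ≤ n
  hT : d₁ + d₂ = T + 1
  hTL : T ≤ L
  hLT : L ≤ 2 * T
  hSP : 8 * (r * n * T) + m = SP
  hB : 16 * (r * T * (m + n * r * T)) ≤ B

namespace Dims

variable {n d₁ d₂ r m T L X SP B : ℕ}

theorem swap (D : Dims n d₁ d₂ r m T L X SP B) : Dims n d₂ d₁ r m T L X SP B :=
  ⟨D.bounds, D.hn, D.hd₂, D.hd₁, D.hr, D.hrn, (add_comm _ _).trans D.hT, D.hTL, D.hLT, D.hSP, D.hB⟩

theorem one_le_T (D : Dims n d₁ d₂ r m T L X SP B) : 1 ≤ T := by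
  have := D.hT; have := D.hd₁; have := D.hd₂; omega

theorem one_le_L (D : Dims n d₁ d₂ r m T L X SP B) : 1 ≤ L := D.one_le_T.trans D.hTL

theorem d₁_le (D : Dims n d₁ d₂ r m T L X SP B) : d₁ ≤ T := by
  have := D.hT; have := D.hd₂; omega

theorem d₂_le (D : Dims n d₁ d₂ r m T L X SP B) : d₂ ≤ T := by
  have := D.hT; have := D.hd₁; omega

/-- Sizes of arrays. -/
theorem le_SP (D : Dims n d₁ d₂ r m T L X SP B) {x : ℕ} (h : x ≤ 8 * (r * n * T)) : x ≤ SP :=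
  h.trans (by have := D.hSP; omega)

theorem m_le_SP (D : Dims n d₁ d₂ r m T L X SP B) : m ≤ SP := by have := D.hSP; omega

theorem rnT_pos (D : Dims n d₁ d₂ r m T L X SP B) : 1 ≤ r * n * T :=
  Nat.mul_pos (Nat.mul_pos D.hr D.hn) D.one_le_T

theorem n_le (D : Dims n d₁ d₂ r m T L X SP B) : n ≤ SP := D.le_SP (by
  have h1 : 1 * n * 1 ≤ r * n * T := Nat.mul_le_mul (Nat.mul_le_mul D.hr le_rfl) D.one_le_T
  omega)

theorem T_le (D : Dims n d₁ d₂ r m T L X SP B) : 2 * T ≤ SP := D.le_SP (by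
  have h1 : 1 * 1 * T ≤ r * n * T := Nat.mul_le_mul (Nat.mul_le_mul D.hr D.hn) le_rfl
  omega)

theorem two_r_le (D : Dims n d₁ d₂ r m T L X SP B) : 2 * r ≤ SP := D.le_SP (by
  have h1 : r * 1 * 1 ≤ r * n * T := Nat.mul_le_mul (Nat.mul_le_mul le_rfl D.hn) D.one_le_T
  omega)

theorem L_le (D : Dims n d₁ d₂ r m T L X SP B) : L ≤ SP := D.hLT.trans D.T_le

end Dims

/-! ### Correctness and resources of the Fourier part of the program -/

namespace RAM

/-! ### Register contents -/

/-- The register contents that describe the dimensions. -/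
structure Regs (n d₁ d₂ r m N T L : ℕ) (s : Store) : Prop where
  n_eq : s.ireg 0 = n
  d₁_eq : s.ireg 1 = d₁
  d₂_eq : s.ireg 2 = d₂
  r_eq : s.ireg 3 = r
  m_eq : s.ireg 4 = m
  N_eq : s.ireg 5 = N
  L_eq : s.ireg 6 = L
  w_eq : s.ireg 7 = 2 * r
  T_eq : s.ireg 8 = T

variable {n d₁ d₂ r m N T L X SP B : ℕ}

theorem Regs.frame {I R IA A : List ℕ} {s s' : Store} (h : Regs n d₁ d₂ r m N T L s)
    (hf : Frame I R IA A s s') (hI : ∀ i < 9, i ∉ I) : Regs n d₁ d₂ r m N T L s' := by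
  constructor <;> rw [hf.ireg _ (hI _ (by norm_num))]
  exacts [h.n_eq, h.d₁_eq, h.d₂_eq, h.r_eq, h.m_eq, h.N_eq, h.L_eq, h.w_eq, h.T_eq]

theorem Regs.le (h : Regs n d₁ d₂ r m N T L s) (D : Dims n d₁ d₂ r m T L X SP B) (hN : N ≤ X) :
    ∀ i ∈ List.range 9, s.ireg i ≤ X := by
  intro i hi
  have hX := D.bounds.le_X
  have h1 := D.n_le; have h2 := D.T_le; have h3 := D.two_r_le; have h4 := D.L_le
  have h5 := D.d₁_le; have h6 := D.d₂_le; have h7 := D.m_le_SP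
  rw [List.mem_range] at hi
  interval_cases i
  · rw [h.n_eq]; omega
  · rw [h.d₁_eq]; omega
  · rw [h.d₂_eq]; omega
  · rw [h.r_eq]; omega
  · rw [h.m_eq]; omega
  · rw [h.N_eq]; exact hN
  · rw [h.L_eq]; omega
  · rw [h.w_eq]; omega
  · rw [h.T_eq]; omega

/-- The transform is evaluated by its definition, with the powers of the root read from a table at
ωa mod L. The box has at most 4rnT² points, which the budget rT(m + nrT) covers, so a fast transform
is unnecessary. -/
theorem dft_spec (D : Dims n d₁ d₂ r m T L X SP B) {s : Store} {src d wd dst tab dv w : ℕ}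
    (hs : Regs n d₁ d₂ r m N T L s) (hN : N ≤ X)
    (hside : NestSide (List.range 9) dst [(10, IExp.reg 0), (11, IExp.reg wd), (12, IExp.reg 6), (13, IExp.reg d)]
      (ix (ix (IExp.reg 10) (IExp.reg wd) (IExp.reg 11)) (IExp.reg 6) (IExp.reg 12))
    (RExp.mul (RExp.get src (ix3 (IExp.reg 13) (IExp.reg 10) (IExp.reg wd) (IExp.reg 11)))
      (RExp.get tab (IExp.mod (IExp.mul (IExp.reg 12) (IExp.reg 13)) (IExp.reg 6)))))
    (hd : s.ireg d = dv) (hd9 : d < 9) (hw : s.ireg wd = w) (hw9 : wd < 9) (hdT : dv ≤ T) (hd1 : 1 ≤ dv)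
    (hw1 : 1 ≤ w) (hwr : w ≤ 2 * r) :
    Good X SP B (dft src d wd dst tab) s ∧
      Frame [10, 11, 12, 13] [] [] [dst] s ((dft src d wd dst tab).exec s).1 ∧
      ∀ i < n, ∀ k < w, ∀ ω < L,
        ((dft src d wd dst tab).exec s).1.rarr dst ((i * w + k) * L + ω) =
          ∑ a ∈ Finset.range dv, s.rarr src ((a * n + i) * w + k) * s.rarr tab ((ω * a) % L) := by
  have e1 : d ≠ 10 ∧ d ≠ 11 ∧ d ≠ 12 ∧ d ≠ 13 := by omega
  have e2 : wd ≠ 10 ∧ wd ≠ 11 ∧ wd ≠ 12 ∧ wd ≠ 13 := by omega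
  have hlen : n * w * L ≤ SP := D.le_SP (by
    calc n * w * L ≤ n * (2 * r) * (2 * T) := by gcongr; exact D.hLT
      _ = 4 * (r * n * T) := by ring
      _ ≤ 8 * (r * n * T) := by omega)
  have hsrc : dv * n * w ≤ SP := D.le_SP (by
    calc dv * n * w ≤ T * n * (2 * r) := by gcongr
      _ = 2 * (r * n * T) := by ring
      _ ≤ 8 * (r * n * T) := by omega)
  have hvol : n * (w * (L * dv)) ≤ B := by
    refine le_trans ?_ D.hB
    calc n * (w * (L * dv)) ≤ n * (2 * r * (2 * T * T)) := by gcongr; exact D.hLT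
      _ = 4 * (r * T * (1 * n * 1 * T)) := by ring
      _ ≤ 16 * (r * T * (m + n * r * T)) := by
        gcongr
        · omega
        · have : 1 * n * 1 * T ≤ n * r * T := by
            rw [one_mul]; gcongr; exact D.hr
          omega
  have key := compute_rule (i := 10)
    (len := IExp.mul (IExp.mul (IExp.reg 0) (IExp.reg wd)) (IExp.reg 6))
    D.bounds (hs.le D hN) hside ?_ ?_ ?_ ?_ ?_
  · obtain ⟨h1, h2, h3⟩ := key
    refine ⟨h1, h2, fun i hi k hk ω hω => ?_⟩
    rw [dft, h3]
    · simp only [boxSum, IExp.val, RExp.val, Store.withI_ireg, Store.withI_rarr, Nat.reduceEqDiff,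
        reduceIte, e1, e2, hs.n_eq, hs.L_eq, hd, hw, sum_ite_const]
      rw [sum_idx3 hi hk hω]
    · simp only [IExp.val, hs.n_eq, hs.L_eq, hw]
      exact idx_lt (idx_lt hi hk) hω
  · simp [LenSide, IExp.noGet, IExp.regs, hw9]
  · simpa only [IExp.val, hs.n_eq, hs.L_eq, hw] using hlen
  · have := D.n_le; have := D.L_le; have := D.T_le; have := D.two_r_le
    simp only [List.forall_mem_cons, IExp.val, hs.n_eq, hs.L_eq, hw, hd, List.not_mem_nil,
      IsEmpty.forall_iff, implies_true, and_true]
    omega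
  · simpa only [boxVol, List.map, List.prod_cons, List.prod_nil, IExp.val, hs.n_eq, hs.L_eq, hw, hd,
      max_eq_right D.hn, max_eq_right hw1, max_eq_right D.one_le_L, max_eq_right hd1, mul_one]
      using hvol
  · simp only [boxAll, IExp.val, RExp.Ok, IExp.Ok, Store.withI_ireg, Nat.reduceEqDiff,
        reduceIte, e1, e2, hs.n_eq, hs.L_eq, hd, hw, true_and, and_true]
    intro i hi k hk ω hω a ha
    exact ⟨(idx_lt (idx_lt hi hk) hω).trans_le hlen, (idx_lt (idx_lt ha hi) hk).trans_le hsrc,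
      (Nat.mod_lt _ D.one_le_L).trans_le D.L_le⟩

end RAM

namespace RAM

variable {n d₁ d₂ r m N T L X SP B : ℕ}

/-! ### Specifications of program parts -/

/-- A program with admissible resources that leads from `s` to `s'` and only changes the given
registers and arrays. -/
structure Runs (X SP B : ℕ) (c : Prog) (I R A : List ℕ) (s s' : Store) : Prop where
  good : Good X SP B c s
  eq : (c.exec s).1 = s'
  frame : Frame I R [] A s s'

theorem Runs.of {c : Prog} {I R A : List ℕ} {s : Store} (h : Good X SP B c s)
    (hf : Frame I R [] A s (c.exec s).1) : Runs X SP B c I R A s (c.exec s).1 :=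
  ⟨h, rfl, hf⟩

theorem Runs.mono {c : Prog} {I R A I' R' A' : List ℕ} {s s' : Store}
    (h : Runs X SP B c I R A s s') (hI : I ⊆ I') (hR : R ⊆ R') (hA : A ⊆ A') :
    Runs X SP B c I' R' A' s s' :=
  ⟨h.good, h.eq, h.frame.mono hI hR (List.Subset.refl _) hA⟩

theorem Runs.seq {c d : Prog} {I R A : List ℕ} {s s' s'' : Store}
    (h : Runs X SP B c I R A s s') (h' : Runs X SP B d I R A s' s'') :
    Runs X SP B (Prog.seq c d) I R A s s'' := by
  obtain ⟨h1, rfl, h3⟩ := h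
  exact ⟨h1.seq h'.good, (exec_seq c d s).trans h'.eq, h3.trans h'.frame⟩

/-- Reassociation: two transforms are verified as a pair, whereas the program text is nested to the
right. -/
theorem Runs.seq_seq {c d e : Prog} {I R A : List ℕ} {s s' s'' : Store}
    (h : Runs X SP B (Prog.seq c d) I R A s s') (h' : Runs X SP B e I R A s' s'') :
    Runs X SP B (Prog.seq c (Prog.seq d e)) I R A s s'' := by
  obtain ⟨h1, h2, h3⟩ := h.seq h'
  refine ⟨⟨⟨h1.ok.1.1, h1.ok.1.2, h1.ok.2⟩, ?_⟩, h2, h3⟩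
  have := h1.time
  simp only [Prog.exec, Usage.comb, Prog.cost, add_assoc] at this ⊢
  exact this

/-- For one output frequency the box has at most 4r²nT points. The table has 2r²L entries, which is
O(rnT) because r ≤ n; storing it for all output frequencies would exceed the space. -/
theorem gram_rule (D : Dims n d₁ d₂ r m T L X SP B) {B' : ℕ} (hB' : 8 * (r * n * T * r) + m ≤ B')
    {s : Store} {dst : ℕ} {x : RExp} (hs : Regs n d₁ d₂ r m N T L s)
    (hrs : ∀ i ∈ List.range 10, s.ireg i ≤ X)
    (hside : NestSide (List.range 10) dst
      [(10, IExp.reg 3), (11, IExp.reg 7), (12, IExp.reg 6), (13, IExp.reg 0)]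
      (ix (ix (IExp.reg 10) (IExp.reg 7) (IExp.reg 11)) (IExp.reg 6) (IExp.reg 12)) x)
    (hok : ∀ k < r, ∀ q < 2 * r, ∀ ω < L, ∀ i < n,
      x.Ok X SP ((((s.withI 10 k).withI 11 q).withI 12 ω).withI 13 i)) :
    Good X SP B' (gram dst x) s ∧ Frame [10, 11, 12, 13] [] [] [dst] s ((gram dst x).exec s).1 ∧
      ∀ k < r, ∀ q < 2 * r, ∀ ω < L,
        ((gram dst x).exec s).1.rarr dst ((k * (2 * r) + q) * L + ω) =
          ∑ i ∈ Finset.range n, x.val ((((s.withI 10 k).withI 11 q).withI 12 ω).withI 13 i) := by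
  have hb : Bounds X SP B' := ⟨D.bounds.le_X, by
    have := D.hSP
    have : r * n * T * 1 ≤ r * n * T * r := Nat.mul_le_mul_left _ D.hr
    omega, D.bounds.two_le, by
    have := Nat.mul_pos D.rnT_pos D.hr
    omega⟩
  have hlen : r * (2 * r) * L ≤ SP := D.le_SP (by
    calc r * (2 * r) * L ≤ r * (2 * n) * (2 * T) := by gcongr; exacts [D.hrn, D.hLT]
      _ = 4 * (r * n * T) := by ring
      _ ≤ 8 * (r * n * T) := by omega)
  have hvol : r * (2 * r * (L * n)) ≤ B' := by
    calc r * (2 * r * (L * n)) ≤ r * (2 * r * (2 * T * n)) := by gcongr; exact D.hLT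
      _ = 4 * (r * n * T * r) := by ring
      _ ≤ B' := by omega
  have h2r : 1 ≤ 2 * r := by have := D.hr; omega
  have key := compute_rule (i := 10)
    (len := IExp.mul (IExp.mul (IExp.reg 3) (IExp.reg 7)) (IExp.reg 6)) hb hrs hside ?_ ?_ ?_ ?_ ?_
  · obtain ⟨h1, h2, h3⟩ := key
    refine ⟨h1, h2, fun k hk q hq ω hω => ?_⟩
    rw [gram, h3]
    · simp only [boxSum, IExp.val, Store.withI_ireg, Nat.reduceEqDiff,
        reduceIte, hs.n_eq, hs.L_eq, hs.r_eq, hs.w_eq, sum_ite_const]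
      rw [sum_idx3 hk hq hω fun k q ω => ∑ i ∈ Finset.range n,
        x.val ((((s.withI 10 k).withI 11 q).withI 12 ω).withI 13 i)]
    · simp only [IExp.val, hs.r_eq, hs.L_eq, hs.w_eq]
      exact idx_lt (idx_lt hk hq) hω
  · simp [LenSide, IExp.noGet, IExp.regs]
  · simpa only [IExp.val, hs.r_eq, hs.L_eq, hs.w_eq] using hlen
  · have := D.n_le; have := D.L_le; have := D.T_le; have := D.two_r_le
    simp only [List.forall_mem_cons, IExp.val, hs.n_eq, hs.L_eq, hs.r_eq, hs.w_eq, List.not_mem_nil,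
      IsEmpty.forall_iff, implies_true, and_true]
    omega
  · simpa only [boxVol, List.map, List.prod_cons, List.prod_nil, IExp.val, hs.n_eq, hs.L_eq,
      hs.r_eq, hs.w_eq, max_eq_right D.hn, max_eq_right D.hr, max_eq_right D.one_le_L,
      max_eq_right h2r, mul_one] using hvol
  · simp only [boxAll, IExp.val, IExp.Ok, Store.withI_ireg, Nat.reduceEqDiff,
        reduceIte, hs.n_eq, hs.L_eq, hs.r_eq, hs.w_eq, true_and, and_true]
    intro k hk q hq ω hω i hi
    exact ⟨(idx_lt (idx_lt hk hq) hω).trans_le hlen, hok k hk q hq ω hω i hi⟩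

theorem mix_rule (D : Dims n d₁ d₂ r m T L X SP B) {B' : ℕ} (hB' : 8 * (r * n * T * r) + m ≤ B')
    {s : Store} {dst : ℕ} {x : RExp} (hs : Regs n d₁ d₂ r m N T L s)
    (hrs : ∀ i ∈ List.range 10, s.ireg i ≤ X)
    (hside : NestSide (List.range 10) dst
      [(10, IExp.reg 3), (11, IExp.reg 0), (12, IExp.reg 7), (13, IExp.reg 6)]
      (ix (IExp.reg 10) (IExp.reg 0) (IExp.reg 11)) x)
    (hok : ∀ k < r, ∀ j < n, ∀ q < 2 * r, ∀ ω < L,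
      x.Ok X SP ((((s.withI 10 k).withI 11 j).withI 12 q).withI 13 ω)) :
    Good X SP B' (mix dst x) s ∧ Frame [10, 11, 12, 13] [] [] [dst] s ((mix dst x).exec s).1 ∧
      ∀ k < r, ∀ j < n, ((mix dst x).exec s).1.rarr dst (k * n + j) =
          ∑ q ∈ Finset.range (2 * r), ∑ ω ∈ Finset.range L,
            x.val ((((s.withI 10 k).withI 11 j).withI 12 q).withI 13 ω) := by
  have hb : Bounds X SP B' := ⟨D.bounds.le_X, by
    have := D.hSP
    have : r * n * T * 1 ≤ r * n * T * r := Nat.mul_le_mul_left _ D.hr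
    omega, D.bounds.two_le, by
    have := Nat.mul_pos D.rnT_pos D.hr
    omega⟩
  have hlen : r * n ≤ SP := D.le_SP (by
    calc r * n = r * n * 1 := by ring
      _ ≤ r * n * T := Nat.mul_le_mul_left _ D.one_le_T
      _ ≤ 8 * (r * n * T) := by omega)
  have hvol : r * (n * (2 * r * L)) ≤ B' := by
    calc r * (n * (2 * r * L)) ≤ r * (n * (2 * r * (2 * T))) := by gcongr; exact D.hLT
      _ = 4 * (r * n * T * r) := by ring
      _ ≤ B' := by omega
  have h2r : 1 ≤ 2 * r := by have := D.hr; omega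
  have key := compute_rule (i := 10)
    (len := IExp.mul (IExp.reg 3) (IExp.reg 0)) hb hrs hside ?_ ?_ ?_ ?_ ?_
  · obtain ⟨h1, h2, h3⟩ := key
    refine ⟨h1, h2, fun k hk j hj => ?_⟩
    rw [mix, h3]
    · simp only [boxSum, IExp.val, Store.withI_ireg, Nat.reduceEqDiff,
        reduceIte, hs.n_eq, hs.L_eq, hs.r_eq, hs.w_eq, sum_ite_const]
      rw [sum_idx2 hk hj fun k j => ∑ q ∈ Finset.range (2 * r), ∑ ω ∈ Finset.range L,
            x.val ((((s.withI 10 k).withI 11 j).withI 12 q).withI 13 ω)]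
    · simp only [IExp.val, hs.r_eq, hs.n_eq]
      exact idx_lt hk hj
  · simp [LenSide, IExp.noGet, IExp.regs]
  · simpa only [IExp.val, hs.r_eq, hs.n_eq] using hlen
  · have := D.n_le; have := D.L_le; have := D.T_le; have := D.two_r_le
    simp only [List.forall_mem_cons, IExp.val, hs.n_eq, hs.L_eq, hs.r_eq, hs.w_eq, List.not_mem_nil,
      IsEmpty.forall_iff, implies_true, and_true]
    omega
  · simpa only [boxVol, List.map, List.prod_cons, List.prod_nil, IExp.val, hs.n_eq, hs.L_eq,
      hs.r_eq, hs.w_eq, max_eq_right D.hn, max_eq_right D.hr, max_eq_right D.one_le_L,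
      max_eq_right h2r, mul_one] using hvol
  · simp only [boxAll, IExp.val, IExp.Ok, Store.withI_ireg, Nat.reduceEqDiff,
        reduceIte, hs.n_eq, hs.L_eq, hs.r_eq, hs.w_eq, true_and, and_true]
    intro k hk j hj q hq ω hω
    exact ⟨(idx_lt hk hj).trans_le hlen, hok k hk j hj q hq ω hω⟩

/-- Two real arrays hold the real and imaginary parts of complex numbers at a position. -/
def CAt (s : Store) (a b k : ℕ) (z : ℂ) : Prop := s.rarr a k = z.re ∧ s.rarr b k = z.im

theorem CAt.frame {I R IA A : List ℕ} {s s' : Store} {a b k : ℕ} {z : ℂ} (h : CAt s a b k z)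
    (hf : Frame I R IA A s s') (ha : a ∉ A) (hb : b ∉ A) : CAt s' a b k z :=
  ⟨by rw [hf.rarr a ha]; exact h.1, by rw [hf.rarr b hb]; exact h.2⟩

/-- The possible arguments of the program `core`. -/
def CoreArgs (P F G out dP dG : ℕ) : Prop :=
  (P = 0 ∧ F = 22 ∧ G = 23 ∧ out = 25 ∧ dP = 1 ∧ dG = 2) ∨
    (P = 1 ∧ F = 23 ∧ G = 22 ∧ out = 26 ∧ dP = 2 ∧ dG = 1)

/-- Inner product of the transforms. -/
noncomputable def gramSum (n : ℕ) (Ph Fh : ℕ → ℕ → ℕ → ℂ) (k q ω' ω : ℕ) : ℂ :=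
  ∑ i ∈ Finset.range n, (starRingEnd ℂ) (Ph i k ω') * Fh i q ω

/-- The spectrum of the result. -/
noncomputable def mixSum (n r L : ℕ) (wh : ℕ → ℂ) (Ph Fh Gh : ℕ → ℕ → ℕ → ℂ) (k j ω' : ℕ) : ℂ :=
  ∑ q ∈ Finset.range (2 * r), ∑ ω ∈ Finset.range L,
    wh ((ω' + L - ω) % L) * gramSum n Ph Fh k q ω' ω * Gh j q ω

-- The machine has no complex numbers, so each complex quantity is followed as a pair of arrays:
-- first the Gram matrices of conj(P̂) and F̂, next the spectrum of the result at ω', and finally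
-- the real part of its inverse transform. The division by L² accounts for two orthogonality
-- relations, one per summed frequency.
set_option maxHeartbeats 1000000 in
theorem coreStep_spec (D : Dims n d₁ d₂ r m T L X SP B) {B' : ℕ}
    (hB' : 8 * (r * n * T * r) + m ≤ B') {s : Store} {P F G out dP dG vG : ℕ}
    (hargs : CoreArgs P F G out dP dG)
    (hs : Regs n d₁ d₂ r m N T L s) (hrs : ∀ i ∈ List.range 10, s.ireg i ≤ X)
    (hdG : s.ireg dG = vG) (hvG : 1 ≤ vG) (hvT : vG ≤ T)
    {ω' : ℕ} (hω' : ω' < L) (h9 : s.ireg 9 = ω')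
    {χ wh : ℕ → ℂ} {Ph Fh Gh : ℕ → ℕ → ℕ → ℂ}
    (hχ : ∀ k < L, CAt s 8 9 k (χ k)) (hwh : ∀ k < L, CAt s 11 12 k (wh k))
    (hP : ∀ i < n, ∀ k < r, ∀ ω < L, CAt s 28 29 ((i * r + k) * L + ω) (Ph i k ω))
    (hF : ∀ i < n, ∀ k < 2 * r, ∀ ω < L, CAt s 30 31 ((i * (2 * r) + k) * L + ω) (Fh i k ω))
    (hG : ∀ i < n, ∀ k < 2 * r, ∀ ω < L, CAt s 32 33 ((i * (2 * r) + k) * L + ω) (Gh i k ω)) :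
    Good X SP B' (coreStep out dG) s ∧
      Frame [10, 11, 12, 13] [] [] [34, 35, 36, 37, out] s ((coreStep out dG).exec s).1 ∧
      ∀ b < vG, ∀ j < n, ∀ k < r,
        ((coreStep out dG).exec s).1.rarr out ((b * n + j) * r + k) =
          s.rarr out ((b * n + j) * r + k) -
            ((starRingEnd ℂ) (χ ((ω' * b) % L)) * mixSum n r L wh Ph Fh Gh k j ω').re /
              ((L * L : ℕ) : ℝ) := by
  have hbnd : ∀ {a c : ℕ}, a < 2 * r → c < L → ∀ {i}, i < n → (i * (2 * r) + a) * L + c < SP := by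
    intro a c ha hc i hi
    refine (idx_lt (idx_lt hi ha) hc).trans_le (D.le_SP ?_)
    calc n * (2 * r) * L ≤ n * (2 * r) * (2 * T) := by gcongr; exact D.hLT
      _ = 4 * (r * n * T) := by ring
      _ ≤ 8 * (r * n * T) := by omega
  have hbndP : ∀ {a c : ℕ}, a < r → c < L → ∀ {i}, i < n → (i * r + a) * L + c < SP := by
    intro a c ha hc i hi
    refine (idx_lt (idx_lt hi ha) hc).trans_le (D.le_SP ?_)
    calc n * r * L ≤ n * r * (2 * T) := by gcongr; exact D.hLT
      _ = 2 * (r * n * T) := by ring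
      _ ≤ 8 * (r * n * T) := by omega
  have hbndG : ∀ {k a c : ℕ}, k < r → a < 2 * r → c < L → (k * (2 * r) + a) * L + c < SP := by
    intro k a c hk ha hc
    refine (idx_lt (idx_lt hk ha) hc).trans_le (D.le_SP ?_)
    calc r * (2 * r) * L ≤ n * (2 * r) * (2 * T) := by gcongr; exacts [D.hrn, D.hLT]
      _ = 4 * (r * n * T) := by ring
      _ ≤ 8 * (r * n * T) := by omega
  have hmod : ∀ k, k % L < SP := fun k => (Nat.mod_lt _ D.one_le_L).trans_le D.L_le
  obtain ⟨g1, f1, v1⟩ := gram_rule D hB' (dst := 34) (x := RExp.add (RExp.mul (pEntry 28) (fEntry 30))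
    (RExp.mul (pEntry 29) (fEntry 31))) hs hrs (by decide) (by
      intro k hk q hq ω hω i hi
      simp only [RExp.Ok, IExp.Ok, IExp.val, Store.withI_ireg, Nat.reduceEqDiff, reduceIte, hs.r_eq,
        hs.L_eq, hs.w_eq, h9, true_and]
      exact ⟨⟨hbndP hk hω' hi, hbnd hq hω hi⟩, hbndP hk hω' hi, hbnd hq hω hi⟩)
  have R1 := Runs.of g1 f1
  generalize (Prog.exec _ s).1 = s1 at f1 v1 R1
  have hr1 : Regs n d₁ d₂ r m N T L s1 := hs.frame f1 (by intro i hi; simp; omega)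
  have h91 : s1.ireg 9 = ω' := (f1.ireg 9 (by simp)).trans h9
  have hrs1 : ∀ i ∈ List.range 10, s1.ireg i ≤ X := fun i hi => by
    rw [f1.ireg i (by rw [List.mem_range] at hi; simp; omega)]; exact hrs i hi
  obtain ⟨g2, f2, v2⟩ := gram_rule D hB' (dst := 35) (x := RExp.sub (RExp.mul (pEntry 28) (fEntry 31))
    (RExp.mul (pEntry 29) (fEntry 30))) hr1 hrs1 (by decide) (by
      intro k hk q hq ω hω i hi
      simp only [RExp.Ok, IExp.Ok, IExp.val, Store.withI_ireg, Nat.reduceEqDiff, reduceIte,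
        hr1.r_eq, hr1.L_eq, hr1.w_eq, h91, true_and]
      exact ⟨⟨hbndP hk hω' hi, hbnd hq hω hi⟩, hbndP hk hω' hi, hbnd hq hω hi⟩)
  have R2 := Runs.of g2 f2
  generalize (Prog.exec _ s1).1 = s2 at f2 v2 R2
  have f12 : Frame [10, 11, 12, 13] [] [] [34, 35] s s2 :=
    (f1.mono (by simp) (by simp) (by simp) (by simp)).trans
      (f2.mono (by simp) (by simp) (by simp) (by simp))
  have hr2 : Regs n d₁ d₂ r m N T L s2 := hs.frame f12 (by intro i hi; simp; omega)
  have h92 : s2.ireg 9 = ω' := (f12.ireg 9 (by simp)).trans h9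
  have hrs2 : ∀ i ∈ List.range 10, s2.ireg i ≤ X := fun i hi => by
    rw [f12.ireg i (by rw [List.mem_range] at hi; simp; omega)]; exact hrs i hi
  have hgram : ∀ k < r, ∀ q < 2 * r, ∀ ω < L,
      CAt s2 34 35 ((k * (2 * r) + q) * L + ω) (gramSum n Ph Fh k q ω' ω) := by
    intro k hk q hq ω hω
    constructor
    · rw [f2.rarr 34 (by simp), v1 k hk q hq ω hω, gramSum, Complex.re_sum]
      refine Finset.sum_congr rfl fun i hi => ?_
      rw [Finset.mem_range] at hi
      simp only [RExp.val, IExp.val, Store.withI_ireg, Store.withI_rarr, Nat.reduceEqDiff,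
        reduceIte, hs.r_eq, hs.L_eq, hs.w_eq, h9, (hP i hi k hk ω' hω').1, (hP i hi k hk ω' hω').2,
        (hF i hi q hq ω hω).1, (hF i hi q hq ω hω).2, Complex.mul_re, Complex.conj_re,
        Complex.conj_im]
      ring
    · rw [v2 k hk q hq ω hω, gramSum, Complex.im_sum]
      refine Finset.sum_congr rfl fun i hi => ?_
      rw [Finset.mem_range] at hi
      simp only [RExp.val, IExp.val, Store.withI_ireg, Store.withI_rarr, Nat.reduceEqDiff,
        reduceIte, hr1.r_eq, hr1.L_eq, hr1.w_eq, h91, f1.rarr 28 (by simp), f1.rarr 29 (by simp),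
        f1.rarr 30 (by simp), f1.rarr 31 (by simp), (hP i hi k hk ω' hω').1,
        (hP i hi k hk ω' hω').2,
        (hF i hi q hq ω hω).1, (hF i hi q hq ω hω).2, Complex.mul_im, Complex.conj_re,
        Complex.conj_im]
      ring
  -- the spectrum
  set x3 := mul3Re (wEntry 11) (wEntry 12) (gramEntry 34) (gramEntry 35) (gEntry 32) (gEntry 33)
    with hx3
  set x4 := mul3Im (wEntry 11) (wEntry 12) (gramEntry 34) (gramEntry 35) (gEntry 32) (gEntry 33)
    with hx4
  have hgood : ∀ s' : Store, Regs n d₁ d₂ r m N T L s' → s'.ireg 9 = ω' → ∀ k < r, ∀ j < n,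
      ∀ q < 2 * r, ∀ ω < L,
      x3.Ok X SP ((((s'.withI 10 k).withI 11 j).withI 12 q).withI 13 ω) ∧
      x4.Ok X SP ((((s'.withI 10 k).withI 11 j).withI 12 q).withI 13 ω) := by
    intro s' hs' h9' k hk j hj q hq ω hω
    have h1 := hmod (ω' + L - ω)
    have h2 := hbndG hk hq hω
    have h3 := hbnd hq hω hj
    simp only [hx3, hx4, RExp.Ok, IExp.Ok, IExp.val, Store.withI_ireg, Nat.reduceEqDiff, reduceIte,
      hs'.L_eq, hs'.w_eq, h9', h1, h2, h3, and_self]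
  -- Stated for any store that still holds the Gram matrices, since the imaginary part is evaluated
  -- after array 36 has been filled.
  have hval : ∀ s' : Store, Frame [10, 11, 12, 13] [] [] [34, 35, 36, 37] s s' →
      s'.rarr 34 = s2.rarr 34 → s'.rarr 35 = s2.rarr 35 → ∀ k < r, ∀ j < n,
      ∀ q < 2 * r, ∀ ω < L,
      x3.val ((((s'.withI 10 k).withI 11 j).withI 12 q).withI 13 ω) =
        (wh ((ω' + L - ω) % L) * gramSum n Ph Fh k q ω' ω * Gh j q ω).re ∧
      x4.val ((((s'.withI 10 k).withI 11 j).withI 12 q).withI 13 ω) =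
        (wh ((ω' + L - ω) % L) * gramSum n Ph Fh k q ω' ω * Gh j q ω).im := by
    intro s' f' h34 h35 k hk j hj q hq ω hω
    have hs' : Regs n d₁ d₂ r m N T L s' := hs.frame f' (by intro i hi; simp; omega)
    have h9' : s'.ireg 9 = ω' := (f'.ireg 9 (by simp)).trans h9
    have h1 := hwh ((ω' + L - ω) % L) (Nat.mod_lt _ D.one_le_L)
    have h2 := hgram k hk q hq ω hω
    have h3 := hG j hj q hq ω hω
    constructor
    · simp only [hx3, RExp.val, IExp.val, Store.withI_ireg, Store.withI_rarr, Nat.reduceEqDiff,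
        reduceIte, hs'.L_eq, hs'.w_eq, h9', f'.rarr 11 (by simp), f'.rarr 12 (by simp),
        f'.rarr 32 (by simp), f'.rarr 33 (by simp), h34, h35, h1.1, h1.2, h2.1, h2.2, h3.1, h3.2,
        Complex.mul_re, Complex.mul_im]
    · simp only [hx4, RExp.val, IExp.val, Store.withI_ireg, Store.withI_rarr, Nat.reduceEqDiff,
        reduceIte, hs'.L_eq, hs'.w_eq, h9', f'.rarr 11 (by simp), f'.rarr 12 (by simp),
        f'.rarr 32 (by simp), f'.rarr 33 (by simp), h34, h35, h1.1, h1.2, h2.1, h2.2, h3.1, h3.2,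
        Complex.mul_re, Complex.mul_im]
  obtain ⟨g3, f3, v3⟩ := mix_rule D hB' (dst := 36) (x := x3) hr2 hrs2 (by decide)
    fun k hk j hj q hq ω hω => (hgood s2 hr2 h92 k hk j hj q hq ω hω).1
  have R3 := Runs.of g3 f3
  generalize (Prog.exec _ s2).1 = s3 at f3 v3 R3
  have f13 : Frame [10, 11, 12, 13] [] [] [34, 35, 36] s s3 :=
    (f12.mono (by simp) (by simp) (by simp) (by simp)).trans
      (f3.mono (by simp) (by simp) (by simp) (by simp))
  have hr3 : Regs n d₁ d₂ r m N T L s3 := hs.frame f13 (by intro i hi; simp; omega)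
  have h93 : s3.ireg 9 = ω' := (f13.ireg 9 (by simp)).trans h9
  have hrs3 : ∀ i ∈ List.range 10, s3.ireg i ≤ X := fun i hi => by
    rw [f13.ireg i (by rw [List.mem_range] at hi; simp; omega)]; exact hrs i hi
  obtain ⟨g4, f4, v4⟩ := mix_rule D hB' (dst := 37) (x := x4) hr3 hrs3 (by decide)
    fun k hk j hj q hq ω hω => (hgood s3 hr3 h93 k hk j hj q hq ω hω).2
  have R4 := Runs.of g4 f4
  generalize (Prog.exec _ s3).1 = s4 at f4 v4 R4
  have f14 : Frame [10, 11, 12, 13] [] [] [34, 35, 36, 37] s s4 :=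
    (f13.mono (by simp) (by simp) (by simp) (by simp)).trans
      (f4.mono (by simp) (by simp) (by simp) (by simp))
  have hr4 : Regs n d₁ d₂ r m N T L s4 := hs.frame f14 (by intro i hi; simp; omega)
  have h94 : s4.ireg 9 = ω' := (f14.ireg 9 (by simp)).trans h9
  have hrs4 : ∀ i ∈ List.range 10, s4.ireg i ≤ X := fun i hi => by
    rw [f14.ireg i (by rw [List.mem_range] at hi; simp; omega)]; exact hrs i hi
  have hmix : ∀ k < r, ∀ j < n,
      CAt s4 36 37 (k * n + j) (mixSum n r L wh Ph Fh Gh k j ω') := by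
    intro k hk j hj
    constructor
    · rw [f4.rarr 36 (by simp), v3 k hk j hj, mixSum, Complex.re_sum]
      refine Finset.sum_congr rfl fun q hq => ?_
      rw [Complex.re_sum]
      refine Finset.sum_congr rfl fun ω hω => ?_
      rw [Finset.mem_range] at hq hω
      exact (hval s2 (f12.mono (by simp) (by simp) (by simp) (by simp)) rfl rfl
        k hk j hj q hq ω hω).1
    · rw [v4 k hk j hj, mixSum, Complex.im_sum]
      refine Finset.sum_congr rfl fun q hq => ?_
      rw [Complex.im_sum]
      refine Finset.sum_congr rfl fun ω hω => ?_
      rw [Finset.mem_range] at hq hω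
      exact (hval s3 (f13.mono (by simp) (by simp) (by simp) (by simp)) (f3.rarr 34 (by simp))
        (f3.rarr 35 (by simp)) k hk j hj q hq ω hω).2
  -- the output
  have hdG13 : dG ≠ 10 ∧ dG ≠ 11 ∧ dG ≠ 12 ∧ dG ≠ 13 ∧ dG < 9 := by
    rcases hargs with h | h <;> omega
  have hout : out ∉ [34, 35, 36, 37] := by
    rcases hargs with h | h <;> simp [h]
  have hdG4 : s4.ireg dG = vG := by
    rw [f14.ireg dG (by simp; omega), hdG]
  have hlen : r * n ≤ SP := D.le_SP (by
    calc r * n = r * n * 1 := by ring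
      _ ≤ r * n * T := Nat.mul_le_mul_left _ D.one_le_T
      _ ≤ 8 * (r * n * T) := by omega)
  have hlenO : vG * n * r ≤ SP := D.le_SP (by
    calc vG * n * r ≤ T * n * r := by gcongr
      _ = r * n * T := by ring
      _ ≤ 8 * (r * n * T) := by omega)
  have hSPB : SP ≤ B' := by
    have := D.hSP
    have : r * n * T * 1 ≤ r * n * T * r := Nat.mul_le_mul_left _ D.hr
    omega
  set x5 : RExp := neg (RExp.div
        (RExp.add
          (RExp.mul (RExp.get 8 (IExp.mod (IExp.mul (IExp.reg 9) (IExp.reg 10)) (IExp.reg 6)))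
            (RExp.get 36 (ix (IExp.reg 12) (IExp.reg 0) (IExp.reg 11))))
          (RExp.mul (RExp.get 9 (IExp.mod (IExp.mul (IExp.reg 9) (IExp.reg 10)) (IExp.reg 6)))
            (RExp.get 37 (ix (IExp.reg 12) (IExp.reg 0) (IExp.reg 11)))))
        (RExp.ofInt (IExp.mul (IExp.reg 6) (IExp.reg 6)))) with hx5
  have key := nest_rule (X := X) (SP := SP) (B := B') (rs := List.range 10) (dst := out)
    (l := [(10, IExp.reg dG), (11, IExp.reg 0), (12, IExp.reg 3)])
    (pos := ix3 (IExp.reg 10) (IExp.reg 11) (IExp.reg 3) (IExp.reg 12))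
    (x := x5)
    ⟨D.bounds.le_X, hSPB, D.bounds.two_le, D.rnT_pos.trans
      ((D.le_SP (by omega)).trans hSPB)⟩ hrs4
    (by rcases hargs with ⟨rfl, rfl, rfl, rfl, rfl, rfl⟩ | ⟨rfl, rfl, rfl, rfl, rfl, rfl⟩ <;> decide)
    ?_ ?_ ?_
  · obtain ⟨g5, f5, v5⟩ := key
    have R5 := Runs.of g5 f5
    generalize (Prog.exec _ s4).1 = s5 at f5 v5 R5
    have hR : Runs X SP B' (coreStep out dG) [10, 11, 12, 13] [] [34, 35, 36, 37, out] s s5 :=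
      (R1.mono (by simp) (by simp) (by simp)).seq
      ((R2.mono (by simp) (by simp) (by simp)).seq
      ((R3.mono (by simp) (by simp) (by simp)).seq
      ((R4.mono (by simp) (by simp) (by simp)).seq
      (R5.mono (by simp) (by simp) (by simp)))))
    rw [hR.eq]
    refine ⟨hR.good, hR.frame, fun b hb j hj k hk => ?_⟩
    refine (v5 ((b * n + j) * r + k)).trans ?_
    rw [f14.rarr out hout, sub_eq_add_neg]
    congr 1
    have h1 := hχ ((ω' * b) % L) (Nat.mod_lt _ D.one_le_L)
    have h2 := hmix k hk j hj
    simp only [hx5, boxSum, IExp.val, RExp.val, Store.withI_ireg, Store.withI_rarr,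
      Nat.reduceEqDiff, reduceIte, hdG4, hr4.n_eq, hr4.L_eq, hr4.r_eq, h94]
    rw [sum_idx3 hb hj hk fun b j k => ((0 : ℕ) : ℝ) -
      (s4.rarr 8 (ω' * b % L) * s4.rarr 36 (k * n + j) +
        s4.rarr 9 (ω' * b % L) * s4.rarr 37 (k * n + j)) / ((L * L : ℕ) : ℝ)]
    rw [f14.rarr 8 (by simp), f14.rarr 9 (by simp), h1.1, h1.2, h2.1, h2.2]
    simp only [Complex.mul_re, Complex.conj_re, Complex.conj_im, Nat.cast_zero]
    ring
  · have := D.n_le; have := D.L_le; have := D.T_le; have := D.two_r_le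
    simp only [List.forall_mem_cons, IExp.val, hr4.n_eq, hr4.r_eq, hdG4, List.not_mem_nil,
      IsEmpty.forall_iff, implies_true, and_true]
    omega
  · simp only [boxVol, List.map, List.prod_cons, List.prod_nil, IExp.val, hr4.n_eq,
      hr4.r_eq, hdG4, max_eq_right D.hn, max_eq_right D.hr, max_eq_right hvG, mul_one]
    rw [← mul_assoc]
    exact hlenO.trans hSPB
  · simp only [hx5, boxAll, IExp.val, IExp.Ok, RExp.Ok, Store.withI_ireg, Nat.reduceEqDiff,
        reduceIte, hdG4, hr4.n_eq, hr4.L_eq, hr4.r_eq, h94, true_and, and_true]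
    intro b hb j hj k hk
    have h1 := (idx_lt hk hj).trans_le hlen
    exact ⟨(idx_lt (idx_lt hb hj) hk).trans_le hlenO, ⟨hmod _, h1⟩, hmod _, h1⟩

end RAM

namespace RAM

variable {n d₁ d₂ r m N T L X SP B : ℕ}

/-! ### Block Hankel products by Fourier transforms -/

/-- Discrete Fourier transforms of the columns of a matrix with `d` blocks of `n` rows and with `w`
columns, where `χ` lists the powers of the root of unity. -/
noncomputable def hat (n w L : ℕ) (χ : ℕ → ℂ) (d : ℕ) (f : ℕ → ℝ) (i k ω : ℕ) : ℂ :=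
  ∑ a ∈ Finset.range d, (f ((a * n + i) * w + k) : ℂ) * χ ((ω * a) % L)

theorem dft_pair (D : Dims n d₁ d₂ r m T L X SP B) {s : Store} {src d wd dst dv w : ℕ}
    (hs : Regs n d₁ d₂ r m N T L s) (hN : N ≤ X)
    (hside : ∀ t ∈ [(dst, 8), (dst + 1, 9)], NestSide (List.range 9) t.1
      [(10, IExp.reg 0), (11, IExp.reg wd), (12, IExp.reg 6), (13, IExp.reg d)]
      (ix (ix (IExp.reg 10) (IExp.reg wd) (IExp.reg 11)) (IExp.reg 6) (IExp.reg 12))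
    (RExp.mul (RExp.get src (ix3 (IExp.reg 13) (IExp.reg 10) (IExp.reg wd) (IExp.reg 11)))
      (RExp.get t.2 (IExp.mod (IExp.mul (IExp.reg 12) (IExp.reg 13)) (IExp.reg 6)))))
    (hd : s.ireg d = dv) (hd9 : d < 9) (hw : s.ireg wd = w) (hw9 : wd < 9) (hdT : dv ≤ T)
    (hd1 : 1 ≤ dv) (hw1 : 1 ≤ w) (hwr : w ≤ 2 * r) (hdst : 10 ≤ dst) (hsd : src ≠ dst)
    {χ : ℕ → ℂ} (hχ : ∀ k < L, CAt s 8 9 k (χ k)) :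
    ∃ s', Runs X SP B (Prog.seq (dft src d wd dst 8) (dft src d wd (dst + 1) 9))
        [10, 11, 12, 13] [] [dst, dst + 1] s s' ∧
      ∀ i < n, ∀ k < w, ∀ ω < L,
        CAt s' dst (dst + 1) ((i * w + k) * L + ω) (hat n w L χ dv (s.rarr src) i k ω) := by
  obtain ⟨g1, f1, v1⟩ := dft_spec D hs hN (hside (dst, 8) (by simp)) hd hd9 hw hw9 hdT hd1 hw1 hwr
  have R1 := Runs.of g1 f1
  dsimp only at v1 R1 f1
  generalize (Prog.exec _ s).1 = s1 at f1 v1 R1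
  have hs1 : Regs n d₁ d₂ r m N T L s1 := hs.frame f1 (by intro i hi; simp; omega)
  obtain ⟨g2, f2, v2⟩ := dft_spec D hs1 hN (hside (dst + 1, 9) (by simp))
    ((f1.ireg d (by simp; omega)).trans hd) hd9 ((f1.ireg wd (by simp; omega)).trans hw) hw9
    hdT hd1 hw1 hwr
  have R2 := Runs.of g2 f2
  dsimp only at v2 R2 f2
  generalize (Prog.exec _ s1).1 = s2 at f2 v2 R2
  refine ⟨s2, (R1.mono (by simp) (by simp) (by simp)).seq (R2.mono (by simp) (by simp) (by simp)),
    fun i hi k hk ω hω => ⟨?_, ?_⟩⟩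
  · rw [f2.rarr dst (by simp), v1 i hi k hk ω hω, hat, Complex.re_sum]
    refine Finset.sum_congr rfl fun a _ => ?_
    rw [(hχ _ (Nat.mod_lt _ D.one_le_L)).1, Complex.re_ofReal_mul]
  · rw [v2 i hi k hk ω hω, hat, Complex.im_sum]
    refine Finset.sum_congr rfl fun a _ => ?_
    rw [f1.rarr 9 (by simp; omega), f1.rarr src (by simpa using hsd),
      (hχ _ (Nat.mod_lt _ D.one_le_L)).2, Complex.im_ofReal_mul]

/-- Six tables of transforms are computed once; the loop over output frequencies then reuses the
same scratch arrays and accumulates into the output. -/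
theorem core_spec (D : Dims n d₁ d₂ r m T L X SP B) {s : Store} {P F G out dP dG vP vG : ℕ}
    (hargs : CoreArgs P F G out dP dG)
    (hs : Regs n d₁ d₂ r m N T L s) (hN : N ≤ X)
    (hdP : s.ireg dP = vP) (hvP : 1 ≤ vP) (hvPT : vP ≤ T)
    (hdG : s.ireg dG = vG) (hvG : 1 ≤ vG) (hvT : vG ≤ T) {χ wh : ℕ → ℂ}
    (hχ : ∀ k < L, CAt s 8 9 k (χ k)) (hwh : ∀ k < L, CAt s 11 12 k (wh k)) :
    ∃ s', Runs X SP B (core P F G out dP dG) [9, 10, 11, 12, 13] []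
        [28, 29, 30, 31, 32, 33, 34, 35, 36, 37, out] s s' ∧
      ∀ b < vG, ∀ j < n, ∀ k < r, s'.rarr out ((b * n + j) * r + k) =
          s.rarr out ((b * n + j) * r + k) - ∑ ω' ∈ Finset.range L,
            ((starRingEnd ℂ) (χ ((ω' * b) % L)) * mixSum n r L wh (hat n r L χ vP (s.rarr P))
              (hat n (2 * r) L χ vP (s.rarr F)) (hat n (2 * r) L χ vG (s.rarr G)) k j ω').re /
              ((L * L : ℕ) : ℝ) := by
  have hr2 : 1 ≤ 2 * r := by have := D.hr; omega
  have hout : out = 25 ∨ out = 26 := by rcases hargs with h | h <;> omega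
  have hPFG : P < 28 ∧ F < 28 ∧ G < 28 ∧ dP < 9 ∧ dG < 9 := by rcases hargs with h | h <;> omega
  obtain ⟨s1, R1, v1⟩ := dft_pair D (src := P) (d := dP) (wd := 3) (dst := 28) hs hN
    (by rcases hargs with ⟨rfl, rfl, rfl, rfl, rfl, rfl⟩ | ⟨rfl, rfl, rfl, rfl, rfl, rfl⟩ <;> decide)
    hdP (by omega) hs.r_eq (by omega) hvPT hvP D.hr (by omega) (by omega) (by omega) hχ
  have hs1 : Regs n d₁ d₂ r m N T L s1 := hs.frame R1.frame (by intro i hi; simp; omega)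
  obtain ⟨s2, R2, v2⟩ := dft_pair D (src := F) (d := dP) (wd := 7) (dst := 30) hs1 hN
    (by rcases hargs with ⟨rfl, rfl, rfl, rfl, rfl, rfl⟩ | ⟨rfl, rfl, rfl, rfl, rfl, rfl⟩ <;> decide)
    ((R1.frame.ireg dP (by simp; omega)).trans hdP) (by omega) hs1.w_eq (by omega) hvPT hvP hr2
    le_rfl (by omega) (by omega) fun k hk => (hχ k hk).frame R1.frame (by simp) (by simp)
  rw [R1.frame.rarr F (by simp; omega)] at v2
  have R12 := (R1.mono (A' := [28, 29, 30, 31]) (List.Subset.refl _) (List.Subset.refl _)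
    (by simp)).seq (R2.mono (List.Subset.refl _) (List.Subset.refl _) (by simp))
  have hs2 : Regs n d₁ d₂ r m N T L s2 := hs.frame R12.frame (by intro i hi; simp; omega)
  obtain ⟨s3, R3, v3⟩ := dft_pair D (src := G) (d := dG) (wd := 7) (dst := 32) hs2 hN
    (by rcases hargs with ⟨rfl, rfl, rfl, rfl, rfl, rfl⟩ | ⟨rfl, rfl, rfl, rfl, rfl, rfl⟩ <;> decide)
    ((R12.frame.ireg dG (by simp; omega)).trans hdG) (by omega) hs2.w_eq (by omega) hvT hvG hr2
    le_rfl (by omega) (by omega) fun k hk => (hχ k hk).frame R12.frame (by simp) (by simp)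
  rw [R12.frame.rarr G (by simp; omega)] at v3
  have R13 := (R12.mono (A' := [28, 29, 30, 31, 32, 33]) (List.Subset.refl _) (List.Subset.refl _)
    (by simp)).seq (R3.mono (List.Subset.refl _) (List.Subset.refl _) (by simp))
  have hs3 : Regs n d₁ d₂ r m N T L s3 := hs.frame R13.frame (by intro i hi; simp; omega)
  set B' := 8 * (r * n * T * r) + m with hB'
  -- At most 2T rounds of 8r²nT + m each. The first summand gives exactly 16·rT·nrT, which is the
  -- origin of the constant 16 in `Dims`.
  have hLB : L * B' ≤ B := by
    refine le_trans ?_ D.hB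
    calc L * B' ≤ 2 * T * B' := Nat.mul_le_mul_right _ D.hLT
      _ = 1 * T * (2 * m) + 16 * (r * T * (n * r * T)) := by rw [hB']; ring
      _ ≤ r * T * (2 * m) + 16 * (r * T * (n * r * T)) := by gcongr; exact D.hr
      _ ≤ r * T * (16 * m) + 16 * (r * T * (n * r * T)) := by gcongr; omega
      _ = 16 * (r * T * (m + n * r * T)) := by ring
  set Q : ℕ → ℕ → ℕ → ℕ → ℝ := fun b j k ω' => ((starRingEnd ℂ) (χ ((ω' * b) % L)) *
    mixSum n r L wh (hat n r L χ vP (s.rarr P))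
              (hat n (2 * r) L χ vP (s.rarr F)) (hat n (2 * r) L χ vG (s.rarr G)) k j ω').re /
              ((L * L : ℕ) : ℝ) with hQ
  have key := Good.loop (X := X) (SP := SP) (B := B) (i := 9) (k := L) (B' := B')
    (e := IExp.reg 6) (c := coreStep out dG) (s := s3)
    (fun l s' => Frame [9, 10, 11, 12, 13] [] [] [34, 35, 36, 37, out] s3 s' ∧
      ∀ b < vG, ∀ j < n, ∀ k < r, s'.rarr out ((b * n + j) * r + k) =
          s.rarr out ((b * n + j) * r + k) - ∑ ω' ∈ Finset.range l, Q b j k ω')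
    (by simp [IExp.Ok]) (fun i hi => hs3.le D hN i (by simp [IExp.regs] at hi; simp [hi]))
    hs3.L_eq D.bounds.pos (by have := D.rnT_pos; have := Nat.mul_pos D.rnT_pos D.hr; omega) hLB
    ⟨Frame.refl _ _ _ _ _, fun b _ j _ k _ => by
      rw [R13.frame.rarr out (by simp; omega), Finset.sum_range_zero, sub_zero]⟩ ?_
  · obtain ⟨g4, f4, v4⟩ := key
    have R4 : Runs X SP B _ [9, 10, 11, 12, 13] [] [34, 35, 36, 37, out] s3 _ := ⟨g4, rfl, f4⟩
    generalize (Prog.exec _ s3).1 = s4 at f4 v4 R4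
    refine ⟨s4, ?_, v4⟩
    exact (R1.mono (by simp) (by simp) (by simp)).seq_seq
      ((R2.mono (by simp) (by simp) (by simp)).seq_seq
      ((R3.mono (by simp) (by simp) (by simp)).seq_seq (R4.mono (by simp) (by simp) (by simp))))
  · rintro l hl s' ⟨f', v'⟩
    have f9 : Frame [9, 10, 11, 12, 13] [] [] [34, 35, 36, 37, out] s3 (s'.withI 9 l) :=
      ⟨fun i hi => by
        rw [Store.withI_ireg, if_neg (by rintro rfl; simp at hi)]; exact f'.ireg i hi,
        f'.rreg, f'.iarr, f'.rarr⟩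
    have hs' : Regs n d₁ d₂ r m N T L (s'.withI 9 l) := hs3.frame f9 (by intro i hi; simp; omega)
    have f0 := (R13.frame.mono (I' := [9, 10, 11, 12, 13]) (R' := []) (IA' := [])
      (A' := [28, 29, 30, 31, 32, 33, 34, 35, 36, 37, out])
      (by simp) (by simp) (by simp) (by simp)).trans
        (f9.mono (by simp) (by simp) (by simp) (by simp))
    have h9 : (s'.withI 9 l).ireg 9 = l := by simp
    obtain ⟨g5, f5, v5⟩ := coreStep_spec D le_rfl hargs hs' (vG := vG) (ω' := l) (χ := χ) (wh := wh)
      (fun i hi => by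
        rcases (Nat.lt_succ_iff_lt_or_eq.mp (List.mem_range.mp hi)) with h | h
        · exact hs'.le D hN i (List.mem_range.mpr h)
        · rw [h, h9]; exact hl.le.trans (D.L_le.trans D.bounds.le_X))
      ((f0.ireg dG (by simp; omega)).trans hdG) hvG hvT hl h9
      (fun k hk => (hχ k hk).frame f0 (by simp; omega) (by simp; omega))
      (fun k hk => (hwh k hk).frame f0 (by simp; omega) (by simp; omega))
      (fun i hi k hk ω hω => (((v1 i hi k hk ω hω).frame R2.frame (by simp) (by simp)).frame R3.frame
        (by simp) (by simp)).frame f9 (by simp; omega) (by simp; omega))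
      (fun i hi k hk ω hω => ((v2 i hi k hk ω hω).frame R3.frame (by simp) (by simp)).frame f9
        (by simp; omega) (by simp; omega))
      (fun i hi k hk ω hω => (v3 i hi k hk ω hω).frame f9 (by simp; omega) (by simp; omega))
    refine ⟨g5, f9.trans (f5.mono (by simp) (by simp) (by simp) (by simp)),
      fun b hb j hj k hk => ?_⟩
    rw [v5 b hb j hj k hk, Finset.sum_range_succ, ← sub_sub, ← v' b hb j hj k hk]
    rfl

end RAM

/-! ### Discrete Fourier transforms -/

-- Interchange of sums: the kernel is a product of a factor in x and a factor in y for each t, so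
-- the x-sum and the y-sum separate.
open Finset in
theorem sum_mul_sum_swap {α β γ δ ι : Type*} (sα : Finset α) (sβ : Finset β) (sγ : Finset γ)
    (sδ : Finset δ) (sι : Finset ι) (b : α → ℂ) (e : α → δ → ℂ) (e' : γ → δ → ℂ) (w : δ → ℂ)
    (p : ι → α → ℂ) (f : ι → β → γ → ℂ) (g : β → γ → ℂ) :
    ∑ x ∈ sα, b x * ∑ q ∈ sβ, ∑ y ∈ sγ, (∑ t ∈ sδ, w t * (e x t * e' y t)) *
        (∑ i ∈ sι, p i x * f i q y) * g q y =
      ∑ q ∈ sβ, ∑ i ∈ sι, ∑ t ∈ sδ, w t * (∑ x ∈ sα, b x * e x t * p i x) *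
        (∑ y ∈ sγ, e' y t * f i q y * g q y) := by
  have h1 : ∀ x q y, b x * ((∑ t ∈ sδ, w t * (e x t * e' y t)) * (∑ i ∈ sι, p i x * f i q y) *
      g q y) = ∑ i ∈ sι, ∑ t ∈ sδ, w t * (b x * e x t * p i x) * (e' y t * f i q y * g q y) := by
    intro x q y
    rw [mul_comm (∑ t ∈ sδ, w t * (e x t * e' y t)), sum_mul_sum, sum_mul, mul_sum]
    refine sum_congr rfl fun i _ => ?_
    rw [sum_mul, mul_sum]
    exact sum_congr rfl fun t _ => by ring
  have h3 : ∀ x, b x * ∑ q ∈ sβ, ∑ y ∈ sγ, (∑ t ∈ sδ, w t * (e x t * e' y t)) *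
        (∑ i ∈ sι, p i x * f i q y) * g q y = ∑ q ∈ sβ, ∑ y ∈ sγ, ∑ i ∈ sι, ∑ t ∈ sδ,
        w t * (b x * e x t * p i x) * (e' y t * f i q y * g q y) := by
    intro x
    rw [mul_sum]
    refine sum_congr rfl fun q _ => ?_
    rw [mul_sum]
    exact sum_congr rfl fun y _ => h1 x q y
  simp_rw [h3]
  rw [sum_comm]
  refine sum_congr rfl fun q _ => ?_
  have h2 : ∀ x, ∑ y ∈ sγ, ∑ i ∈ sι, ∑ t ∈ sδ, w t * (b x * e x t * p i x) *
      (e' y t * f i q y * g q y) = ∑ i ∈ sι, ∑ t ∈ sδ, w t * (b x * e x t * p i x) *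
      ∑ y ∈ sγ, (e' y t * f i q y * g q y) := by
    intro x
    rw [sum_comm]
    refine sum_congr rfl fun i _ => ?_
    rw [sum_comm]
    exact sum_congr rfl fun t _ => by rw [mul_sum]
  simp_rw [h2]
  rw [sum_comm]
  refine sum_congr rfl fun i _ => ?_
  rw [sum_comm]
  refine sum_congr rfl fun t _ => ?_
  rw [← sum_mul, ← mul_sum]

/-- On the unit circle the conjugate is the inverse, so this is a geometric sum with ratio ζ^(x−t).
Primitivity and x, t < L make the ratio different from 1 unless x = t. -/
theorem sum_root_orthogonal {L : ℕ} {ζ : ℂ} (hζ : IsPrimitiveRoot ζ L) (h1 : ζ * star ζ = 1)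
    {x t : ℕ} (hx : x < L) (ht : t < L) :
    ∑ ω ∈ Finset.range L, ζ ^ (ω * x) * star ζ ^ (ω * t) = if x = t then (L : ℂ) else 0 := by
  have hpow : ∀ ω, ζ ^ (ω * x) * star ζ ^ (ω * t) = (ζ ^ x * star ζ ^ t) ^ ω := by
    intro ω; rw [mul_pow, ← pow_mul, ← pow_mul, mul_comm x, mul_comm t]
  simp_rw [hpow]
  split_ifs with h
  · subst h
    simp only [← mul_pow, h1, one_pow, Finset.sum_const, Finset.card_range, nsmul_eq_mul, mul_one]
  · have hne : ζ ^ x * star ζ ^ t ≠ 1 := by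
      intro h2
      apply h
      apply hζ.pow_inj hx ht
      calc ζ ^ x = ζ ^ x * (ζ * star ζ) ^ t := by rw [h1, one_pow, mul_one]
        _ = ζ ^ x * star ζ ^ t * ζ ^ t := by rw [mul_pow]; ring
        _ = ζ ^ t := by rw [h2, one_mul]
    have hL : (ζ ^ x * star ζ ^ t) ^ L = 1 := by
      rw [mul_pow, ← pow_mul, ← pow_mul, mul_comm x, mul_comm t, pow_mul, pow_mul, hζ.pow_eq_one,
        ← star_pow, hζ.pow_eq_one]
      simp
    rw [geom_sum_eq hne, hL, sub_self, zero_div]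

namespace RAM

/-! ### The result of the inner products of the transforms -/

-- The spectrum of the weights at ω' − ω is a sum over t of w(t) ζ^(ω't) conj(ζ)^(ωt). For fixed t
-- the sum over ω' selects t = a + b and the sum over ω selects a' + b' = t, each with a factor L.
-- All these indices are below T ≤ L, so nothing wraps around.
open Finset in
theorem sum_conj_mixSum {n r T L vP vG : ℕ} {ζ : ℂ} (hζ : IsPrimitiveRoot ζ L)
    (h1 : ζ * star ζ = 1) (hTL : T ≤ L) (hT : vP + vG = T + 1) (w P F G : ℕ → ℝ) (χ wh : ℕ → ℂ)
    (hχ : ∀ k < L, χ k = ζ ^ k) (hwh : ∀ k < L, wh k = ∑ t ∈ range T, (w t : ℂ) * ζ ^ (k * t))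
    {b j k : ℕ} (hb : b < vG) :
    ∑ ω' ∈ range L, ((starRingEnd ℂ) (χ ((ω' * b) % L)) * mixSum n r L wh (hat n r L χ vP P)
              (hat n (2 * r) L χ vP F) (hat n (2 * r) L χ vG G) k j ω').re /
              ((L * L : ℕ) : ℝ) =
      ∑ a ∈ range vP, ∑ i ∈ range n, P ((a * n + i) * r + k) * (w (a + b) *
        ∑ q ∈ range (2 * r), ∑ a' ∈ range vP, ∑ b' ∈ range vG,
          if a' + b' = a + b then F ((a' * n + i) * (2 * r) + q) * G ((b' * n + j) * (2 * r) + q)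
          else 0) := by
  rcases Nat.eq_zero_or_pos vP with rfl | hvP
  · simp [mixSum, gramSum, hat]
  have hL : 0 < L := by omega
  have hmod : ∀ k, χ (k % L) = ζ ^ k := by
    intro k
    rw [hχ _ (Nat.mod_lt _ hL), ← pow_eq_pow_mod k hζ.pow_eq_one]
  have hhat : ∀ (w d : ℕ) (f : ℕ → ℝ) (i k ω : ℕ), hat n w L χ d f i k ω =
      ∑ a ∈ range d, (f ((a * n + i) * w + k) : ℂ) * ζ ^ (ω * a) := by
    intro w d f i k ω
    simp only [hat, hmod]
  have hstar : ζ ^ L = 1 := hζ.pow_eq_one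
  -- The frequency difference splits into a product, which is what lets the two frequency sums be
  -- separated.
  have hwh' : ∀ ω' ∈ range L, ∀ ω ∈ range L, wh ((ω' + L - ω) % L) =
      ∑ t ∈ range T, (w t : ℂ) * (ζ ^ (ω' * t) * star ζ ^ (ω * t)) := by
    intro ω' _ ω hω
    rw [hwh _ (Nat.mod_lt _ hL)]
    refine sum_congr rfl fun t _ => ?_
    have e : ζ ^ ((ω' + L - ω) % L) = ζ ^ ω' * star ζ ^ ω := by
      rw [← pow_eq_pow_mod _ hstar]
      have hω' := mem_range.mp hω
      calc ζ ^ (ω' + L - ω) = ζ ^ (ω' + L - ω) * (ζ * star ζ) ^ ω := by rw [h1, one_pow, mul_one]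
        _ = ζ ^ (ω' + L - ω + ω) * star ζ ^ ω := by rw [mul_pow, pow_add]; ring
        _ = ζ ^ ω' * star ζ ^ ω := by
          rw [Nat.sub_add_cancel (by omega), pow_add, hstar, mul_one]
    rw [pow_mul, e, mul_pow, ← pow_mul, ← pow_mul]
  have hLC : ((L * L : ℕ) : ℝ) ≠ 0 := by positivity
  rw [← sum_div, div_eq_iff hLC, ← Complex.re_sum]
  have e1 : ∀ ω' ∈ range L, (starRingEnd ℂ) (χ ((ω' * b) % L)) * mixSum n r L wh
      (hat n r L χ vP P) (hat n (2 * r) L χ vP F) (hat n (2 * r) L χ vG G) k j ω' =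
      star ζ ^ (ω' * b) * ∑ q ∈ range (2 * r), ∑ ω ∈ range L,
        (∑ t ∈ range T, (w t : ℂ) * (ζ ^ (ω' * t) * star ζ ^ (ω * t))) *
        (∑ i ∈ range n, (starRingEnd ℂ) (hat n r L χ vP P i k ω') * hat n (2 * r) L χ vP F i q ω) *
        hat n (2 * r) L χ vG G j q ω := by
    intro ω' hω'
    rw [hmod, map_pow, mixSum]
    congr 1
    refine sum_congr rfl fun q _ => sum_congr rfl fun ω hω => ?_
    rw [hwh' ω' hω' ω hω, gramSum]
  rw [sum_congr rfl e1, sum_mul_sum_swap]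
  -- Output frequency: orthogonality between t and a + b.
  have e2 : ∀ i, ∀ t ∈ range T, ∑ x ∈ range L, star ζ ^ (x * b) * ζ ^ (x * t) *
      (starRingEnd ℂ) (hat n r L χ vP P i k x) =
      ∑ a ∈ range vP, if t = a + b then (P ((a * n + i) * r + k) : ℂ) * L else 0 := by
    intro i t ht
    have : ∀ x, star ζ ^ (x * b) * ζ ^ (x * t) * (starRingEnd ℂ) (hat n r L χ vP P i k x) =
        ∑ a ∈ range vP, (P ((a * n + i) * r + k) : ℂ) *
          (ζ ^ (x * t) * star ζ ^ (x * (a + b))) := by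
      intro x
      rw [hhat, map_sum, mul_sum]
      refine sum_congr rfl fun a _ => ?_
      rw [map_mul, Complex.conj_ofReal, map_pow, mul_add, pow_add]
      simp only [starRingEnd_apply]
      ring
    simp_rw [this]
    rw [sum_comm]
    refine sum_congr rfl fun a ha => ?_
    rw [mem_range] at ha ht
    rw [← mul_sum, sum_root_orthogonal hζ h1 (by omega) (by omega)]
    split_ifs <;> simp
  -- Summation frequency: orthogonality between a' + b' and t, which is the convolution theorem.
  have e3 : ∀ i q, ∀ t ∈ range T, ∑ y ∈ range L, star ζ ^ (y * t) * hat n (2 * r) L χ vP F i q y *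
      hat n (2 * r) L χ vG G j q y =
      ∑ a' ∈ range vP, ∑ b' ∈ range vG, if a' + b' = t then
        (F ((a' * n + i) * (2 * r) + q) : ℂ) * G ((b' * n + j) * (2 * r) + q) * L else 0 := by
    intro i q t ht
    have : ∀ y, star ζ ^ (y * t) * hat n (2 * r) L χ vP F i q y * hat n (2 * r) L χ vG G j q y =
        ∑ a' ∈ range vP, ∑ b' ∈ range vG, (F ((a' * n + i) * (2 * r) + q) : ℂ) *
          G ((b' * n + j) * (2 * r) + q) * (ζ ^ (y * (a' + b')) * star ζ ^ (y * t)) := by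
      intro y
      rw [hhat, hhat, mul_assoc, sum_mul_sum, mul_sum]
      refine sum_congr rfl fun a' _ => ?_
      rw [mul_sum]
      refine sum_congr rfl fun b' _ => ?_
      rw [mul_add, pow_add]
      ring
    simp_rw [this]
    rw [sum_comm]
    refine sum_congr rfl fun a ha => ?_
    rw [sum_comm]
    refine sum_congr rfl fun b' hb' => ?_
    rw [mem_range] at ha ht hb'
    rw [← mul_sum, sum_root_orthogonal hζ h1 (by omega) (by omega)]
    split_ifs <;> simp
  have e4 : ∀ q i, ∑ t ∈ range T, (w t : ℂ) * (∑ x ∈ range L, star ζ ^ (x * b) * ζ ^ (x * t) *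
      (starRingEnd ℂ) (hat n r L χ vP P i k x)) *
      (∑ y ∈ range L, star ζ ^ (y * t) * hat n (2 * r) L χ vP F i q y *
        hat n (2 * r) L χ vG G j q y) =
      ((∑ a ∈ range vP, P ((a * n + i) * r + k) * (w (a + b) *
        ∑ a' ∈ range vP, ∑ b' ∈ range vG,
          if a' + b' = a + b then F ((a' * n + i) * (2 * r) + q) * G ((b' * n + j) * (2 * r) + q)
          else 0) * ((L * L : ℕ) : ℝ) : ℝ) : ℂ) := by
    intro q i
    have : ∀ t ∈ range T, (w t : ℂ) * (∑ x ∈ range L, star ζ ^ (x * b) * ζ ^ (x * t) *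
      (starRingEnd ℂ) (hat n r L χ vP P i k x)) *
      (∑ y ∈ range L, star ζ ^ (y * t) * hat n (2 * r) L χ vP F i q y *
        hat n (2 * r) L χ vG G j q y) = ∑ a ∈ range vP, if t = a + b then
        (w t : ℂ) * ((P ((a * n + i) * r + k) : ℂ) * L) * (∑ a' ∈ range vP, ∑ b' ∈ range vG,
        if a' + b' = t then
        (F ((a' * n + i) * (2 * r) + q) : ℂ) * G ((b' * n + j) * (2 * r) + q) * L else 0) else 0 := by
      intro t ht
      rw [e2 i t ht, e3 i q t ht, mul_assoc, sum_mul, mul_sum]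
      refine sum_congr rfl fun a _ => ?_
      split_ifs <;> ring
    rw [sum_congr rfl this, sum_comm, Complex.ofReal_sum]
    refine sum_congr rfl fun a ha => ?_
    rw [mem_range] at ha
    rw [sum_ite_eq' (range T) (a + b), if_pos (mem_range.mpr (by omega))]
    have : ∀ a' b', (if a' + b' = a + b then
        (F ((a' * n + i) * (2 * r) + q) : ℂ) * G ((b' * n + j) * (2 * r) + q) * L else 0) =
        (if a' + b' = a + b then
        (F ((a' * n + i) * (2 * r) + q) : ℂ) * G ((b' * n + j) * (2 * r) + q) else 0) * L := by
      intro a' b'; split_ifs <;> simp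
    simp_rw [this, ← sum_mul]
    push_cast
    simp only [apply_ite Complex.ofReal, Complex.ofReal_mul, Complex.ofReal_zero]
    ring
  simp_rw [e4, ← Complex.ofReal_sum, Complex.ofReal_re]
  rw [sum_mul]
  simp_rw [sum_mul]
  rw [sum_comm]
  simp_rw [mul_sum, sum_mul]
  have e5 : ∀ i, ∑ q ∈ range (2 * r), ∑ a ∈ range vP, ∑ a' ∈ range vP, ∑ b' ∈ range vG,
     (P ((a * n + i) * r + k) * (w (a + b) * if a' + b' = a + b then
        F ((a' * n + i) * (2 * r) + q) * G ((b' * n + j) * (2 * r) + q) else 0)) *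
        ((L * L : ℕ) : ℝ) = ∑ a ∈ range vP, ∑ q ∈ range (2 * r), ∑ a' ∈ range vP, ∑ b' ∈ range vG,
     (P ((a * n + i) * r + k) * (w (a + b) * if a' + b' = a + b then
        F ((a' * n + i) * (2 * r) + q) * G ((b' * n + j) * (2 * r) + q) else 0)) *
        ((L * L : ℕ) : ℝ) := fun i => sum_comm
  simp_rw [e5]
  rw [sum_comm]

end RAM

namespace RAM

variable {n d₁ d₂ r m N T L X SP B : ℕ}

/-! ### Rules for single instructions and the root of unity -/

/-- Set a real register. -/
noncomputable def Store.withR (s : Store) (i : ℕ) (v : ℝ) : Store :=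
  { s with rreg := Function.update s.rreg i v }

@[simp] theorem Store.withR_rreg (s : Store) (i : ℕ) (v : ℝ) (j : ℕ) :
    (s.withR i v).rreg j = if j = i then v else s.rreg j := by
  simp [Store.withR, Function.update_apply]

@[simp] theorem Store.withR_ireg (s : Store) (i : ℕ) (v : ℝ) : (s.withR i v).ireg = s.ireg := rfl
@[simp] theorem Store.withR_rarr (s : Store) (i : ℕ) (v : ℝ) : (s.withR i v).rarr = s.rarr := rfl

/-- Write into a real array. -/
noncomputable def Store.put (s : Store) (a k : ℕ) (v : ℝ) : Store :=
  { s with rarr := Function.update s.rarr a (Function.update (s.rarr a) k v) }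

@[simp] theorem Store.put_rarr (s : Store) (a k : ℕ) (v : ℝ) (a' k' : ℕ) :
    (s.put a k v).rarr a' k' = if a' = a ∧ k' = k then v else s.rarr a' k' := by
  rcases eq_or_ne a' a with rfl | h
  · simp [Store.put, Function.update_apply]
  · simp [Store.put, h]

@[simp] theorem Store.put_ireg (s : Store) (a k : ℕ) (v : ℝ) : (s.put a k v).ireg = s.ireg := rfl
@[simp] theorem Store.put_rreg (s : Store) (a k : ℕ) (v : ℝ) : (s.put a k v).rreg = s.rreg := rfl

theorem Runs.setI {i : ℕ} {e : IExp} {s : Store} {I R A : List ℕ} (hB : 1 ≤ B) (hi : i ∈ I)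
    (he : e.Ok X SP s) (hr : ∀ i ∈ e.regs, s.ireg i ≤ X) :
    Runs X SP B (Prog.setI i e) I R A s (s.withI i (e.val s)) :=
  ⟨Good.setI hB he hr, rfl, fun j hj => by
    rw [Store.withI_ireg, if_neg (by rintro rfl; exact hj hi)], fun _ _ => rfl, fun _ _ => rfl,
    fun _ _ => rfl⟩

theorem Runs.setR {i : ℕ} {x : RExp} {s : Store} {I R A : List ℕ} (hB : 1 ≤ B) (hi : i ∈ R)
    (he : x.Ok X SP s) (hr : ∀ i ∈ x.regs, s.ireg i ≤ X) :
    Runs X SP B (Prog.setR i x) I R A s (s.withR i (x.val s)) :=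
  ⟨Good.setR hB he hr, rfl, fun _ _ => rfl, fun j hj => by
    rw [Store.withR_rreg, if_neg (by rintro rfl; exact hj hi)], fun _ _ => rfl, fun _ _ => rfl⟩

theorem Runs.putR {a : ℕ} {p : IExp} {x : RExp} {s : Store} {I R A : List ℕ} (hB : 1 ≤ B)
    (ha : a ∈ A) (hp : p.Ok X SP s) (hlt : p.val s < SP) (hx : x.Ok X SP s)
    (hr : ∀ i ∈ p.regs ++ x.regs, s.ireg i ≤ X) :
    Runs X SP B (Prog.putR a p x) I R A s (s.put a (p.val s) (x.val s)) :=
  ⟨Good.putR hB hp hlt hx hr, rfl, fun _ _ => rfl, fun _ _ => rfl, fun _ _ => rfl, fun j hj => by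
    funext k
    rw [Store.put_rarr, if_neg (by rintro ⟨rfl, -⟩; exact hj ha)]⟩

theorem Runs.loop {i k B' : ℕ} {e : IExp} {c : Prog} {s : Store} {I R A : List ℕ}
    (Inv : ℕ → Store → Prop)
    (he : e.Ok X SP s) (hr : ∀ i ∈ e.regs, s.ireg i ≤ X) (hk : e.val s = k) (hB : 1 ≤ B)
    (hB' : 1 ≤ B') (hkB : k * B' ≤ B) (hi : i ∈ I) (h0 : Inv 0 s)
    (hstep : ∀ j < k, ∀ s', Frame I R [] A s (s'.withI i j) → Inv j s' →
      ∃ s'', Runs X SP B' c I R A (s'.withI i j) s'' ∧ Inv (j + 1) s'') :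
    ∃ s', Runs X SP B (Prog.loop i e c) I R A s s' ∧ Inv k s' := by
  have key := Good.loop (fun j s' => Frame I R [] A s s' ∧ Inv j s') he hr hk hB hB' hkB
    ⟨Frame.refl _ _ _ _ _, h0⟩ fun j hj s' hs' => by
      have f : Frame I R [] A s (s'.withI i j) := ⟨fun l hl => by
        rw [Store.withI_ireg, if_neg (by rintro rfl; exact hl hi)]; exact hs'.1.ireg l hl,
        hs'.1.rreg, hs'.1.iarr, hs'.1.rarr⟩
      obtain ⟨s'', ⟨h1, rfl, h2⟩, h3⟩ := hstep j hj s' f hs'.2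
      exact ⟨h1, f.trans h2, h3⟩
  exact ⟨_, ⟨key.1, rfl, key.2.1⟩, key.2.2⟩

theorem Runs.ifLt_pos {e f : IExp} {c d : Prog} {s s' : Store} {I R A : List ℕ} (hB : 1 ≤ B)
    (he : e.Ok X SP s) (hf : f.Ok X SP s) (hr : ∀ i ∈ e.regs ++ f.regs, s.ireg i ≤ X)
    (h : e.val s < f.val s) (hc : Runs X SP B c I R A s s') :
    Runs X SP B (Prog.ifLt e f c d) I R A s s' := by
  refine ⟨Good.ifLt hB he hf hr (fun _ => hc.good) (fun h' => absurd h h'), ?_, hc.frame⟩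
  rw [← hc.eq]
  simp only [Prog.exec, if_pos h]

theorem Runs.ifLt_neg {e f : IExp} {c d : Prog} {s s' : Store} {I R A : List ℕ} (hB : 1 ≤ B)
    (he : e.Ok X SP s) (hf : f.Ok X SP s) (hr : ∀ i ∈ e.regs ++ f.regs, s.ireg i ≤ X)
    (h : ¬e.val s < f.val s) (hd : Runs X SP B d I R A s s') :
    Runs X SP B (Prog.ifLt e f c d) I R A s s' := by
  refine ⟨Good.ifLt hB he hf hr (fun h' => absurd h' h) (fun _ => hd.good), ?_, hd.frame⟩
  rw [← hd.eq]
  simp only [Prog.exec, if_neg h]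

theorem Runs.skip {s : Store} {I R A : List ℕ} (hB : 1 ≤ B) : Runs X SP B Prog.skip I R A s s :=
  ⟨⟨trivial, by simpa [Prog.exec, Prog.cost, Usage.tick] using hB⟩, rfl, Frame.refl _ _ _ _ _⟩

/-- Half-angle formulas. A nonnegative sine puts the angle into [0, π], where both half-angle values
are nonnegative and the principal square roots have the right sign. -/
theorem half_angle {c t : ℝ} (h : c ^ 2 + t ^ 2 = 1) (ht : 0 ≤ t) :
    ((Real.sqrt ((1 + c) / 2) : ℂ) + Real.sqrt ((1 - c) / 2) * Complex.I) ^ 2 =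
      (c : ℂ) + t * Complex.I := by
  have h1 : -1 ≤ c := by nlinarith
  have h2 : c ≤ 1 := by nlinarith
  have e1 : Real.sqrt ((1 + c) / 2) ^ 2 = (1 + c) / 2 := Real.sq_sqrt (by linarith)
  have e2 : Real.sqrt ((1 - c) / 2) ^ 2 = (1 - c) / 2 := Real.sq_sqrt (by linarith)
  have e3 : Real.sqrt ((1 + c) / 2) * Real.sqrt ((1 - c) / 2) = t / 2 := by
    rw [← Real.sqrt_mul (by linarith), ← Real.sqrt_sq (by linarith : 0 ≤ t / 2)]
    congr 1
    nlinarith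
  apply Complex.ext
  · simp only [sq, Complex.mul_re, Complex.add_re, Complex.ofReal_re, Complex.ofReal_im,
      Complex.I_re, Complex.I_im, Complex.add_im, Complex.mul_im]
    nlinarith
  · simp only [sq, Complex.mul_re, Complex.add_re, Complex.ofReal_re, Complex.ofReal_im,
      Complex.I_re, Complex.I_im, Complex.add_im, Complex.mul_im]
    nlinarith

/-- The real registers 3 and 4 hold a root of unity of order `2 ^ (k + 1)`. -/
structure RootAt (k : ℕ) (s : Store) : Prop where
  unit : s.rreg 3 ^ 2 + s.rreg 4 ^ 2 = 1
  nonneg : 0 ≤ s.rreg 4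
  pow : ((s.rreg 3 : ℂ) + s.rreg 4 * Complex.I) ^ 2 ^ k = -1

/-- The power with exponent 2^k is −1 ≠ 1 and its square is 1, which determines the order. -/
theorem RootAt.isPrimitiveRoot {k : ℕ} {s : Store} (h : RootAt k s) :
    IsPrimitiveRoot ((s.rreg 3 : ℂ) + s.rreg 4 * Complex.I) (2 ^ (k + 1)) := by
  rw [IsPrimitiveRoot.iff_orderOf]
  refine orderOf_eq_prime_pow ?_ ?_
  · rw [h.pow]; norm_num
  · rw [pow_succ, pow_mul, h.pow]; norm_num

theorem RootAt.half {k : ℕ} {s s' : Store} (h : RootAt k s)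
    (h3 : s'.rreg 3 = Real.sqrt ((1 + s.rreg 3) / 2))
    (h4 : s'.rreg 4 = Real.sqrt ((1 - s.rreg 3) / 2)) : RootAt (k + 1) s' := by
  have h1 : -1 ≤ s.rreg 3 := by have := h.unit; nlinarith
  have h2 : s.rreg 3 ≤ 1 := by have := h.unit; nlinarith
  constructor
  · rw [h3, h4, Real.sq_sqrt (by linarith), Real.sq_sqrt (by linarith)]
    ring
  · rw [h4]; positivity
  · rw [h3, h4, pow_succ, mul_comm (2 ^ k), pow_mul, half_angle h.unit h.nonneg, h.pow]

/-- Doubling only happens while the order is below T, so the order never exceeds 2T; afterwards the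
step is idle. -/
theorem rootStep_spec {s : Store} {k T : ℕ} (hT : s.ireg 8 = T)
    (hTX : 2 * T ≤ X) (hk : s.ireg 6 = 2 ^ (k + 1)) (hk' : 2 ^ (k + 1) ≤ 2 * T) (hr : RootAt k s) :
    ∃ s', Runs X SP 1 rootStep [6, 7, 8, 10] [3, 4, 5] [] s s' ∧ s'.ireg 7 = s.ireg 7 ∧
      s'.ireg 8 = s.ireg 8 ∧ ∃ k', s'.ireg 6 = 2 ^ (k' + 1) ∧ 2 ^ (k' + 1) ≤ 2 * T ∧ RootAt k' s' ∧
      (T ≤ 2 ^ (k' + 1) ∨ k < k') := by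
  have hreg6 : s.ireg 6 ≤ X := by omega
  have hreg8 : s.ireg 8 ≤ X := by omega
  by_cases h : s.ireg 6 < s.ireg 8
  · have R := (Runs.setI (X := X) (SP := SP) (B := 1) (i := 6) (e := (IExp.mul (IExp.lit 2) (IExp.reg 6)))
      (s := s) (I := [6, 7, 8, 10]) (R := [3, 4, 5]) (A := []) le_rfl (by simp) (by simp [IExp.Ok])
      (by simpa [IExp.regs] using hreg6)).seq
      ((Runs.setR (i := 5) (x := (RExp.sqrt (RExp.div (RExp.add (RExp.ofInt (IExp.lit 1)) (RExp.reg 3))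
      (RExp.ofInt (IExp.lit 2))))) le_rfl (by simp) (by simp [IExp.Ok, RExp.Ok])
        (by simp [IExp.regs, RExp.regs])).seq
      ((Runs.setR (i := 4) (x := (RExp.sqrt (RExp.div (RExp.sub (RExp.ofInt (IExp.lit 1)) (RExp.reg 3))
      (RExp.ofInt (IExp.lit 2))))) le_rfl (by simp) (by simp [IExp.Ok, RExp.Ok])
        (by simp [IExp.regs, RExp.regs])).seq
      (Runs.setR (i := 3) (x := RExp.reg 5) le_rfl (by simp) (by simp [RExp.Ok])
        (by simp [RExp.regs]))))
    replace R := Runs.ifLt_pos (e := IExp.reg 6) (f := IExp.reg 8) (d := Prog.skip) le_rfl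
      (by simp [IExp.Ok]) (by simp [IExp.Ok]) (by simp [IExp.regs, hreg6, hreg8]) h R
    refine ⟨_, R, by simp, by simp, k + 1, by simp [IExp.val, hk, pow_succ]; ring,
      by rw [pow_succ]; omega, ?_, Or.inr (by omega)⟩
    refine RootAt.half hr ?_ ?_
    · simp only [RExp.val, IExp.val, Store.withR_rreg, Store.withI_rreg, Nat.reduceEqDiff, reduceIte,
        Nat.cast_one, Nat.cast_ofNat]
    · simp only [RExp.val, IExp.val, Store.withR_rreg, Store.withI_rreg, Nat.reduceEqDiff, reduceIte,
        Nat.cast_one, Nat.cast_ofNat]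
  · exact ⟨s, Runs.ifLt_neg le_rfl (by simp [IExp.Ok]) (by simp [IExp.Ok])
      (by simp [IExp.regs, hreg6, hreg8]) h (Runs.skip le_rfl), rfl, rfl, k, hk, hk', hr,
      Or.inl (by omega)⟩

/-- The search starts with −1, of order 2 ≤ 2T. T rounds are more than enough and still cheap, which
avoids a logarithm in the loop bound. -/
theorem setupRoot_spec (hb : Bounds X SP B) {s : Store} {d₁ d₂ r : ℕ} (hd₁ : s.ireg 1 = d₁)
    (hd₂ : s.ireg 2 = d₂) (hr : s.ireg 3 = r) (hT : d₁ + d₂ = T + 1) (hTX : 2 * T ≤ SP)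
    (hT1 : 1 ≤ T) (hd₁X : d₁ ≤ X) (hd₂X : d₂ ≤ X) (hrX : r ≤ X) :
    ∃ s' L, ∃ ζ : ℂ, Runs X SP B setupRoot [6, 7, 8, 10] [3, 4, 5] [] s s' ∧ T ≤ L ∧ L ≤ 2 * T ∧
      s'.ireg 6 = L ∧ s'.ireg 7 = 2 * r ∧ s'.ireg 8 = T ∧ IsPrimitiveRoot ζ L ∧ ζ * star ζ = 1 ∧
      s'.rreg 3 = ζ.re ∧ s'.rreg 4 = ζ.im := by
  have hX := hb.le_X
  have R1 := Runs.setI (X := X) (SP := SP) (B := B) (i := 8)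
    (e := (IExp.sub (IExp.add (IExp.reg 1) (IExp.reg 2)) (IExp.lit 1)))
    (s := s) (I := [6, 7, 8, 10]) (R := [3, 4, 5]) (A := []) hb.pos (by simp) (by simp [IExp.Ok])
    (by simp [IExp.regs]; omega)
  have e1 : (s.withI 8 ((IExp.sub (IExp.add (IExp.reg 1) (IExp.reg 2)) (IExp.lit 1)).val s)) =
      s.withI 8 T := by
    congr 1; simp only [IExp.val]; omega
  rw [e1] at R1
  have R2 := Runs.setI (X := X) (SP := SP) (B := B) (i := 7)
    (e := (IExp.mul (IExp.lit 2) (IExp.reg 3)))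
    (s := s.withI 8 T) (I := [6, 7, 8, 10]) (R := [3, 4, 5]) (A := []) hb.pos (by simp)
    (by simp [IExp.Ok]) (by simp [IExp.regs]; omega)
  have R3 := Runs.setI (X := X) (SP := SP) (B := B) (i := 6) (e := IExp.lit 2)
    (s := (s.withI 8 T).withI 7 (2 * r)) (I := [6, 7, 8, 10]) (R := [3, 4, 5]) (A := []) hb.pos
    (by simp) (by simp [IExp.Ok]) (by simp [IExp.regs])
  have e2 : ((s.withI 8 T).withI 7 ((IExp.mul (IExp.lit 2) (IExp.reg 3)).val (s.withI 8 T))) =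
      (s.withI 8 T).withI 7 (2 * r) := by
    congr 1; simp [IExp.val, hr]
  rw [e2] at R2
  have R4 := Runs.setR (X := X) (SP := SP) (B := B) (i := 3) (x := neg (RExp.ofInt (IExp.lit 1)))
    (s := ((s.withI 8 T).withI 7 (2 * r)).withI 6 2) (I := [6, 7, 8, 10]) (R := [3, 4, 5]) (A := [])
    hb.pos (by simp) (by simp [RExp.Ok, IExp.Ok]) (by simp [RExp.regs, IExp.regs])
  have R5 := Runs.setR (X := X) (SP := SP) (B := B) (i := 4) (x := (RExp.ofInt (IExp.lit 0)))
    (s := (((s.withI 8 T).withI 7 (2 * r)).withI 6 2).withR 3 (-1)) (I := [6, 7, 8, 10])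
    (R := [3, 4, 5]) (A := [])
    hb.pos (by simp) (by simp [RExp.Ok, IExp.Ok]) (by simp [RExp.regs, IExp.regs])
  have e3 : (((s.withI 8 T).withI 7 (2 * r)).withI 6 2).withR 3
    ((neg (RExp.ofInt (IExp.lit 1))).val (((s.withI 8 T).withI 7 (2 * r)).withI 6 2)) =
    (((s.withI 8 T).withI 7 (2 * r)).withI 6 2).withR 3 (-1) := by
    congr 1; simp [RExp.val, IExp.val]
  rw [e3] at R4
  have R15 := R1.seq (R2.seq (R3.seq (R4.seq R5)))
  set s5 := ((((s.withI 8 T).withI 7 (2 * r)).withI 6 2).withR 3 (-1)).withR 4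
    ((RExp.ofInt (IExp.lit 0)).val ((((s.withI 8 T).withI 7 (2 * r)).withI 6 2).withR 3 (-1))) with hs5
  have h5 : s5.ireg 6 = 2 ∧ s5.ireg 7 = 2 * r ∧ s5.ireg 8 = T ∧ RootAt 0 s5 := by
    refine ⟨by simp [hs5], by simp [hs5], by simp [hs5], ?_⟩
    constructor <;> simp [hs5, RExp.val, IExp.val]
  clear_value s5
  obtain ⟨s6, R6, h67, h68, k, hk, hk', hrk, hor⟩ := Runs.loop (X := X) (SP := SP) (B := B)
    (I := [6, 7, 8, 10]) (R := [3, 4, 5]) (A := [])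
    (i := 10) (k := T) (B' := 1) (e := IExp.reg 8) (c := rootStep) (s := s5)
    (fun j s' => s'.ireg 7 = 2 * r ∧ s'.ireg 8 = T ∧ ∃ k, s'.ireg 6 = 2 ^ (k + 1) ∧
      2 ^ (k + 1) ≤ 2 * T ∧ RootAt k s' ∧ (T ≤ 2 ^ (k + 1) ∨ j ≤ k))
    (by simp [IExp.Ok]) (by simp [IExp.regs]; omega) h5.2.2.1 hb.pos le_rfl
    (by have := hb.le_B; omega) (by simp)
    ⟨h5.2.1, h5.2.2.1, 0, h5.1, by omega, h5.2.2.2, Or.inr le_rfl⟩ (by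
      rintro j hj s' f ⟨h7, h8, k, h6, hk', hrk, hor⟩
      obtain ⟨s'', R, h7', h8', k', h6', hk'', hrk', hor'⟩ := rootStep_spec (X := X) (SP := SP)
        (s := s'.withI 10 j) (k := k) (T := T) (by simpa using h8) (by omega) (by simpa using h6) hk'
        ⟨hrk.unit, hrk.nonneg, hrk.pow⟩
      refine ⟨s'', R, ?_, ?_, k', h6', hk'', hrk', ?_⟩
      · rw [h7']; simpa using h7
      · rw [h8']; simpa using h8
      · rcases hor' with h | h
        · exact Or.inl h
        · rcases hor with h2 | h2
          · refine Or.inl (h2.trans (Nat.pow_le_pow_right (by norm_num) (by omega)))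
          · exact Or.inr (by omega))
  refine ⟨s6, 2 ^ (k + 1), _, ?_, ?_, hk', hk, h67, h68, hrk.isPrimitiveRoot, ?_, ?_, ?_⟩
  · exact R1.seq (R2.seq (R3.seq (R4.seq (R5.seq R6))))
  · rcases hor with h | h
    · exact h
    -- Here every round has doubled the order, so it exceeds 2^T ≥ T.
    · exact h.trans ((Nat.lt_two_pow_self).le.trans (Nat.pow_le_pow_right (by norm_num) (by omega)))
  · have := hrk.unit
    apply Complex.ext
    · simp; nlinarith
    · simp; ring
  · simp
  · simp

end RAM

/-- Inverse number of the block positions of a block Hankel matrix that hold block `t`. -/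
noncomputable def invCount (d₁ d₂ t : ℕ) : ℝ :=
  1 / ∑ a ∈ Finset.range d₁, ∑ b ∈ Finset.range d₂, if a + b = t then 1 else 0

namespace RAM

variable {n d₁ d₂ r m N T L X SP B : ℕ}

/-! ### Tables -/

theorem nest_runs (hXB : Bounds X SP B) {rs : List ℕ} {dst : ℕ} {l : List (ℕ × IExp)} {pos : IExp}
    {x : RExp} {s : Store} (hrs : ∀ i ∈ rs, s.ireg i ≤ X) (hside : NestSide rs dst l pos x)
    (hb : ∀ t ∈ l, t.2.val s ≤ SP) (hB : boxVol l s ≤ B)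
    (hok : boxAll l (fun s => pos.Ok X SP s ∧ pos.val s < SP ∧ x.Ok X SP s) s) :
    ∃ s', Runs X SP B (nest l (addTo dst pos x)) (l.map Prod.fst) [] [dst] s s' ∧
      ∀ y, s'.rarr dst y =
        s.rarr dst y + boxSum l (fun s => if pos.val s = y then x.val s else 0) s := by
  obtain ⟨h1, h2, h3⟩ := nest_rule hXB hrs hside hb hB hok
  exact ⟨_, Runs.of h1 h2, h3⟩

theorem compute_runs (hXB : Bounds X SP B) {rs : List ℕ} {i dst : ℕ} {len : IExp}
    {l : List (ℕ × IExp)} {pos : IExp}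
    {x : RExp} {s : Store} (hrs : ∀ i ∈ rs, s.ireg i ≤ X) (hside : NestSide rs dst l pos x)
    (hlen : LenSide rs i len l) (hlSP : len.val s ≤ SP)
    (hb : ∀ t ∈ l, t.2.val s ≤ SP) (hB : boxVol l s ≤ B)
    (hok : boxAll l (fun s => pos.Ok X SP s ∧ pos.val s < SP ∧ x.Ok X SP s) s) :
    ∃ s', Runs X SP B (compute i dst len l pos x) (l.map Prod.fst) [] [dst] s s' ∧
      ∀ y < len.val s, s'.rarr dst y =
        boxSum l (fun s => if pos.val s = y then x.val s else 0) s := by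
  obtain ⟨h1, h2, h3⟩ := compute_rule hXB hrs hside hlen hlSP hb hB hok
  exact ⟨_, Runs.of h1 h2, h3⟩

theorem powerTable_spec (D : Dims n d₁ d₂ r m T L X SP B) {s : Store} {ζ : ℂ}
    (hs : Regs n d₁ d₂ r m N T L s) (h3 : s.rreg 3 = ζ.re) (h4 : s.rreg 4 = ζ.im)
    (h5 : s.rreg 5 = 1) (h6 : s.rreg 6 = 0) :
    ∃ s', Runs X SP B (Prog.loop 10 (IExp.reg 6) tableStep) [10, 11] [5, 6, 7] [8, 9] s s' ∧
      ∀ k < L, CAt s' 8 9 k (ζ ^ k) := by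
  have hX := D.bounds.le_X
  have hL := D.L_le
  obtain ⟨s', R, -, -, h⟩ := Runs.loop (X := X) (SP := SP) (B := B) (I := [10, 11]) (R := [5, 6, 7])
    (A := [8, 9]) (i := 10) (k := L) (B' := 1) (e := IExp.reg 6) (c := tableStep) (s := s)
    (fun j s' => s'.rreg 5 = (ζ ^ j).re ∧ s'.rreg 6 = (ζ ^ j).im ∧ ∀ k < j, CAt s' 8 9 k (ζ ^ k))
    (by simp [IExp.Ok]) (by simp [IExp.regs, hs.L_eq]; omega) hs.L_eq D.bounds.pos le_rfl
    (by have := D.bounds.le_B; omega) (by simp) ⟨by simp [h5], by simp [h6], by simp⟩ (by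
    rintro j hj s' f ⟨i5, i6, i⟩
    have i3 : s'.rreg 3 = ζ.re := (f.rreg 3 (by simp)).trans h3
    have i4 : s'.rreg 4 = ζ.im := (f.rreg 4 (by simp)).trans h4
    have R := (Runs.putR (X := X) (SP := SP) (B := 1) (a := 8) (p := IExp.reg 10) (x := RExp.reg 5)
      (s := s'.withI 10 j) (I := [10, 11]) (R := [5, 6, 7]) (A := [8, 9]) le_rfl (by simp)
      (by simp [IExp.Ok]) (by simp [IExp.val]; omega) (by simp [RExp.Ok])
      (by simp [IExp.regs, RExp.regs]; omega)).seq
      ((Runs.putR (a := 9) (p := IExp.reg 10) (x := RExp.reg 6) le_rfl (by simp)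
      (by simp [IExp.Ok]) (by simp [IExp.val]; omega) (by simp [RExp.Ok])
      (by simp [IExp.regs, RExp.regs]; omega)).seq
      ((Runs.setR (i := 7) (x := RExp.sub (RExp.mul (RExp.reg 5) (RExp.reg 3))
    (RExp.mul (RExp.reg 6) (RExp.reg 4))) le_rfl (by simp) (by simp [RExp.Ok])
        (by simp [RExp.regs])).seq
      ((Runs.setR (i := 6) (x := RExp.add (RExp.mul (RExp.reg 5) (RExp.reg 4))
    (RExp.mul (RExp.reg 6) (RExp.reg 3))) le_rfl (by simp) (by simp [RExp.Ok])
        (by simp [RExp.regs])).seq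
      (Runs.setR (i := 5) (x := RExp.reg 7) le_rfl (by simp) (by simp [RExp.Ok])
        (by simp [RExp.regs])))))
    refine ⟨_, R, ?_, ?_, fun k hk => ?_⟩
    · simp [RExp.val, i3, i4, i5, i6, pow_succ]
    · simp [RExp.val, i3, i4, i5, i6, pow_succ]
    · rcases Nat.lt_succ_iff_lt_or_eq.mp hk with h | rfl
      · simp only [CAt, RExp.val, IExp.val, Store.put_rarr, Store.withR_rarr, Store.withI_rarr,
          Store.put_ireg, Store.withI_ireg, reduceIte, h.ne, and_false]
        exact i k h
      · simp [CAt, RExp.val, IExp.val, i5, i6])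
  exact ⟨s', R, h⟩

/-- Block counts are obtained by incrementing a counter for each block position, and the spectrum of
their reciprocals by its definition; all of this takes O(T²) operations. -/
theorem setupTables_spec (D : Dims n d₁ d₂ r m T L X SP B) {s : Store} {ζ : ℂ}
    (hs : Regs n d₁ d₂ r m N T L s) (hN : N ≤ X) (h3 : s.rreg 3 = ζ.re) (h4 : s.rreg 4 = ζ.im)
    (hζ : ζ ^ L = 1) :
    ∃ s', Runs X SP B setupTables [10, 11] [5, 6, 7] [8, 9, 10, 11, 12, 38] s s' ∧
      (∀ k < L, CAt s' 8 9 k (ζ ^ k)) ∧ (∀ t < T, s'.rarr 10 t = invCount d₁ d₂ t) ∧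
      ∀ k < L, CAt s' 11 12 k (∑ t ∈ Finset.range T, (invCount d₁ d₂ t : ℂ) * ζ ^ (k * t)) := by
  have hb := D.bounds
  have hT1 := D.one_le_T
  have hL1 := D.one_le_L
  have hT := D.T_le
  have hL := D.L_le
  have hd₁ := D.d₁_le
  have hd₂ := D.d₂_le
  have hdT := D.hT
  have hvol : ∀ {x y : ℕ}, x ≤ 2 * T → y ≤ T → x * y ≤ B := by
    intro x y hx hy
    refine le_trans ?_ D.hB
    calc x * y ≤ 2 * T * T := Nat.mul_le_mul hx hy
      _ = 2 * (1 * T * (1 * 1 * T)) := by ring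
      _ ≤ 2 * (r * T * (n * r * T)) := by gcongr <;> first | exact D.hr | exact D.hn
      _ ≤ 16 * (r * T * (m + n * r * T)) := by gcongr <;> omega
  have R1 := (Runs.setR (X := X) (SP := SP) (B := B) (i := 5) (x := (RExp.ofInt (IExp.lit 1)))
    (s := s) (I := [10, 11]) (R := [5, 6, 7]) (A := [8, 9, 10, 11, 12, 38]) hb.pos (by simp)
    (by simp [RExp.Ok, IExp.Ok]) (by simp [IExp.regs, RExp.regs]))
  have R2 := (Runs.setR (X := X) (SP := SP) (B := B) (i := 6) (x := (RExp.ofInt (IExp.lit 0)))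
    (s := s.withR 5 ((RExp.ofInt (IExp.lit 1)).val s)) (I := [10, 11]) (R := [5, 6, 7])
    (A := [8, 9, 10, 11, 12, 38]) hb.pos (by simp)
    (by simp [RExp.Ok, IExp.Ok]) (by simp [IExp.regs, RExp.regs]))
  set s2 := (s.withR 5 ((RExp.ofInt (IExp.lit 1)).val s)).withR 6 ((RExp.ofInt (IExp.lit 0)).val
    (s.withR 5 ((RExp.ofInt (IExp.lit 1)).val s))) with hs2
  have R12 := R1.seq R2
  obtain ⟨s3, R3, v3⟩ := powerTable_spec D (s := s2) (ζ := ζ) (hs.frame R12.frame (by intro i hi; simp; omega))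
    (by simp [hs2, h3]) (by simp [hs2, h4]) (by simp [hs2, RExp.val, IExp.val])
    (by simp [hs2, RExp.val, IExp.val])
  clear_value s2
  have S3 := R12.seq (R3.mono (I' := [10, 11]) (R' := [5, 6, 7]) (A' := [8, 9, 10, 11, 12, 38])
    (by simp) (by simp) (by simp))
  have hr3 := hs.frame S3.frame (by intro i hi; simp; omega)
  -- the number of the positions of a block
  have key4 := compute_runs hb (rs := List.range 9) (s := s3) (i := 10) (dst := 38)
    (len := IExp.reg 8)
    (l := [(10, IExp.reg 1), (11, IExp.reg 2)]) (pos := IExp.add (IExp.reg 10) (IExp.reg 11))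
    (x := RExp.ofInt (IExp.lit 1)) (hr3.le D hN) (by decide) (by decide)
    (by simp only [IExp.val, hr3.T_eq]; omega)
    (by simp only [List.forall_mem_cons, IExp.val, hr3.d₁_eq, hr3.d₂_eq, List.not_mem_nil,
          IsEmpty.forall_iff, implies_true, and_true]; omega)
    (by simp only [boxVol, List.map, List.prod_cons, List.prod_nil, IExp.val, hr3.d₁_eq, hr3.d₂_eq,
          max_eq_right D.hd₁, max_eq_right D.hd₂, mul_one]; exact hvol (by omega) (by omega))
    (by
      simp only [boxAll, IExp.val, IExp.Ok, RExp.Ok, Store.withI_ireg, Nat.reduceEqDiff, reduceIte,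
        hr3.d₁_eq, hr3.d₂_eq, true_and, and_true]
      intro a ha b hb; omega)
  obtain ⟨s4, R4, v4⟩ := key4
  replace v4 : ∀ t < T, s4.rarr 38 t =
      ∑ a ∈ Finset.range d₁, ∑ b ∈ Finset.range d₂, if a + b = t then 1 else 0 := by
    intro t ht
    rw [v4 t (by simpa [IExp.val, hr3.T_eq] using ht)]
    simp only [boxSum, IExp.val, RExp.val, Store.withI_ireg, Nat.reduceEqDiff, reduceIte,
        hr3.d₁_eq, hr3.d₂_eq, Nat.cast_one]
  have S4 := S3.seq (R4.mono (by simp) (by simp) (by simp))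
  have hr4 := hs.frame S4.frame (by intro i hi; simp; omega)
  -- the weights
  have key5 := compute_runs hb (rs := List.range 9) (s := s4) (i := 10) (dst := 10)
    (len := IExp.reg 8)
    (l := [(10, IExp.reg 8)]) (pos := IExp.reg 10)
    (x := RExp.div (RExp.ofInt (IExp.lit 1)) (RExp.get 38 (IExp.reg 10))) (hr4.le D hN) (by decide)
    (by decide)
    (by simp only [IExp.val, hr4.T_eq]; omega)
    (by simp only [List.forall_mem_cons, IExp.val, hr4.T_eq, List.not_mem_nil,
          IsEmpty.forall_iff, implies_true, and_true]; omega)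
    (by simp only [boxVol, List.map, List.prod_cons, List.prod_nil, IExp.val, hr4.T_eq,
          max_eq_right hT1]; exact hvol (by omega) (by omega))
    (by
      simp only [boxAll, IExp.val, IExp.Ok, RExp.Ok, Store.withI_ireg, reduceIte,
        hr4.T_eq, true_and]
      intro a ha; omega)
  obtain ⟨s5, R5, v5⟩ := key5
  replace v5 : ∀ t < T, s5.rarr 10 t = invCount d₁ d₂ t := by
    intro t ht
    rw [v5 t (by simpa [IExp.val, hr4.T_eq] using ht)]
    simp only [boxSum, IExp.val, RExp.val, Store.withI_ireg, Store.withI_rarr, reduceIte,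
        hr4.T_eq, Nat.cast_one]
    rw [Finset.sum_ite_eq', if_pos (Finset.mem_range.mpr ht), v4 t ht, invCount]
  have S5 := S4.seq (R5.mono (by simp) (by simp) (by simp))
  have hr5 := hs.frame S5.frame (by intro i hi; simp; omega)
  have c5 : ∀ k < L, CAt s5 8 9 k (ζ ^ k) := fun k hk =>
    ((v3 k hk).frame R4.frame (by simp) (by simp)).frame R5.frame (by simp) (by simp)
  have hmod : ∀ k, CAt s5 8 9 (k % L) (ζ ^ k) := fun k => by
    rw [pow_eq_pow_mod k hζ]; exact c5 _ (Nat.mod_lt _ hL1)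
  -- their transform
  have key6 := compute_runs hb (rs := List.range 9) (s := s5) (i := 10) (dst := 11)
    (len := IExp.reg 6)
    (l := [(10, IExp.reg 6), (11, IExp.reg 8)]) (pos := IExp.reg 10)
    (x := RExp.mul (RExp.get 10 (IExp.reg 11)) (RExp.get 8
      (IExp.mod (IExp.mul (IExp.reg 10) (IExp.reg 11)) (IExp.reg 6)))) (hr5.le D hN) (by decide)
    (by decide)
    (by simp only [IExp.val, hr5.L_eq]; omega)
    (by simp only [List.forall_mem_cons, IExp.val, hr5.T_eq, hr5.L_eq, List.not_mem_nil,
          IsEmpty.forall_iff, implies_true, and_true]; omega)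
    (by simp only [boxVol, List.map, List.prod_cons, List.prod_nil, IExp.val, hr5.T_eq, hr5.L_eq,
          max_eq_right hT1, max_eq_right hL1, mul_one]; exact hvol D.hLT le_rfl)
    (by
      simp only [boxAll, IExp.val, IExp.Ok, RExp.Ok, Store.withI_ireg, Nat.reduceEqDiff, reduceIte,
        hr5.T_eq, hr5.L_eq, true_and, and_true]
      intro a ha t ht
      have := Nat.mod_lt (a * t) hL1
      omega)
  obtain ⟨s6, R6, v6⟩ := key6
  have S6 := S5.seq (R6.mono (by simp) (by simp) (by simp))
  have hr6 := hs.frame S6.frame (by intro i hi; simp; omega)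
  have key7 := compute_runs hb (rs := List.range 9) (s := s6) (i := 10) (dst := 12)
    (len := IExp.reg 6)
    (l := [(10, IExp.reg 6), (11, IExp.reg 8)]) (pos := IExp.reg 10)
    (x := RExp.mul (RExp.get 10 (IExp.reg 11)) (RExp.get 9
      (IExp.mod (IExp.mul (IExp.reg 10) (IExp.reg 11)) (IExp.reg 6)))) (hr6.le D hN) (by decide)
    (by decide)
    (by simp only [IExp.val, hr6.L_eq]; omega)
    (by simp only [List.forall_mem_cons, IExp.val, hr6.T_eq, hr6.L_eq, List.not_mem_nil,
          IsEmpty.forall_iff, implies_true, and_true]; omega)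
    (by simp only [boxVol, List.map, List.prod_cons, List.prod_nil, IExp.val, hr6.T_eq, hr6.L_eq,
          max_eq_right hT1, max_eq_right hL1, mul_one]; exact hvol D.hLT le_rfl)
    (by
      simp only [boxAll, IExp.val, IExp.Ok, RExp.Ok, Store.withI_ireg, Nat.reduceEqDiff, reduceIte,
        hr6.T_eq, hr6.L_eq, true_and, and_true]
      intro a ha t ht
      have := Nat.mod_lt (a * t) hL1
      omega)
  obtain ⟨s7, R7, v7⟩ := key7
  refine ⟨s7, R1.seq (R2.seq ((R3.mono (by simp) (by simp) (by simp)).seq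
    ((R4.mono (by simp) (by simp) (by simp)).seq ((R5.mono (by simp) (by simp) (by simp)).seq
    ((R6.mono (by simp) (by simp) (by simp)).seq (R7.mono (by simp) (by simp) (by simp))))))),
    fun k hk => ((c5 k hk).frame R6.frame (by simp) (by simp)).frame R7.frame (by simp) (by simp),
    fun t ht => ?_, fun k hk => ⟨?_, ?_⟩⟩
  · rw [R7.frame.rarr 10 (by simp), R6.frame.rarr 10 (by simp), v5 t ht]
  · rw [R7.frame.rarr 11 (by simp), v6 k (by simpa [IExp.val, hr5.L_eq] using hk), Complex.re_sum]
    simp only [boxSum, IExp.val, RExp.val, Store.withI_ireg, Store.withI_rarr, Nat.reduceEqDiff,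
      reduceIte, hr5.L_eq, hr5.T_eq, sum_ite_const]
    rw [Finset.sum_ite_eq', if_pos (Finset.mem_range.mpr hk)]
    refine Finset.sum_congr rfl fun t ht => ?_
    rw [v5 t (Finset.mem_range.mp ht), (hmod _).1, Complex.re_ofReal_mul]
  · rw [v7 k (by simpa [IExp.val, hr6.L_eq] using hk), Complex.im_sum]
    simp only [boxSum, IExp.val, RExp.val, Store.withI_ireg, Store.withI_rarr, Nat.reduceEqDiff,
      reduceIte, hr6.L_eq, hr6.T_eq, sum_ite_const]
    rw [Finset.sum_ite_eq', if_pos (Finset.mem_range.mpr hk)]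
    refine Finset.sum_congr rfl fun t ht => ?_
    rw [R6.frame.rarr 10 (by simp), R6.frame.rarr 9 (by simp), v5 t (Finset.mem_range.mp ht),
      (hmod _).2, Complex.im_ofReal_mul]

end RAM

/-! ### Layout of matrices and parameters in arrays -/

theorem sum_blk {n d : ℕ} (f : ℕ → ℕ → ℝ) :
    ∑ a ∈ Finset.range d, ∑ i ∈ Finset.range n, f a i = ∑ p : Blk n d, f p.1 p.2 := by
  rw [Fintype.sum_prod_type, Finset.sum_range]
  exact Finset.sum_congr rfl fun a _ => Finset.sum_range _

/-- Position of an entry of a parameter in an array that holds all of them. -/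
def flat {n d₁ d₂ r : ℕ} : Par n d₁ d₂ r → ℕ
  | Sum.inl (i, j) => i * r + j
  | Sum.inr (Sum.inl (i, q)) => r * r + (i * (d₂ * n) + (q.1 * n + q.2))
  | Sum.inr (Sum.inr (p, j)) => r * r + r * (d₂ * n) + ((p.1 * n + p.2) * r + j)

section Flat

variable {n d₁ d₂ r : ℕ}

theorem blk_lt {d : ℕ} (q : Blk n d) : (q.1 : ℕ) * n + q.2 < d * n := idx_lt q.1.isLt q.2.isLt

theorem flat_lt (c : Par n d₁ d₂ r) : flat c < r * r + r * (d₂ * n) + d₁ * n * r := by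
  rcases c with ⟨i, j⟩ | ⟨i, q⟩ | ⟨p, j⟩
  · have := idx_lt i.isLt j.isLt
    simp only [flat]; omega
  · have := idx_lt i.isLt (blk_lt q)
    simp only [flat]; omega
  · have := idx_lt (blk_lt p) j.isLt
    simp only [flat]; omega

/-- The three components of a parameter occupy consecutive disjoint segments of the array, so a loop
over one of them leaves the others unchanged. -/
theorem sum_flat1 (f : ℕ → ℕ → ℝ) (c : Par n d₁ d₂ r) :
    ∑ i ∈ Finset.range r, ∑ j ∈ Finset.range r, (if i * r + j = flat c then f i j else 0) =
      match c with
      | Sum.inl (i, j) => f i j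
      | Sum.inr _ => 0 := by
  rcases c with ⟨i, j⟩ | c
  · exact sum_idx2 i.isLt j.isLt f
  · refine Finset.sum_eq_zero fun i hi => Finset.sum_eq_zero fun j hj => if_neg ?_
    have := idx_lt (Finset.mem_range.mp hi) (Finset.mem_range.mp hj)
    rcases c with ⟨i, q⟩ | ⟨p, j⟩ <;> simp only [flat] <;> omega

theorem sum_flat2 (f : ℕ → ℕ → ℕ → ℝ) (c : Par n d₁ d₂ r) :
    ∑ i ∈ Finset.range r, ∑ b ∈ Finset.range d₂, ∑ j ∈ Finset.range n,
      (if r * r + (i * (d₂ * n) + (b * n + j)) = flat c then f i b j else 0) =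
      match c with
      | Sum.inr (Sum.inl (i, q)) => f i q.1 q.2
      | _ => 0 := by
  have key : ∀ i ∈ Finset.range r, ∀ b ∈ Finset.range d₂, ∀ j ∈ Finset.range n,
      i * (d₂ * n) + (b * n + j) < r * (d₂ * n) := fun i hi b hb j hj =>
    idx_lt (Finset.mem_range.mp hi) (idx_lt (Finset.mem_range.mp hb) (Finset.mem_range.mp hj))
  rcases c with ⟨i, j⟩ | ⟨i, q⟩ | ⟨p, j⟩
  · refine Finset.sum_eq_zero fun i' hi => Finset.sum_eq_zero fun b hb =>
      Finset.sum_eq_zero fun j' hj => if_neg ?_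
    have := idx_lt i.isLt j.isLt
    simp only [flat]; omega
  · dsimp only
    rw [← sum_idx3 i.isLt q.1.isLt q.2.isLt f]
    refine Finset.sum_congr rfl fun i' _ => Finset.sum_congr rfl fun b _ =>
      Finset.sum_congr rfl fun j _ => if_congr ?_ rfl rfl
    simp only [flat, Nat.add_left_cancel_iff]
    rw [add_mul, add_mul, mul_assoc, mul_assoc, add_assoc, add_assoc]
  · refine Finset.sum_eq_zero fun i' hi => Finset.sum_eq_zero fun b hb =>
      Finset.sum_eq_zero fun j' hj => if_neg ?_
    have := key i' hi b hb j' hj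
    simp only [flat]; omega

theorem sum_flat3 (f : ℕ → ℕ → ℕ → ℝ) (c : Par n d₁ d₂ r) :
    ∑ a ∈ Finset.range d₁, ∑ i ∈ Finset.range n, ∑ j ∈ Finset.range r,
      (if r * r + r * (d₂ * n) + ((a * n + i) * r + j) = flat c then f a i j else 0) =
      match c with
      | Sum.inr (Sum.inr (p, j)) => f p.1 p.2 j
      | _ => 0 := by
  rcases c with ⟨i, j⟩ | ⟨i, q⟩ | ⟨p, j⟩
  · refine Finset.sum_eq_zero fun a _ => Finset.sum_eq_zero fun b _ =>
      Finset.sum_eq_zero fun j' _ => if_neg ?_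
    have := idx_lt i.isLt j.isLt
    simp only [flat]; omega
  · refine Finset.sum_eq_zero fun a _ => Finset.sum_eq_zero fun b _ =>
      Finset.sum_eq_zero fun j' _ => if_neg ?_
    have := idx_lt i.isLt (blk_lt q)
    simp only [flat]; omega
  · dsimp only
    rw [← sum_idx3 p.1.isLt p.2.isLt j.isLt f]
    refine Finset.sum_congr rfl fun i' _ => Finset.sum_congr rfl fun b _ =>
      Finset.sum_congr rfl fun j _ => if_congr ?_ rfl rfl
    simp only [flat, Nat.add_left_cancel_iff]

/-- A loop that fills the first B of W columns of a matrix stored row by row. Together with the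
variant with an offset it assembles two matrices side by side. -/
theorem sum_low {A C B W a c k : ℕ} (hBW : B ≤ W) (ha : a < A) (hc : c < C) (hk : k < W)
    (f : ℕ → ℕ → ℕ → ℝ) :
    ∑ a' ∈ Finset.range A, ∑ c' ∈ Finset.range C, ∑ k' ∈ Finset.range B,
      (if (a' * C + c') * W + k' = (a * C + c) * W + k then f a' c' k' else 0) =
      if k < B then f a c k else 0 := by
  have h : ∀ a' c', ∑ k' ∈ Finset.range B,
      (if (a' * C + c') * W + k' = (a * C + c) * W + k then f a' c' k' else 0) =
      if a' * C + c' = a * C + c then (if k < B then f a' c' k else 0) else 0 := by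
    intro a' c'
    rw [Finset.sum_congr rfl fun k' hk' => if_congr
      (idx_inj ((Finset.mem_range.mp hk').trans_le hBW) hk) rfl rfl]
    simp only [ite_and, sum_ite_const, Finset.sum_ite_eq', Finset.mem_range]
  simp_rw [h]
  exact sum_idx2 ha hc _

theorem sum_high {A C B W o a c k : ℕ} (hBW : o + B ≤ W) (ha : a < A) (hc : c < C) (hk : k < W)
    (f : ℕ → ℕ → ℕ → ℝ) :
    ∑ a' ∈ Finset.range A, ∑ c' ∈ Finset.range C, ∑ k' ∈ Finset.range B,
      (if (a' * C + c') * W + (o + k') = (a * C + c) * W + k then f a' c' k' else 0) =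
      if o ≤ k ∧ k < o + B then f a c (k - o) else 0 := by
  have h : ∀ a' c', ∑ k' ∈ Finset.range B,
      (if (a' * C + c') * W + (o + k') = (a * C + c) * W + k then f a' c' k' else 0) =
      if a' * C + c' = a * C + c then (if o ≤ k ∧ k < o + B then f a' c' (k - o) else 0) else 0 := by
    intro a' c'
    have e : ∀ k' ∈ Finset.range B, ((a' * C + c') * W + (o + k') = (a * C + c) * W + k ↔
        a' * C + c' = a * C + c ∧ (o ≤ k ∧ k' = k - o)) := fun k' hk' => by
      rw [idx_inj (by have := Finset.mem_range.mp hk'; omega) hk]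
      refine and_congr_right fun _ => ?_
      omega
    rw [Finset.sum_congr rfl fun k' hk' => if_congr (e k' hk') rfl rfl]
    simp only [ite_and, sum_ite_const, Finset.sum_ite_eq', Finset.mem_range]
    congr 1
    by_cases h1 : o ≤ k
    · simp only [h1, if_true]
      exact if_congr (by omega) rfl rfl
    · simp [h1]
  simp_rw [h]
  exact sum_idx2 ha hc _

end Flat

/-! ### Size estimates for array positions and index boxes -/

namespace Dims

variable {n d₁ d₂ r m T L X SP B : ℕ}

theorem rr_le (D : Dims n d₁ d₂ r m T L X SP B) : r * r ≤ r * n * T := by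
  calc r * r = r * r * 1 := (mul_one _).symm
    _ ≤ r * n * T := Nat.mul_le_mul (Nat.mul_le_mul_left _ D.hrn) D.one_le_T

theorem dnr_le (_D : Dims n d₁ d₂ r m T L X SP B) {d : ℕ} (hd : d ≤ T) :
    d * n * r ≤ r * n * T := by
  calc d * n * r ≤ T * n * r := by gcongr
    _ = r * n * T := by ring

theorem tot_le (D : Dims n d₁ d₂ r m T L X SP B) :
    r * r + r * (d₂ * n) + d₁ * n * r ≤ 3 * (r * n * T) := by
  have h1 := D.rr_le
  have h2 := D.dnr_le D.d₁_le
  have h3 := D.dnr_le D.d₂_le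
  have h4 : r * (d₂ * n) = d₂ * n * r := by ring
  omega

theorem rr_lt (D : Dims n d₁ d₂ r m T L X SP B) {i j : ℕ} (hi : i < r) (hj : j < r) :
    i * r + j < SP :=
  (idx_lt hi hj).trans_le (D.le_SP (by have := D.rr_le; omega))

theorem dnr_lt (D : Dims n d₁ d₂ r m T L X SP B) {d a i k : ℕ} (hd : d ≤ T) (ha : a < d)
    (hi : i < n) (hk : k < r) : (a * n + i) * r + k < SP :=
  (idx_lt (idx_lt ha hi) hk).trans_le (D.le_SP (by have := D.dnr_le hd; omega))

theorem dnw_lt (D : Dims n d₁ d₂ r m T L X SP B) {d a i k : ℕ} (hd : d ≤ T) (ha : a < d)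
    (hi : i < n) (hk : k < 2 * r) : (a * n + i) * (2 * r) + k < SP :=
  (idx_lt (idx_lt ha hi) hk).trans_le (D.le_SP (by
    have := D.dnr_le hd
    have e : d * n * (2 * r) = 2 * (d * n * r) := by ring
    omega))

theorem pos2_lt (D : Dims n d₁ d₂ r m T L X SP B) {i b j : ℕ} (hi : i < r) (hb : b < d₂)
    (hj : j < n) : r * r + (i * (d₂ * n) + (b * n + j)) < SP :=
  (show _ < 3 * (r * n * T) + 1 by
    have := idx_lt hi (idx_lt hb hj); have := D.tot_le; omega).trans_le (D.le_SP (by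
    have := D.rnT_pos; omega))

theorem pos3_lt (D : Dims n d₁ d₂ r m T L X SP B) {a i k : ℕ} (ha : a < d₁) (hi : i < n)
    (hk : k < r) : r * r + r * (d₂ * n) + ((a * n + i) * r + k) < SP :=
  (show _ < 3 * (r * n * T) + 1 by
    have := idx_lt (idx_lt ha hi) hk; have := D.tot_le; omega).trans_le (D.le_SP (by
    have := D.rnT_pos; omega))

theorem le_B (D : Dims n d₁ d₂ r m T L X SP B) {x : ℕ} (h : x ≤ 4 * (r * n * T * r)) : x ≤ B := by
  refine le_trans ?_ D.hB
  calc x ≤ 4 * (r * n * T * r) := h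
    _ = 4 * (r * T * (n * r * 1)) := by ring
    _ ≤ 4 * (r * T * (n * r * T)) := by gcongr; exact D.one_le_T
    _ ≤ 16 * (r * T * (m + n * r * T)) := by gcongr <;> omega

theorem le_B' (D : Dims n d₁ d₂ r m T L X SP B) {x : ℕ} (h : x ≤ 4 * (r * n * T)) : x ≤ B :=
  D.le_B (h.trans (by
    have : r * n * T * 1 ≤ r * n * T * r := Nat.mul_le_mul_left _ D.hr
    omega))

end Dims

namespace RAM

variable {n d₁ d₂ r m N T L X SP B : ℕ}

/-! ### Contents of arrays -/

/-- A real array holds a matrix with `n` rows in a block. -/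
def MatAt {d w : ℕ} (s : Store) (a : ℕ) (M : Matrix (Blk n d) (Fin w) ℝ) : Prop :=
  ∀ (p : Blk n d) (k : Fin w), s.rarr a ((p.1 * n + p.2) * w + k) = M p k

/-- A real array holds a matrix, row by row. -/
def SqAt (s : Store) (a : ℕ) (M : Matrix (Fin r) (Fin r) ℝ) : Prop :=
  ∀ i j : Fin r, s.rarr a (i * r + j) = M i j

/-- A real array holds a vector. -/
def VecAt (s : Store) (a : ℕ) (v : Fin m → ℝ) : Prop := ∀ l : Fin m, s.rarr a l = v l

/-- A real array holds a parameter. -/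
def FlatAt (s : Store) (a : ℕ) (γ : Par n d₁ d₂ r → ℝ) : Prop := ∀ c, s.rarr a (flat c) = γ c

/-- The constant part of the memory contents. -/
structure Ctx (S : StepData n d₁ d₂ r m) (N T L : ℕ) (ζ : ℂ) (s : Store) : Prop where
  regs : Regs n d₁ d₂ r m N T L s
  lam_eq : s.rreg 0 = S.lam
  ε_eq : s.rreg 1 = S.ε
  row_eq : ∀ l : Fin m, s.iarr 0 l = (S.ω l).1
  col_eq : ∀ l : Fin m, s.iarr 1 l = (S.ω l).2.1
  time_eq : ∀ l : Fin m, s.iarr 2 l = (S.ω l).2.2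
  U_eq : MatAt s 0 S.U
  V_eq : MatAt s 1 S.V
  σ_eq : ∀ i : Fin r, s.rarr 2 i = S.σ i
  y_eq : VecAt s 3 S.y
  root : ∀ k < L, CAt s 8 9 k (ζ ^ k)
  weight : ∀ t < T, s.rarr 10 t = invCount d₁ d₂ t
  weightHat : ∀ k < L, CAt s 11 12 k (∑ t ∈ Finset.range T, (invCount d₁ d₂ t : ℂ) * ζ ^ (k * t))

/-- Among the low-numbered arrays only 4 to 7, which hold the parameter and the output, are not part
of the constant data. -/
theorem Ctx.frame {S : StepData n d₁ d₂ r m} {ζ : ℂ} {s s' : Store} {I R A : List ℕ}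
    (h : Ctx S N T L ζ s) (hf : Frame I R [] A s s') (hI : ∀ i < 9, i ∉ I)
    (hR : 0 ∉ R ∧ 1 ∉ R) (hA : ∀ a < 13, a ∈ A → a = 4 ∨ a = 5 ∨ a = 6 ∨ a = 7) :
    Ctx S N T L ζ s' := by
  have e : ∀ a < 13, (a ≠ 4 ∧ a ≠ 5 ∧ a ≠ 6 ∧ a ≠ 7) → a ∉ A := fun a ha h hm => by
    have := hA a ha hm; omega
  exact
  { regs := h.regs.frame hf hI
    lam_eq := (hf.rreg 0 hR.1).trans h.lam_eq
    ε_eq := (hf.rreg 1 hR.2).trans h.ε_eq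
    row_eq := fun l => by rw [hf.iarr 0 (by simp)]; exact h.row_eq l
    col_eq := fun l => by rw [hf.iarr 1 (by simp)]; exact h.col_eq l
    time_eq := fun l => by rw [hf.iarr 2 (by simp)]; exact h.time_eq l
    U_eq := fun p k => by rw [hf.rarr 0 (e 0 (by omega) (by omega))]; exact h.U_eq p k
    V_eq := fun p k => by rw [hf.rarr 1 (e 1 (by omega) (by omega))]; exact h.V_eq p k
    σ_eq := fun i => by rw [hf.rarr 2 (e 2 (by omega) (by omega))]; exact h.σ_eq i
    y_eq := fun l => by rw [hf.rarr 3 (e 3 (by omega) (by omega))]; exact h.y_eq l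
    root := fun k hk => (h.root k hk).frame hf (e 8 (by omega) (by omega))
      (e 9 (by omega) (by omega))
    weight := fun t ht => by rw [hf.rarr 10 (e 10 (by omega) (by omega))]; exact h.weight t ht
    weightHat := fun k hk => (h.weightHat k hk).frame hf (e 11 (by omega) (by omega))
      (e 12 (by omega) (by omega)) }

/-! ### Sizes of index boxes -/

/-- The sizes of an index box are admissible. -/
def BoxOk (SP B : ℕ) (l : List (ℕ × IExp)) (s : Store) : Prop :=
  (∀ t ∈ l, t.2.val s ≤ SP) ∧ boxVol l s ≤ B

theorem boxOk_rr (D : Dims n d₁ d₂ r m T L X SP B) {s : Store} (hs : Regs n d₁ d₂ r m N T L s) :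
    BoxOk SP B [(10, IExp.reg 3), (11, IExp.reg 3)] s := by
  have := D.two_r_le
  refine ⟨?_, ?_⟩
  · simp only [List.forall_mem_cons, IExp.val, hs.r_eq, List.not_mem_nil, IsEmpty.forall_iff,
      implies_true, and_true]
    omega
  · simp only [boxVol, List.map, List.prod_cons, List.prod_nil, IExp.val, hs.r_eq,
      max_eq_right D.hr, mul_one]
    exact D.le_B' (by have := D.rr_le; omega)

theorem boxOk_rrdn (D : Dims n d₁ d₂ r m T L X SP B) {s : Store} (hs : Regs n d₁ d₂ r m N T L s)
    {d dv : ℕ} (hd : s.ireg d = dv) (hd1 : 1 ≤ dv) (hdT : dv ≤ T) :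
    BoxOk SP B [(10, IExp.reg 3), (11, IExp.reg 3), (12, IExp.reg d), (13, IExp.reg 0)] s := by
  have := D.two_r_le
  have := D.n_le
  have := D.T_le
  refine ⟨?_, ?_⟩
  · simp only [List.forall_mem_cons, IExp.val, hs.r_eq, hs.n_eq, hd, List.not_mem_nil,
      IsEmpty.forall_iff, implies_true, and_true]
    omega
  · simp only [boxVol, List.map, List.prod_cons, List.prod_nil, IExp.val, hs.r_eq, hs.n_eq, hd,
      max_eq_right D.hr, max_eq_right D.hn, max_eq_right hd1, mul_one]
    refine D.le_B ?_
    calc r * (r * (dv * n)) ≤ r * (r * (T * n)) := by gcongr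
      _ = 1 * (r * n * T * r) := by ring
      _ ≤ 4 * (r * n * T * r) := by gcongr; omega

theorem boxOk_rdn (D : Dims n d₁ d₂ r m T L X SP B) {s : Store} (hs : Regs n d₁ d₂ r m N T L s) :
    BoxOk SP B [(10, IExp.reg 3), (11, IExp.reg 2), (12, IExp.reg 0)] s := by
  have := D.two_r_le
  have := D.n_le
  have := D.T_le
  have hdT := D.d₂_le
  refine ⟨?_, ?_⟩
  · simp only [List.forall_mem_cons, IExp.val, hs.r_eq, hs.n_eq, hs.d₂_eq, List.not_mem_nil,
      IsEmpty.forall_iff, implies_true, and_true]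
    omega
  · simp only [boxVol, List.map, List.prod_cons, List.prod_nil, IExp.val, hs.r_eq, hs.n_eq,
      hs.d₂_eq, max_eq_right D.hr, max_eq_right D.hn, max_eq_right D.hd₂, mul_one]
    refine D.le_B' ?_
    calc r * (d₂ * n) ≤ r * (T * n) := by gcongr
      _ = 1 * (r * n * T) := by ring
      _ ≤ 4 * (r * n * T) := by gcongr; omega

theorem boxOk_rdnr (D : Dims n d₁ d₂ r m T L X SP B) {s : Store} (hs : Regs n d₁ d₂ r m N T L s) :
    BoxOk SP B [(10, IExp.reg 3), (11, IExp.reg 2), (12, IExp.reg 0), (13, IExp.reg 3)] s := by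
  have := D.two_r_le
  have := D.n_le
  have := D.T_le
  have hdT := D.d₂_le
  refine ⟨?_, ?_⟩
  · simp only [List.forall_mem_cons, IExp.val, hs.r_eq, hs.n_eq, hs.d₂_eq, List.not_mem_nil,
      IsEmpty.forall_iff, implies_true, and_true]
    omega
  · simp only [boxVol, List.map, List.prod_cons, List.prod_nil, IExp.val, hs.r_eq, hs.n_eq,
      hs.d₂_eq, max_eq_right D.hr, max_eq_right D.hn, max_eq_right D.hd₂, mul_one]
    refine D.le_B ?_
    calc r * (d₂ * (n * r)) ≤ r * (T * (n * r)) := by gcongr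
      _ = 1 * (r * n * T * r) := by ring
      _ ≤ 4 * (r * n * T * r) := by gcongr; omega

theorem boxOk_dnr (D : Dims n d₁ d₂ r m T L X SP B) {s : Store} (hs : Regs n d₁ d₂ r m N T L s)
    {d dv : ℕ} (hd : s.ireg d = dv) (hd1 : 1 ≤ dv) (hdT : dv ≤ T) :
    BoxOk SP B [(10, IExp.reg d), (11, IExp.reg 0), (12, IExp.reg 3)] s := by
  have := D.two_r_le
  have := D.n_le
  have := D.T_le
  refine ⟨?_, ?_⟩
  · simp only [List.forall_mem_cons, IExp.val, hs.r_eq, hs.n_eq, hd, List.not_mem_nil,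
      IsEmpty.forall_iff, implies_true, and_true]
    omega
  · simp only [boxVol, List.map, List.prod_cons, List.prod_nil, IExp.val, hs.r_eq, hs.n_eq, hd,
      max_eq_right D.hr, max_eq_right D.hn, max_eq_right hd1, mul_one]
    refine D.le_B' ?_
    calc dv * (n * r) ≤ T * (n * r) := by gcongr
      _ = 1 * (r * n * T) := by ring
      _ ≤ 4 * (r * n * T) := by gcongr; omega

theorem boxOk_dnrr (D : Dims n d₁ d₂ r m T L X SP B) {s : Store} (hs : Regs n d₁ d₂ r m N T L s)
    {d dv : ℕ} (hd : s.ireg d = dv) (hd1 : 1 ≤ dv) (hdT : dv ≤ T) :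
    BoxOk SP B [(10, IExp.reg d), (11, IExp.reg 0), (12, IExp.reg 3), (13, IExp.reg 3)] s := by
  have := D.two_r_le
  have := D.n_le
  have := D.T_le
  refine ⟨?_, ?_⟩
  · simp only [List.forall_mem_cons, IExp.val, hs.r_eq, hs.n_eq, hd, List.not_mem_nil,
      IsEmpty.forall_iff, implies_true, and_true]
    omega
  · simp only [boxVol, List.map, List.prod_cons, List.prod_nil, IExp.val, hs.r_eq, hs.n_eq, hd,
      max_eq_right D.hr, max_eq_right D.hn, max_eq_right hd1, mul_one]
    refine D.le_B ?_
    calc dv * (n * (r * r)) ≤ T * (n * (r * r)) := by gcongr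
      _ = 1 * (r * n * T * r) := by ring
      _ ≤ 4 * (r * n * T * r) := by gcongr; omega

end RAM

namespace RAM

variable {n d₁ d₂ r m N T L X SP B : ℕ}

/-! ### Composition -/

theorem seq_rule {c d : Prog} {I R A I₁ R₁ A₁ : List ℕ} {s : Store} {V Q : Store → Prop}
    (h : ∃ s₁, Runs X SP B c I₁ R₁ A₁ s s₁ ∧ V s₁) (hI : I₁ ⊆ I) (hR : R₁ ⊆ R) (hA : A₁ ⊆ A)
    (next : ∀ s₁, Frame I₁ R₁ [] A₁ s s₁ → V s₁ → ∃ s', Runs X SP B d I R A s₁ s' ∧ Q s') :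
    ∃ s', Runs X SP B (Prog.seq c d) I R A s s' ∧ Q s' := by
  obtain ⟨s₁, R₁, v₁⟩ := h
  obtain ⟨s', R', q⟩ := next s₁ R₁.frame v₁
  exact ⟨s', (R₁.mono hI hR hA).seq R', q⟩

theorem last_rule {c : Prog} {I R A I₁ R₁ A₁ : List ℕ} {s : Store} {V Q : Store → Prop}
    (h : ∃ s₁, Runs X SP B c I₁ R₁ A₁ s s₁ ∧ V s₁) (hI : I₁ ⊆ I) (hR : R₁ ⊆ R) (hA : A₁ ⊆ A)
    (next : ∀ s₁, Frame I₁ R₁ [] A₁ s s₁ → V s₁ → Q s₁) :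
    ∃ s', Runs X SP B c I R A s s' ∧ Q s' := by
  obtain ⟨s₁, R₁, v₁⟩ := h
  exact ⟨s₁, R₁.mono hI hR hA, next s₁ R₁.frame v₁⟩

theorem Ctx.frame' {S : StepData n d₁ d₂ r m} {ζ : ℂ} {s s' : Store} {I A : List ℕ}
    (h : Ctx S N T L ζ s) (hf : Frame I [] [] A s s') (hI : ∀ i < 9, i ∉ I)
    (hA : ∀ a ∈ A, 13 ≤ a) : Ctx S N T L ζ s' :=
  h.frame hf hI (by simp) fun a ha hm => absurd (hA a hm) (by omega)

theorem FlatAt.at1 {s : Store} {a : ℕ} {γ : Par n d₁ d₂ r → ℝ} (h : FlatAt s a γ) (i j : Fin r) :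
    s.rarr a (i * r + j) = γ (Sum.inl (i, j)) := h (Sum.inl (i, j))

theorem FlatAt.at2 {s : Store} {a : ℕ} {γ : Par n d₁ d₂ r → ℝ} (h : FlatAt s a γ) (i : Fin r)
    (q : Blk n d₂) : s.rarr a (r * r + (i * (d₂ * n) + (q.1 * n + q.2))) =
      γ (Sum.inr (Sum.inl (i, q))) := h (Sum.inr (Sum.inl (i, q)))

theorem FlatAt.at3 {s : Store} {a : ℕ} {γ : Par n d₁ d₂ r → ℝ} (h : FlatAt s a γ) (p : Blk n d₁)
    (j : Fin r) : s.rarr a (r * r + r * (d₂ * n) + ((p.1 * n + p.2) * r + j)) =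
      γ (Sum.inr (Sum.inr (p, j))) := h (Sum.inr (Sum.inr (p, j)))

theorem FlatAt.frame {s s' : Store} {a : ℕ} {γ : Par n d₁ d₂ r → ℝ} {I R IA A : List ℕ}
    (h : FlatAt s a γ) (hf : Frame I R IA A s s') (ha : a ∉ A) : FlatAt s' a γ := fun c => by
  rw [hf.rarr a ha]; exact h c

/-- The arrays 22 and 23 hold factors of a matrix. -/
def FactorsAt (r : ℕ) (s : Store) (Z : Matrix (Blk n d₁) (Blk n d₂) ℝ) : Prop :=
  ∀ p q, ∑ k ∈ Finset.range (2 * r), s.rarr 22 ((p.1 * n + p.2) * (2 * r) + k) *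
    s.rarr 23 ((q.1 * n + q.2) * (2 * r) + k) = Z p q

/-- Collecting all terms with U on the left and the remaining ones with Vᵀ on the right exhibits
rank at most 2r. Neither the projections nor the full matrix is ever formed. -/
theorem tangentFun_eq_factors (U : Matrix (Blk n d₁) (Fin r) ℝ) (V : Matrix (Blk n d₂) (Fin r) ℝ)
    (γ : Par n d₁ d₂ r → ℝ) (Γ₁ : Matrix (Fin r) (Fin r) ℝ) (Γ₂ : Matrix (Fin r) (Blk n d₂) ℝ)
    (Γ₃ : Matrix (Blk n d₁) (Fin r) ℝ) (h₁ : ∀ i j, Γ₁ i j = γ (Sum.inl (i, j)))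
    (h₂ : ∀ i q, Γ₂ i q = γ (Sum.inr (Sum.inl (i, q))))
    (h₃ : ∀ p j, Γ₃ p j = γ (Sum.inr (Sum.inr (p, j)))) :
    tangentFun U V γ = U * (Γ₂ᵀ + V * (Γ₁ - Γ₂ * V)ᵀ)ᵀ + (Γ₃ - U * (Uᵀ * Γ₃)) * Vᵀ := by
  have e₁ : (Matrix.of fun i j => γ (Sum.inl (i, j))) = Γ₁ := by ext; simp [h₁]
  have e₂ : (Matrix.of fun i q => γ (Sum.inr (Sum.inl (i, q)))) = Γ₂ := by ext; simp [h₂]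
  have e₃ : (Matrix.of fun p j => γ (Sum.inr (Sum.inr (p, j)))) = Γ₃ := by ext; simp [h₃]
  rw [tangentFun, e₁, e₂, e₃]
  simp only [Matrix.transpose_add, Matrix.transpose_mul, Matrix.transpose_transpose, Matrix.mul_add,
    Matrix.mul_sub, Matrix.sub_mul, Matrix.mul_one, Matrix.one_mul, Matrix.mul_assoc]
  abel

/-- An array holds two matrices with `r` columns, one next to the other. -/
def PairAt {d : ℕ} (s : Store) (a : ℕ) (M M' : Matrix (Blk n d) (Fin r) ℝ) : Prop :=
  ∀ (p : Blk n d) (k : Fin r), s.rarr a ((p.1 * n + p.2) * (2 * r) + k) = M p k ∧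
    s.rarr a ((p.1 * n + p.2) * (2 * r) + (r + k)) = M' p k

theorem PairAt.frame {d : ℕ} {s s' : Store} {a : ℕ} {M M' : Matrix (Blk n d) (Fin r) ℝ}
    {I R IA A : List ℕ} (h : PairAt s a M M') (hf : Frame I R IA A s s') (ha : a ∉ A) :
    PairAt s' a M M' := fun p k => by
  rw [hf.rarr a ha]; exact h p k

theorem SqAt.frame {s s' : Store} {a : ℕ} {M : Matrix (Fin r) (Fin r) ℝ} {I R IA A : List ℕ}
    (h : SqAt s a M) (hf : Frame I R IA A s s') (ha : a ∉ A) : SqAt s' a M := fun i j => by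
  rw [hf.rarr a ha]; exact h i j

theorem MatAt.frame {d w : ℕ} {s s' : Store} {a : ℕ} {M : Matrix (Blk n d) (Fin w) ℝ}
    {I R IA A : List ℕ} (h : MatAt s a M) (hf : Frame I R IA A s s') (ha : a ∉ A) :
    MatAt s' a M := fun p k => by
  rw [hf.rarr a ha]; exact h p k

theorem factorsAt_of_pairAt {s : Store} {U A : Matrix (Blk n d₁) (Fin r) ℝ}
    {V A' : Matrix (Blk n d₂) (Fin r) ℝ} (h : PairAt s 22 U A) (h' : PairAt s 23 A' V) :
    FactorsAt r s (U * A'ᵀ + A * Vᵀ) := by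
  intro p q
  rw [two_mul, Finset.sum_range_add, Finset.sum_range, Finset.sum_range, ← two_mul]
  simp only [(h _ _).1, (h _ _).2, (h' _ _).1, (h' _ _).2, Matrix.add_apply, Matrix.mul_apply,
    Matrix.transpose_apply]

theorem sum_low_pair {d : ℕ} (p : Blk n d) (k : Fin r) (f : ℕ → ℕ → ℕ → ℝ) :
    (∑ a' ∈ Finset.range d, ∑ c' ∈ Finset.range n, ∑ k' ∈ Finset.range r,
      (if (a' * n + c') * (2 * r) + k' = (p.1 * n + p.2) * (2 * r) + k then f a' c' k' else 0) =
      f p.1 p.2 k) ∧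
    ∑ a' ∈ Finset.range d, ∑ c' ∈ Finset.range n, ∑ k' ∈ Finset.range r,
      (if (a' * n + c') * (2 * r) + k' = (p.1 * n + p.2) * (2 * r) + (r + k) then f a' c' k' else 0) =
      0 := by
  have := k.isLt
  rw [sum_low (by omega) p.1.isLt p.2.isLt (by omega),
    sum_low (by omega) p.1.isLt p.2.isLt (by omega), if_pos k.isLt, if_neg (by omega)]
  exact ⟨rfl, rfl⟩

theorem sum_high_pair {d : ℕ} (p : Blk n d) (k : Fin r) (f : ℕ → ℕ → ℕ → ℝ) :
    (∑ a' ∈ Finset.range d, ∑ c' ∈ Finset.range n, ∑ k' ∈ Finset.range r,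
      (if (a' * n + c') * (2 * r) + (r + k') = (p.1 * n + p.2) * (2 * r) + k then f a' c' k' else 0) =
      0) ∧
    ∑ a' ∈ Finset.range d, ∑ c' ∈ Finset.range n, ∑ k' ∈ Finset.range r,
      (if (a' * n + c') * (2 * r) + (r + k') = (p.1 * n + p.2) * (2 * r) + (r + k) then f a' c' k'
        else 0) = f p.1 p.2 k := by
  have := k.isLt
  rw [sum_high (by omega) p.1.isLt p.2.isLt (by omega),
    sum_high (by omega) p.1.isLt p.2.isLt (by omega), if_neg (by omega), if_pos (by omega),
    Nat.add_sub_cancel_left]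
  exact ⟨rfl, rfl⟩

/-- Array 20 receives Γ₁ − Γ₂V and array 21 receives UᵀΓ₃. The first factor (array 22) is U beside
Γ₃ − U(UᵀΓ₃), the second (array 23) is Γ₂ᵀ + V(Γ₁ − Γ₂V)ᵀ beside V. Each loop has at most r²nT
points. -/
theorem factors_spec (D : Dims n d₁ d₂ r m T L X SP B) (hN : N ≤ X) {S : StepData n d₁ d₂ r m}
    {ζ : ℂ} {s : Store} {γ : Par n d₁ d₂ r → ℝ} (hc : Ctx S N T L ζ s) (hγ : FlatAt s 15 γ) :
    ∃ s', Runs X SP B factors [10, 11, 12, 13] [] [20, 21, 22, 23] s s' ∧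
      FactorsAt r s' (tangentFun S.U S.V γ) := by
  have hb := D.bounds
  set Γ₁ : Matrix (Fin r) (Fin r) ℝ := Matrix.of fun i j => γ (Sum.inl (i, j)) with hΓ₁
  set Γ₂ : Matrix (Fin r) (Blk n d₂) ℝ := Matrix.of fun i q => γ (Sum.inr (Sum.inl (i, q))) with hΓ₂
  set Γ₃ : Matrix (Blk n d₁) (Fin r) ℝ := Matrix.of fun p j => γ (Sum.inr (Sum.inr (p, j))) with hΓ₃
  have hrr := D.rr_le
  have hr0 := hc.regs
  unfold factors
  refine seq_rule (compute_runs hb (hr0.le D hN) (by decide) (by decide) ?_ (boxOk_rr D hr0).1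
    (boxOk_rr D hr0).2 ?_) (by simp) (by simp) (by simp) ?_
  · simp only [IExp.val, hr0.r_eq]; exact D.le_SP (by omega)
  · simp only [boxAll, IExp.val, IExp.Ok, RExp.Ok, Store.withI_ireg, Nat.reduceEqDiff, reduceIte,
      hr0.r_eq, true_and]
    intro i hi j hj
    exact ⟨D.rr_lt hi hj, D.rr_lt hi hj⟩
  intro s1 f1 v1
  replace v1 : SqAt s1 20 Γ₁ := fun i j => by
    rw [v1 _ (by simp only [IExp.val, hr0.r_eq]; exact idx_lt i.isLt j.isLt)]
    simp only [boxSum, IExp.val, RExp.val, Store.withI_ireg, Store.withI_rarr, Nat.reduceEqDiff,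
      reduceIte, hr0.r_eq]
    rw [sum_idx2 i.isLt j.isLt fun i j => s.rarr 15 (i * r + j), hγ.at1]; rfl
  have hc1 := hc.frame' f1 (by intro i hi; simp; omega) (by simp)
  have hγ1 := hγ.frame f1 (by simp)
  have hr1 := hc1.regs
  clear f1
  refine seq_rule (nest_runs hb (hr1.le D hN) (by decide)
    (boxOk_rrdn D hr1 hr1.d₂_eq D.hd₂ D.d₂_le).1 (boxOk_rrdn D hr1 hr1.d₂_eq D.hd₂ D.d₂_le).2 ?_)
    (by simp) (by simp) (by simp) ?_
  · simp only [boxAll, IExp.val, IExp.Ok, RExp.Ok, Store.withI_ireg, Nat.reduceEqDiff, reduceIte,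
      hr1.r_eq, hr1.d₂_eq, hr1.n_eq, true_and]
    intro i hi j hj b hb j' hj'
    exact ⟨D.rr_lt hi hj, D.pos2_lt hi hb hj', D.dnr_lt D.d₂_le hb hj' hj⟩
  intro s2 f2 v2
  replace v2 : SqAt s2 20 (Γ₁ - Γ₂ * S.V) := fun i j => by
    rw [v2, v1 i j]
    simp only [boxSum, IExp.val, RExp.val, Store.withI_ireg, Store.withI_rarr, Nat.reduceEqDiff,
      reduceIte, hr1.r_eq, hr1.d₂_eq, hr1.n_eq, sum_ite_const]
    rw [sum_idx2 i.isLt j.isLt fun i j => ∑ b ∈ Finset.range d₂, ∑ j' ∈ Finset.range n,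
      (((0 : ℕ) : ℝ) - s1.rarr 15 (r * r + (i * (d₂ * n) + (b * n + j'))) *
        s1.rarr 1 ((b * n + j') * r + j)), sum_blk fun b j' => (((0 : ℕ) : ℝ) -
        s1.rarr 15 (r * r + (i * (d₂ * n) + (b * n + j'))) * s1.rarr 1 ((b * n + j') * r + j))]
    simp only [hγ1.at2, hc1.V_eq _ _, Nat.cast_zero, zero_sub, Finset.sum_neg_distrib,
      Matrix.sub_apply, Matrix.mul_apply, ← sub_eq_add_neg]
    rfl
  have hc2 := hc1.frame' f2 (by intro i hi; simp; omega) (by simp)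
  have hγ2 := hγ1.frame f2 (by simp)
  have hr2 := hc2.regs
  clear f2 v1 hγ1 hγ
  refine seq_rule (compute_runs hb (hr2.le D hN) (by decide) (by decide) ?_
    (boxOk_rrdn D hr2 hr2.d₁_eq D.hd₁ D.d₁_le).1 (boxOk_rrdn D hr2 hr2.d₁_eq D.hd₁ D.d₁_le).2 ?_)
    (by simp) (by simp) (by simp) ?_
  · simp only [IExp.val, hr2.r_eq]; exact D.le_SP (by omega)
  · simp only [boxAll, IExp.val, IExp.Ok, RExp.Ok, Store.withI_ireg, Nat.reduceEqDiff, reduceIte,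
      hr2.r_eq, hr2.d₁_eq, hr2.d₂_eq, hr2.n_eq, true_and]
    intro i hi j hj b hb j' hj'
    exact ⟨D.rr_lt hi hj, D.dnr_lt D.d₁_le hb hj' hi, D.pos3_lt hb hj' hj⟩
  intro s3 f3 v3
  replace v3 : SqAt s3 21 (S.Uᵀ * Γ₃) := fun i j => by
    rw [v3 _ (by simp only [IExp.val, hr2.r_eq]; exact idx_lt i.isLt j.isLt)]
    simp only [boxSum, IExp.val, RExp.val, Store.withI_ireg, Store.withI_rarr, Nat.reduceEqDiff,
      reduceIte, hr2.r_eq, hr2.d₁_eq, hr2.d₂_eq, hr2.n_eq, sum_ite_const]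
    rw [sum_idx2 i.isLt j.isLt fun i j => ∑ b ∈ Finset.range d₁, ∑ j' ∈ Finset.range n,
      s2.rarr 0 ((b * n + j') * r + i) * s2.rarr 15 (r * r + r * (d₂ * n) + ((b * n + j') * r + j)),
      sum_blk fun b j' => s2.rarr 0 ((b * n + j') * r + i) *
        s2.rarr 15 (r * r + r * (d₂ * n) + ((b * n + j') * r + j))]
    simp only [hγ2.at3, hc2.U_eq _ _, Matrix.mul_apply]
    rfl
  have hc3 := hc2.frame' f3 (by intro i hi; simp; omega) (by simp)
  have hγ3 := hγ2.frame f3 (by simp)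
  have w3 := v2.frame f3 (by simp)
  have hr3 := hc3.regs
  clear f3 v2 hγ2
  -- the first factor
  refine seq_rule (compute_runs hb (hr3.le D hN) (by decide) (by decide) ?_
    (boxOk_dnr D hr3 hr3.d₁_eq D.hd₁ D.d₁_le).1 (boxOk_dnr D hr3 hr3.d₁_eq D.hd₁ D.d₁_le).2 ?_)
    (by simp) (by simp) (by simp) ?_
  · simp only [IExp.val, hr3.n_eq, hr3.d₁_eq, hr3.w_eq]
    refine D.le_SP ?_
    have := D.dnr_le D.d₁_le
    calc d₁ * n * (2 * r) = 2 * (d₁ * n * r) := by ring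
      _ ≤ 8 * (r * n * T) := by omega
  · simp only [boxAll, IExp.val, IExp.Ok, RExp.Ok, Store.withI_ireg, Nat.reduceEqDiff, reduceIte,
      hr3.r_eq, hr3.d₁_eq, hr3.n_eq, hr3.w_eq, true_and]
    intro a ha i hi k hk
    exact ⟨D.dnw_lt D.d₁_le ha hi (by omega), D.dnr_lt D.d₁_le ha hi hk⟩
  intro s4 f4 v4
  replace v4 : PairAt s4 22 S.U 0 := fun p k => by
    have h := sum_low_pair p k fun a i k => s3.rarr 0 ((a * n + i) * r + k)
    have hk := k.isLt
    rw [v4 _ (by simp only [IExp.val, hr3.n_eq, hr3.d₁_eq, hr3.w_eq]; exact idx_lt (blk_lt p) (by omega)),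
      v4 _ (by simp only [IExp.val, hr3.n_eq, hr3.d₁_eq, hr3.w_eq]; exact idx_lt (blk_lt p) (by omega))]
    simp only [boxSum, IExp.val, RExp.val, Store.withI_ireg, Store.withI_rarr, Nat.reduceEqDiff,
      reduceIte, hr3.r_eq, hr3.d₁_eq, hr3.n_eq, hr3.w_eq, h.1, h.2, hc3.U_eq _ _, true_and]
    rfl
  have hc4 := hc3.frame' f4 (by intro i hi; simp; omega) (by simp)
  have hγ4 := hγ3.frame f4 (by simp)
  have w4 := w3.frame f4 (by simp)
  replace v3 := v3.frame f4 (by simp)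
  have hr4 := hc4.regs
  clear f4 w3 hγ3
  refine seq_rule (nest_runs hb (hr4.le D hN) (by decide)
    (boxOk_dnr D hr4 hr4.d₁_eq D.hd₁ D.d₁_le).1 (boxOk_dnr D hr4 hr4.d₁_eq D.hd₁ D.d₁_le).2 ?_)
    (by simp) (by simp) (by simp) ?_
  · simp only [boxAll, IExp.val, IExp.Ok, RExp.Ok, Store.withI_ireg, Nat.reduceEqDiff, reduceIte,
      hr4.r_eq, hr4.d₁_eq, hr4.d₂_eq, hr4.n_eq, hr4.w_eq, true_and]
    intro a ha i hi k hk
    exact ⟨D.dnw_lt D.d₁_le ha hi (by omega), D.pos3_lt ha hi hk⟩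
  intro s5 f5 v5
  replace v5 : PairAt s5 22 S.U Γ₃ := fun p k => by
    have h := sum_high_pair p k fun a i k => s4.rarr 15 (r * r + r * (d₂ * n) + ((a * n + i) * r + k))
    simp only [v5, boxSum, IExp.val, RExp.val, Store.withI_ireg, Store.withI_rarr, Nat.reduceEqDiff,
      reduceIte, hr4.r_eq, hr4.d₁_eq, hr4.d₂_eq, hr4.n_eq, hr4.w_eq, h.1, h.2, v4 _ _, hγ4.at3,
      add_zero, true_and]
    exact zero_add _
  have hc5 := hc4.frame' f5 (by intro i hi; simp; omega) (by simp)
  have hγ5 := hγ4.frame f5 (by simp)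
  have w5 := w4.frame f5 (by simp)
  replace v3 := v3.frame f5 (by simp)
  have hr5 := hc5.regs
  clear f5 w4 hγ4
  refine seq_rule (nest_runs hb (hr5.le D hN) (by decide)
    (boxOk_dnrr D hr5 hr5.d₁_eq D.hd₁ D.d₁_le).1 (boxOk_dnrr D hr5 hr5.d₁_eq D.hd₁ D.d₁_le).2 ?_)
    (by simp) (by simp) (by simp) ?_
  · simp only [boxAll, IExp.val, IExp.Ok, RExp.Ok, Store.withI_ireg, Nat.reduceEqDiff, reduceIte,
      hr5.r_eq, hr5.d₁_eq, hr5.n_eq, hr5.w_eq, true_and]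
    intro a ha i hi k hk k' hk'
    exact ⟨D.dnw_lt D.d₁_le ha hi (by omega), D.dnr_lt D.d₁_le ha hi hk', D.rr_lt hk' hk⟩
  intro s6 f6 v6
  replace v6 : PairAt s6 22 S.U (Γ₃ - S.U * (S.Uᵀ * Γ₃)) := fun p k => by
    have h := sum_high_pair p k fun a i k => ∑ k' ∈ Finset.range r, (((0 : ℕ) : ℝ) -
      s5.rarr 0 ((a * n + i) * r + k') * s5.rarr 21 (k' * r + k))
    simp only [v6, boxSum, IExp.val, RExp.val, Store.withI_ireg, Store.withI_rarr, Nat.reduceEqDiff,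
      reduceIte, hr5.r_eq, hr5.d₁_eq, hr5.n_eq, hr5.w_eq, sum_ite_const, h.1, h.2, v5 _ _,
      add_zero, true_and]
    simp only [Finset.sum_range, hc5.U_eq _ _, v3 _ _, Nat.cast_zero, zero_sub,
      Finset.sum_neg_distrib, Matrix.sub_apply, Matrix.mul_apply, ← sub_eq_add_neg]
  have hc6 := hc5.frame' f6 (by intro i hi; simp; omega) (by simp)
  have hγ6 := hγ5.frame f6 (by simp)
  have w6 := w5.frame f6 (by simp)
  have hr6 := hc6.regs
  clear f6 w5 hγ5 v5 v4 v3
  -- the second factor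
  refine seq_rule (compute_runs hb (hr6.le D hN) (by decide) (by decide) ?_
    (boxOk_dnr D hr6 hr6.d₂_eq D.hd₂ D.d₂_le).1 (boxOk_dnr D hr6 hr6.d₂_eq D.hd₂ D.d₂_le).2 ?_)
    (by simp) (by simp) (by simp) ?_
  · simp only [IExp.val, hr6.n_eq, hr6.d₂_eq, hr6.w_eq]
    refine D.le_SP ?_
    have := D.dnr_le D.d₂_le
    calc d₂ * n * (2 * r) = 2 * (d₂ * n * r) := by ring
      _ ≤ 8 * (r * n * T) := by omega
  · simp only [boxAll, IExp.val, IExp.Ok, RExp.Ok, Store.withI_ireg, Nat.reduceEqDiff, reduceIte,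
      hr6.r_eq, hr6.d₂_eq, hr6.n_eq, hr6.w_eq, true_and]
    intro a ha i hi k hk
    exact ⟨D.dnw_lt D.d₂_le ha hi (by omega), D.dnr_lt D.d₂_le ha hi hk⟩
  intro s7 f7 v7
  replace v7 : PairAt s7 23 0 S.V := fun p k => by
    have h := sum_high_pair p k fun a i k => s6.rarr 1 ((a * n + i) * r + k)
    have hk := k.isLt
    rw [v7 _ (by simp only [IExp.val, hr6.n_eq, hr6.d₂_eq, hr6.w_eq]; exact idx_lt (blk_lt p) (by omega)),
      v7 _ (by simp only [IExp.val, hr6.n_eq, hr6.d₂_eq, hr6.w_eq]; exact idx_lt (blk_lt p) (by omega))]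
    simp only [boxSum, IExp.val, RExp.val, Store.withI_ireg, Store.withI_rarr, Nat.reduceEqDiff,
      reduceIte, hr6.r_eq, hr6.d₂_eq, hr6.n_eq, hr6.w_eq, h.1, h.2, hc6.V_eq _ _, and_true]
    rfl
  have hc7 := hc6.frame' f7 (by intro i hi; simp; omega) (by simp)
  have hγ7 := hγ6.frame f7 (by simp)
  have w7 := w6.frame f7 (by simp)
  have u7 := v6.frame f7 (by simp)
  have hr7 := hc7.regs
  clear f7 w6 hγ6 v6
  refine seq_rule (nest_runs hb (hr7.le D hN) (by decide)
    (boxOk_dnr D hr7 hr7.d₂_eq D.hd₂ D.d₂_le).1 (boxOk_dnr D hr7 hr7.d₂_eq D.hd₂ D.d₂_le).2 ?_)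
    (by simp) (by simp) (by simp) ?_
  · simp only [boxAll, IExp.val, IExp.Ok, RExp.Ok, Store.withI_ireg, Nat.reduceEqDiff, reduceIte,
      hr7.r_eq, hr7.d₂_eq, hr7.n_eq, hr7.w_eq, true_and]
    intro a ha i hi k hk
    exact ⟨D.dnw_lt D.d₂_le ha hi (by omega), D.pos2_lt hk ha hi⟩
  intro s8 f8 v8
  replace v8 : PairAt s8 23 Γ₂ᵀ S.V := fun p k => by
    have h := sum_low_pair p k fun a i k => s7.rarr 15 (r * r + (k * (d₂ * n) + (a * n + i)))
    simp only [v8, boxSum, IExp.val, RExp.val, Store.withI_ireg, Store.withI_rarr, Nat.reduceEqDiff,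
      reduceIte, hr7.r_eq, hr7.d₂_eq, hr7.n_eq, hr7.w_eq, h.1, h.2, v7 _ _, hγ7.at2,
      add_zero, and_true]
    exact zero_add _
  have hc8 := hc7.frame' f8 (by intro i hi; simp; omega) (by simp)
  have w8 := w7.frame f8 (by simp)
  have u8 := u7.frame f8 (by simp)
  have hr8 := hc8.regs
  clear f8 w7 hγ7 u7
  refine last_rule (nest_runs hb (hr8.le D hN) (by decide)
    (boxOk_dnrr D hr8 hr8.d₂_eq D.hd₂ D.d₂_le).1 (boxOk_dnrr D hr8 hr8.d₂_eq D.hd₂ D.d₂_le).2 ?_)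
    (by simp) (by simp) (by simp) ?_
  · simp only [boxAll, IExp.val, IExp.Ok, RExp.Ok, Store.withI_ireg, Nat.reduceEqDiff, reduceIte,
      hr8.r_eq, hr8.d₂_eq, hr8.n_eq, hr8.w_eq, true_and]
    intro a ha i hi k hk k' hk'
    exact ⟨D.dnw_lt D.d₂_le ha hi (by omega), D.rr_lt hk hk', D.dnr_lt D.d₂_le ha hi hk'⟩
  intro s9 f9 v9
  rw [tangentFun_eq_factors S.U S.V γ Γ₁ Γ₂ Γ₃ (fun _ _ => rfl) (fun _ _ => rfl) fun _ _ => rfl]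
  refine factorsAt_of_pairAt (u8.frame f9 (by simp)) fun p k => ?_
  have h := sum_low_pair p k fun a i k => ∑ k' ∈ Finset.range r, s8.rarr 20 (k * r + k') *
    s8.rarr 1 ((a * n + i) * r + k')
  simp only [v9, boxSum, IExp.val, RExp.val, Store.withI_ireg, Store.withI_rarr, Nat.reduceEqDiff,
    reduceIte, hr8.r_eq, hr8.d₂_eq, hr8.n_eq, hr8.w_eq, sum_ite_const, h.1, h.2, v8 _ _,
    add_zero, and_true]
  simp only [Finset.sum_range, hc8.V_eq _ _, w8 _ _, Matrix.add_apply, Matrix.mul_apply,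
    Matrix.transpose_apply]
  congr 1
  exact Finset.sum_congr rfl fun _ _ => mul_comm _ _

end RAM

/-! ### Entries of the operators -/

section Entries

variable {n d₁ d₂ r m : ℕ}

/-- The adjoint of the block Hankel operator sums along block antidiagonals. -/
theorem hankelMat_transpose_mulVec (Z : Matrix (Blk n d₁) (Blk n d₂) ℝ) (l : Loc n d₁ d₂) :
    ((hankelMat n d₁ d₂)ᵀ *ᵥ vec Z) l = ∑ a : Fin d₁, ∑ b : Fin d₂,
      if (a : ℕ) + b = l.2.2 then Z (a, l.1) (b, l.2.1) else 0 := by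
  obtain ⟨i, j, t⟩ := l
  simp only [Matrix.mulVec, dotProduct, Matrix.transpose_apply, hankelMat, Matrix.of_apply, vec,
    ite_mul, one_mul, zero_mul, Fintype.sum_prod_type]
  refine Finset.sum_congr rfl fun a _ => ?_
  rw [Finset.sum_comm]
  refine Finset.sum_congr rfl fun b _ => ?_
  simp only [ite_and, Finset.sum_ite_irrel, Finset.sum_const_zero, Finset.sum_ite_eq,
    Finset.mem_univ, if_true]
  exact if_congr eq_comm rfl rfl

theorem blockCount_inv (l : Loc n d₁ d₂) : (blockCount n d₁ d₂ l)⁻¹ = invCount d₁ d₂ l.2.2 := by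
  -- Entries of H are 0 or 1, so squares may be dropped and the count is the antidiagonal sum of the
  -- all-ones matrix.
  have h := hankelMat_transpose_mulVec (Matrix.of fun _ _ => 1) l
  rw [invCount, one_div, Finset.sum_range]
  congr 1
  calc blockCount n d₁ d₂ l = ((hankelMat n d₁ d₂)ᵀ *ᵥ vec (Matrix.of fun _ _ => 1)) l := by
        simp only [blockCount, Matrix.mulVec, dotProduct, Matrix.transpose_apply, vec,
          Matrix.of_apply, mul_one]
        refine Finset.sum_congr rfl fun x _ => ?_
        simp only [hankelMat, Matrix.of_apply]
        split_ifs <;> norm_num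
    _ = _ := by
        rw [h]
        refine Finset.sum_congr rfl fun a _ => ?_
        rw [Finset.sum_range]
        rfl

theorem countInv_mulVec (v : Loc n d₁ d₂ → ℝ) (l : Loc n d₁ d₂) :
    (countInv n d₁ d₂ *ᵥ v) l = invCount d₁ d₂ l.2.2 * v l := by
  rw [countInv, Matrix.mulVec_diagonal, blockCount_inv]

theorem sampleMat_mulVec (ω : Fin m → Loc n d₁ d₂) (v : Loc n d₁ d₂ → ℝ) (l : Fin m) :
    (sampleMat ω *ᵥ v) l = v (ω l) := by
  simp [sampleMat, Matrix.mulVec, dotProduct]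

theorem sampleMat_transpose_mulVec (ω : Fin m → Loc n d₁ d₂) (q : Fin m → ℝ)
    (x : Loc n d₁ d₂) : ((sampleMat ω)ᵀ *ᵥ q) x = ∑ l, if x = ω l then q l else 0 := by
  simp [sampleMat, Matrix.mulVec, dotProduct]

/-- The matrix whose products with the singular vectors determine the image under the linear
system. -/
noncomputable def StepData.residualMat (S : StepData n d₁ d₂ r m) (q : Fin m → ℝ)
    (Z : Matrix (Blk n d₁) (Blk n d₂) ℝ) : Matrix (Blk n d₁) (Blk n d₂) ℝ :=
  blockHankel (countInv n d₁ d₂ *ᵥ ((sampleMat S.ω)ᵀ *ᵥ q - (hankelMat n d₁ d₂)ᵀ *ᵥ vec Z))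

/-- Eᵀ and P_TᵀG both end with P_TᵀH, so everything except the diagonal part passes through one
block Hankel matrix. The parameter κ lets the same program apply M (κ = 0) and evaluate Mγ − b (κ =
1). -/
theorem StepData.system_eq [NeZero d₁] [NeZero d₂] {S : StepData n d₁ d₂ r m}
    (κ : ℝ) (γ : Par n d₁ d₂ r → ℝ) :
    S.M *ᵥ γ - κ • S.rhs = (tangentMat S.U S.V)ᵀ *ᵥ vec (S.residualMat
      (S.K⁻¹ *ᵥ (S.E *ᵥ γ - κ • S.y)) (tangentFun S.U S.V γ)) + fun c => S.mDiag c * γ c := by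
  have e : (fun c => S.mDiag c * γ c) = Matrix.diagonal S.mDiag *ᵥ γ :=
    funext fun c => (Matrix.mulVec_diagonal _ _ c).symm
  have hE : S.Eᵀ = (tangentMat S.U S.V)ᵀ * (hankelMat n d₁ d₂ * (countInv n d₁ d₂ *
      (sampleMat S.ω)ᵀ)) := by
    rw [StepData.E_eq]
    simp only [Matrix.transpose_mul, Matrix.transpose_transpose, countInv_transpose]
  rw [e, StepData.residualMat, ← hankelMat_mulVec, ← tangentMat_mulVec, StepData.M_eq, StepData.rhs,
    Matrix.mul_assoc (tangentMat S.U S.V)ᵀ, normHankelMat_mul_transpose]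
  have h1 : (tangentMat S.U S.V)ᵀ *ᵥ (hankelMat n d₁ d₂ *ᵥ (countInv n d₁ d₂ *ᵥ
      ((sampleMat S.ω)ᵀ *ᵥ (S.K⁻¹ *ᵥ (S.E *ᵥ γ - κ • S.y)) -
        (hankelMat n d₁ d₂)ᵀ *ᵥ (tangentMat S.U S.V *ᵥ γ)))) =
      S.Eᵀ *ᵥ (S.K⁻¹ *ᵥ (S.E *ᵥ γ - κ • S.y)) - (tangentMat S.U S.V)ᵀ *ᵥ (hankelMat n d₁ d₂ *ᵥ
        (countInv n d₁ d₂ *ᵥ ((hankelMat n d₁ d₂)ᵀ *ᵥ (tangentMat S.U S.V *ᵥ γ)))) := by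
    rw [hE]
    simp only [Matrix.mulVec_sub, ← Matrix.mulVec_mulVec]
  rw [h1]
  simp only [Matrix.add_mulVec, Matrix.sub_mulVec, ← Matrix.mulVec_mulVec, Matrix.mulVec_sub,
    Matrix.mulVec_smul]
  abel

end Entries

theorem sum_antidiagonal_ite {d a t : ℕ} (f : ℕ → ℝ) :
    ∑ b ∈ Finset.range d, (if a + b = t then f b else 0) =
      if a ≤ t ∧ t - a < d then f (t - a) else 0 := by
  by_cases h : a ≤ t
  · rw [Finset.sum_congr rfl fun b _ => if_congr (show a + b = t ↔ b = t - a by omega) rfl rfl,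
      Finset.sum_ite_eq']
    simp [h]
  · rw [if_neg (fun h' => h h'.1)]
    exact Finset.sum_eq_zero fun b _ => if_neg (by omega)

namespace RAM

variable {n d₁ d₂ r m N T L X SP B : ℕ}

/-! ### Samples of a tangent vector -/

/-- For loops over the samples; the maximum with 1 covers m = 0 and is absorbed by nrT ≥ 1. -/
theorem _root_.TOIRLS.Dims.le_B_max (D : Dims n d₁ d₂ r m T L X SP B) {x : ℕ}
    (h : x ≤ max 1 m * (T * (2 * r))) : x ≤ B := by
  refine le_trans (h.trans ?_) D.hB
  have h1 := Nat.mul_pos (Nat.mul_pos D.hn D.hr) D.one_le_T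
  calc max 1 m * (T * (2 * r)) ≤ (m + n * r * T) * (T * (2 * r)) := by
        gcongr; omega
    _ = 2 * (r * T * (m + n * r * T)) := by ring
    _ ≤ 16 * (r * T * (m + n * r * T)) := by omega

/-- The value of the expression `onDiag`. -/
theorem onDiag_val (a t d : ℕ) :
    ((((1 - (a - t)) * (1 - (t - a + 1 - d)) : ℕ)) : ℝ) = if a ≤ t ∧ t - a < d then 1 else 0 := by
  split_ifs with h
  · rw [show 1 - (a - t) = 1 by omega, show 1 - (t - a + 1 - d) = 1 by omega]; norm_num
  · rw [Nat.cast_eq_zero, Nat.mul_eq_zero]; omega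

/-- Weighted block antidiagonal sums of the product of the factors in the arrays 22 and 23. -/
noncomputable def antidiagSum (d₁ d₂ n r : ℕ) (s : Store) (i j t : ℕ) : ℝ :=
  ∑ a ∈ Finset.range d₁, ∑ b ∈ Finset.range d₂, if a + b = t then
    ∑ k ∈ Finset.range (2 * r), s.rarr 22 ((a * n + i) * (2 * r) + k) *
      s.rarr 23 ((b * n + j) * (2 * r) + k) else 0

theorem antidiagSum_eq {s : Store} {Z : Matrix (Blk n d₁) (Blk n d₂) ℝ} (h : FactorsAt r s Z)
    (l : Loc n d₁ d₂) :
    antidiagSum d₁ d₂ n r s l.1 l.2.1 l.2.2 = ((hankelMat n d₁ d₂)ᵀ *ᵥ vec Z) l := by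
  rw [hankelMat_transpose_mulVec, antidiagSum, Finset.sum_range]
  refine Finset.sum_congr rfl fun a _ => ?_
  rw [Finset.sum_range]
  refine Finset.sum_congr rfl fun b _ => ?_
  rw [h (a, l.1) (b, l.2.1)]

theorem Ctx.time_lt {S : StepData n d₁ d₂ r m} {ζ : ℂ} {s : Store} (hc : Ctx S N T L ζ s)
    (D : Dims n d₁ d₂ r m T L X SP B) {l : ℕ} (hl : l < m) :
    s.iarr 2 l < T ∧ s.iarr 0 l < n ∧ s.iarr 1 l < n := by
  have h1 := hc.time_eq ⟨l, hl⟩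
  have h2 := hc.row_eq ⟨l, hl⟩
  have h3 := hc.col_eq ⟨l, hl⟩
  dsimp only at h1 h2 h3
  rw [h1, h2, h3]
  refine ⟨?_, Fin.isLt _, Fin.isLt _⟩
  have := (S.ω ⟨l, hl⟩).2.2.isLt
  have := D.hT
  omega

/-- Only the m sampled entries of HᵀP_Tγ are evaluated, each as an antidiagonal sum of at most d₁
inner products of factor rows of length 2r. -/
theorem samples_spec [NeZero d₁] [NeZero d₂] (D : Dims n d₁ d₂ r m T L X SP B) (hN : N ≤ X)
    {S : StepData n d₁ d₂ r m} (hS : S.Valid)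
    {ζ : ℂ} {s : Store} {γ : Par n d₁ d₂ r → ℝ} (hc : Ctx S N T L ζ s)
    (hZ : FactorsAt r s (tangentFun S.U S.V γ)) :
    ∃ s', Runs X SP B samples [10, 11, 12, 13] [] [24] s s' ∧
      VecAt s' 24 (S.K⁻¹ *ᵥ (S.E *ᵥ γ - s.rreg 2 • S.y)) := by
  have hb := D.bounds
  have hmSP := D.m_le_SP
  have hTSP := D.T_le
  have hnSP := D.n_le
  have hX := hb.le_X
  have hd₁T := D.d₁_le
  have hr0 := hc.regs
  have h2r := D.two_r_le
  have hr1 := D.hr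
  unfold samples
  refine seq_rule (compute_runs hb (hr0.le D hN) (by decide) (by decide) ?_ ?_ ?_ ?_)
    (by simp) (by simp) (by simp) ?_
  · simpa only [IExp.val, hr0.m_eq] using hmSP
  · simp only [List.forall_mem_cons, IExp.val, hr0.m_eq, hr0.d₁_eq, hr0.w_eq, List.not_mem_nil,
      IsEmpty.forall_iff, implies_true, and_true]
    omega
  · simp only [boxVol, List.map, List.prod_cons, List.prod_nil, IExp.val, hr0.m_eq, hr0.d₁_eq,
      hr0.w_eq, max_eq_right D.hd₁, max_eq_right (show 1 ≤ 2 * r by omega), mul_one]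
    exact D.le_B_max (by gcongr)
  · simp only [boxAll, IExp.val, IExp.Ok, RExp.Ok, Store.withI_ireg, Store.withI_iarr,
      Nat.reduceEqDiff, reduceIte, hr0.m_eq, hr0.d₁_eq, hr0.w_eq, hr0.n_eq, true_and, and_true]
    intro l hl a ha k hk
    obtain ⟨h1, h2, h3⟩ := hc.time_lt D hl
    have := D.dnw_lt hd₁T ha h2 hk
    -- Off the antidiagonal the indicator annihilates the value, but the cell is read nevertheless.
    -- Its address is below T·n·2r, so it is admissible.
    have := D.dnw_lt le_rfl (show s.iarr 2 l - a < T by omega) h3 hk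
    and_intros <;> omega
  intro s1 f1 v1
  set g : Fin m → ℝ := fun l => invCount d₁ d₂ (S.ω l).2.2 / S.kDiag l *
    ((hankelMat n d₁ d₂)ᵀ *ᵥ vec (tangentFun S.U S.V γ)) (S.ω l) with hg
  have hk : ∀ l : Fin m, S.lam / (S.ε * S.ε) + invCount d₁ d₂ (S.ω l).2.2 = S.kDiag l := fun l => by
    rw [StepData.kDiag, blockCount_inv, sq, div_eq_mul_inv]
  have hTl : ∀ l : Fin m, ((S.ω l).2.2 : ℕ) < T := fun l => by
    rw [← hc.time_eq]; exact (hc.time_lt D l.isLt).1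
  replace v1 : VecAt s1 24 g := fun l => by
    rw [v1 _ (by simp only [IExp.val, hr0.m_eq]; exact l.isLt)]
    simp only [boxSum, IExp.val, RExp.val, Store.withI_ireg, Store.withI_iarr, Store.withI_rarr,
      Store.withI_rreg, Nat.reduceEqDiff, reduceIte, hr0.m_eq, hr0.d₁_eq, hr0.d₂_eq, hr0.w_eq,
      hr0.n_eq, sum_ite_const]
    rw [Finset.sum_ite_eq', if_pos (Finset.mem_range.mpr l.isLt)]
    simp only [hc.time_eq l, hc.row_eq l, hc.col_eq l, onDiag_val, hc.lam_eq, hc.ε_eq,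
      hc.weight _ (hTl l), hk l]
    rw [hg]
    dsimp only
    rw [← antidiagSum_eq hZ, antidiagSum, Finset.mul_sum]
    refine Finset.sum_congr rfl fun a _ => ?_
    rw [sum_antidiagonal_ite fun b => ∑ k ∈ Finset.range (2 * r),
      s.rarr 22 ((a * n + (S.ω l).1) * (2 * r) + k) *
      s.rarr 23 ((b * n + (S.ω l).2.1) * (2 * r) + k), ← Finset.mul_sum]
    split_ifs <;> ring
  have hc1 := hc.frame' f1 (by intro i hi; simp; omega) (by simp)
  have hκ : s1.rreg 2 = s.rreg 2 := f1.rreg 2 (by simp)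
  have hr1 := hc1.regs
  clear f1
  refine last_rule (nest_runs hb (hr1.le D hN) (by decide) ?_ ?_ ?_) (by simp) (by simp) (by simp) ?_
  · simp only [List.forall_mem_cons, IExp.val, hr1.m_eq, List.not_mem_nil,
      IsEmpty.forall_iff, implies_true, and_true]
    omega
  · simp only [boxVol, List.map, List.prod_cons, List.prod_nil, IExp.val, hr1.m_eq, mul_one]
    refine D.le_B_max (Nat.le_mul_of_pos_right _ (Nat.mul_pos D.one_le_T (by omega)))
  · simp only [boxAll, IExp.val, IExp.Ok, RExp.Ok, Store.withI_ireg, Store.withI_iarr,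
      reduceIte, hr1.m_eq, true_and, and_true]
    intro l hl
    obtain ⟨h1, h2, h3⟩ := hc1.time_lt D hl
    and_intros <;> omega
  intro s2 f2 v2 l
  rw [v2, v1 l, StepData.K_inv hS, Matrix.mulVec_diagonal, StepData.E_eq]
  simp only [boxSum, IExp.val, RExp.val, Store.withI_ireg, Store.withI_iarr, Store.withI_rarr,
      Store.withI_rreg, reduceIte, hr1.m_eq]
  rw [Finset.sum_ite_eq', if_pos (Finset.mem_range.mpr l.isLt)]
  simp only [hc1.time_eq l, hc1.lam_eq, hc1.ε_eq, hc1.y_eq l, hκ, hc1.weight _ (hTl l), hk l, hg,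
    Pi.sub_apply, Pi.smul_apply, smul_eq_mul, ← Matrix.mulVec_mulVec, sampleMat_mulVec,
    countInv_mulVec, tangentMat_mulVec, Nat.cast_zero]
  ring

end RAM

namespace RAM

variable {n d₁ d₂ r m N T L X SP B : ℕ}

/-! ### Products of the residual matrix with the singular vectors -/

/-- The possible arguments of the program `half`. -/
def HalfArgs (P F G out dP dG iaP iaG : ℕ) : Prop :=
  (P = 0 ∧ F = 22 ∧ G = 23 ∧ out = 25 ∧ dP = 1 ∧ dG = 2 ∧ iaP = 0 ∧ iaG = 1) ∨
    (P = 1 ∧ F = 23 ∧ G = 22 ∧ out = 26 ∧ dP = 2 ∧ dG = 1 ∧ iaP = 1 ∧ iaG = 0)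

/-- A sample in block t, multiplied by block row a of P, contributes to block row t − a of the
result only. Running over samples and a costs O(m d r) without forming the sparse Hankel matrix. -/
theorem scatter_spec (D : Dims n d₁ d₂ r m T L X SP B) (hN : N ≤ X)
    {S : StepData n d₁ d₂ r m} {ζ : ℂ} {s : Store} {q : Fin m → ℝ}
    {P F G out dP dG iaP iaG vP vG : ℕ} (hargs : HalfArgs P F G out dP dG iaP iaG)
    (hc : Ctx S N T L ζ s) (hq : VecAt s 24 q) (hdP : s.ireg dP = vP) (hvP : 1 ≤ vP)
    (hvPT : vP ≤ T) (hdG : s.ireg dG = vG) (hvT : vG ≤ T) :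
    ∃ s', Runs X SP B (scatter P out dP dG iaP iaG) [10, 11, 12] [] [out] s s' ∧
      ∀ b < vG, ∀ j < n, ∀ k < r, s'.rarr out ((b * n + j) * r + k) =
        ∑ a ∈ Finset.range vP, ∑ i ∈ Finset.range n, s.rarr P ((a * n + i) * r + k) *
          (invCount d₁ d₂ (a + b) * ∑ l : Fin m,
            if s.iarr iaP l = i ∧ s.iarr iaG l = j ∧ s.iarr 2 l = a + b then q l else 0) := by
  have hb := D.bounds
  have hmSP := D.m_le_SP
  have hTSP := D.T_le
  have hnSP := D.n_le
  have hX := hb.le_X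
  have hr0 := hc.regs
  have h2r := D.two_r_le
  have hr1 := D.hr
  have hlt : ∀ {l}, l < m → s.iarr 2 l < T ∧ s.iarr iaP l < n ∧ s.iarr iaG l < n := by
    intro l hl
    have := hc.time_lt D hl
    rcases hargs with h | h
    · rw [h.2.2.2.2.2.2.1, h.2.2.2.2.2.2.2]; exact this
    · rw [h.2.2.2.2.2.2.1, h.2.2.2.2.2.2.2]; exact ⟨this.1, this.2.2, this.2.1⟩
  have hdPG : dP ≠ 10 ∧ dP ≠ 11 ∧ dP ≠ 12 ∧ dG ≠ 10 ∧ dG ≠ 11 ∧ dG ≠ 12 := by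
    rcases hargs with h | h <;> omega
  unfold scatter
  refine last_rule (compute_runs hb (hr0.le D hN) (by
      rcases hargs with ⟨rfl, rfl, rfl, rfl, rfl, rfl, rfl, rfl⟩ | ⟨rfl, rfl, rfl, rfl, rfl, rfl, rfl, rfl⟩
        <;> decide)
    (by
      rcases hargs with ⟨rfl, rfl, rfl, rfl, rfl, rfl, rfl, rfl⟩ | ⟨rfl, rfl, rfl, rfl, rfl, rfl, rfl, rfl⟩
        <;> decide) ?_ ?_ ?_ ?_)
    (by simp) (by simp) (by simp) ?_
  · simp only [IExp.val, hr0.n_eq, hr0.r_eq, hdG]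
    exact D.le_SP (by have := D.dnr_le hvT; omega)
  · simp only [List.forall_mem_cons, IExp.val, hr0.m_eq, hdP, hr0.r_eq, List.not_mem_nil,
      IsEmpty.forall_iff, implies_true, and_true]
    omega
  · simp only [boxVol, List.map, List.prod_cons, List.prod_nil, IExp.val, hr0.m_eq, hdP,
      hr0.r_eq, max_eq_right hvP, max_eq_right hr1, mul_one]
    exact D.le_B_max (by gcongr; omega)
  · simp only [boxAll, IExp.val, IExp.Ok, RExp.Ok, Store.withI_ireg, Store.withI_iarr,
      Nat.reduceEqDiff, reduceIte, hr0.m_eq, hdP, hdPG, hr0.r_eq, hr0.n_eq, true_and, and_true]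
    intro l hl a ha k hk
    obtain ⟨h1, h2, h3⟩ := hlt hl
    have := D.dnr_lt hvPT ha h2 hk
    have := D.dnr_lt le_rfl (show s.iarr 2 l - a < T by omega) h3 hk
    and_intros <;> omega
  intro s1 _ v1 b hb j hj k hk
  rw [v1 _ (by simp only [IExp.val, hr0.n_eq, hr0.r_eq, hdG]; exact idx_lt (idx_lt hb hj) hk)]
  simp only [boxSum, IExp.val, RExp.val, Store.withI_ireg, Store.withI_iarr, Store.withI_rarr,
      Nat.reduceEqDiff, reduceIte, hr0.m_eq, hdP, hdG, hdPG, hr0.r_eq, hr0.n_eq, onDiag_val]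
  rw [Finset.sum_range]
  have e1 : ∀ l : Fin m, ∀ a ∈ Finset.range vP, ∑ k' ∈ Finset.range r,
      (if ((s.iarr 2 l - a) * n + s.iarr iaG l) * r + k' = (b * n + j) * r + k then
        (if a ≤ s.iarr 2 l ∧ s.iarr 2 l - a < vG then (1 : ℝ) else 0) *
          (s.rarr 10 (s.iarr 2 l) * s.rarr 24 l) * s.rarr P ((a * n + s.iarr iaP l) * r + k')
        else 0) = ∑ i ∈ Finset.range n, s.rarr P ((a * n + i) * r + k) *
          (invCount d₁ d₂ (a + b) *
            if s.iarr iaP l = i ∧ s.iarr iaG l = j ∧ s.iarr 2 l = a + b then q l else 0) := by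
    intro l a _
    obtain ⟨h1, h2, h3⟩ := hlt l.isLt
    have e2 : ∀ k' ∈ Finset.range r, (((s.iarr 2 l - a) * n + s.iarr iaG l) * r + k' =
        (b * n + j) * r + k ↔ (s.iarr 2 l - a = b ∧ s.iarr iaG l = j) ∧ k' = k) := fun k' hk' => by
      rw [idx_inj (Finset.mem_range.mp hk') hk, idx_inj h3 hj]
    rw [Finset.sum_congr rfl fun k' hk' => if_congr (e2 k' hk') rfl rfl]
    simp only [ite_and, sum_ite_const]
    rw [Finset.sum_ite_eq', if_pos (Finset.mem_range.mpr hk)]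
    simp only [mul_ite, mul_zero, Finset.sum_ite_eq, Finset.mem_range, h2, if_true]
    by_cases h4 : s.iarr iaG l = j
    · by_cases h5 : s.iarr 2 l = a + b
      · rw [hq l, hc.weight _ h1, h5]
        simp [h4, hb]
        ring
      · rw [if_neg (h5 : ¬ s.iarr 2 l = a + b)]
        simp only [ite_self]
        -- The truncated difference may equal b although t ≠ a + b. This happens only for t < a,
        -- where the indicator is zero.
        by_cases h6 : s.iarr 2 l - a = b
        · rw [if_neg (show ¬ a ≤ s.iarr 2 l by omega)]; simp
        · rw [if_neg h6]
    · simp [h4]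
  rw [Finset.sum_congr rfl fun l _ => Finset.sum_congr rfl (e1 l), Finset.sum_comm]
  refine Finset.sum_congr rfl fun a _ => ?_
  rw [Finset.sum_comm]
  refine Finset.sum_congr rfl fun i _ => ?_
  rw [Finset.mul_sum, Finset.mul_sum]

/-- After the Fourier identity both parts are sums over a and i of P times w(a + b) times a quantity
depending on a + b, so they combine into one. -/
theorem half_spec (D : Dims n d₁ d₂ r m T L X SP B) (hN : N ≤ X)
    {S : StepData n d₁ d₂ r m} {ζ : ℂ} (hζ : IsPrimitiveRoot ζ L) (hζ1 : ζ * star ζ = 1)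
    {s : Store} {q : Fin m → ℝ}
    {P F G out dP dG iaP iaG vP vG : ℕ} (hargs : HalfArgs P F G out dP dG iaP iaG)
    (hc : Ctx S N T L ζ s) (hq : VecAt s 24 q) (hdP : s.ireg dP = vP) (hvP : 1 ≤ vP)
    (hdG : s.ireg dG = vG) (hvG : 1 ≤ vG) (hPG : vP + vG = T + 1) :
    ∃ s', Runs X SP B (half P F G out dP dG iaP iaG) [9, 10, 11, 12, 13] []
        [28, 29, 30, 31, 32, 33, 34, 35, 36, 37, out] s s' ∧
      ∀ b < vG, ∀ j < n, ∀ k < r, s'.rarr out ((b * n + j) * r + k) =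
        ∑ a ∈ Finset.range vP, ∑ i ∈ Finset.range n, s.rarr P ((a * n + i) * r + k) *
          (invCount d₁ d₂ (a + b) * (∑ l : Fin m,
            (if s.iarr iaP l = i ∧ s.iarr iaG l = j ∧ s.iarr 2 l = a + b then q l else 0) -
            ∑ a' ∈ Finset.range vP, ∑ b' ∈ Finset.range vG, if a' + b' = a + b then
              ∑ c ∈ Finset.range (2 * r), s.rarr F ((a' * n + i) * (2 * r) + c) *
                s.rarr G ((b' * n + j) * (2 * r) + c) else 0)) := by
  have hP : P ≠ out ∧ F ≠ out ∧ G ≠ out ∧ 13 ≤ out := by rcases hargs with h | h <;> omega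
  have hd : dP < 9 ∧ dG < 9 := by rcases hargs with h | h <;> omega
  unfold half
  refine seq_rule (scatter_spec D hN hargs hc hq hdP hvP (by omega) hdG (by omega)) (by simp)
    (by simp) (by simp) fun s1 f1 v1 => ?_
  have hc1 := hc.frame' f1 (by intro i hi; simp; omega) (by simp; omega)
  refine last_rule (core_spec D (by
    rcases hargs with h | h
    · exact Or.inl ⟨h.1, h.2.1, h.2.2.1, h.2.2.2.1, h.2.2.2.2.1, h.2.2.2.2.2.1⟩
    · exact Or.inr ⟨h.1, h.2.1, h.2.2.1, h.2.2.2.1, h.2.2.2.2.1, h.2.2.2.2.2.1⟩) hc1.regs hN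
    ((f1.ireg dP (by simp; omega)).trans hdP) hvP (by omega)
    ((f1.ireg dG (by simp; omega)).trans hdG) hvG (by omega) hc1.root hc1.weightHat)
    (by simp) (by simp) (by simp) fun s2 f2 v2 b hb j hj k hk => ?_
  rw [v2 b hb j hj k hk, v1 b hb j hj k hk, f1.rarr P (by simpa using hP.1),
    f1.rarr F (by simpa using hP.2.1), f1.rarr G (by simpa using hP.2.2.1),
    sum_conj_mixSum hζ hζ1 D.hTL hPG (invCount d₁ d₂) _ _ _ _ _ (fun _ _ => rfl) (fun _ _ => rfl) hb,
    ← Finset.sum_sub_distrib]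
  refine Finset.sum_congr rfl fun a _ => ?_
  rw [← Finset.sum_sub_distrib]
  refine Finset.sum_congr rfl fun i _ => ?_
  rw [← mul_sub, ← mul_sub]
  congr 3
  rw [Finset.sum_comm]
  refine Finset.sum_congr rfl fun a' _ => ?_
  rw [Finset.sum_comm]
  exact Finset.sum_congr rfl fun b' _ => sum_ite_const _ _ _

theorem residualMat_apply (S : StepData n d₁ d₂ r m) (q : Fin m → ℝ)
    (Z : Matrix (Blk n d₁) (Blk n d₂) ℝ) {s : Store} {ζ : ℂ} (hc : Ctx S N T L ζ s)
    (hZ : FactorsAt r s Z) (p : Blk n d₁) (p' : Blk n d₂) :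
    S.residualMat q Z p p' = invCount d₁ d₂ (p.1 + p'.1) * (∑ l : Fin m,
      (if s.iarr 0 l = p.2 ∧ s.iarr 1 l = p'.2 ∧ s.iarr 2 l = p.1 + p'.1 then q l else 0) -
      antidiagSum d₁ d₂ n r s p.2 p'.2 (p.1 + p'.1)) := by
  rw [StepData.residualMat, blockHankel, Matrix.of_apply, countInv_mulVec, Pi.sub_apply,
    sampleMat_transpose_mulVec, ← antidiagSum_eq hZ]
  dsimp only
  congr 2
  refine Finset.sum_congr rfl fun l _ => if_congr ?_ rfl rfl
  rw [hc.row_eq, hc.col_eq, hc.time_eq, Prod.ext_iff, Prod.ext_iff, Fin.ext_iff, Fin.ext_iff,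
    Fin.ext_iff]
  dsimp only
  constructor
  · rintro ⟨h1, h2, h3⟩; exact ⟨h1.symm, h2.symm, h3.symm⟩
  · rintro ⟨h1, h2, h3⟩; exact ⟨h1.symm, h2.symm, h3.symm⟩

theorem half_left (D : Dims n d₁ d₂ r m T L X SP B) (hN : N ≤ X)
    {S : StepData n d₁ d₂ r m} {ζ : ℂ} (hζ : IsPrimitiveRoot ζ L) (hζ1 : ζ * star ζ = 1)
    {s : Store} {q : Fin m → ℝ} {Z : Matrix (Blk n d₁) (Blk n d₂) ℝ}
    (hc : Ctx S N T L ζ s) (hq : VecAt s 24 q) (hZ : FactorsAt r s Z) :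
    ∃ s', Runs X SP B (half 0 22 23 25 1 2 0 1) [9, 10, 11, 12, 13] []
        [28, 29, 30, 31, 32, 33, 34, 35, 36, 37, 25] s s' ∧
      MatAt s' 25 ((S.residualMat q Z)ᵀ * S.U) := by
  refine last_rule (half_spec D hN hζ hζ1 (Or.inl ⟨rfl, rfl, rfl, rfl, rfl, rfl, rfl, rfl⟩) hc hq
    hc.regs.d₁_eq D.hd₁ hc.regs.d₂_eq D.hd₂ D.hT) (by simp) (by simp) (by simp)
    fun s1 _ v1 p' k => ?_
  rw [v1 _ p'.1.isLt _ p'.2.isLt _ k.isLt, sum_blk fun a i => s.rarr 0 ((a * n + i) * r + k) *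
          (invCount d₁ d₂ (a + p'.1) * (∑ l : Fin m,
            (if s.iarr 0 l = i ∧ s.iarr 1 l = p'.2 ∧ s.iarr 2 l = a + p'.1 then q l else 0) -
            ∑ a' ∈ Finset.range d₁, ∑ b' ∈ Finset.range d₂, if a' + b' = a + p'.1 then
              ∑ c ∈ Finset.range (2 * r), s.rarr 22 ((a' * n + i) * (2 * r) + c) *
                s.rarr 23 ((b' * n + p'.2) * (2 * r) + c) else 0)), Matrix.mul_apply]
  refine Finset.sum_congr rfl fun p _ => ?_
  rw [hc.U_eq p k, Matrix.transpose_apply, residualMat_apply S q Z hc hZ, mul_comm]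
  rfl

/-- The transpose of the residual matrix has the same structure with the roles of rows and columns,
of d₁ and d₂, and of the two factors exchanged. -/
theorem half_right (D : Dims n d₁ d₂ r m T L X SP B) (hN : N ≤ X)
    {S : StepData n d₁ d₂ r m} {ζ : ℂ} (hζ : IsPrimitiveRoot ζ L) (hζ1 : ζ * star ζ = 1)
    {s : Store} {q : Fin m → ℝ} {Z : Matrix (Blk n d₁) (Blk n d₂) ℝ}
    (hc : Ctx S N T L ζ s) (hq : VecAt s 24 q) (hZ : FactorsAt r s Z) :
    ∃ s', Runs X SP B (half 1 23 22 26 2 1 1 0) [9, 10, 11, 12, 13] []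
        [28, 29, 30, 31, 32, 33, 34, 35, 36, 37, 26] s s' ∧
      MatAt s' 26 (S.residualMat q Z * S.V) := by
  refine last_rule (half_spec D hN hζ hζ1 (Or.inr ⟨rfl, rfl, rfl, rfl, rfl, rfl, rfl, rfl⟩) hc hq
    hc.regs.d₂_eq D.hd₂ hc.regs.d₁_eq D.hd₁ D.swap.hT) (by simp) (by simp) (by simp)
    fun s1 _ v1 p k => ?_
  rw [v1 _ p.1.isLt _ p.2.isLt _ k.isLt, sum_blk fun b j => s.rarr 1 ((b * n + j) * r + k) *
          (invCount d₁ d₂ (b + p.1) * (∑ l : Fin m,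
            (if s.iarr 1 l = j ∧ s.iarr 0 l = p.2 ∧ s.iarr 2 l = b + p.1 then q l else 0) -
            ∑ b' ∈ Finset.range d₂, ∑ a' ∈ Finset.range d₁, if b' + a' = b + p.1 then
              ∑ c ∈ Finset.range (2 * r), s.rarr 23 ((b' * n + j) * (2 * r) + c) *
                s.rarr 22 ((a' * n + p.2) * (2 * r) + c) else 0)), Matrix.mul_apply]
  refine Finset.sum_congr rfl fun p' _ => ?_
  rw [hc.V_eq p' k, residualMat_apply S q Z hc hZ, mul_comm, add_comm (p'.1 : ℕ) p.1]
  congr 3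
  · exact Finset.sum_congr rfl fun l _ => if_congr and_left_comm rfl rfl
  · rw [antidiagSum, Finset.sum_comm]
    refine Finset.sum_congr rfl fun a _ => Finset.sum_congr rfl fun b _ =>
      if_congr (by rw [add_comm]) (Finset.sum_congr rfl fun c _ => mul_comm _ _) rfl

end RAM

namespace RAM

variable {n d₁ d₂ r m N T L X SP B : ℕ}

/-! ### Multiplication with the matrix of the linear system -/

/-- Leading singular values exceed ε, so the maxima in the weight disappear and the program can use
the stored values directly. -/
theorem mDiag_inl {S : StepData n d₁ d₂ r m} (hS : S.Valid) (i j : Fin r) :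
    S.mDiag (Sum.inl (i, j)) = S.σ i * S.σ j / (S.σ i * S.σ j - S.ε * S.ε) := by
  simp only [StepData.mDiag, tangentWeight, mul_inv, inv_inv, max_eq_left (hS.ε_lt _).le, sq]

theorem mDiag_inr_inl {S : StepData n d₁ d₂ r m} (hS : S.Valid) (i : Fin r) (q : Blk n d₂) :
    S.mDiag (Sum.inr (Sum.inl (i, q))) = S.σ i * S.ε / (S.σ i * S.ε - S.ε * S.ε) := by
  simp only [StepData.mDiag, tangentWeight, mul_inv, inv_inv, max_eq_left (hS.ε_lt _).le, sq]

theorem mDiag_inr_inr {S : StepData n d₁ d₂ r m} (hS : S.Valid) (p : Blk n d₁) (j : Fin r) :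
    S.mDiag (Sum.inr (Sum.inr (p, j))) = S.ε * S.σ j / (S.ε * S.σ j - S.ε * S.ε) := by
  simp only [StepData.mDiag, tangentWeight, mul_inv, inv_inv, max_eq_left (hS.ε_lt _).le, sq]

theorem _root_.TOIRLS.Dims.tot_le_SP (D : Dims n d₁ d₂ r m T L X SP B) :
    r * r + r * (d₂ * n) + d₁ * n * r ≤ SP :=
  D.le_SP (by have := D.tot_le; omega)

/-- The projections are expanded: UᵀY(1 − VVᵀ) = UᵀY − (UᵀYV)Vᵀ and (1 − UUᵀ)YV = YV − U(UᵀYV). Thus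
YᵀU, YV and the small matrix UᵀYV in array 27 suffice. -/
theorem gather_spec (D : Dims n d₁ d₂ r m T L X SP B) (hN : N ≤ X) {S : StepData n d₁ d₂ r m}
    (hS : S.Valid) {ζ : ℂ} {s : Store} {γ : Par n d₁ d₂ r → ℝ}
    {Y : Matrix (Blk n d₁) (Blk n d₂) ℝ} (hc : Ctx S N T L ζ s)
    (hγ : FlatAt s 15 γ) (h25 : MatAt s 25 (Yᵀ * S.U)) (h26 : MatAt s 26 (Y * S.V)) :
    ∃ s', Runs X SP B gather [10, 11, 12, 13] [] [16, 27] s s' ∧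
      FlatAt s' 16 ((tangentMat S.U S.V)ᵀ *ᵥ vec Y + fun c => S.mDiag c * γ c) := by
  have hb := D.bounds
  have hrr := D.rr_le
  have hr0 := hc.regs
  unfold gather
  refine seq_rule (compute_runs hb (hr0.le D hN) (by decide) (by decide) ?_
    (boxOk_rrdn D hr0 hr0.d₁_eq D.hd₁ D.d₁_le).1 (boxOk_rrdn D hr0 hr0.d₁_eq D.hd₁ D.d₁_le).2 ?_)
    (by simp) (by simp) (by simp) ?_
  · simp only [IExp.val, hr0.r_eq]; exact D.le_SP (by omega)
  · simp only [boxAll, IExp.val, IExp.Ok, RExp.Ok, Store.withI_ireg, Nat.reduceEqDiff, reduceIte,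
      hr0.r_eq, hr0.d₁_eq, hr0.n_eq, true_and]
    intro i hi j hj b hb j' hj'
    exact ⟨D.rr_lt hi hj, D.dnr_lt D.d₁_le hb hj' hi, D.dnr_lt D.d₁_le hb hj' hj⟩
  intro s1 f1 v1
  replace v1 : SqAt s1 27 (S.Uᵀ * (Y * S.V)) := fun i j => by
    rw [v1 _ (by simp only [IExp.val, hr0.r_eq]; exact idx_lt i.isLt j.isLt)]
    simp only [boxSum, IExp.val, RExp.val, Store.withI_ireg, Store.withI_rarr, Nat.reduceEqDiff,
      reduceIte, hr0.r_eq, hr0.d₁_eq, hr0.n_eq, sum_ite_const]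
    rw [sum_idx2 i.isLt j.isLt fun i j => ∑ b ∈ Finset.range d₁, ∑ j' ∈ Finset.range n,
      s.rarr 0 ((b * n + j') * r + i) * s.rarr 26 ((b * n + j') * r + j),
      sum_blk fun b j' => s.rarr 0 ((b * n + j') * r + i) * s.rarr 26 ((b * n + j') * r + j)]
    simp only [hc.U_eq _ _, h26 _ _]
    rfl
  have hc1 := hc.frame' f1 (by intro i hi; simp; omega) (by simp)
  have hγ1 := hγ.frame f1 (by simp)
  replace h25 := h25.frame f1 (by simp)
  replace h26 := h26.frame f1 (by simp)
  have hr1 := hc1.regs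
  clear f1
  refine seq_rule (compute_runs hb (hr1.le D hN) (by decide) (by decide) ?_ (boxOk_rr D hr1).1
    (boxOk_rr D hr1).2 ?_) (by simp) (by simp) (by simp) ?_
  · simp only [IExp.val, hr1.r_eq, hr1.d₁_eq, hr1.d₂_eq, hr1.n_eq]; exact D.tot_le_SP
  · simp only [boxAll, IExp.val, IExp.Ok, RExp.Ok, Store.withI_ireg, Nat.reduceEqDiff, reduceIte,
      hr1.r_eq, true_and]
    intro i hi j hj
    have := D.rr_lt hi hj
    have := D.two_r_le
    refine ⟨?_, ?_, ?_, ⟨?_, ?_⟩, ⟨?_, ?_⟩, trivial⟩ <;> omega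
  intro s2 f2 v2
  replace v2 : FlatAt s2 16 (parOf (S.Uᵀ * (Y * S.V) + Matrix.of fun i j =>
      S.mDiag (Sum.inl (i, j)) * γ (Sum.inl (i, j))) 0 0 : Par n d₁ d₂ r → ℝ) := fun c => by
    rw [v2 _ (by simp only [IExp.val, hr1.r_eq, hr1.d₁_eq, hr1.d₂_eq, hr1.n_eq]; exact flat_lt c)]
    simp only [boxSum, IExp.val, RExp.val, Store.withI_ireg, Store.withI_rarr, Store.withI_rreg,
      Nat.reduceEqDiff, reduceIte, hr1.r_eq]
    rw [sum_flat1 fun i j => s1.rarr 27 (i * r + j) + s1.rarr 15 (i * r + j) *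
      (s1.rarr 2 i * s1.rarr 2 j / (s1.rarr 2 i * s1.rarr 2 j - s1.rreg 1 * s1.rreg 1))]
    rcases c with ⟨i, j⟩ | c | c
    · simp only [v1 i j, hγ1.at1, hc1.σ_eq, hc1.ε_eq, ← mDiag_inl hS]
      rw [mul_comm]; rfl
    · rfl
    · rfl
  have hc2 := hc1.frame' f2 (by intro i hi; simp; omega) (by simp)
  have hγ2 := hγ1.frame f2 (by simp)
  replace h25 := h25.frame f2 (by simp)
  replace h26 := h26.frame f2 (by simp)
  replace v1 := v1.frame f2 (by simp)
  have hr2 := hc2.regs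
  clear f2 hγ1
  refine seq_rule (nest_runs hb (hr2.le D hN) (by decide)
    (boxOk_rdn D hr2).1 (boxOk_rdn D hr2).2 ?_) (by simp) (by simp) (by simp) ?_
  · simp only [boxAll, IExp.val, IExp.Ok, RExp.Ok, Store.withI_ireg, Nat.reduceEqDiff, reduceIte,
      hr2.r_eq, hr2.d₂_eq, hr2.n_eq, true_and, and_true]
    intro i hi b hb j hj
    have := D.two_r_le
    exact ⟨D.pos2_lt hi hb hj, D.dnr_lt D.d₂_le hb hj hi, D.pos2_lt hi hb hj, by omega⟩
  intro s3 f3 v3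
  replace v3 : FlatAt s3 16 (parOf (S.Uᵀ * (Y * S.V) + Matrix.of fun i j =>
      S.mDiag (Sum.inl (i, j)) * γ (Sum.inl (i, j))) (S.Uᵀ * Y + Matrix.of fun i q =>
      S.mDiag (Sum.inr (Sum.inl (i, q))) * γ (Sum.inr (Sum.inl (i, q)))) 0 : Par n d₁ d₂ r → ℝ) :=
      fun c => by
    rw [v3, v2 c]
    simp only [boxSum, IExp.val, RExp.val, Store.withI_ireg, Store.withI_rarr, Store.withI_rreg,
      Nat.reduceEqDiff, reduceIte, hr2.r_eq, hr2.d₂_eq, hr2.n_eq]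
    rw [sum_flat2 fun i b j => s2.rarr 25 ((b * n + j) * r + i) +
      s2.rarr 15 (r * r + (i * (d₂ * n) + (b * n + j))) *
      (s2.rarr 2 i * s2.rreg 1 / (s2.rarr 2 i * s2.rreg 1 - s2.rreg 1 * s2.rreg 1))]
    rcases c with c | ⟨i, q⟩ | c
    · exact add_zero _
    · simp only [h25 q i, hγ2.at2, hc2.σ_eq, hc2.ε_eq, ← mDiag_inr_inl hS _ q]
      rw [mul_comm]
      simp only [parOf, Matrix.zero_apply, zero_add, Matrix.add_apply, Matrix.of_apply]
      congr 1
      rw [← Matrix.transpose_apply (Yᵀ * S.U), Matrix.transpose_mul, Matrix.transpose_transpose]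
    · exact add_zero _
  have hc3 := hc2.frame' f3 (by intro i hi; simp; omega) (by simp)
  have hγ3 := hγ2.frame f3 (by simp)
  replace h26 := h26.frame f3 (by simp)
  replace v1 := v1.frame f3 (by simp)
  have hr3 := hc3.regs
  clear f3 hγ2 v2 h25
  refine seq_rule (nest_runs hb (hr3.le D hN) (by decide)
    (boxOk_rdnr D hr3).1 (boxOk_rdnr D hr3).2 ?_) (by simp) (by simp) (by simp) ?_
  · simp only [boxAll, IExp.val, IExp.Ok, RExp.Ok, Store.withI_ireg, Nat.reduceEqDiff, reduceIte,
      hr3.r_eq, hr3.d₂_eq, hr3.n_eq, true_and]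
    intro i hi b hb j hj k hk
    exact ⟨D.pos2_lt hi hb hj, D.rr_lt hi hk, D.dnr_lt D.d₂_le hb hj hk⟩
  intro s4 f4 v4
  replace v4 : FlatAt s4 16 (parOf (S.Uᵀ * (Y * S.V) + Matrix.of fun i j =>
      S.mDiag (Sum.inl (i, j)) * γ (Sum.inl (i, j))) (S.Uᵀ * Y * (1 - S.V * S.Vᵀ) +
      Matrix.of fun i q => S.mDiag (Sum.inr (Sum.inl (i, q))) * γ (Sum.inr (Sum.inl (i, q)))) 0 :
      Par n d₁ d₂ r → ℝ) := fun c => by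
    rw [v4, v3 c]
    simp only [boxSum, IExp.val, RExp.val, Store.withI_ireg, Store.withI_rarr,
      Nat.reduceEqDiff, reduceIte, hr3.r_eq, hr3.d₂_eq, hr3.n_eq, sum_ite_const]
    rw [sum_flat2 fun i b j => ∑ k ∈ Finset.range r, (((0 : ℕ) : ℝ) - s3.rarr 27 (i * r + k) *
      s3.rarr 1 ((b * n + j) * r + k))]
    rcases c with c | ⟨i, q⟩ | c
    · exact add_zero _
    · simp only [Finset.sum_range, hc3.V_eq q, v1 i, Nat.cast_zero, zero_sub,
        Finset.sum_neg_distrib, parOf, Matrix.add_apply, Matrix.of_apply]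
      have e : S.Uᵀ * Y * (1 - S.V * S.Vᵀ) = S.Uᵀ * Y - S.Uᵀ * (Y * S.V) * S.Vᵀ := by
        simp only [Matrix.mul_sub, Matrix.mul_one, Matrix.mul_assoc]
      rw [e, Matrix.sub_apply, Matrix.mul_apply (M := S.Uᵀ * (Y * S.V))]
      simp only [Matrix.transpose_apply]
      ring
    · exact add_zero _
  have hc4 := hc3.frame' f4 (by intro i hi; simp; omega) (by simp)
  have hγ4 := hγ3.frame f4 (by simp)
  replace h26 := h26.frame f4 (by simp)
  replace v1 := v1.frame f4 (by simp)
  have hr4 := hc4.regs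
  clear f4 hγ3 v3
  refine seq_rule (nest_runs hb (hr4.le D hN) (by decide)
    (boxOk_dnr D hr4 hr4.d₁_eq D.hd₁ D.d₁_le).1 (boxOk_dnr D hr4 hr4.d₁_eq D.hd₁ D.d₁_le).2 ?_)
    (by simp) (by simp) (by simp) ?_
  · simp only [boxAll, IExp.val, IExp.Ok, RExp.Ok, Store.withI_ireg, Nat.reduceEqDiff, reduceIte,
      hr4.r_eq, hr4.d₁_eq, hr4.d₂_eq, hr4.n_eq, true_and, and_true]
    intro a ha i hi k hk
    have := D.two_r_le
    exact ⟨D.pos3_lt ha hi hk, D.dnr_lt D.d₁_le ha hi hk, D.pos3_lt ha hi hk, by omega⟩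
  intro s5 f5 v5
  replace v5 : FlatAt s5 16 (parOf (S.Uᵀ * (Y * S.V) + Matrix.of fun i j =>
      S.mDiag (Sum.inl (i, j)) * γ (Sum.inl (i, j))) (S.Uᵀ * Y * (1 - S.V * S.Vᵀ) +
      Matrix.of fun i q => S.mDiag (Sum.inr (Sum.inl (i, q))) * γ (Sum.inr (Sum.inl (i, q))))
      (Y * S.V + Matrix.of fun p j => S.mDiag (Sum.inr (Sum.inr (p, j))) *
        γ (Sum.inr (Sum.inr (p, j)))) : Par n d₁ d₂ r → ℝ) := fun c => by
    rw [v5, v4 c]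
    simp only [boxSum, IExp.val, RExp.val, Store.withI_ireg, Store.withI_rarr, Store.withI_rreg,
      Nat.reduceEqDiff, reduceIte, hr4.r_eq, hr4.d₁_eq, hr4.d₂_eq, hr4.n_eq]
    rw [sum_flat3 fun a i k => s4.rarr 26 ((a * n + i) * r + k) +
      s4.rarr 15 (r * r + r * (d₂ * n) + ((a * n + i) * r + k)) *
      (s4.rreg 1 * s4.rarr 2 k / (s4.rreg 1 * s4.rarr 2 k - s4.rreg 1 * s4.rreg 1))]
    rcases c with c | c | ⟨p, j⟩
    · exact add_zero _
    · exact add_zero _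
    · simp only [h26 p j, hγ4.at3, hc4.σ_eq, hc4.ε_eq, ← mDiag_inr_inr hS p]
      rw [mul_comm]
      simp only [parOf, Matrix.zero_apply, zero_add, Matrix.add_apply, Matrix.of_apply]
  have hc5 := hc4.frame' f5 (by intro i hi; simp; omega) (by simp)
  replace v1 := v1.frame f5 (by simp)
  have hr5 := hc5.regs
  clear f5 hγ4 v4 h26
  refine last_rule (nest_runs hb (hr5.le D hN) (by decide)
    (boxOk_dnrr D hr5 hr5.d₁_eq D.hd₁ D.d₁_le).1 (boxOk_dnrr D hr5 hr5.d₁_eq D.hd₁ D.d₁_le).2 ?_)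
    (by simp) (by simp) (by simp) ?_
  · simp only [boxAll, IExp.val, IExp.Ok, RExp.Ok, Store.withI_ireg, Nat.reduceEqDiff, reduceIte,
      hr5.r_eq, hr5.d₁_eq, hr5.d₂_eq, hr5.n_eq, true_and]
    intro a ha i hi k hk k' hk'
    exact ⟨D.pos3_lt ha hi hk, D.dnr_lt D.d₁_le ha hi hk', D.rr_lt hk' hk⟩
  intro s6 f6 v6 c
  rw [v6, v5 c, tangentMat_transpose_mulVec]
  simp only [boxSum, IExp.val, RExp.val, Store.withI_ireg, Store.withI_rarr,
    Nat.reduceEqDiff, reduceIte, hr5.r_eq, hr5.d₁_eq, hr5.d₂_eq, hr5.n_eq, sum_ite_const]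
  rw [sum_flat3 fun a i k => ∑ k' ∈ Finset.range r, (((0 : ℕ) : ℝ) -
    s5.rarr 0 ((a * n + i) * r + k') * s5.rarr 27 (k' * r + k))]
  rcases c with ⟨i, j⟩ | ⟨i, q⟩ | ⟨p, j⟩
  · simp only [parOf, Matrix.add_apply, Matrix.of_apply, Pi.add_apply, add_zero, Matrix.mul_assoc]
  · simp only [parOf, Matrix.add_apply, Matrix.of_apply, Pi.add_apply, add_zero]
  · simp only [Finset.sum_range, hc5.U_eq p, v1 _ j, Nat.cast_zero, zero_sub,
      Finset.sum_neg_distrib, parOf, Matrix.add_apply, Matrix.of_apply, Pi.add_apply]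
    rw [Matrix.mul_assoc, Matrix.sub_mul, Matrix.one_mul, Matrix.sub_apply, Matrix.mul_assoc S.U,
      Matrix.mul_apply (M := S.U) (N := S.Uᵀ * (Y * S.V))]
    ring

/-- Real register 2 supplies κ, so one program serves the iteration, the initial residual and the
final sample vector. -/
theorem applySystem_spec [NeZero d₁] [NeZero d₂] (D : Dims n d₁ d₂ r m T L X SP B) (hN : N ≤ X)
    {S : StepData n d₁ d₂ r m} (hS : S.Valid) {ζ : ℂ} (hζ : IsPrimitiveRoot ζ L)
    (hζ1 : ζ * star ζ = 1) {s : Store} {γ : Par n d₁ d₂ r → ℝ} (hc : Ctx S N T L ζ s)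
    (hγ : FlatAt s 15 γ) :
    ∃ s', Runs X SP B applySystem [9, 10, 11, 12, 13] [] [16, 20, 21, 22, 23, 24, 25, 26, 27, 28,
        29, 30, 31, 32, 33, 34, 35, 36, 37] s s' ∧
      FlatAt s' 16 (S.M *ᵥ γ - s.rreg 2 • S.rhs) ∧
      VecAt s' 24 (S.K⁻¹ *ᵥ (S.E *ᵥ γ - s.rreg 2 • S.y)) := by
  unfold applySystem
  refine seq_rule (factors_spec D hN hc hγ) (by simp) (by simp) (by simp) fun s1 f1 v1 => ?_
  have hc1 := hc.frame' f1 (by intro i hi; simp; omega) (by simp)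
  refine seq_rule (samples_spec D hN hS hc1 v1) (by simp) (by simp) (by simp) fun s2 f2 v2 => ?_
  rw [f1.rreg 2 (by simp)] at v2
  have hc2 := hc1.frame' f2 (by intro i hi; simp; omega) (by simp)
  have w2 : FactorsAt r s2 (tangentFun S.U S.V γ) := fun p q => by
    rw [← v1 p q, f2.rarr 22 (by simp), f2.rarr 23 (by simp)]
  refine seq_rule (half_left D hN hζ hζ1 hc2 v2 w2) (by simp) (by simp) (by simp)
    fun s3 f3 v3 => ?_
  have hc3 := hc2.frame' f3 (by intro i hi; simp; omega) (by simp)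
  have w3 : FactorsAt r s3 (tangentFun S.U S.V γ) := fun p q => by
    rw [← w2 p q, f3.rarr 22 (by simp), f3.rarr 23 (by simp)]
  have u3 : VecAt s3 24 (S.K⁻¹ *ᵥ (S.E *ᵥ γ - s.rreg 2 • S.y)) := fun l => by
    rw [← v2 l, f3.rarr 24 (by simp)]
  refine seq_rule (half_right D hN hζ hζ1 hc3 u3 w3) (by simp) (by simp) (by simp)
    fun s4 f4 v4 => ?_
  have hc4 := hc3.frame' f4 (by intro i hi; simp; omega) (by simp)
  refine last_rule (gather_spec D hN hS hc4 ((((hγ.frame f1 (by simp)).frame f2 (by simp)).frame f3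
    (by simp)).frame f4 (by simp)) (v3.frame f4 (by simp)) v4) (by simp) (by simp) (by simp)
    fun s5 f5 v5 => ⟨?_, fun l => ?_⟩
  · rwa [StepData.system_eq]
  · rw [← u3 l, f5.rarr 24 (by simp), f4.rarr 24 (by simp)]

end RAM

namespace RAM

variable {n d₁ d₂ r m N T L X SP B : ℕ}

/-! ### Vector operations on parameters -/

theorem sum_par (f : Par n d₁ d₂ r → ℝ) :
    ∑ c, f c = ∑ i : Fin r, ∑ j : Fin r, f (Sum.inl (i, j)) +
      ∑ i : Fin r, ∑ q : Blk n d₂, f (Sum.inr (Sum.inl (i, q))) +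
      ∑ p : Blk n d₁, ∑ j : Fin r, f (Sum.inr (Sum.inr (p, j))) := by
  rw [Fintype.sum_sum_type, Fintype.sum_sum_type, add_assoc, Fintype.sum_prod_type,
    Fintype.sum_prod_type, Fintype.sum_prod_type]

/-- The possible arguments of the program `dotPar`. -/
def DotArgs (dst a b : ℕ) : Prop :=
  (dst = 18 ∧ a = 15 ∧ b = 16) ∨ (dst = 19 ∧ a = 14 ∧ b = 14) ∨ (dst = 17 ∧ a = 14 ∧ b = 14)

theorem dotPar_spec (D : Dims n d₁ d₂ r m T L X SP B) (hN : N ≤ X) {S : StepData n d₁ d₂ r m}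
    {ζ : ℂ} {s : Store} {dst a b : ℕ} (hargs : DotArgs dst a b) {γ δ : Par n d₁ d₂ r → ℝ}
    (hc : Ctx S N T L ζ s) (hγ : FlatAt s a γ) (hδ : FlatAt s b δ) :
    ∃ s', Runs X SP B (dotPar dst a b) [10, 11, 12] [] [dst] s s' ∧ s'.rarr dst 0 = γ ⬝ᵥ δ := by
  have hb := D.bounds
  have hr0 := hc.regs
  have hpos : 0 < SP := D.n_le.trans_lt' D.hn
  have hdst : 13 ≤ dst ∧ a ≠ dst ∧ b ≠ dst := by rcases hargs with h | h | h <;> omega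
  -- Reduces the syntactic side conditions to three closed instances that can be decided.
  have side : ∀ {P : ℕ → ℕ → ℕ → Prop}, P 18 15 16 → P 19 14 14 → P 17 14 14 → P dst a b := by
    rcases hargs with ⟨rfl, rfl, rfl⟩ | ⟨rfl, rfl, rfl⟩ | ⟨rfl, rfl, rfl⟩
    · exact fun h _ _ => h
    · exact fun _ h _ => h
    · exact fun _ _ h => h
  have ha : a ∉ [dst] := by simpa using hdst.2.1
  have hb' : b ∉ [dst] := by simpa using hdst.2.2
  unfold dotPar
  refine seq_rule (compute_runs hb (hr0.le D hN)
    (side (P := fun dst a b => NestSide (List.range 9) dst [(10, IExp.reg 3), (11, IExp.reg 3)]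
      (IExp.lit 0) (RExp.mul (RExp.get a (pos1 (IExp.reg 10) (IExp.reg 11)))
        (RExp.get b (pos1 (IExp.reg 10) (IExp.reg 11))))) (by decide) (by decide) (by decide))
    (by decide) ?_ (boxOk_rr D hr0).1 (boxOk_rr D hr0).2 ?_) (by simp) (by simp) (by simp) ?_
  · exact hpos
  · simp only [boxAll, IExp.val, IExp.Ok, RExp.Ok, Store.withI_ireg, Nat.reduceEqDiff, reduceIte,
      hr0.r_eq, true_and]
    intro i hi j hj
    exact ⟨hpos, D.rr_lt hi hj, D.rr_lt hi hj⟩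
  intro s1 f1 v1
  replace v1 : s1.rarr dst 0 = ∑ i : Fin r, ∑ j : Fin r, γ (Sum.inl (i, j)) * δ (Sum.inl (i, j)) := by
    rw [v1 0 (by simp [IExp.val])]
    simp only [boxSum, IExp.val, RExp.val, Store.withI_ireg, Store.withI_rarr, Nat.reduceEqDiff,
      reduceIte, hr0.r_eq, Finset.sum_range, hγ.at1, hδ.at1]
  have hc1 := hc.frame' f1 (by intro i hi; simp; omega) (by simpa using hdst.1)
  have hγ1 := hγ.frame f1 ha
  have hδ1 := hδ.frame f1 hb'
  have hr1 := hc1.regs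
  clear f1
  refine seq_rule (nest_runs hb (hr1.le D hN)
    (side (P := fun dst a b => NestSide (List.range 9) dst
      [(10, IExp.reg 3), (11, IExp.reg 2), (12, IExp.reg 0)]
      (IExp.lit 0) (RExp.mul (RExp.get a (pos2 (IExp.reg 10) (IExp.reg 11) (IExp.reg 12)))
        (RExp.get b (pos2 (IExp.reg 10) (IExp.reg 11) (IExp.reg 12)))))
        (by decide) (by decide) (by decide))
    (boxOk_rdn D hr1).1 (boxOk_rdn D hr1).2 ?_) (by simp) (by simp) (by simp) ?_
  · simp only [boxAll, IExp.val, IExp.Ok, RExp.Ok, Store.withI_ireg, Nat.reduceEqDiff, reduceIte,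
      hr1.r_eq, hr1.d₂_eq, hr1.n_eq, true_and]
    intro i hi b hb j hj
    exact ⟨hpos, D.pos2_lt hi hb hj, D.pos2_lt hi hb hj⟩
  intro s2 f2 v2
  specialize v2 0
  simp only [boxSum, IExp.val, RExp.val, Store.withI_ireg, Store.withI_rarr, Nat.reduceEqDiff,
    reduceIte, hr1.r_eq, hr1.d₂_eq, hr1.n_eq, v1] at v2
  simp only [sum_blk fun b' j => s1.rarr a (r * r + (_ * (d₂ * n) + (b' * n + j))) *
    s1.rarr b (r * r + (_ * (d₂ * n) + (b' * n + j)))] at v2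
  simp only [Finset.sum_range, hγ1.at2, hδ1.at2] at v2
  have hc2 := hc1.frame' f2 (by intro i hi; simp; omega) (by simpa using hdst.1)
  have hγ2 := hγ1.frame f2 ha
  have hδ2 := hδ1.frame f2 hb'
  have hr2 := hc2.regs
  clear f2
  refine last_rule (nest_runs hb (hr2.le D hN)
    (side (P := fun dst a b => NestSide (List.range 9) dst
      [(10, IExp.reg 1), (11, IExp.reg 0), (12, IExp.reg 3)]
      (IExp.lit 0) (RExp.mul (RExp.get a (pos3 (IExp.reg 10) (IExp.reg 11) (IExp.reg 12)))
        (RExp.get b (pos3 (IExp.reg 10) (IExp.reg 11) (IExp.reg 12)))))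
        (by decide) (by decide) (by decide))
    (boxOk_dnr D hr2 hr2.d₁_eq D.hd₁ D.d₁_le).1 (boxOk_dnr D hr2 hr2.d₁_eq D.hd₁ D.d₁_le).2 ?_)
    (by simp) (by simp) (by simp) ?_
  · simp only [boxAll, IExp.val, IExp.Ok, RExp.Ok, Store.withI_ireg, Nat.reduceEqDiff, reduceIte,
      hr2.r_eq, hr2.d₁_eq, hr2.d₂_eq, hr2.n_eq, true_and]
    intro i hi b hb j hj
    exact ⟨hpos, D.pos3_lt hi hb hj, D.pos3_lt hi hb hj⟩
  intro s3 f3 v3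
  specialize v3 0
  simp only [boxSum, IExp.val, RExp.val, Store.withI_ireg, Store.withI_rarr, Nat.reduceEqDiff,
    reduceIte, hr2.r_eq, hr2.d₁_eq, hr2.d₂_eq, hr2.n_eq, v2] at v3
  rw [sum_blk fun b' j => ∑ k ∈ Finset.range r,
    s2.rarr a (r * r + r * (d₂ * n) + ((b' * n + j) * r + k)) *
    s2.rarr b (r * r + r * (d₂ * n) + ((b' * n + j) * r + k))] at v3
  simp only [Finset.sum_range, hγ2.at3, hδ2.at3] at v3
  rw [v3, dotProduct, sum_par]

theorem boxOk_tot (D : Dims n d₁ d₂ r m T L X SP B) {s : Store} (hs : Regs n d₁ d₂ r m N T L s) :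
    BoxOk SP B [(10, tot)] s := by
  have := D.tot_le_SP
  have := D.tot_le
  have := D.rnT_pos
  refine ⟨?_, ?_⟩
  · simpa only [List.forall_mem_cons, IExp.val, hs.r_eq, hs.n_eq, hs.d₁_eq, hs.d₂_eq,
      List.not_mem_nil, IsEmpty.forall_iff, implies_true, and_true]
  · simp only [boxVol, List.map, List.prod_cons, List.prod_nil, IExp.val, hs.r_eq, hs.n_eq,
      hs.d₁_eq, hs.d₂_eq, mul_one]
    exact D.le_B' (by omega)

theorem setPar_spec (D : Dims n d₁ d₂ r m T L X SP B) (hN : N ≤ X) {s : Store}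
    (hs : Regs n d₁ d₂ r m N T L s) {dst : ℕ} {x : RExp} (v : Par n d₁ d₂ r → ℝ)
    (hside : NestSide (List.range 9) dst [(10, tot)] (IExp.reg 10) x)
    (hok : ∀ k < SP, x.Ok X SP (s.withI 10 k)) (hx : ∀ c, x.val (s.withI 10 (flat c)) = v c) :
    ∃ s', Runs X SP B (setPar dst x) [10] [] [dst] s s' ∧ FlatAt s' dst v := by
  unfold setPar
  have htot := D.tot_le_SP
  refine last_rule (compute_runs D.bounds (hs.le D hN) hside (by decide) ?_ (boxOk_tot D hs).1
    (boxOk_tot D hs).2 ?_) (by simp) (by simp) (by simp) fun s1 _ v1 c => ?_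
  · simpa only [IExp.val, hs.r_eq, hs.d₁_eq, hs.d₂_eq, hs.n_eq] using htot
  · simp only [boxAll, IExp.val, IExp.Ok, Store.withI_ireg, reduceIte, hs.r_eq, hs.d₁_eq,
      hs.d₂_eq, hs.n_eq, true_and]
    exact fun k hk => ⟨by omega, hok k (by omega)⟩
  · have hlt := flat_lt c
    rw [v1 _ (by simpa only [IExp.val, hs.r_eq, hs.d₁_eq, hs.d₂_eq, hs.n_eq] using hlt)]
    simp only [boxSum, IExp.val, Store.withI_ireg, reduceIte, hs.r_eq, hs.d₁_eq, hs.d₂_eq, hs.n_eq]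
    rw [Finset.sum_ite_eq', if_pos (Finset.mem_range.mpr hlt), hx]

theorem addPar_spec (D : Dims n d₁ d₂ r m T L X SP B) (hN : N ≤ X) {s : Store}
    (hs : Regs n d₁ d₂ r m N T L s) {dst : ℕ} {x : RExp} {u : Par n d₁ d₂ r → ℝ}
    (hu : FlatAt s dst u) (v : Par n d₁ d₂ r → ℝ)
    (hside : NestSide (List.range 9) dst [(10, tot)] (IExp.reg 10) x)
    (hok : ∀ k < SP, x.Ok X SP (s.withI 10 k)) (hx : ∀ c, x.val (s.withI 10 (flat c)) = v c) :
    ∃ s', Runs X SP B (addPar dst x) [10] [] [dst] s s' ∧ FlatAt s' dst (u + v) := by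
  unfold addPar
  have htot := D.tot_le_SP
  refine last_rule (nest_runs D.bounds (hs.le D hN) hside (boxOk_tot D hs).1
    (boxOk_tot D hs).2 ?_) (by simp) (by simp) (by simp) fun s1 _ v1 c => ?_
  · simp only [boxAll, IExp.val, IExp.Ok, Store.withI_ireg, reduceIte, hs.r_eq, hs.d₁_eq,
      hs.d₂_eq, hs.n_eq, true_and]
    exact fun k hk => ⟨by omega, hok k (by omega)⟩
  · have hlt := flat_lt c
    rw [v1, hu c]
    simp only [boxSum, IExp.val, Store.withI_ireg, reduceIte, hs.r_eq, hs.d₁_eq, hs.d₂_eq, hs.n_eq]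
    rw [Finset.sum_ite_eq', if_pos (Finset.mem_range.mpr hlt), hx, Pi.add_apply]

/-! ### The conjugate gradient iteration -/

/-- The memory holds a state of the conjugate gradient method. -/
structure CgAt (S : StepData n d₁ d₂ r m) (N T L : ℕ) (ζ : ℂ) (γ₀ : Par n d₁ d₂ r → ℝ)
    (st : CGState (Par n d₁ d₂ r)) (s : Store) : Prop where
  ctx : Ctx S N T L ζ s
  κ_eq : s.rreg 2 = 0
  sol : FlatAt s 13 (γ₀ + st.sol)
  res : FlatAt s 14 st.res
  dir : FlatAt s 15 st.dir
  rr : s.rarr 17 0 = st.res ⬝ᵥ st.res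

theorem CgAt.frame {S : StepData n d₁ d₂ r m} {ζ : ℂ} {γ₀ : Par n d₁ d₂ r → ℝ}
    {st : CGState (Par n d₁ d₂ r)} {s s' : Store} {I : List ℕ} (h : CgAt S N T L ζ γ₀ st s)
    (hf : Frame I [] [] [] s s') (hI : ∀ i < 9, i ∉ I) : CgAt S N T L ζ γ₀ st s' :=
  ⟨h.ctx.frame' hf hI (by simp), (hf.rreg 2 (by simp)).trans h.κ_eq, h.sol.frame hf (by simp),
    h.res.frame hf (by simp), h.dir.frame hf (by simp), by rw [hf.rarr 17 (by simp)]; exact h.rr⟩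

/-- The squared norm of the residual is kept in array 17 from one step to the next. Machine division
and real division agree on denominator 0, so the steps after termination are reproduced as well. -/
theorem cgBody_spec [NeZero d₁] [NeZero d₂] (D : Dims n d₁ d₂ r m T L X SP B) (hN : N ≤ X)
    {S : StepData n d₁ d₂ r m} (hS : S.Valid) {ζ : ℂ} (hζ : IsPrimitiveRoot ζ L)
    (hζ1 : ζ * star ζ = 1) {s : Store} {γ₀ : Par n d₁ d₂ r → ℝ} {st : CGState (Par n d₁ d₂ r)}
    (h : CgAt S N T L ζ γ₀ st s) :
    ∃ s', Runs X SP B cgBody [9, 10, 11, 12, 13] [] [13, 14, 15, 16, 17, 18, 19, 20, 21, 22, 23,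
        24, 25, 26, 27, 28, 29, 30, 31, 32, 33, 34, 35, 36, 37, 39] s s' ∧
      CgAt S N T L ζ γ₀ (cgStep S.M st) s' := by
  have hpos : 0 < SP := D.n_le.trans_lt' D.hn
  unfold cgBody
  refine seq_rule (applySystem_spec D hN hS hζ hζ1 h.ctx h.dir) (by simp) (by simp) (by simp) ?_
  intro s1 f1 v1
  replace v1 := v1.1
  rw [h.κ_eq, zero_smul, sub_zero] at v1
  have c1 := h.ctx.frame' f1 (by intro i hi; simp; omega) (by simp)
  have κ1 := (f1.rreg 2 (by simp)).trans h.κ_eq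
  have x1 := h.sol.frame f1 (by simp)
  have r1 := h.res.frame f1 (by simp)
  have p1 := h.dir.frame f1 (by simp)
  have q1 : s1.rarr 17 0 = st.res ⬝ᵥ st.res := by rw [f1.rarr 17 (by simp)]; exact h.rr
  clear f1 h
  refine seq_rule (dotPar_spec D hN (Or.inl ⟨rfl, rfl, rfl⟩) c1 p1 v1) (by simp) (by simp)
    (by simp) ?_
  intro s2 f2 e2
  have c2 := c1.frame' f2 (by intro i hi; simp; omega) (by simp)
  have κ2 := (f2.rreg 2 (by simp)).trans κ1
  have x2 := x1.frame f2 (by simp)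
  have r2 := r1.frame f2 (by simp)
  have p2 := p1.frame f2 (by simp)
  have v2 := v1.frame f2 (by simp)
  have q2 : s2.rarr 17 0 = st.res ⬝ᵥ st.res := by rw [f2.rarr 17 (by simp)]; exact q1
  clear f2 c1 κ1 x1 r1 p1 v1 q1
  set α := (st.res ⬝ᵥ st.res) / (st.dir ⬝ᵥ (S.M *ᵥ st.dir)) with hα
  refine seq_rule (addPar_spec D hN c2.regs x2 (α • st.dir) (by decide) ?_ ?_) (by simp) (by simp)
    (by simp) ?_
  · intro k hk
    simp only [IExp.val, IExp.Ok, RExp.Ok, Store.withI_ireg, reduceIte, true_and]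
    exact ⟨⟨hpos, hpos⟩, hk⟩
  · intro c
    simp only [IExp.val, RExp.val, Store.withI_ireg, Store.withI_rarr, reduceIte, p2 c, q2, e2]
    rfl
  intro s3 f3 x3
  have c3 := c2.frame' f3 (by intro i hi; simp; omega) (by simp)
  have κ3 := (f3.rreg 2 (by simp)).trans κ2
  have r3 := r2.frame f3 (by simp)
  have p3 := p2.frame f3 (by simp)
  have v3 := v2.frame f3 (by simp)
  have q3 : s3.rarr 17 0 = st.res ⬝ᵥ st.res := by rw [f3.rarr 17 (by simp)]; exact q2
  have e3 : s3.rarr 18 0 = st.dir ⬝ᵥ (S.M *ᵥ st.dir) := by rw [f3.rarr 18 (by simp)]; exact e2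
  clear f3 c2 κ2 x2 r2 p2 v2 q2 e2
  refine seq_rule (addPar_spec D hN c3.regs r3 (-(α • (S.M *ᵥ st.dir))) (by decide) ?_ ?_) (by simp)
    (by simp) (by simp) ?_
  · intro k hk
    simp only [IExp.val, IExp.Ok, RExp.Ok, Store.withI_ireg, reduceIte, true_and]
    exact ⟨⟨hpos, hpos⟩, hk⟩
  · intro c
    simp only [IExp.val, RExp.val, Store.withI_ireg, Store.withI_rarr, reduceIte, v3 c, q3, e3,
      Nat.cast_zero, zero_sub]
    rfl
  intro s4 f4 r4
  rw [← sub_eq_add_neg] at r4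
  set res' := st.res - α • (S.M *ᵥ st.dir) with hres'
  have c4 := c3.frame' f4 (by intro i hi; simp; omega) (by simp)
  have κ4 := (f4.rreg 2 (by simp)).trans κ3
  have x4 := x3.frame f4 (by simp)
  have p4 := p3.frame f4 (by simp)
  have q4 : s4.rarr 17 0 = st.res ⬝ᵥ st.res := by rw [f4.rarr 17 (by simp)]; exact q3
  clear f4 c3 κ3 x3 r3 p3 v3 q3 e3
  refine seq_rule (dotPar_spec D hN (Or.inr (Or.inl ⟨rfl, rfl, rfl⟩)) c4 r4 r4) (by simp) (by simp)
    (by simp) ?_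
  intro s5 f5 e5
  have c5 := c4.frame' f5 (by intro i hi; simp; omega) (by simp)
  have κ5 := (f5.rreg 2 (by simp)).trans κ4
  have x5 := x4.frame f5 (by simp)
  have r5 := r4.frame f5 (by simp)
  have p5 := p4.frame f5 (by simp)
  have q5 : s5.rarr 17 0 = st.res ⬝ᵥ st.res := by rw [f5.rarr 17 (by simp)]; exact q4
  clear f5 c4 κ4 x4 r4 p4 q4
  -- The old direction is copied to array 39, because assignment zeroes its destination before
  -- reading.
  refine seq_rule (setPar_spec D hN c5.regs st.dir (by decide) ?_ ?_) (by simp) (by simp)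
    (by simp) ?_
  · intro k hk
    simp only [IExp.val, IExp.Ok, RExp.Ok, Store.withI_ireg, reduceIte, true_and]
    exact hk
  · intro c
    simp only [IExp.val, RExp.val, Store.withI_ireg, Store.withI_rarr, reduceIte, p5 c]
  intro s6 f6 p6
  have c6 := c5.frame' f6 (by intro i hi; simp; omega) (by simp)
  have κ6 := (f6.rreg 2 (by simp)).trans κ5
  have x6 := x5.frame f6 (by simp)
  have r6 := r5.frame f6 (by simp)
  have q6 : s6.rarr 17 0 = st.res ⬝ᵥ st.res := by rw [f6.rarr 17 (by simp)]; exact q5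
  have e6 : s6.rarr 19 0 = res' ⬝ᵥ res' := by rw [f6.rarr 19 (by simp)]; exact e5
  clear f6 c5 κ5 x5 r5 p5 q5 e5
  refine seq_rule (setPar_spec D hN c6.regs
    (res' + ((res' ⬝ᵥ res') / (st.res ⬝ᵥ st.res)) • st.dir) (by decide) ?_ ?_) (by simp) (by simp)
    (by simp) ?_
  · intro k hk
    simp only [IExp.val, IExp.Ok, RExp.Ok, Store.withI_ireg, reduceIte, true_and]
    exact ⟨hk, ⟨hpos, hpos⟩, hk⟩
  · intro c
    simp only [IExp.val, RExp.val, Store.withI_ireg, Store.withI_rarr, reduceIte, p6 c, r6 c, q6, e6]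
    rfl
  intro s7 f7 p7
  have c7 := c6.frame' f7 (by intro i hi; simp; omega) (by simp)
  have κ7 := (f7.rreg 2 (by simp)).trans κ6
  have x7 := x6.frame f7 (by simp)
  have r7 := r6.frame f7 (by simp)
  have e7 : s7.rarr 19 0 = res' ⬝ᵥ res' := by rw [f7.rarr 19 (by simp)]; exact e6
  clear f7 c6 κ6 x6 r6 p6 q6 e6
  refine last_rule (compute_runs D.bounds (c7.regs.le D hN) (by decide) (by decide) ?_ ?_ ?_ ?_)
    (by simp) (by simp) (by simp) ?_
  · exact hpos
  · simp only [List.forall_mem_cons, IExp.val, List.not_mem_nil, IsEmpty.forall_iff, implies_true,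
      and_true]
    exact hpos
  · simpa [boxVol, IExp.val] using D.bounds.pos
  · simp only [boxAll, IExp.val, IExp.Ok, RExp.Ok, Store.withI_ireg, reduceIte, true_and]
    exact fun k hk => ⟨by omega, hpos⟩
  intro s8 f8 v8
  exact ⟨c7.frame' f8 (by intro i hi; simp; omega) (by simp), (f8.rreg 2 (by simp)).trans κ7, by
    have := x7.frame f8 (by simp)
    rw [add_assoc] at this
    exact this, r7.frame f8 (by simp), p7.frame f8 (by simp), by
    rw [v8 0 (by simp [IExp.val])]
    simp only [boxSum, IExp.val, RExp.val, Store.withI_ireg, Store.withI_rarr, reduceIte,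
      Finset.sum_range_one]
    exact e7⟩

end RAM

namespace RAM

variable {n d₁ d₂ r m N T L X SP B : ℕ}

/-! ### The whole program -/

theorem load_spec (D : Dims n d₁ d₂ r m T L X SP B) (hN : N ≤ X) {S : StepData n d₁ d₂ r m}
    {ζ : ℂ} {s : Store} {γ : Par n d₁ d₂ r → ℝ} (hc : Ctx S N T L ζ s) (hγ : HoldsPar s 4 γ) :
    ∃ s', Runs X SP B load [10, 11, 12] [] [15] s s' ∧ FlatAt s' 15 γ := by
  have hb := D.bounds
  have hr0 := hc.regs
  have htot := D.tot_le_SP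
  unfold load
  refine seq_rule (compute_runs hb (hr0.le D hN) (by decide) (by decide) ?_ (boxOk_rr D hr0).1
    (boxOk_rr D hr0).2 ?_) (by simp) (by simp) (by simp) ?_
  · simpa only [IExp.val, hr0.r_eq, hr0.d₁_eq, hr0.d₂_eq, hr0.n_eq] using htot
  · simp only [boxAll, IExp.val, IExp.Ok, RExp.Ok, Store.withI_ireg, Nat.reduceEqDiff, reduceIte,
      hr0.r_eq, true_and]
    intro i hi j hj
    exact ⟨D.rr_lt hi hj, D.rr_lt hi hj⟩
  intro s1 f1 v1
  replace v1 : FlatAt s1 15 (parOf (Matrix.of fun i j => γ (Sum.inl (i, j))) 0 0 :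
      Par n d₁ d₂ r → ℝ) := fun c => by
    rw [v1 _ (by simp only [IExp.val, hr0.r_eq, hr0.d₁_eq, hr0.d₂_eq, hr0.n_eq]; exact flat_lt c)]
    simp only [boxSum, IExp.val, RExp.val, Store.withI_ireg, Store.withI_rarr,
      Nat.reduceEqDiff, reduceIte, hr0.r_eq]
    rw [sum_flat1 fun i j => s.rarr 4 (i * r + j)]
    rcases c with ⟨i, j⟩ | c | c
    · exact hγ.1 i j
    · rfl
    · rfl
  have hr1 := hr0.frame f1 (by intro i hi; simp; omega)
  have h5 : s1.rarr 5 = s.rarr 5 := f1.rarr 5 (by simp)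
  have h6 : s1.rarr 6 = s.rarr 6 := f1.rarr 6 (by simp)
  clear f1
  refine seq_rule (nest_runs hb (hr1.le D hN) (by decide)
    (boxOk_rdn D hr1).1 (boxOk_rdn D hr1).2 ?_) (by simp) (by simp) (by simp) ?_
  · simp only [boxAll, IExp.val, IExp.Ok, RExp.Ok, Store.withI_ireg, Nat.reduceEqDiff, reduceIte,
      hr1.r_eq, hr1.d₂_eq, hr1.n_eq, true_and]
    intro i hi b hb j hj
    exact ⟨D.pos2_lt hi hb hj, (D.pos2_lt hi hb hj).trans_le' (Nat.le_add_left _ _)⟩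
  intro s2 f2 v2
  replace v2 : FlatAt s2 15 (parOf (Matrix.of fun i j => γ (Sum.inl (i, j)))
      (Matrix.of fun i q => γ (Sum.inr (Sum.inl (i, q)))) 0 : Par n d₁ d₂ r → ℝ) := fun c => by
    rw [v2, v1 c]
    simp only [boxSum, IExp.val, RExp.val, Store.withI_ireg, Store.withI_rarr,
      Nat.reduceEqDiff, reduceIte, hr1.r_eq, hr1.d₂_eq, hr1.n_eq, h5]
    rw [sum_flat2 fun i b j => s.rarr 5 (i * (d₂ * n) + (b * n + j))]
    rcases c with c | ⟨i, q⟩ | c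
    · exact add_zero _
    · exact (zero_add _).trans (hγ.2.1 i q)
    · exact add_zero _
  have hr2 := hr1.frame f2 (by intro i hi; simp; omega)
  replace h6 : s2.rarr 6 = s.rarr 6 := (f2.rarr 6 (by simp)).trans h6
  clear f2
  refine last_rule (nest_runs hb (hr2.le D hN) (by decide)
    (boxOk_dnr D hr2 hr2.d₁_eq D.hd₁ D.d₁_le).1 (boxOk_dnr D hr2 hr2.d₁_eq D.hd₁ D.d₁_le).2 ?_)
    (by simp) (by simp) (by simp) ?_
  · simp only [boxAll, IExp.val, IExp.Ok, RExp.Ok, Store.withI_ireg, Nat.reduceEqDiff, reduceIte,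
      hr2.r_eq, hr2.d₁_eq, hr2.d₂_eq, hr2.n_eq, true_and]
    intro a ha i hi k hk
    exact ⟨D.pos3_lt ha hi hk, D.dnr_lt D.d₁_le ha hi hk⟩
  intro s3 f3 v3 c
  rw [v3, v2 c]
  simp only [boxSum, IExp.val, RExp.val, Store.withI_ireg, Store.withI_rarr,
    Nat.reduceEqDiff, reduceIte, hr2.r_eq, hr2.d₁_eq, hr2.d₂_eq, hr2.n_eq, h6]
  rw [sum_flat3 fun a i k => s.rarr 6 ((a * n + i) * r + k)]
  rcases c with c | c | ⟨p, j⟩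
  · exact add_zero _
  · exact add_zero _
  · exact (zero_add _).trans (hγ.2.2 p j)

theorem save_spec (D : Dims n d₁ d₂ r m T L X SP B) (hN : N ≤ X) {s : Store}
    (hs : Regs n d₁ d₂ r m N T L s) {γ : Par n d₁ d₂ r → ℝ} {q : Fin m → ℝ}
    (hγ : FlatAt s 13 γ) (hq : VecAt s 24 q) :
    ∃ s', Runs X SP B save [10, 11, 12] [] [4, 5, 6, 7] s s' ∧ HoldsOutput s' γ (-q) := by
  have hb := D.bounds
  have htot := D.tot_le_SP
  have hm := D.m_le_SP
  unfold save
  refine seq_rule (compute_runs hb (hs.le D hN) (by decide) (by decide) ?_ ?_ ?_ ?_)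
    (by simp) (by simp) (by simp) ?_
  · simpa only [IExp.val, hs.m_eq] using hm
  · simpa only [List.forall_mem_cons, IExp.val, hs.m_eq, List.not_mem_nil, IsEmpty.forall_iff,
      implies_true, and_true] using hm
  · simp only [boxVol, List.map, List.prod_cons, List.prod_nil, IExp.val, hs.m_eq, mul_one]
    have := D.one_le_T
    have := D.hr
    exact D.le_B_max (Nat.le_mul_of_pos_right _ (Nat.mul_pos D.one_le_T (by omega)))
  · simp only [boxAll, IExp.val, IExp.Ok, RExp.Ok, Store.withI_ireg, reduceIte, hs.m_eq, true_and]
    exact fun k hk => ⟨by omega, by omega⟩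
  intro s1 f1 v1
  replace v1 : ∀ l : Fin m, s1.rarr 7 l = (-q) l := fun l => by
    rw [v1 _ (by simp only [IExp.val, hs.m_eq]; exact l.isLt)]
    simp only [boxSum, IExp.val, RExp.val, Store.withI_ireg, Store.withI_rarr, reduceIte, hs.m_eq]
    rw [Finset.sum_ite_eq', if_pos (Finset.mem_range.mpr l.isLt), hq l, Nat.cast_zero, zero_sub]
    rfl
  have hr1 := hs.frame f1 (by intro i hi; simp; omega)
  have hγ1 := hγ.frame f1 (by simp)
  clear f1
  refine seq_rule (compute_runs hb (hr1.le D hN) (by decide) (by decide) ?_ (boxOk_rr D hr1).1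
    (boxOk_rr D hr1).2 ?_) (by simp) (by simp) (by simp) ?_
  · simp only [IExp.val, hr1.r_eq]; omega
  · simp only [boxAll, IExp.val, IExp.Ok, RExp.Ok, Store.withI_ireg, Nat.reduceEqDiff, reduceIte,
      hr1.r_eq, true_and]
    intro i hi j hj
    exact ⟨D.rr_lt hi hj, D.rr_lt hi hj⟩
  intro s2 f2 v2
  replace v2 : ∀ i j : Fin r, s2.rarr 4 (i * r + j) = γ (Sum.inl (i, j)) := fun i j => by
    rw [v2 _ (by simp only [IExp.val, hr1.r_eq]; exact idx_lt i.isLt j.isLt)]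
    simp only [boxSum, IExp.val, RExp.val, Store.withI_ireg, Store.withI_rarr,
      Nat.reduceEqDiff, reduceIte, hr1.r_eq]
    rw [sum_idx2 i.isLt j.isLt fun i j => s1.rarr 13 (i * r + j), hγ1.at1]
  have hr2 := hr1.frame f2 (by intro i hi; simp; omega)
  have hγ2 := hγ1.frame f2 (by simp)
  replace v1 : ∀ l : Fin m, s2.rarr 7 l = (-q) l := fun l => by
    rw [f2.rarr 7 (by simp), v1]
  clear f2
  refine seq_rule (compute_runs hb (hr2.le D hN) (by decide) (by decide) ?_
    (boxOk_rdn D hr2).1 (boxOk_rdn D hr2).2 ?_) (by simp) (by simp) (by simp) ?_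
  · simp only [IExp.val, hr2.r_eq, hr2.d₂_eq, hr2.n_eq]; omega
  · simp only [boxAll, IExp.val, IExp.Ok, RExp.Ok, Store.withI_ireg, Nat.reduceEqDiff, reduceIte,
      hr2.r_eq, hr2.d₂_eq, hr2.n_eq, true_and]
    intro i hi b hb j hj
    exact ⟨(D.pos2_lt hi hb hj).trans_le' (Nat.le_add_left _ _), D.pos2_lt hi hb hj⟩
  intro s3 f3 v3
  replace v3 : ∀ (i : Fin r) (q : Blk n d₂), s3.rarr 5 (i * (d₂ * n) + (q.1 * n + q.2)) =
      γ (Sum.inr (Sum.inl (i, q))) := fun i q => by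
    have h := sum_flat2 (d₁ := d₁) (fun i b j => s2.rarr 13 (r * r + (i * (d₂ * n) + (b * n + j))))
      (Sum.inr (Sum.inl (i, q)))
    simp only [flat, Nat.add_left_cancel_iff] at h
    rw [v3 _ (by
      simp only [IExp.val, hr2.r_eq, hr2.d₂_eq, hr2.n_eq]; exact idx_lt i.isLt (blk_lt q))]
    simp only [boxSum, IExp.val, RExp.val, Store.withI_ireg, Store.withI_rarr,
      Nat.reduceEqDiff, reduceIte, hr2.r_eq, hr2.d₂_eq, hr2.n_eq, h, hγ2.at2]
  have hr3 := hr2.frame f3 (by intro i hi; simp; omega)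
  have hγ3 := hγ2.frame f3 (by simp)
  replace v1 : ∀ l : Fin m, s3.rarr 7 l = (-q) l := fun l => by
    rw [f3.rarr 7 (by simp), v1]
  replace v2 : ∀ i j : Fin r, s3.rarr 4 (i * r + j) = γ (Sum.inl (i, j)) := fun i j => by
    rw [f3.rarr 4 (by simp), v2]
  clear f3
  refine last_rule (compute_runs hb (hr3.le D hN) (by decide) (by decide) ?_
    (boxOk_dnr D hr3 hr3.d₁_eq D.hd₁ D.d₁_le).1 (boxOk_dnr D hr3 hr3.d₁_eq D.hd₁ D.d₁_le).2 ?_)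
    (by simp) (by simp) (by simp) ?_
  · simp only [IExp.val, hr3.r_eq, hr3.d₁_eq, hr3.n_eq]; omega
  · simp only [boxAll, IExp.val, IExp.Ok, RExp.Ok, Store.withI_ireg, Nat.reduceEqDiff, reduceIte,
      hr3.r_eq, hr3.d₁_eq, hr3.d₂_eq, hr3.n_eq, true_and]
    intro a ha i hi k hk
    exact ⟨D.dnr_lt D.d₁_le ha hi hk, D.pos3_lt ha hi hk⟩
  intro s4 f4 v4
  refine ⟨⟨fun i j => ?_, fun i q => ?_, fun p j => ?_⟩, fun l => ?_⟩
  · rw [f4.rarr 4 (by simp), v2]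
  · rw [f4.rarr (4 + 1) (by simp), v3]
  · have h := sum_flat3 (d₂ := d₂)
      (fun a i k => s3.rarr 13 (r * r + r * (d₂ * n) + ((a * n + i) * r + k)))
      (Sum.inr (Sum.inr (p, j)))
    simp only [flat, Nat.add_left_cancel_iff] at h
    rw [v4 _ (by
      simp only [IExp.val, hr3.r_eq, hr3.d₁_eq, hr3.n_eq]; exact idx_lt (blk_lt p) j.isLt)]
    simp only [boxSum, IExp.val, RExp.val, Store.withI_ireg, Store.withI_rarr,
      Nat.reduceEqDiff, reduceIte, hr3.r_eq, hr3.d₁_eq, hr3.d₂_eq, hr3.n_eq, h, hγ3.at3]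
  · rw [f4.rarr 7 (by simp), v1]

theorem setR_lit_spec (hb : Bounds X SP B) (i c : ℕ) (s : Store) :
    ∃ s', Runs X SP B (Prog.setR i (RExp.ofInt (IExp.lit c))) [] [i] [] s s' ∧ s'.rreg i = c :=
  ⟨_, Runs.setR hb.pos (by simp) (by simp [IExp.Ok, RExp.Ok]) (by simp [IExp.regs, RExp.regs]),
    by simp [RExp.val, IExp.val]⟩

theorem Ctx.frame_κ {S : StepData n d₁ d₂ r m} {ζ : ℂ} {s s' : Store} (h : Ctx S N T L ζ s)
    (hf : Frame [] [2] [] [] s s') : Ctx S N T L ζ s' :=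
  h.frame hf (by simp) (by simp) (by simp)

/-- With κ = 1 the system program returns Mγ₀ − b, the negative of the initial residual; κ is then
reset to 0 for the iteration. -/
theorem cgInit_spec [NeZero d₁] [NeZero d₂] (D : Dims n d₁ d₂ r m T L X SP B) (hN : N ≤ X)
    {S : StepData n d₁ d₂ r m} (hS : S.Valid) {ζ : ℂ} (hζ : IsPrimitiveRoot ζ L)
    (hζ1 : ζ * star ζ = 1) {s : Store} {γ₀ : Par n d₁ d₂ r → ℝ} (hc : Ctx S N T L ζ s)
    (hγ : HoldsPar s 4 γ₀) :
    ∃ s', Runs X SP B cgInit [9, 10, 11, 12, 13] [2] [13, 14, 15, 16, 17, 20, 21, 22, 23,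
        24, 25, 26, 27, 28, 29, 30, 31, 32, 33, 34, 35, 36, 37] s s' ∧
      CgAt S N T L ζ γ₀ (cgSeq S.M (S.rhs - S.M *ᵥ γ₀) 0) s' := by
  unfold cgInit
  refine seq_rule (load_spec D hN hc hγ) (by simp) (by simp) (by simp) fun s1 f1 v1 => ?_
  have c1 := hc.frame' f1 (by intro i hi; simp; omega) (by simp)
  refine seq_rule (setPar_spec D hN c1.regs γ₀ (by decide) ?_ ?_) (by simp) (by simp) (by simp) ?_
  · intro k hk
    simpa only [IExp.val, IExp.Ok, RExp.Ok, Store.withI_ireg, reduceIte, true_and]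
  · intro c
    simp only [IExp.val, RExp.val, Store.withI_ireg, Store.withI_rarr, reduceIte, v1 c]
  intro s2 f2 v2
  have c2 := c1.frame' f2 (by intro i hi; simp; omega) (by simp)
  have w2 := v1.frame f2 (by simp)
  refine seq_rule (setR_lit_spec D.bounds 2 1 s2) (by simp) (by simp) (by simp) fun s3 f3 κ3 => ?_
  have c3 := c2.frame_κ f3
  have v3 := v2.frame f3 (by simp)
  refine seq_rule (applySystem_spec D hN hS hζ hζ1 c3 (w2.frame f3 (by simp))) (by simp) (by simp)
    (by simp) fun s4 f4 v4 => ?_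
  replace v4 := v4.1
  rw [κ3, Nat.cast_one, one_smul] at v4
  have c4 := c3.frame' f4 (by intro i hi; simp; omega) (by simp)
  have x4 := v3.frame f4 (by simp)
  refine seq_rule (setPar_spec D hN c4.regs (S.rhs - S.M *ᵥ γ₀) (by decide) ?_ ?_) (by simp)
    (by simp) (by simp) ?_
  · intro k hk
    simpa only [IExp.val, IExp.Ok, RExp.Ok, Store.withI_ireg, reduceIte, true_and]
  · intro c
    simp only [IExp.val, RExp.val, Store.withI_ireg, Store.withI_rarr, reduceIte, v4 c,
      Nat.cast_zero, zero_sub, Pi.sub_apply, neg_sub]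
  intro s5 f5 v5
  have c5 := c4.frame' f5 (by intro i hi; simp; omega) (by simp)
  have x5 := x4.frame f5 (by simp)
  refine seq_rule (setPar_spec D hN c5.regs (S.rhs - S.M *ᵥ γ₀) (by decide) ?_ ?_) (by simp)
    (by simp) (by simp) ?_
  · intro k hk
    simpa only [IExp.val, IExp.Ok, RExp.Ok, Store.withI_ireg, reduceIte, true_and]
  · intro c
    simp only [IExp.val, RExp.val, Store.withI_ireg, Store.withI_rarr, reduceIte, v5 c]
  intro s6 f6 v6
  have c6 := c5.frame' f6 (by intro i hi; simp; omega) (by simp)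
  have x6 := x5.frame f6 (by simp)
  have r6 := v5.frame f6 (by simp)
  refine seq_rule (setR_lit_spec D.bounds 2 0 s6) (by simp) (by simp) (by simp) fun s7 f7 κ7 => ?_
  have c7 := c6.frame_κ f7
  have r7 := r6.frame f7 (by simp)
  refine last_rule (dotPar_spec D hN (Or.inr (Or.inr ⟨rfl, rfl, rfl⟩)) c7 r7 r7) (by simp) (by simp)
    (by simp) fun s8 f8 e8 => ?_
  refine ⟨c7.frame' f8 (by intro i hi; simp; omega) (by simp), (f8.rreg 2 (by simp)).trans ?_, ?_,
    r7.frame f8 (by simp), (v6.frame f7 (by simp)).frame f8 (by simp), e8⟩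
  · rw [κ7, Nat.cast_zero]
  · have := (x6.frame f7 (by simp)).frame f8 (by simp)
    rwa [← add_zero γ₀] at this

theorem cgFinish_spec [NeZero d₁] [NeZero d₂] (D : Dims n d₁ d₂ r m T L X SP B) (hN : N ≤ X)
    {S : StepData n d₁ d₂ r m} (hS : S.Valid) {ζ : ℂ} (hζ : IsPrimitiveRoot ζ L)
    (hζ1 : ζ * star ζ = 1) {s : Store} {γ : Par n d₁ d₂ r → ℝ} (hc : Ctx S N T L ζ s)
    (hγ : FlatAt s 13 γ) :
    ∃ s', Runs X SP B cgFinish [9, 10, 11, 12, 13] [2] [4, 5, 6, 7, 15, 16, 20, 21, 22, 23,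
        24, 25, 26, 27, 28, 29, 30, 31, 32, 33, 34, 35, 36, 37] s s' ∧
      HoldsOutput s' γ (S.residual γ) := by
  unfold cgFinish
  refine seq_rule (setPar_spec D hN hc.regs γ (by decide) ?_ ?_) (by simp) (by simp) (by simp) ?_
  · intro k hk
    simpa only [IExp.val, IExp.Ok, RExp.Ok, Store.withI_ireg, reduceIte, true_and]
  · intro c
    simp only [IExp.val, RExp.val, Store.withI_ireg, Store.withI_rarr, reduceIte, hγ c]
  intro s1 f1 v1
  have c1 := hc.frame' f1 (by intro i hi; simp; omega) (by simp)
  have x1 := hγ.frame f1 (by simp)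
  refine seq_rule (setR_lit_spec D.bounds 2 1 s1) (by simp) (by simp) (by simp) fun s2 f2 κ2 => ?_
  have c2 := c1.frame_κ f2
  have x2 := x1.frame f2 (by simp)
  refine seq_rule (applySystem_spec D hN hS hζ hζ1 c2 (v1.frame f2 (by simp))) (by simp) (by simp)
    (by simp) fun s3 f3 v3 => ?_
  replace v3 := v3.2
  rw [κ2, Nat.cast_one, one_smul] at v3
  have c3 := c2.frame' f3 (by intro i hi; simp; omega) (by simp)
  refine last_rule (save_spec D hN c3.regs (x2.frame f3 (by simp)) v3) (by simp) (by simp) (by simp)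
    fun s4 _ v4 => ?_
  -- The sample vector is K⁻¹(Eγ − y), so its negative, which is what gets saved, is p.
  rwa [← Matrix.mulVec_neg, neg_sub] at v4

/-- Two budgets: `B₀` for a single conjugate gradient step and `B` for everything. The order L is
found only at run time, so the size hypotheses are required for every admissible L. -/
theorem mainProg_spec [NeZero d₁] [NeZero d₂] {B₀ : ℕ}
    (D₀ : ∀ L, T ≤ L → L ≤ 2 * T → Dims n d₁ d₂ r m T L X SP B₀)
    (D : ∀ L, T ≤ L → L ≤ 2 * T → Dims n d₁ d₂ r m T L X SP B) (hB : N * B₀ ≤ B)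
    (hN : N ≤ X) {S : StepData n d₁ d₂ r m} (hS : S.Valid) {s : Store}
    {γ₀ : Par n d₁ d₂ r → ℝ} (hs : HoldsInput s S N γ₀) :
    Good X SP B mainProg s ∧
      HoldsOutput (mainProg.exec s).1 (S.cgParam γ₀ N) (S.residual (S.cgParam γ₀ N)) := by
  have DT := D T le_rfl (by omega)
  have hb := DT.bounds
  have hX := hb.le_X
  have h1 := DT.d₁_le
  have h2 := DT.d₂_le
  have h3 := DT.two_r_le
  have h4 := DT.L_le
  have h5 := DT.T_le
  have h6 := DT.m_le_SP
  have hTSP : 2 * T ≤ SP := DT.le_SP (by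
    have : 1 * T ≤ r * n * T := Nat.mul_le_mul_right _ (Nat.mul_pos DT.hr DT.hn)
    omega)
  obtain ⟨s1, L, ζ, R1, hTL, hLT, e6, e7, e8, hζ, hζ1, e3, e4⟩ := setupRoot_spec hb hs.d₁_eq hs.d₂_eq
    hs.r_eq DT.hT hTSP DT.one_le_T (by omega) (by omega) (by omega)
  specialize D L hTL hLT
  specialize D₀ L hTL hLT
  have f1 := R1.frame
  have r1 : Regs n d₁ d₂ r m N T L s1 :=
    ⟨(f1.ireg 0 (by simp)).trans hs.n_eq, (f1.ireg 1 (by simp)).trans hs.d₁_eq,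
      (f1.ireg 2 (by simp)).trans hs.d₂_eq, (f1.ireg 3 (by simp)).trans hs.r_eq,
      (f1.ireg 4 (by simp)).trans hs.m_eq, (f1.ireg 5 (by simp)).trans hs.N_eq, e6, e7, e8⟩
  obtain ⟨s2, R2, hroot, hweight, hhat⟩ := setupTables_spec D r1 hN e3 e4 hζ.pow_eq_one
  have f2 := R2.frame
  have c2 : Ctx S N T L ζ s2 :=
    { regs := r1.frame f2 (by intro i hi; simp; omega)
      lam_eq := by rw [f2.rreg 0 (by simp), f1.rreg 0 (by simp)]; exact hs.lam_eq
      ε_eq := by rw [f2.rreg 1 (by simp), f1.rreg 1 (by simp)]; exact hs.ε_eq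
      row_eq := fun l => by rw [f2.iarr 0 (by simp), f1.iarr 0 (by simp)]; exact hs.row_eq l
      col_eq := fun l => by rw [f2.iarr 1 (by simp), f1.iarr 1 (by simp)]; exact hs.col_eq l
      time_eq := fun l => by rw [f2.iarr 2 (by simp), f1.iarr 2 (by simp)]; exact hs.time_eq l
      U_eq := fun p k => by rw [f2.rarr 0 (by simp), f1.rarr 0 (by simp)]; exact hs.U_eq p k
      V_eq := fun p k => by rw [f2.rarr 1 (by simp), f1.rarr 1 (by simp)]; exact hs.V_eq p k
      σ_eq := fun i => by rw [f2.rarr 2 (by simp), f1.rarr 2 (by simp)]; exact hs.σ_eq i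
      y_eq := fun l => by rw [f2.rarr 3 (by simp), f1.rarr 3 (by simp)]; exact hs.y_eq l
      root := hroot
      weight := hweight
      weightHat := hhat }
  have hγ : HoldsPar s2 4 γ₀ := by
    refine ⟨fun i j => ?_, fun i q => ?_, fun p j => ?_⟩
    · rw [f2.rarr 4 (by simp), f1.rarr 4 (by simp)]; exact hs.par.1 i j
    · rw [f2.rarr (4 + 1) (by simp), f1.rarr (4 + 1) (by simp)]; exact hs.par.2.1 i q
    · rw [f2.rarr (4 + 2) (by simp), f1.rarr (4 + 2) (by simp)]; exact hs.par.2.2 p j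
  obtain ⟨s3, R3, h3⟩ := cgInit_spec D hN hS hζ hζ1 c2 hγ
  obtain ⟨s4, R4, h4⟩ := Runs.loop (X := X) (SP := SP) (B := B) (i := 20) (k := N) (B' := B₀)
    (e := IExp.reg 5) (c := cgBody) (s := s3) (I := [9, 10, 11, 12, 13, 20]) (R := [])
    (A := [13, 14, 15, 16, 17, 18, 19, 20, 21, 22, 23,
        24, 25, 26, 27, 28, 29, 30, 31, 32, 33, 34, 35, 36, 37, 39])
    (fun j => CgAt S N T L ζ γ₀ (cgSeq S.M (S.rhs - S.M *ᵥ γ₀) j))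
    (by simp [IExp.Ok]) (by
      intro i hi
      obtain rfl : i = 5 := by simpa [IExp.regs] using hi
      rw [h3.ctx.regs.N_eq]; exact hN)
    h3.ctx.regs.N_eq hb.pos D₀.bounds.pos hB (by simp) h3 (by
      intro j _ s' _ h
      obtain ⟨s'', R, h'⟩ := cgBody_spec D₀ hN hS hζ hζ1 (h.frame (s' := s'.withI 20 j) (I := [20])
        ⟨fun i hi => by rw [Store.withI_ireg, if_neg (by simpa using hi)], fun _ _ => rfl,
          fun _ _ => rfl, fun _ _ => rfl⟩ (by intro i hi; simp; omega))
      refine ⟨s'', R.mono (by simp) (by simp) (by simp), ?_⟩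
      rwa [cgSeq_succ])
  obtain ⟨s5, R5, h5⟩ := cgFinish_spec D hN hS hζ hζ1 h4.ctx h4.sol
  have hrun : Runs X SP B mainProg (List.range 21) (List.range 8) (List.range 40) s s5 := by
    unfold mainProg
    exact (R1.mono (by decide) (by decide) (by decide)).seq
      ((R2.mono (by decide) (by decide) (by decide)).seq
      ((R3.mono (by decide) (by decide) (by decide)).seq
      ((R4.mono (by decide) (by decide) (by decide)).seq
      (R5.mono (by decide) (by decide) (by decide)))))
  refine ⟨hrun.good, ?_⟩
  rw [hrun.eq]
  exact h5

end RAM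

/-- The resource bounds of the conjugate gradient program. -/
theorem RAM.mainProg_bounds {n d₁ d₂ r m N T : ℕ} (hn : 1 ≤ n) (hd₁ : 1 ≤ d₁) (hd₂ : 1 ≤ d₂)
    (hr : 1 ≤ r) (hrn : r ≤ n) (hT : T = d₁ + d₂ - 1) (hN : 1 ≤ N)
    {S : StepData n d₁ d₂ r m} (hS : S.Valid) {s : RAM.Store} {γ₀ : Par n d₁ d₂ r → ℝ}
    (hs : HoldsInput s S N γ₀) :
    HoldsOutput (mainProg.exec s).1 (S.cgParam γ₀ N) (S.residual (S.cgParam γ₀ N)) ∧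
      (mainProg.exec s).2.time ≤ mainProg.cost * (N * (16 * (r * T * (m + n * r * T)))) ∧
      (mainProg.exec s).2.space ≤ 8 * (r * n * T) + m ∧
      (mainProg.exec s).2.word ≤ ((n + T + m + N + 1) ^ 6) ^ mainProg.size := by
  have : NeZero d₁ := ⟨by omega⟩
  have : NeZero d₂ := ⟨by omega⟩
  have hT1 : 1 ≤ T := by omega
  have hrT : 1 ≤ r * T := Nat.mul_pos hr hT1
  set Y := n + T + m + N + 1 with hY
  set SP := 8 * (r * n * T) + m with hSP
  set B₀ := 16 * (r * T * (m + n * r * T)) with hB₀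
  have hYY : Y ≤ Y ^ 6 := Nat.le_self_pow (by norm_num) Y
  have hX : SP ≤ Y ^ 6 := by
    -- n, T and N are at least 1. So 9 ≤ Y³, which absorbs the constant in 9Y³ ≤ Y⁶.
    have h4 : 4 ≤ Y := by omega
    calc SP ≤ 8 * (Y * Y * Y) + Y := by
          rw [hSP]
          gcongr <;> omega
      _ ≤ 8 * (Y * Y * Y) + Y * Y * Y := by
          gcongr
          rw [mul_assoc]
          exact Nat.le_mul_of_pos_right _ (by positivity)
      _ = 9 * Y ^ 3 := by ring
      _ ≤ Y ^ 3 * Y ^ 3 := by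
          gcongr
          calc 9 ≤ 4 ^ 3 := by norm_num
            _ ≤ Y ^ 3 := by gcongr
      _ = Y ^ 6 := by ring
  have hB : SP ≤ B₀ := by
    rw [hSP, hB₀]
    have h1 : m ≤ r * T * m := Nat.le_mul_of_pos_left _ hrT
    have h2 : n * r * T ≤ r * T * (n * r * T) := Nat.le_mul_of_pos_left _ hrT
    rw [mul_add]
    have h3 : n * r * T = r * n * T := by ring
    omega
  have hB0 : 1 ≤ B₀ := by
    have : 1 ≤ r * n * T := Nat.mul_pos (Nat.mul_pos hr hn) hT1
    omega
  have hNB : B₀ ≤ N * B₀ := Nat.le_mul_of_pos_left _ hN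
  have key := mainProg_spec (X := Y ^ 6) (SP := SP) (B := N * B₀) (B₀ := B₀) (T := T)
    (fun L h h' => ⟨⟨hX, hB, by omega, hB0⟩, hn, hd₁, hd₂, hr, hrn, by omega, h, h', rfl, le_rfl⟩)
    (fun L h h' => ⟨⟨hX, hB.trans hNB, by omega, hB0.trans hNB⟩, hn, hd₁, hd₂, hr, hrn, by omega, h,
      h', rfl, hNB⟩) le_rfl (by omega) hS hs
  have hbd := Prog.Ok.bound (by omega : 2 ≤ Y ^ 6) mainProg s key.1.ok
  exact ⟨key.2, key.1.time, hbd.1, hbd.2⟩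

end TOIRLS

/-! ### Assembly of the theorem -/

open TOIRLS in
theorem theorem5p1 :
    ∃ (prog : RAM.Prog) (C : ℕ),
      ∀ (n d₁ d₂ r m k : ℕ) (_hn : 1 ≤ n) (hd₁ : 1 ≤ d₁) (hd₂ : 1 ≤ d₂) (_hr : 1 ≤ r) (hrn : r ≤ n)
        (_hk : 2 ≤ k)
        (ω : Fin m → Loc n d₁ d₂) (_hω : Function.Injective ω) (y : Fin m → ℝ)
        (lam : ℝ) (_hlam : 0 ≤ lam)
        (it : ℕ → Iterate n d₁ d₂) (_hrun : IsRun ω y lam r k it)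
        (_hε : 0 < (it (k - 1)).ε) (_hrank : (it (k - 1)).rank = r)
        (S : StepData n d₁ d₂ r m)
        (_hS : S = stepData r (hrn.trans (Nat.le_mul_of_pos_left n hd₁))
          (hrn.trans (Nat.le_mul_of_pos_left n hd₂)) ω y lam (it (k - 1)))
        (T : ℕ) (_hT : T = d₁ + d₂ - 1),
        -- the linear system
        Fintype.card (Par n d₁ d₂ r) ≤ C * (r * n * T) ∧
        S.M.PosDef ∧
        (∀ γ, S.M *ᵥ γ = S.rhs → S.reconstruct (S.residual γ) γ = (it k).X) ∧
        ∀ (γ₀ : Par n d₁ d₂ r → ℝ) (N : ℕ),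
          (Fintype.card (Par n d₁ d₂ r) ≤ N →
            S.reconstruct (S.residual (S.cgParam γ₀ N)) (S.cgParam γ₀ N) = (it k).X) ∧
          -- computation of the approximation after `N` conjugate gradient steps
          (1 ≤ N → ∀ s : RAM.Store, HoldsInput s S N γ₀ →
            HoldsOutput (prog.exec s).1 (S.cgParam γ₀ N) (S.residual (S.cgParam γ₀ N)) ∧
            ((prog.exec s).2.time : ℝ) ≤
              C * (N * (r * T) * (m + n * Real.log T + n * r * T)) ∧
            (prog.exec s).2.space ≤ C * (r * n * T + m) ∧
            (prog.exec s).2.word ≤ (n + T + m + N + 1) ^ C) := by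
  -- One constant for all claims: 16·cost for the time, 6·size for the exponent of the integer
  -- bound, and 8 for the space and the dimension.
  refine ⟨RAM.mainProg, 16 * RAM.mainProg.cost + 6 * RAM.mainProg.size + 8, ?_⟩
  generalize hcost : RAM.mainProg.cost = c
  generalize hsize : RAM.mainProg.size = z
  intro n d₁ d₂ r m k hn hd₁ hd₂ hr hrn hk ω hω y lam hlam it hrun hε hrank S hS T hT
  have : NeZero d₁ := ⟨by omega⟩
  have : NeZero d₂ := ⟨by omega⟩
  have hsvd := hrun.svd (k - 1) (by omega) (by omega)
  have hlt : ∀ i : Fin r, (it (k - 1)).ε < (it (k - 1)).σ i := fun i =>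
    lt_sigma_of_rank hsvd.antitone hrank i.isLt
  have hValid : S.Valid := by
    rw [hS]
    exact ⟨hω, hlam, hε, hlt⟩
  have hU : S.Uᵀ * S.U = 1 := by
    rw [hS]
    exact leadingCols_transpose_mul _ hsvd.left_orth
  have hV : S.Vᵀ * S.V = 1 := by
    rw [hS]
    exact leadingCols_transpose_mul _ hsvd.right_orth
  have hM : S.M.PosDef := StepData.M_posDef hValid hU hV
  have hsolve : ∀ γ, S.M *ᵥ γ = S.rhs → S.reconstruct (S.residual γ) γ = (it k).X := by
    intro γ hγ
    have hstep := hrun.step (k - 1) (by omega) (by omega)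
    rw [Nat.sub_add_cancel (by omega : 1 ≤ k)] at hstep
    refine StepData.reconstruct_eq_of_isWLS (W := weightOp (it (k - 1)).U (it (k - 1)).σ
      (it (k - 1)).V S.ε) hValid hU hV (fun Z => ?_) ?_ hγ
    · exact vec_weightOp S (hrn.trans (Nat.le_mul_of_pos_left n hd₁))
        (hrn.trans (Nat.le_mul_of_pos_left n hd₂)) hsvd.left_orth' hsvd.right_orth' (by rw [hS]; rfl)
        (by rw [hS]; rfl) (by rw [hS]; exact fun _ => rfl)
        (fun i hi => by
          rw [hS]; exact sigma_le_of_rank hsvd.antitone hsvd.zero hε hrank hi) hV hU Z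
    · rw [hS]
      exact hstep
  refine ⟨?_, hM, hsolve, fun γ₀ N => ⟨fun hN => hsolve _ ?_, fun hN s hs => ?_⟩⟩
  -- Each of the three components has at most rnT entries; the square block uses r ≤ n.
  · have h1 : r * r * 1 ≤ r * n * T := Nat.mul_le_mul (Nat.mul_le_mul_left _ hrn) (by omega)
    have h2 : r * (d₂ * n) ≤ r * n * T := by
      calc r * (d₂ * n) ≤ r * (T * n) := by gcongr; omega
        _ = r * n * T := by ring
    have h3 : d₁ * n * r ≤ r * n * T := by
      calc d₁ * n * r ≤ T * n * r := by gcongr; omega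
        _ = r * n * T := by ring
    simp only [Fintype.card_sum, Fintype.card_prod, Fintype.card_fin]
    calc r * r + (r * (d₂ * n) + d₁ * n * r) ≤ 3 * (r * n * T) := by omega
      _ ≤ _ := by gcongr; omega
  -- The correction solves MΔ = b − Mγ₀ exactly, so γ₀ + Δ solves the original system.
  · rw [StepData.cgParam, Matrix.mulVec_add, mulVec_cg_eq hM _ hN, add_sub_cancel]
  · obtain ⟨hout, htime, hspace, hword⟩ := RAM.mainProg_bounds hn hd₁ hd₂ hr hrn hT hN hValid hs
    refine ⟨hout, ?_, ?_, ?_⟩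
    · rw [hcost] at htime
      have hlog : 0 ≤ (n : ℝ) * Real.log T :=
        -- The program's own bound has no logarithmic term; it is added here as a nonnegative
        -- quantity.
        mul_nonneg (Nat.cast_nonneg _) (Real.log_natCast_nonneg _)
      calc ((RAM.mainProg.exec s).2.time : ℝ)
          ≤ ((c * (N * (16 * (r * T * (m + n * r * T)))) : ℕ) : ℝ) := by exact_mod_cast htime
        _ = ((16 * c : ℕ) : ℝ) * (N * (r * T) * (m + 0 + n * r * T)) := by push_cast; ring
        _ ≤ _ := by
          clear hcost hsize hout htime hspace hword
          gcongr
          omega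
    · refine hspace.trans ?_
      calc 8 * (r * n * T) + m ≤ 8 * (r * n * T + m) := by omega
        _ ≤ _ := by gcongr; omega
    · rw [hsize, ← pow_mul] at hword
      exact hword.trans (Nat.pow_le_pow_right (by omega) (by omega))
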